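/- **Setting.** Let $N\ge 3$, $n_\tau\ge 2$, and let $\tau:\mathcal S_N\to O_{n_\tau}(\mathbb R)$ be a representation by orthogonal matrices that is irreducible on $V_\tau=\mathbb C^{n_\tau}$ (the matrix form, in an orthonormal basis, of the irreducible module of a partition of $N$ other than $(N)$ and $(1^N)$). Permutations act on points by $(xw)_i=x_{w(i)}$. Let $S_1(\tau)$ be the scalar with $\sum_{i<j}\tau((i,j))=S_1(\tau)I$, and let $\gamma=S_1(\tau)/N$, $\omega=e^{2\pi \mathrm i/N}$, $x_0=(1,\omega,\dots,\omega^{N-1})$, $\upsilon=\tau(w_0)$ with $w_0=(1,2,\dots,N)$ the $N$-cycle, and $\sigma=\tau((N-1,N))$. For $a,b\in\mathbb C$ let $\rho(a,b)=\frac a2(I-\sigma)+\frac b2(I+\sigma)$. Let $\kappa$ be real. Let $\mathbb T^N=\{x\in\mathbb C^N:|x_j|=1\text{ for all }j\}$ with $\mathrm dm=(2\pi)^{-N}\mathrm d\theta_1\cdots \mathrm d\theta_N$, $x_j=e^{\mathrm i\theta_j}$, and let $\mathbb T^N_{\rm reg}$ be the set of its points with pairwise distinct coordinates. *The matrix $L$.*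 Let $\mathcal C_0=\{(e^{\mathrm i\theta_j})_j:\theta_1<\dots<\theta_N<\theta_1+2\pi\}$. On $\mathcal C_0$ let $L$ be the $n_\tau\times n_\tau$ matrix solution, holomorphic in a neighbourhood of $\mathcal C_0$ in $\{x\in\mathbb C^N: x_i\neq0,\ x_i\ne x_j \text{ for } i\neq j\}$, of $$\partial_iL(x)=\kappa L(x)\Big\{\sum_{j\ne i}\frac{\tau((i,j))}{x_i-x_j}-\frac{\gamma}{x_i}I\Big\}\quad(1\le i\le N),\qquad L(x_0)=I,$$ and extend it to $\mathbb T^N_{\rm reg}$ by $L(x)=L(xw_x^{-1})\tau(w_x)$, where $w_x$ is the unique permutation with $w_x(1)=1$ and $xw_x^{-1}\in\mathcal C_0$. *The matrix $L_1(x_0)$.* Write $x(u,z)=(x_1,\dots,x_{N-2},u-z,u+z)$ and $\beta_k(x(u,0))=\sum_{j=1}^{N-2}\tau((j,N))(u-x_j)^{-k-1}$, $B_k=(-1)^k\beta_k-\sigma\beta_k\sigma$. Let $\alpha_0(x(u,0))$ be the holomorphic matrix function with $\alpha_0=I$ at $x^{(0)}=(1,\omega,\dots,\omega^{N-3},\omega^{-3/2},\omega^{-3/2})$,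 where $\omega^{-3/2}=e^{-3\pi\mathrm i/N}$, and $$\partial_u\alpha_0=\kappa\alpha_0\{\beta_0+\sigma\beta_0\sigma\},\qquad \partial_j\alpha_0=\kappa\alpha_0\Big\{\sum_{i\le N-2,\,i\ne j}\frac{\tau((i,j))}{x_j-x_i}-\frac{\tau((j,N-1))+\tau((j,N))}{u-x_j}\Big\}\quad(1\le j\le N-2),$$ on an open set of points $(x_1,\dots,x_{N-2},u)$ with non-zero, pairwise distinct coordinates that contains the segment from $(1,\omega,\dots,\omega^{N-3},\omega^{-3/2})$ to $(1,\omega,\dots,\omega^{N-3},\frac12(\omega^{N-2}+\omega^{N-1}))$. For $k\ge1$ put $S_k=\sum_{i=0}^{k-1}\alpha_{k-1-i}B_i$, and $\alpha_k=\frac{\kappa}{k}S_k$ if $k$ is even, $\alpha_k=\rho\big(\frac{\kappa}{k-2\kappa},\frac{\kappa}{k+2\kappa}\big)S_k$ if $k$ is odd. Then, with principal branches of the powers, $$L_1(x)=\Big(\prod_{j=1}^Nx_j\Big)^{-\gamma\kappa}\rho(z^{-\kappa},z^{\kappa})\sum_{k=0}^\infty\alpha_k(x(u,0))z^k,\qquad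 u=\tfrac12(x_{N-1}+x_N),\quad z=\tfrac12(x_N-x_{N-1}),$$ and $L_1(x_0)$ is its value at $x=x_0$. *The operators.* For $f\in C^{1}(\mathbb T^N;V_\tau)$ let $$x_i\mathcal D_if(x)=x_i\partial_if(x)+\kappa\sum_{j\ne i}\frac{x_i}{x_i-x_j}\tau((i,j))\big(f(x)-f(x(i,j))\big),\qquad x_i\partial_i=-\mathrm i\,\frac{\partial}{\partial\theta_i}.$$ **Theorem 7.1.** Suppose $|\kappa|<\big(2(N^2-N+2)\big)^{-1}$ and let $H$ be a Hermitian $n_\tau\times n_\tau$ matrix such that $\upsilon H=H\upsilon$ and $(L_1(x_0)^*)^{-1}HL_1(x_0)^{-1}$ commutes with $\sigma$. Then for all $f,g\in C^{1}(\mathbb T^N;V_\tau)$ and $1\le i\le N$ the functions $(x_i\mathcal D_if)^*L^*HLg$ and $f^*L^*HL\,x_i\mathcal D_ig$ are integrable over $\mathbb T^N$ with respect to $m$, and $$\int_{\mathbb T^N}\big\{(x_i\mathcal D_if(x))^*L(x)^*HL(x)g(x)-f(x)^*L(x)^*HL(x)\,x_i\mathcal D_ig(x)\big\}\,\mathrm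 dm(x)=0.$$ -/

import Mathlib

open scoped Matrix

noncomputable section

namespace TorusDunkl

variable {N n : ℕ}

/-! ### The representation

The coordinates `1, …, N` are indexed by `Fin N = {0, …, N - 1}`.  A permutation acts on points
from the right by `(x w)_i = x_{w(i)}`, that is `x w = x ∘ w`. -/

/-- The matrix `τ(w)` with complex entries. -/
def rep (τ : Equiv.Perm (Fin N) →* Matrix.orthogonalGroup (Fin n) ℝ) (w : Equiv.Perm (Fin N)) :
    Matrix (Fin n) (Fin n) ℂ :=
  (τ w : Matrix (Fin n) (Fin n) ℝ).map Complex.ofReal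

/-- The action of the symmetric group on `V_τ = ℂⁿ` through the matrices `τ(w)`, as a
representation in the sense of Mathlib. -/
def complexRep (τ : Equiv.Perm (Fin N) →* Matrix.orthogonalGroup (Fin n) ℝ) :
    Representation ℂ (Equiv.Perm (Fin N)) (Fin n → ℂ) where
  toFun w := Matrix.toLin' (rep τ w)
  map_one' := by
    have h : rep τ 1 = 1 := by
      simp [rep, Matrix.map_one]
    rw [h, Matrix.toLin'_one]
    rfl
  map_mul' v w := by
    have h : rep τ (v * w) = rep τ v * rep τ w := by
      have h' := Matrix.map_mul (L := (τ v : Matrix (Fin n) (Fin n) ℝ))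
        (M := (τ w : Matrix (Fin n) (Fin n) ℝ)) (f := Complex.ofRealHom)
      rw [rep, _root_.map_mul]
      exact h'
    rw [h, Matrix.toLin'_mul]
    rfl

/-- `S₁(τ)`: the scalar by which the central element `∑_{i<j} (i,j)` acts on the irreducible
module `V_τ` (the sum of the contents of the partition), read off from the trace. -/
def contentSum (τ : Equiv.Perm (Fin N) →* Matrix.orthogonalGroup (Fin n) ℝ) : ℝ :=
  (∑ i : Fin N, ∑ j ∈ Finset.Ioi i,
    (τ (Equiv.swap i j) : Matrix (Fin n) (Fin n) ℝ).trace) / n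

/-- `γ = S₁(τ) / N`. -/
def gam (τ : Equiv.Perm (Fin N) →* Matrix.orthogonalGroup (Fin n) ℝ) : ℝ :=
  contentSum τ / N

/-- The first coordinate. -/
def fstIdx (hN : 3 ≤ N) : Fin N := ⟨0, by omega⟩

/-- The coordinate number `N - 1`. -/
def penIdx (hN : 3 ≤ N) : Fin N := ⟨N - 2, by omega⟩

/-- The coordinate number `N`. -/
def lstIdx (hN : 3 ≤ N) : Fin N := ⟨N - 1, by omega⟩

/-- The coordinates number `1, …, N - 2`. -/
def inIdx (j : Fin (N - 2)) : Fin N := ⟨j, by omega⟩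

/-- `υ = τ(w₀)` with `w₀` the `N`-cycle `(1, 2, …, N)`, `w₀(i) = i + 1`. -/
def upsilon (τ : Equiv.Perm (Fin N) →* Matrix.orthogonalGroup (Fin n) ℝ) :
    Matrix (Fin n) (Fin n) ℂ :=
  rep τ (finRotate N)

/-- `σ = τ((N-1, N))`. -/
def sigma (hN : 3 ≤ N) (τ : Equiv.Perm (Fin N) →* Matrix.orthogonalGroup (Fin n) ℝ) :
    Matrix (Fin n) (Fin n) ℂ :=
  rep τ (Equiv.swap (penIdx hN) (lstIdx hN))

/-- `ρ(a, b)`: the matrix acting by `a` on the eigenspace of `σ` for `-1` and by `b` on the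
eigenspace for `1`; it is `diag(a I, b I)` in a basis in which `σ = diag(-I, I)`. -/
def rho (hN : 3 ≤ N) (τ : Equiv.Perm (Fin N) →* Matrix.orthogonalGroup (Fin n) ℝ) (a b : ℂ) :
    Matrix (Fin n) (Fin n) ℂ :=
  (a / 2) • (1 - sigma hN τ) + (b / 2) • (1 + sigma hN τ)

/-! ### The differential system and its normalized solution -/

/-- `ω ^ s = exp(2πi s / N)` for real `s`. -/
def omegaPow (N : ℕ) (s : ℝ) : ℂ := Complex.exp (2 * Real.pi * s / N * Complex.I)

/-- The base point `x₀ = (1, ω, …, ω^{N-1})`. -/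
def basePoint (N : ℕ) : Fin N → ℂ := fun j => omegaPow N ((j : ℕ) : ℝ)

/-- Points with non-zero and pairwise distinct coordinates. -/
def regSet (N : ℕ) : Set (Fin N → ℂ) :=
  {x | (∀ i, x i ≠ 0) ∧ Function.Injective x}

/-- The chamber `𝒞₀`: the points `(e^{iθ_1}, …, e^{iθ_N})` with
`θ_1 < θ_2 < ⋯ < θ_N < θ_1 + 2π`; it is the connected component of the regular part of the torus
that contains `x₀`. -/
def chamber (hN : 3 ≤ N) : Set (Fin N → ℂ) :=
  {x | ∃ θ : Fin N → ℝ, StrictMono θ ∧ θ (lstIdx hN) < θ (fstIdx hN) + 2 * Real.pi ∧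
    x = fun j => Complex.exp (θ j * Complex.I)}

/-- The coefficient matrix `∑_{j ≠ i} τ((i,j)) / (x_i - x_j) - (γ / x_i) I`. -/
def coeffMat (τ : Equiv.Perm (Fin N) →* Matrix.orthogonalGroup (Fin n) ℝ) (i : Fin N)
    (x : Fin N → ℂ) : Matrix (Fin n) (Fin n) ℂ :=
  (∑ j ∈ Finset.univ.erase i, (1 / (x i - x j)) • rep τ (Equiv.swap i j))
    - ((gam τ : ℂ) / x i) • (1 : Matrix (Fin n) (Fin n) ℂ)

/-- `L` is the solution of `∂_i L = κ L {∑_{j ≠ i} τ((i,j)) / (x_i - x_j) - γ / x_i}` on `𝒞₀`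
(holomorphic on a neighbourhood of `𝒞₀` in the regular set) with `L(x₀) = I`, extended to the
regular part of the torus by `L(x) = L(x w_x⁻¹) τ(w_x)` where `w_x(1) = 1` and `x w_x⁻¹ ∈ 𝒞₀`.
This determines `L` on the regular part of the torus. -/
structure IsFundamentalMatrix (hN : 3 ≤ N)
    (τ : Equiv.Perm (Fin N) →* Matrix.orthogonalGroup (Fin n) ℝ) (κ : ℝ)
    (L : (Fin N → ℂ) → Matrix (Fin n) (Fin n) ℂ) : Prop where
  solves : ∃ U : Set (Fin N → ℂ), IsOpen U ∧ chamber hN ⊆ U ∧ U ⊆ regSet N ∧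
    DifferentiableOn ℂ L U ∧
    ∀ x ∈ U, ∀ i, HasDerivAt (fun t : ℂ => L (Function.update x i t))
      ((κ : ℂ) • (L x * coeffMat τ i x)) (x i)
  base : L (basePoint N) = 1
  extend : ∀ (x : Fin N → ℂ) (w : Equiv.Perm (Fin N)), w (fstIdx hN) = fstIdx hN →
    x ∘ ⇑w⁻¹ ∈ chamber hN → L x = L (x ∘ ⇑w⁻¹) * rep τ w

/-! ### The series solution at the face `x_{N-1} = x_N`

The points `x(u, z) = (x_1, …, x_{N-2}, u - z, u + z)` are described by `y = (x_1, …, x_{N-2})`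
together with `u` and `z`; the face `z = 0` is parametrized by the pairs `(y, u)`. -/

/-- `β_k(x(u,0)) = ∑_{j ≤ N-2} τ((j,N)) / (u - x_j)^{k+1}`. -/
def beta (hN : 3 ≤ N) (τ : Equiv.Perm (Fin N) →* Matrix.orthogonalGroup (Fin n) ℝ) (k : ℕ)
    (p : (Fin (N - 2) → ℂ) × ℂ) : Matrix (Fin n) (Fin n) ℂ :=
  ∑ j : Fin (N - 2), (1 / (p.2 - p.1 j) ^ (k + 1)) • rep τ (Equiv.swap (inIdx j) (lstIdx hN))

/-- `B_k = (-1)^k β_k - σ β_k σ`. -/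
def bigB (hN : 3 ≤ N) (τ : Equiv.Perm (Fin N) →* Matrix.orthogonalGroup (Fin n) ℝ) (k : ℕ)
    (p : (Fin (N - 2) → ℂ) × ℂ) : Matrix (Fin n) (Fin n) ℂ :=
  (-1 : ℂ) ^ k • beta hN τ k p - sigma hN τ * beta hN τ k p * sigma hN τ

/-- The coefficients `α_k(x(u,0))` obtained from `α_0`: with `S_k = ∑_{i<k} α_{k-1-i} B_i`,
`α_k = (κ / k) S_k` for even `k ≥ 2` and `α_k = ρ(κ / (k - 2κ), κ / (k + 2κ)) S_k` for odd `k`. -/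
def alpha (hN : 3 ≤ N) (τ : Equiv.Perm (Fin N) →* Matrix.orthogonalGroup (Fin n) ℝ) (κ : ℝ)
    (α₀ : (Fin (N - 2) → ℂ) × ℂ → Matrix (Fin n) (Fin n) ℂ) (p : (Fin (N - 2) → ℂ) × ℂ) :
    ℕ → Matrix (Fin n) (Fin n) ℂ
  | 0 => α₀ p
  | k + 1 =>
    let S : Matrix (Fin n) (Fin n) ℂ :=
      ∑ i : Fin (k + 1), alpha hN τ κ α₀ p (k - i) * bigB hN τ i p
    if Even (k + 1) then ((κ : ℂ) / ((k + 1 : ℕ) : ℂ)) • S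
    else rho hN τ ((κ : ℂ) / (((k + 1 : ℕ) : ℂ) - 2 * κ))
      ((κ : ℂ) / (((k + 1 : ℕ) : ℂ) + 2 * κ)) * S
  termination_by k => k
  decreasing_by omega

/-- The first `N - 2` coordinates `(1, ω, …, ω^{N-3})` of `x₀`. -/
def faceY (N : ℕ) : Fin (N - 2) → ℂ := fun j => omegaPow N ((j : ℕ) : ℝ)

/-- The value `u = ω^{-3/2}` at the base point
`x^{(0)} = (1, ω, …, ω^{N-3}, ω^{-3/2}, ω^{-3/2})` of the face. -/
def faceU (N : ℕ) : ℂ := omegaPow N (-3 / 2)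

/-- The coordinate `u = (x_{N-1} + x_N) / 2` of `x(u, z)`. -/
def uCoord (hN : 3 ≤ N) (x : Fin N → ℂ) : ℂ := (x (penIdx hN) + x (lstIdx hN)) / 2

/-- The coordinate `z = (x_N - x_{N-1}) / 2` of `x(u, z)`. -/
def zCoord (hN : 3 ≤ N) (x : Fin N → ℂ) : ℂ := (x (lstIdx hN) - x (penIdx hN)) / 2

/-- `α₀` is the normalized leading coefficient on the open set `D` of regular face points: it is
holomorphic on `D`, has the value `I` at `x^{(0)}` and satisfies
`∂_u α₀ = κ α₀ (β_0 + σ β_0 σ)` and, for `1 ≤ j ≤ N - 2`,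
`∂_j α₀ = κ α₀ {∑_{i ≤ N-2, i ≠ j} τ((i,j)) / (x_j - x_i) -
  (τ((j,N-1)) + τ((j,N))) / (u - x_j)}`.
The set `D` contains the segment from `x^{(0)}` to the face point `x(u, 0)` that belongs to `x₀`:
this singles out the branch of `α₀` that gives a solution on `𝒞₀`. -/
structure IsLeadingCoeff (hN : 3 ≤ N)
    (τ : Equiv.Perm (Fin N) →* Matrix.orthogonalGroup (Fin n) ℝ) (κ : ℝ)
    (D : Set ((Fin (N - 2) → ℂ) × ℂ))
    (α₀ : (Fin (N - 2) → ℂ) × ℂ → Matrix (Fin n) (Fin n) ℂ) : Prop where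
  isOpen : IsOpen D
  regular : ∀ p ∈ D, (∀ j, p.1 j ≠ 0) ∧ p.2 ≠ 0 ∧ Function.Injective p.1 ∧ ∀ j, p.1 j ≠ p.2
  segment_subset :
    segment ℝ (faceY N, faceU N) (faceY N, uCoord hN (basePoint N)) ⊆ D
  base : α₀ (faceY N, faceU N) = 1
  differentiableOn : DifferentiableOn ℂ α₀ D
  deriv_u : ∀ p ∈ D, HasDerivAt (fun t : ℂ => α₀ (p.1, t))
    ((κ : ℂ) • (α₀ p * (beta hN τ 0 p + sigma hN τ * beta hN τ 0 p * sigma hN τ))) p.2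
  deriv_y : ∀ p ∈ D, ∀ j, HasDerivAt (fun t : ℂ => α₀ (Function.update p.1 j t, p.2))
    ((κ : ℂ) • (α₀ p *
      ((∑ i ∈ Finset.univ.erase j,
          (1 / (p.1 j - p.1 i)) • rep τ (Equiv.swap (inIdx i) (inIdx j)))
        - (1 / (p.2 - p.1 j)) • (rep τ (Equiv.swap (inIdx j) (penIdx hN))
            + rep τ (Equiv.swap (inIdx j) (lstIdx hN)))))) (p.1 j)

/-- The series solution `L₁(x) = (∏_j x_j)^{-γκ} ρ(z^{-κ}, z^κ) ∑_k α_k(x(u,0)) z^k`, with the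
principal branches of the powers.  (At a point of the torus another branch multiplies `L₁` on the
left by a unitary matrix that is a combination of `I` and `σ`.) -/
def seriesSol (hN : 3 ≤ N) (τ : Equiv.Perm (Fin N) →* Matrix.orthogonalGroup (Fin n) ℝ) (κ : ℝ)
    (α₀ : (Fin (N - 2) → ℂ) × ℂ → Matrix (Fin n) (Fin n) ℂ) (x : Fin N → ℂ) :
    Matrix (Fin n) (Fin n) ℂ :=
  (∏ j, x j) ^ (-(gam τ : ℂ) * κ) •
    (rho hN τ (zCoord hN x ^ (-(κ : ℂ))) (zCoord hN x ^ (κ : ℂ)) *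
      ∑' k : ℕ, zCoord hN x ^ k •
        alpha hN τ κ α₀ (fun j => x (inIdx j), uCoord hN x) k)

/-! ### Functions and operators on the torus -/

/-- `f : 𝕋^N → V_τ` is of class `C¹`. -/
def IsC1 (f : (Fin N → Circle) → (Fin n → ℂ)) : Prop :=
  ContDiff ℝ 1 (fun θ : Fin N → ℝ => f (fun j => Circle.exp (θ j)))

/-- `x_i ∂_i f = -i ∂f/∂θ_i` for a function on the torus, where `x_i = e^{iθ_i}`. -/
def xPartial (i : Fin N) (f : (Fin N → Circle) → (Fin n → ℂ)) (x : Fin N → Circle) :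
    Fin n → ℂ :=
  (-Complex.I) • deriv (fun t : ℝ => f (Function.update x i (x i * Circle.exp t))) 0

/-- `x_i 𝒟_i f(x) = x_i ∂_i f(x) + κ ∑_{j ≠ i} x_i / (x_i - x_j) τ((i,j)) (f(x) - f(x(i,j)))`. -/
def xDunkl (τ : Equiv.Perm (Fin N) →* Matrix.orthogonalGroup (Fin n) ℝ) (κ : ℝ) (i : Fin N)
    (f : (Fin N → Circle) → (Fin n → ℂ)) (x : Fin N → Circle) : Fin n → ℂ :=
  xPartial i f x + (κ : ℂ) • ∑ j ∈ Finset.univ.erase i,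
    ((x i : ℂ) / ((x i : ℂ) - (x j : ℂ))) •
      (rep τ (Equiv.swap i j) *ᵥ (f x - f (x ∘ ⇑(Equiv.swap i j))))

/-- The measure `(2π)^{-N} dθ_1 ⋯ dθ_N` on the angles `-π < θ_j ≤ π`. -/
def angleMeasure (N : ℕ) : MeasureTheory.Measure (Fin N → ℝ) :=
  ENNReal.ofReal (((2 * Real.pi) ^ N)⁻¹) •
    MeasureTheory.volume.restrict (Set.univ.pi fun _ => Set.Ioc (-Real.pi) Real.pi)

/-- The point `(e^{iθ_1}, …, e^{iθ_N})` of the torus. -/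
def torusPoint (θ : Fin N → ℝ) : Fin N → Circle := fun j => Circle.exp (θ j)

/-- `f(x)^* L(x)^* H L(x) g(x)` for functions `f`, `g` on the torus. -/
def formDensity (L : (Fin N → ℂ) → Matrix (Fin n) (Fin n) ℂ) (H : Matrix (Fin n) (Fin n) ℂ)
    (f g : (Fin N → Circle) → (Fin n → ℂ)) (x : Fin N → Circle) : ℂ :=
  star (f x) ⬝ᵥ (((L fun j => (x j : ℂ))ᴴ * H * L fun j => (x j : ℂ)) *ᵥ g x)

end TorusDunkl

end

namespace TorusDunkl

section

open scoped Matrix.Norms.L2Operator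
open Set Filter Topology

variable {N n : ℕ}

/-! ### Uniqueness for linear differential inequalities -/

/-! Write `K = L^* H L`, put `x_j = exp(i θ_j)`, and let a wall be a set where two coordinates
coincide.

Algebra. The extension of `L` across the chambers and the hypothesis that `υ` commutes with `H` make
`K` equivariant: `K(xw) = τ(w)⁻¹ K(x) τ(w)` for every permutation `w` (`formMat_comp`). The
differential system for `L` expresses `dK` through the same coefficients `x_i / (x_i - x_j)` that
occur in the Dunkl operators. Hence, with `Φ = F^* K G`, the integrand equals `i ∂Φ/∂θ_i` plus one
term for each `j ≠ i` that is odd under the transposition `(i,j)` (`sesq_angleDunkl_sub`). On a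
manifold without walls the integral would vanish at once; everything else deals with the
singularities of `K` at the walls.

Integration by parts. Multiply by a permutation invariant cutoff that vanishes within distance `ε`
of the walls. The odd terms integrate to zero, and by periodicity the derivative moves to the
cutoff. The part of the derivative of the cutoff that belongs to the wall `x_i = x_j` is odd under
`(i,j)`, so it sees only the difference of `Φ` and its reflection
(`exists_norm_integral_cutoffDeriv_le`). It has size `1/ε` on a strip of width of order `ε`. Let `p
= |κ| N (N-1)`, which is less than `1/2`. Away from the other walls by `√ε` the difference is
`O(ε^(1/2-p))`; on the remaining part of the strip, of measure `O(ε √ε)`, the crude bound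
`O(ε^(-p))` is enough. Both contributions are `O(ε^(1/2-p))` and vanish in the limit
(`integral_eq_zero_of_odd_add_partial`).

Growth. Integrating the system along a segment from the base point bounds `L` by `δ^(-p/2)` when all
gaps are at least `δ`, hence `K` by `δ^(-p)` (`exists_norm_fundamental_le`,
`exists_norm_formMat_le`). This also gives integrability.

Near a wall. By equivariance it suffices to treat `x_{N-1} = x_N` and the defect `K - σKσ`. Across
the wall the singular part of `dK` is a multiple of `σK + Kσ`, which commutes with `σ`, so the
derivative of the defect is `O(t^(-p))` at distance `t`. If the defect tends to zero at the wall, it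
is therefore `O(t^(1-p))` (`exists_norm_defect_le`). The vanishing of this limit propagates along
the wall by Gronwall's inequality, because `σ` exchanges the two sides and the regular coefficients
differ across the wall only by `O(t)` (`tendsto_defect_of_isWallPoint`). One point of the wall is
thus enough.

The point of the wall. On the arc from the wall to `x₀` on which the last two coordinates separate
symmetrically, the series `L₁` solves the same equation as `L`, so `K = L₁^* M L₁` with `M` the
matrix assumed to commute with `σ`. Since `L₁` is a scalar times `ρ(z^(-κ), z^κ) (α₀ + O(z))` and
`α₀` and `ρ` commute with `σ`, the defect is `O(|z|^(1-2|κ|))` (`tendsto_defect_wallBase`). That the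
series is a solution rests on the bound `‖α_k‖ ≤ ‖α₀‖ d^(-k)` (`norm_alpha_le`) and on the
`u`-derivative of `α_k`. The latter follows from a uniqueness argument for formal power series
(`deriv_coeff_eq_of_recursion`) whose compatibility condition is a consequence of the braid
relations (`sum_commutator_bigA_bigB`). -/

lemma eq_zero_of_norm_deriv_le_left {E : Type*} [NormedAddCommGroup E] [NormedSpace ℝ E]
    {f f' : ℝ → E} {a b K : ℝ} (hf : ContinuousOn f (Icc a b))
    (hf' : ∀ x ∈ Ioo a b, HasDerivAt f (f' x) x)
    (hK : ∀ x ∈ Ioo a b, ‖f' x‖ ≤ K * ‖f x‖) (ha : f a = 0) : ∀ x ∈ Icc a b, f x = 0 := by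
  intro x hx
  rcases hx.1.eq_or_lt with rfl | hax
  · exact ha
  -- The derivative is controlled only in the open interval, so Gronwall's inequality is started at
  -- `y > a`; afterwards `y` tends to `a`, where `f` vanishes by continuity.
  have key : ∀ y ∈ Ioo a x, ‖f x‖ ≤ ‖f y‖ * Real.exp (K * (x - y)) := by
    intro y hy
    have h := norm_le_gronwallBound_of_norm_deriv_right_le (f := f) (f' := f') (δ := ‖f y‖)
      (K := K) (ε := 0) (a := y) (b := x)
      (hf.mono (Icc_subset_Icc hy.1.le hx.2))
      (fun t ht => (hf' t ⟨hy.1.trans_le ht.1, ht.2.trans_le hx.2⟩).hasDerivWithinAt) le_rfl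
      (fun t ht => by simpa using hK t ⟨hy.1.trans_le ht.1, ht.2.trans_le hx.2⟩)
      x ⟨hy.2.le, le_rfl⟩
    rwa [gronwallBound_ε0] at h
  have hlim : Tendsto (fun y => ‖f y‖ * Real.exp (K * (x - y))) (𝓝[>] a)
      (𝓝 (‖f a‖ * Real.exp (K * (x - a)))) := by
    have h1 : Tendsto f (𝓝[>] a) (𝓝 (f a)) := by
      have := hf a ⟨le_rfl, hx.1.trans hx.2⟩
      refine this.mono_left ?_
      rw [← nhdsWithin_Ioo_eq_nhdsGT (hax.trans_le hx.2)]
      exact nhdsWithin_mono _ Ioo_subset_Icc_self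
    have h2 : Tendsto (fun y => Real.exp (K * (x - y))) (𝓝[>] a) (𝓝 (Real.exp (K * (x - a)))) :=
      (Continuous.tendsto (by fun_prop) a).mono_left nhdsWithin_le_nhds
    exact h1.norm.mul h2
  rw [ha, norm_zero, zero_mul] at hlim
  have : ‖f x‖ ≤ 0 := ge_of_tendsto hlim (by
    filter_upwards [Ioo_mem_nhdsGT hax] with y hy using key y hy)
  exact norm_le_zero_iff.mp this

lemma eq_zero_of_norm_deriv_le_right {E : Type*} [NormedAddCommGroup E] [NormedSpace ℝ E]
    {f f' : ℝ → E} {a b K : ℝ} (hf : ContinuousOn f (Icc a b))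
    (hf' : ∀ x ∈ Ioo a b, HasDerivAt f (f' x) x)
    (hK : ∀ x ∈ Ioo a b, ‖f' x‖ ≤ K * ‖f x‖) (hb : f b = 0) : ∀ x ∈ Icc a b, f x = 0 := by
  intro x hx
  have h := eq_zero_of_norm_deriv_le_left (f := fun t => f (-t)) (f' := fun t => -f' (-t))
    (a := -b) (b := -a) (K := K)
    (hf.comp continuous_neg.continuousOn fun t ht => ⟨by linarith [ht.2], by linarith [ht.1]⟩)
    (fun t ht => by
      have := (hf' (-t) ⟨by linarith [ht.2], by linarith [ht.1]⟩).scomp t (hasDerivAt_neg t)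
      simpa [Function.comp_def] using this)
    (fun t ht => by
      simpa using hK (-t) ⟨by linarith [ht.2], by linarith [ht.1]⟩)
    (by simpa using hb) (-x) ⟨by linarith [hx.2], by linarith [hx.1]⟩
  simpa using h

/-! ### The matrices of the representation -/

variable (τ : Equiv.Perm (Fin N) →* Matrix.orthogonalGroup (Fin n) ℝ)

@[simp] lemma rep_one : rep τ 1 = 1 := by simp [rep, Matrix.map_one]

lemma rep_mul (v w : Equiv.Perm (Fin N)) : rep τ (v * w) = rep τ v * rep τ w := by
  have h' := Matrix.map_mul (L := (τ v : Matrix (Fin n) (Fin n) ℝ))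
    (M := (τ w : Matrix (Fin n) (Fin n) ℝ)) (f := Complex.ofRealHom)
  rw [rep, _root_.map_mul]
  exact h'

lemma rep_conjTranspose (w : Equiv.Perm (Fin N)) : (rep τ w)ᴴ = rep τ w⁻¹ := by
  ext i j
  simp [rep, Matrix.conjTranspose_apply, map_inv, Matrix.UnitaryGroup.inv_val, Matrix.star_apply]

lemma rep_mul_inv (w : Equiv.Perm (Fin N)) : rep τ w * rep τ w⁻¹ = 1 := by
  rw [← rep_mul]; simp

lemma rep_inv_mul (w : Equiv.Perm (Fin N)) : rep τ w⁻¹ * rep τ w = 1 := by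
  rw [← rep_mul]; simp

lemma rep_swap_mul_self (i j : Fin N) : rep τ (Equiv.swap i j) * rep τ (Equiv.swap i j) = 1 := by
  rw [← rep_mul]; simp

lemma rep_swap_conjTranspose (i j : Fin N) :
    (rep τ (Equiv.swap i j))ᴴ = rep τ (Equiv.swap i j) := by
  rw [rep_conjTranspose, Equiv.swap_inv]

lemma rep_mul_swap (w : Equiv.Perm (Fin N)) (i j : Fin N) :
    rep τ w * rep τ (Equiv.swap i j) = rep τ (Equiv.swap (w i) (w j)) * rep τ w := by
  rw [← rep_mul, ← rep_mul, Equiv.mul_swap_eq_swap_mul]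

lemma norm_rep_le (w : Equiv.Perm (Fin N)) : ‖rep τ w‖ ≤ 1 := by
  have h := Matrix.l2_opNorm_conjTranspose_mul_self (rep τ w)
  rw [rep_conjTranspose, rep_inv_mul] at h
  have h1 : ‖(1 : Matrix (Fin n) (Fin n) ℂ)‖ ≤ 1 := by
    have := Matrix.l2_opNorm_diagonal (𝕜 := ℂ) (fun _ : Fin n => (1 : ℂ))
    rw [Matrix.diagonal_one] at this
    rw [this]
    exact (pi_norm_le_iff_of_nonneg zero_le_one).2 fun i => by simp
  rw [h] at h1
  nlinarith [norm_nonneg (rep τ w)]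

lemma norm_rep_mul_le (w : Equiv.Perm (Fin N)) (A : Matrix (Fin n) (Fin n) ℂ) :
    ‖rep τ w * A‖ ≤ ‖A‖ :=
  (norm_mul_le _ _).trans (mul_le_of_le_one_left (norm_nonneg _) (norm_rep_le τ w))

lemma norm_mul_rep_le (w : Equiv.Perm (Fin N)) (A : Matrix (Fin n) (Fin n) ℂ) :
    ‖A * rep τ w‖ ≤ ‖A‖ :=
  (norm_mul_le _ _).trans (mul_le_of_le_one_right (norm_nonneg _) (norm_rep_le τ w))

/-- Equality fails for `n = 0`, which is not excluded here. -/
lemma norm_one_le : ‖(1 : Matrix (Fin n) (Fin n) ℂ)‖ ≤ 1 := by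
  simpa using norm_rep_le (1 : Equiv.Perm (Fin 0) →* Matrix.orthogonalGroup (Fin n) ℝ) 1

/-- A matrix commuting with an irreducible representation is scalar. -/
lemma eq_smul_one_of_commute (hτ : (complexRep τ).IsIrreducible) (A : Matrix (Fin n) (Fin n) ℂ)
    (hA : ∀ w, A * rep τ w = rep τ w * A) : ∃ c : ℂ, A = c • (1 : Matrix (Fin n) (Fin n) ℂ) := by
  have := hτ
  let F : Representation.IntertwiningMap (complexRep τ) (complexRep τ) :=
    { toLinearMap := Matrix.toLin' A
      isIntertwining' := fun g => by
        change Matrix.toLin' A ∘ₗ Matrix.toLin' (rep τ g) = Matrix.toLin' (rep τ g) ∘ₗ _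
        rw [← Matrix.toLin'_mul, ← Matrix.toLin'_mul, hA] }
  obtain ⟨c, hc⟩ := (Representation.IsIrreducible.algebraMap_intertwiningMap_bijective_of_isAlgClosed
    (ρ := complexRep τ)).2 F
  refine ⟨c, ?_⟩
  apply Matrix.toLin'.injective
  ext1 v
  have h2 := congrArg (fun G : Representation.IntertwiningMap (complexRep τ) (complexRep τ) =>
    G.toLinearMap) hc
  have h3 : Matrix.toLin' A = F.toLinearMap := rfl
  rw [h3, ← h2, map_smul, Matrix.toLin'_one]
  rfl

lemma sum_rep_swap_symm :
    (∑ i : Fin N, ∑ j ∈ Finset.univ.erase i, rep τ (Equiv.swap i j))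
      = (2 : ℂ) • ∑ i : Fin N, ∑ j ∈ Finset.Ioi i, rep τ (Equiv.swap i j) := by
  have h1 : ∀ i : Fin N, (∑ j ∈ Finset.univ.erase i, rep τ (Equiv.swap i j))
      = (∑ j ∈ Finset.Ioi i, rep τ (Equiv.swap i j))
        + ∑ j ∈ Finset.Iio i, rep τ (Equiv.swap i j) := by
    intro i
    rw [← Finset.sum_union]
    · congr 1
      ext j
      simp [eq_comm]
    · rw [Finset.disjoint_left]
      intro j h1 h2
      simp at h1 h2
      exact absurd h1 (not_lt.2 h2.le)
  simp_rw [h1, Finset.sum_add_distrib, two_smul]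
  congr 1
  rw [Finset.sum_comm' (t' := Finset.univ) (s' := fun j => Finset.Ioi j) (by simp)]
  simp_rw [Equiv.swap_comm]

/-- The class of transpositions is stable under conjugation, so by Schur's lemma the sum is a
scalar. Taking traces identifies it: ordered pairs count every transposition twice, which gives `2
S₁(τ) = 2Nγ`. -/
lemma sum_rep_swap (hn : 2 ≤ n) (hN : 3 ≤ N) (hτ : (complexRep τ).IsIrreducible) :
    (∑ i : Fin N, ∑ j ∈ Finset.univ.erase i, rep τ (Equiv.swap i j))
      = (2 * N * gam τ : ℂ) • (1 : Matrix (Fin n) (Fin n) ℂ) := by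
  have hcomm : ∀ w, (∑ i : Fin N, ∑ j ∈ Finset.univ.erase i, rep τ (Equiv.swap i j)) * rep τ w
      = rep τ w * ∑ i : Fin N, ∑ j ∈ Finset.univ.erase i, rep τ (Equiv.swap i j) := by
    intro w
    simp_rw [Finset.mul_sum, Finset.sum_mul, rep_mul_swap]
    symm
    refine Fintype.sum_equiv w _ _ fun i => ?_
    refine Finset.sum_bij (fun j _ => w j) (by simp) (by simp) ?_ (by simp)
    intro j hj
    simp only [Finset.mem_erase] at hj
    exact ⟨w.symm j, by simp [Equiv.symm_apply_eq, hj.1]⟩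
  obtain ⟨c, hc⟩ := eq_smul_one_of_commute τ hτ _ hcomm
  rw [hc]
  congr 1
  rw [sum_rep_swap_symm] at hc
  have ht := congrArg Matrix.trace hc
  simp only [Matrix.trace_smul, Matrix.trace_sum, Matrix.trace_one, Fintype.card_fin,
    smul_eq_mul] at ht
  have htr : ∀ w, (rep τ w).trace = ((τ w : Matrix (Fin n) (Fin n) ℝ).trace : ℂ) := by
    intro w
    simp [rep, Matrix.trace]
  simp_rw [htr] at ht
  have hn0 : (n : ℂ) ≠ 0 := by norm_cast; omega
  have hN0 : (N : ℂ) ≠ 0 := by norm_cast; omega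
  rw [gam, contentSum]
  push_cast
  field_simp
  exact ht.symm

lemma sigma_mul_self (hN : 3 ≤ N) : sigma hN τ * sigma hN τ = 1 := rep_swap_mul_self τ _ _

lemma sigma_conjTranspose (hN : 3 ≤ N) : (sigma hN τ)ᴴ = sigma hN τ :=
  rep_swap_conjTranspose τ _ _

end

end TorusDunkl

namespace TorusDunkl

noncomputable section

open scoped Matrix.Norms.L2Operator
open Set Filter Topology

variable {N n : ℕ}

/-! ### Angular coordinates -/

/-- The point with the angles `θ`. -/
def expPoint (θ : Fin N → ℝ) : Fin N → ℂ := fun j => Complex.exp (θ j * Complex.I)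

/-- The chamber `𝒞₀` in angular coordinates. -/
def angleChamber (hN : 3 ≤ N) : Set (Fin N → ℝ) :=
  {θ | StrictMono θ ∧ θ (lstIdx hN) < θ (fstIdx hN) + 2 * Real.pi}

/-- The angles of the base point. -/
def baseAngles (N : ℕ) : Fin N → ℝ := fun j => 2 * Real.pi * (j : ℕ) / N

/-- `cot (a / 2) / 2`. -/
def halfCot (a : ℝ) : ℝ := Real.cos (a / 2) / (2 * Real.sin (a / 2))

-- The quotient by zero is `0`, which allows diagonal terms to be added to, or dropped from, the
-- cotangent sums.
@[simp] lemma halfCot_zero : halfCot 0 = 0 := by simp [halfCot]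

lemma halfCot_neg (a : ℝ) : halfCot (-a) = -halfCot a := by
  simp [halfCot, neg_div, div_neg]

lemma halfCot_add_two_pi (a : ℝ) : halfCot (a + 2 * Real.pi) = halfCot a := by
  have : (a + 2 * Real.pi) / 2 = a / 2 + Real.pi := by ring
  rw [halfCot, this, Real.cos_add_pi, Real.sin_add_pi, mul_neg, neg_div_neg_eq, halfCot]

lemma halfCot_add_int_mul_two_pi (a : ℝ) (m : ℤ) :
    halfCot (a + m * (2 * Real.pi)) = halfCot a :=
  (show Function.Periodic halfCot (2 * Real.pi) from halfCot_add_two_pi).int_mul m a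

lemma exp_sub_exp (a b : ℝ) : Complex.exp (a * Complex.I) - Complex.exp (b * Complex.I)
    = 2 * Complex.I * Complex.exp ((a + b) / 2 * Complex.I) * Real.sin ((a - b) / 2) := by
  have h1 : Complex.exp (a * Complex.I)
      = Complex.exp ((a + b) / 2 * Complex.I) * Complex.exp ((a - b) / 2 * Complex.I) := by
    rw [← Complex.exp_add]; congr 1; ring
  have h2 : Complex.exp (b * Complex.I)
      = Complex.exp ((a + b) / 2 * Complex.I) * Complex.exp (-((a - b) / 2) * Complex.I) := by
    rw [← Complex.exp_add]; congr 1; ring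
  rw [h1, h2, Complex.ofReal_sin]
  push_cast
  rw [Complex.sin]
  linear_combination (-Complex.exp ((a + b) / 2 * Complex.I) *
    (Complex.exp (-((a - b) / 2) * Complex.I) - Complex.exp ((a - b) / 2 * Complex.I)))
      * Complex.I_mul_I

/-- The real part is odd in `a - b` and the imaginary part is constant. This splitting is the source
of the Hermitian and skew-Hermitian parts of the coefficients in angular coordinates. -/
lemma I_mul_exp_div {a b : ℝ} (h : Complex.exp (a * Complex.I) ≠ Complex.exp (b * Complex.I)) :
    Complex.I * (Complex.exp (a * Complex.I) /
      (Complex.exp (a * Complex.I) - Complex.exp (b * Complex.I)))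
      = (halfCot (a - b) : ℂ) + Complex.I / 2 := by
  have hd := sub_ne_zero.2 h
  rw [exp_sub_exp] at hd ⊢
  have hs : (Real.sin ((a - b) / 2) : ℂ) ≠ 0 := right_ne_zero_of_mul hd
  have he : Complex.exp ((a + b) / 2 * Complex.I) ≠ 0 := Complex.exp_ne_zero _
  have h1 : Complex.exp (a * Complex.I)
      = Complex.exp ((a + b) / 2 * Complex.I) *
        (Real.cos ((a - b) / 2) + Real.sin ((a - b) / 2) * Complex.I) := by
    rw [Complex.ofReal_cos, Complex.ofReal_sin, ← Complex.exp_mul_I, ← Complex.exp_add]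
    congr 1; push_cast; ring
  rw [h1, halfCot]
  push_cast at hs ⊢
  field_simp

lemma expPoint_mem_chamber {hN : 3 ≤ N} {θ : Fin N → ℝ} (h : θ ∈ angleChamber hN) :
    expPoint θ ∈ chamber hN := ⟨θ, h.1, h.2, rfl⟩

lemma chamber_eq_image (hN : 3 ≤ N) : chamber hN = expPoint '' angleChamber hN := by
  ext x
  constructor
  · rintro ⟨θ, h1, h2, rfl⟩
    exact ⟨θ, ⟨h1, h2⟩, rfl⟩
  · rintro ⟨θ, h, rfl⟩
    exact expPoint_mem_chamber h

lemma baseAngles_mem (hN : 3 ≤ N) : baseAngles N ∈ angleChamber hN := by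
  have hN0 : (0 : ℝ) < N := by exact_mod_cast (by omega : 0 < N)
  refine ⟨fun i j hij => ?_, ?_⟩
  · have : ((i : ℕ) : ℝ) < ((j : ℕ) : ℝ) := by exact_mod_cast hij
    unfold baseAngles
    have := Real.pi_pos
    gcongr
  · have h1 : (((lstIdx hN : Fin N) : ℕ) : ℝ) = N - 1 := by
      simp [lstIdx, Nat.cast_sub (by omega : 1 ≤ N)]
    simp only [baseAngles, h1]
    have : ((fstIdx hN : Fin N) : ℕ) = 0 := rfl
    rw [this, div_lt_iff₀ hN0]
    have := Real.pi_pos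
    simp
    nlinarith

lemma expPoint_baseAngles : expPoint (baseAngles N) = basePoint N := by
  ext j
  simp [expPoint, baseAngles, basePoint, omegaPow]

lemma angleChamber_le {hN : 3 ≤ N} {θ : Fin N → ℝ} (h : θ ∈ angleChamber hN) (i : Fin N) :
    θ (fstIdx hN) ≤ θ i ∧ θ i ≤ θ (lstIdx hN) :=
  ⟨h.1.monotone (Fin.mk_le_of_le_val (Nat.zero_le _)), h.1.monotone (by
    rw [Fin.le_def]; simp only [lstIdx]; omega)⟩

/-- In this pairwise form the chamber is an intersection of open convex strips. -/
lemma angleChamber_iff {hN : 3 ≤ N} {θ : Fin N → ℝ} : θ ∈ angleChamber hN ↔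
    ∀ i j, i < j → 0 < θ j - θ i ∧ θ j - θ i < 2 * Real.pi := by
  constructor
  · intro h i j hij
    have h1 := angleChamber_le h i
    have h2 := angleChamber_le h j
    exact ⟨sub_pos.2 (h.1 hij), by linarith [h.2]⟩
  · intro h
    refine ⟨fun i j hij => sub_pos.1 (h i j hij).1, ?_⟩
    have := (h (fstIdx hN) (lstIdx hN) (by rw [Fin.lt_def]; simp [fstIdx, lstIdx]; omega)).2
    linarith

lemma convex_angleChamber (hN : 3 ≤ N) : Convex ℝ (angleChamber hN) := by
  intro x hx y hy a b ha hb hab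
  rw [angleChamber_iff] at *
  intro i j hij
  have h1 := hx i j hij
  have h2 := hy i j hij
  have e : (a • x + b • y) j - (a • x + b • y) i = a * (x j - x i) + b * (y j - y i) := by
    simp; ring
  rw [e]
  have := (convex_Ioo (0 : ℝ) (2 * Real.pi)) (x := x j - x i) ⟨h1.1, h1.2⟩
    (y := y j - y i) ⟨h2.1, h2.2⟩ ha hb hab
  exact ⟨this.1, this.2⟩

lemma isOpen_angleChamber (hN : 3 ≤ N) : IsOpen (angleChamber hN) := by
  have : angleChamber hN = ⋂ i : Fin N, ⋂ j : Fin N, ⋂ _ : i < j,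
      {θ | 0 < θ j - θ i ∧ θ j - θ i < 2 * Real.pi} := by
    ext θ
    simp [angleChamber_iff]
  rw [this]
  refine isOpen_iInter_of_finite fun i => isOpen_iInter_of_finite fun j =>
    isOpen_iInter_of_finite fun _ => ?_
  have hc : Continuous fun θ : Fin N → ℝ => θ j - θ i := by fun_prop
  exact (isOpen_lt continuous_const hc).inter (isOpen_lt hc continuous_const)

lemma sin_half_ne_zero {hN : 3 ≤ N} {θ : Fin N → ℝ} (h : θ ∈ angleChamber hN) {i j : Fin N}
    (hij : i ≠ j) : Real.sin ((θ i - θ j) / 2) ≠ 0 := by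
  rw [angleChamber_iff] at h
  rcases lt_or_gt_of_ne hij with h1 | h1
  · have := h i j h1
    rw [← neg_sub, neg_div, Real.sin_neg, neg_ne_zero]
    exact (Real.sin_pos_of_pos_of_lt_pi (by linarith) (by linarith)).ne'
  · have := h j i h1
    exact (Real.sin_pos_of_pos_of_lt_pi (by linarith) (by linarith)).ne'

lemma expPoint_injective_iff {θ : Fin N → ℝ} : Function.Injective (expPoint θ) ↔
    ∀ i j, i ≠ j → Real.sin ((θ i - θ j) / 2) ≠ 0 := by
  have key : ∀ i j, expPoint θ i = expPoint θ j ↔ Real.sin ((θ i - θ j) / 2) = 0 := by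
    intro i j
    rw [← sub_eq_zero]
    simp only [expPoint]
    rw [exp_sub_exp]
    simp only [mul_eq_zero, Complex.exp_ne_zero, Complex.I_ne_zero]
    norm_cast
    simp
  constructor
  · intro h i j hij h0
    exact hij (h ((key i j).2 h0))
  · intro h i j hij
    by_contra hne
    exact h i j hne ((key i j).1 hij)

/-! ### The coefficient matrices in angular coordinates -/

section coefficients

variable (τ : Equiv.Perm (Fin N) →* Matrix.orthogonalGroup (Fin n) ℝ)

/-- The Hermitian part of the coefficient matrix in the direction `v`. -/
def cotMat (θ v : Fin N → ℝ) : Matrix (Fin n) (Fin n) ℂ :=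
  ∑ i, ∑ j, (((v i - v j) / 2 * halfCot (θ i - θ j) : ℝ) : ℂ) • rep τ (Equiv.swap i j)

/-- The part of the coefficient matrix that does not depend on the point. -/
def constMat (v : Fin N → ℝ) : Matrix (Fin n) (Fin n) ℂ :=
  ∑ i, ∑ j, (((v i + v j) / 4 : ℝ) : ℂ) • rep τ (Equiv.swap i j)

/-- The coefficient matrix of the system for `L` in the direction `v`. -/
def angleCoeff (θ v : Fin N → ℝ) : Matrix (Fin n) (Fin n) ℂ :=
  cotMat τ θ v + Complex.I • (constMat τ v - (((gam τ + 1 / 2) * ∑ i, v i : ℝ) : ℂ) • 1)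

/-- Symmetrize the double sum: the cotangent is odd and picks out `v i - v j`, the constant `i/2`
picks out `v i + v j`. The diagonal terms contained in `constMat` are compensated by the `1/2` added
to `γ` in `angleCoeff`. -/
lemma angleCoeff_eq (θ v : Fin N → ℝ) : angleCoeff τ θ v =
    ∑ i, (v i : ℂ) • ((∑ j ∈ Finset.univ.erase i,
      ((halfCot (θ i - θ j) : ℂ) + Complex.I / 2) • rep τ (Equiv.swap i j))
      - (Complex.I * gam τ) • (1 : Matrix (Fin n) (Fin n) ℂ)) := by
  have h1 : ∀ i : Fin N, (∑ j ∈ Finset.univ.erase i,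
      ((halfCot (θ i - θ j) : ℂ) + Complex.I / 2) • rep τ (Equiv.swap i j))
      = (∑ j, ((halfCot (θ i - θ j) : ℂ) + Complex.I / 2) • rep τ (Equiv.swap i j))
        - (Complex.I / 2) • 1 := by
    intro i
    rw [← Finset.add_sum_erase _ _ (Finset.mem_univ i)]
    simp
    exact rep_one τ
  have hsymm : ∀ F : Fin N → Fin N → Matrix (Fin n) (Fin n) ℂ,
      ∑ i, ∑ j, F i j = ∑ i, ∑ j, (1 / 2 : ℂ) • (F i j + F j i) := by
    intro F
    simp_rw [smul_add, Finset.sum_add_distrib]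
    rw [Finset.sum_comm (f := fun i j => (1 / 2 : ℂ) • F j i), ← two_smul ℂ]
    simp_rw [← Finset.smul_sum]
    rw [smul_smul]
    norm_num
  have h2 : ∑ i, ∑ j, ((v i : ℂ) * ((halfCot (θ i - θ j) : ℂ) + Complex.I / 2)) •
      rep τ (Equiv.swap i j) = cotMat τ θ v + Complex.I • constMat τ v := by
    rw [hsymm]
    simp only [cotMat, constMat, Finset.smul_sum, ← Finset.sum_add_distrib]
    refine Finset.sum_congr rfl fun i _ => Finset.sum_congr rfl fun j _ => ?_
    rw [Equiv.swap_comm j i, ← add_smul, smul_smul, smul_smul, ← add_smul]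
    congr 1
    have : halfCot (θ j - θ i) = -halfCot (θ i - θ j) := by rw [← halfCot_neg]; congr 1; ring
    rw [this]
    push_cast
    ring
  simp_rw [h1, smul_sub, Finset.smul_sum, smul_smul, Finset.sum_sub_distrib]
  rw [h2, angleCoeff, ← Finset.sum_smul, ← Finset.sum_smul, smul_sub, smul_smul, sub_sub,
    ← add_sub_assoc, ← add_smul]
  congr 2
  push_cast
  rw [← Finset.sum_mul, ← Finset.sum_mul]
  ring

lemma rep_mul_cotMat (w : Equiv.Perm (Fin N)) (θ v : Fin N → ℝ) :
    rep τ w * cotMat τ (θ ∘ w) (v ∘ w) = cotMat τ θ v * rep τ w := by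
  simp only [cotMat, Finset.mul_sum, Finset.sum_mul, mul_smul_comm, smul_mul_assoc, rep_mul_swap]
  exact Fintype.sum_equiv w _ _ fun i => Fintype.sum_equiv w _ _ fun j => rfl

lemma rep_mul_constMat (w : Equiv.Perm (Fin N)) (v : Fin N → ℝ) :
    rep τ w * constMat τ (v ∘ w) = constMat τ v * rep τ w := by
  simp only [constMat, Finset.mul_sum, Finset.sum_mul, mul_smul_comm, smul_mul_assoc, rep_mul_swap]
  exact Fintype.sum_equiv w _ _ fun i => Fintype.sum_equiv w _ _ fun j => rfl

/-- Permuting the coordinates only reindexes the sums, since `τ(w)` conjugates transpositions to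
transpositions. This is the invariance of the system under the symmetric group. -/
lemma rep_mul_angleCoeff (w : Equiv.Perm (Fin N)) (θ v : Fin N → ℝ) :
    rep τ w * angleCoeff τ (θ ∘ w) (v ∘ w) = angleCoeff τ θ v * rep τ w := by
  have h : ∑ i, (v ∘ w) i = ∑ i, v i := Equiv.sum_comp w v
  rw [angleCoeff, angleCoeff, h, mul_add (rep τ w), rep_mul_cotMat, mul_smul_comm, mul_sub (rep τ w),
    rep_mul_constMat]
  simp [add_mul, sub_mul]

lemma cotMat_add_two_pi (θ v : Fin N → ℝ) (m : Fin N → ℤ) :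
    cotMat τ (fun i => θ i + m i * (2 * Real.pi)) v = cotMat τ θ v := by
  unfold cotMat
  refine Finset.sum_congr rfl fun i _ => Finset.sum_congr rfl fun j _ => ?_
  have : θ i + m i * (2 * Real.pi) - (θ j + m j * (2 * Real.pi))
      = θ i - θ j + ((m i - m j : ℤ) : ℝ) * (2 * Real.pi) := by push_cast; ring
  rw [this, halfCot_add_int_mul_two_pi]

lemma angleCoeff_add_two_pi (θ v : Fin N → ℝ) (m : Fin N → ℤ) :
    angleCoeff τ (fun i => θ i + m i * (2 * Real.pi)) v = angleCoeff τ θ v := by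
  rw [angleCoeff, cotMat_add_two_pi, angleCoeff]

lemma cotMat_conjTranspose (θ v : Fin N → ℝ) : (cotMat τ θ v)ᴴ = cotMat τ θ v := by
  simp [cotMat, Matrix.conjTranspose_sum, Matrix.conjTranspose_smul, rep_swap_conjTranspose]

lemma constMat_conjTranspose (v : Fin N → ℝ) : (constMat τ v)ᴴ = constMat τ v := by
  simp [constMat, Matrix.conjTranspose_sum, Matrix.conjTranspose_smul, rep_swap_conjTranspose]

lemma norm_constMat_le (v : Fin N → ℝ) :
    ‖constMat τ v‖ ≤ ∑ i, ∑ j, |v i + v j| / 4 := by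
  refine (norm_sum_le _ _).trans (Finset.sum_le_sum fun i _ =>
    (norm_sum_le _ _).trans (Finset.sum_le_sum fun j _ => ?_))
  refine (norm_smul_le _ _).trans ((mul_le_of_le_one_right (norm_nonneg _)
    (norm_rep_le τ _)).trans ?_)
  rw [Complex.norm_real, Real.norm_eq_abs, abs_div, abs_of_pos (by norm_num : (0 : ℝ) < 4)]

/-- The odd cotangent terms cancel in pairs, and `γ` is normalized so that its term cancels `i/2`
times the sum of all transpositions. Consequently `L` does not change when all coordinates are
rotated by the same angle. -/
lemma angleCoeff_const (hn : 2 ≤ n) (hN : 3 ≤ N) (hτ : (complexRep τ).IsIrreducible)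
    (θ : Fin N → ℝ) (c : ℝ) : angleCoeff τ θ (fun _ => c) = 0 := by
  rw [angleCoeff_eq, ← Finset.smul_sum, Finset.sum_sub_distrib]
  have h : (∑ i : Fin N, ∑ j ∈ Finset.univ.erase i,
      ((halfCot (θ i - θ j) : ℂ) + Complex.I / 2) • rep τ (Equiv.swap i j))
      = (Complex.I / 2) • ∑ i : Fin N, ∑ j ∈ Finset.univ.erase i, rep τ (Equiv.swap i j) := by
    simp_rw [add_smul, Finset.sum_add_distrib, ← Finset.smul_sum]
    rw [add_eq_right]
    have h1 : (∑ i : Fin N, ∑ j ∈ Finset.univ.erase i,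
        (halfCot (θ i - θ j) : ℂ) • rep τ (Equiv.swap i j))
        = ∑ i : Fin N, ∑ j, (halfCot (θ i - θ j) : ℂ) • rep τ (Equiv.swap i j) := by
      refine Finset.sum_congr rfl fun i _ => Finset.sum_erase _ (by simp)
    -- The double sum is shown to equal its own negative after its two indices are exchanged.
    have h2 : ∀ X : Matrix (Fin n) (Fin n) ℂ, X = -X → X = 0 := fun X hX => by
      ext a b
      exact self_eq_neg.1 (congrFun (congrFun hX a) b)
    rw [h1]
    refine h2 _ ?_
    conv_lhs => rw [Finset.sum_comm]
    rw [← Finset.sum_neg_distrib]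
    refine Finset.sum_congr rfl fun i _ => ?_
    rw [← Finset.sum_neg_distrib]
    refine Finset.sum_congr rfl fun j _ => ?_
    rw [Equiv.swap_comm, ← neg_smul, ← neg_sub, halfCot_neg]
    push_cast
    rfl
  rw [h, sum_rep_swap τ hn hN hτ, Finset.sum_const, Finset.card_univ, Fintype.card_fin, smul_smul,
    ← Nat.cast_smul_eq_nsmul ℂ, smul_smul, ← sub_smul]
  have : Complex.I / 2 * (2 * N * gam τ) - N * (Complex.I * gam τ) = 0 := by ring
  rw [this, zero_smul, smul_zero]

end coefficients

end

end TorusDunkl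

namespace TorusDunkl

noncomputable section

open scoped Matrix.Norms.L2Operator
open Set Filter Topology

variable {N n : ℕ}

/-! ### The system in angular coordinates -/

section system

variable (τ : Equiv.Perm (Fin N) →* Matrix.orthogonalGroup (Fin n) ℝ)

/-- `F` solves `dF = κ F · A` at `θ`, with `A` the coefficient form in angular coordinates. -/
def SolvesAt (κ : ℝ) (F : (Fin N → ℝ) → Matrix (Fin n) (Fin n) ℂ) (θ : Fin N → ℝ) : Prop :=
  ∃ D : (Fin N → ℝ) →L[ℝ] Matrix (Fin n) (Fin n) ℂ, HasFDerivAt F D θ ∧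
    ∀ v, D v = (κ : ℂ) • (F θ * angleCoeff τ θ v)

lemma hasFDerivAt_expPoint (θ : Fin N → ℝ) : HasFDerivAt (𝕜 := ℝ) expPoint
    (ContinuousLinearMap.pi fun j => (ContinuousLinearMap.proj (R := ℝ) (φ := fun _ : Fin N => ℝ)
      j).smulRight (Complex.I * Complex.exp (θ j * Complex.I))) θ := by
  rw [hasFDerivAt_pi']
  intro j
  have h1 : HasDerivAt (fun t : ℝ => Complex.exp (t * Complex.I))
      (Complex.I * Complex.exp (θ j * Complex.I)) (θ j) := by
    have := ((Complex.ofRealCLM.hasDerivAt (x := θ j)).mul_const Complex.I).cexp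
    simpa [mul_comm] using this
  have h2 := h1.hasFDerivAt.comp θ (hasFDerivAt_apply (𝕜 := ℝ) j θ)
  refine h2.congr_fderiv ?_
  ext v
  simp

/-- Holomorphy gives a complex differential, which the partial derivatives determine. Composing with
the exponential map multiplies the `i`-th partial derivative by `i x_i`, and this factor turns
`coeffMat` into the bracket of `angleCoeff_eq`. -/
lemma solvesAt_of_isFundamentalMatrix {hN : 3 ≤ N} {κ : ℝ}
    {L : (Fin N → ℂ) → Matrix (Fin n) (Fin n) ℂ} (hL : IsFundamentalMatrix hN τ κ L)
    {θ : Fin N → ℝ} (hθ : θ ∈ angleChamber hN) :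
    SolvesAt τ κ (fun θ => L (expPoint θ)) θ := by
  obtain ⟨U, hU, hCU, hUr, hd, hpart⟩ := hL.solves
  have hx : expPoint θ ∈ U := hCU (expPoint_mem_chamber hθ)
  have hF := (hd.differentiableAt (hU.mem_nhds hx)).hasFDerivAt
  set F := fderiv ℂ L (expPoint θ) with hFdef
  have hFi : ∀ i, F (Pi.single i 1) = (κ : ℂ) • (L (expPoint θ) * coeffMat τ i (expPoint θ)) := by
    intro i
    have h1 := hasDerivAt_update (expPoint θ) i (expPoint θ i)
    have hF' : HasFDerivAt L F (Function.update (expPoint θ) i (expPoint θ i)) := by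
      rwa [Function.update_eq_self]
    exact (hF'.comp_hasDerivAt _ h1).unique (hpart _ hx i)
  refine ⟨_, (hF.restrictScalars ℝ).comp θ (hasFDerivAt_expPoint θ), fun v => ?_⟩
  have h1 : ((F.restrictScalars ℝ).comp (ContinuousLinearMap.pi fun j =>
      (ContinuousLinearMap.proj (R := ℝ) (φ := fun _ : Fin N => ℝ) j).smulRight
        (Complex.I * Complex.exp (θ j * Complex.I)))) v
      = F (fun j => (v j : ℂ) * (Complex.I * expPoint θ j)) := by
    simp only [ContinuousLinearMap.comp_apply, ContinuousLinearMap.coe_restrictScalars']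
    congr 1
  change ((F.restrictScalars ℝ).comp _) v = _
  rw [h1]
  change (F : (Fin N → ℂ) →ₗ[ℂ] Matrix (Fin n) (Fin n) ℂ) _ = _
  rw [LinearMap.pi_apply_eq_sum_univ (F : (Fin N → ℂ) →ₗ[ℂ] Matrix (Fin n) (Fin n) ℂ),
    angleCoeff_eq, Finset.mul_sum, Finset.smul_sum]
  refine Finset.sum_congr rfl fun i _ => ?_
  have h2 : (fun j => if i = j then (1 : ℂ) else 0) = Pi.single i 1 := by
    ext j; simp [Pi.single_apply, eq_comm]
  rw [h2]
  have h3 : (F : (Fin N → ℂ) →ₗ[ℂ] Matrix (Fin n) (Fin n) ℂ) (Pi.single i 1)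
      = (κ : ℂ) • (L (expPoint θ) * coeffMat τ i (expPoint θ)) := hFi i
  have key : (∑ j ∈ Finset.univ.erase i,
      ((halfCot (θ i - θ j) : ℂ) + Complex.I / 2) • rep τ (Equiv.swap i j))
      - (Complex.I * gam τ) • (1 : Matrix (Fin n) (Fin n) ℂ)
      = (Complex.I * expPoint θ i) • coeffMat τ i (expPoint θ) := by
    rw [coeffMat, smul_sub, Finset.smul_sum, smul_smul]
    congr 1
    · refine Finset.sum_congr rfl fun j hj => ?_
      rw [smul_smul]
      congr 1
      have hne : expPoint θ i ≠ expPoint θ j := fun h =>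
        (Finset.ne_of_mem_erase hj) ((hUr hx).2 h).symm
      rw [← I_mul_exp_div hne]
      simp only [expPoint]
      ring
    · congr 1
      have : expPoint θ i ≠ 0 := Complex.exp_ne_zero _
      field_simp
  rw [h3, key]
  simp only [mul_smul_comm, smul_smul]
  congr 1
  ring

lemma exists_hasFDerivAt_mul_mul {E : Type*} [NormedAddCommGroup E] [NormedSpace ℝ E]
    {F : E → Matrix (Fin n) (Fin n) ℂ} {D : E →L[ℝ] Matrix (Fin n) (Fin n) ℂ} {x : E}
    (h : HasFDerivAt F D x) (A B : Matrix (Fin n) (Fin n) ℂ) :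
    ∃ D' : E →L[ℝ] Matrix (Fin n) (Fin n) ℂ, HasFDerivAt (fun y => A * F y * B) D' x ∧
      ∀ v, D' v = A * D v * B := by
  have hA : HasFDerivAt (fun y => A * F y * B) _ x :=
    (((LinearMap.mulRight ℝ B ∘ₗ LinearMap.mulLeft ℝ A).toContinuousLinearMap).hasFDerivAt
      (x := F x)).comp x h
  exact ⟨_, hA, fun v => rfl⟩

/-- Coefficients act from the right, so a constant factor on the left is harmless, while the factor
`τ(w)⁻¹` on the right converts the coefficients at the permuted point into those at `θ`. Shifts by
multiples of `2π` do not change the coefficients. -/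
lemma SolvesAt.rep_conj {κ : ℝ} {F : (Fin N → ℝ) → Matrix (Fin n) (Fin n) ℂ} {θ : Fin N → ℝ}
    (w : Equiv.Perm (Fin N)) (m : Fin N → ℤ)
    (h : SolvesAt τ κ F ((fun i => θ i + m i * (2 * Real.pi)) ∘ w)) :
    SolvesAt τ κ (fun θ => rep τ w * F ((fun i => θ i + m i * (2 * Real.pi)) ∘ w) * rep τ w⁻¹)
      θ := by
  obtain ⟨D, hD, hDv⟩ := h
  have hrot : HasFDerivAt (𝕜 := ℝ)
      (fun θ : Fin N → ℝ => (fun i => θ i + m i * (2 * Real.pi)) ∘ w)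
      (ContinuousLinearMap.pi fun j =>
        ContinuousLinearMap.proj (R := ℝ) (φ := fun _ : Fin N => ℝ) (w j)) θ := by
    rw [hasFDerivAt_pi']
    intro j
    exact (hasFDerivAt_apply (𝕜 := ℝ) (w j) θ).add_const _
  obtain ⟨D', h1, hD'⟩ := exists_hasFDerivAt_mul_mul (hD.comp θ hrot) (rep τ w) (rep τ w⁻¹)
  refine ⟨_, h1, fun v => ?_⟩
  have e := rep_mul_angleCoeff τ w (fun i => θ i + m i * (2 * Real.pi)) v
  rw [angleCoeff_add_two_pi] at e
  have hv : (ContinuousLinearMap.pi fun j =>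
        ContinuousLinearMap.proj (R := ℝ) (φ := fun _ : Fin N => ℝ) (w j)) v = v ∘ w := rfl
  have e2 : angleCoeff τ θ v = rep τ w *
      angleCoeff τ ((fun i => θ i + m i * (2 * Real.pi)) ∘ w) (v ∘ w) * rep τ w⁻¹ := by
    rw [e, mul_assoc, rep_mul_inv, mul_one]
  rw [hD', ContinuousLinearMap.comp_apply, hv, hDv]
  simp only [mul_smul_comm, smul_mul_assoc]
  rw [e2]
  congr 1
  simp only [mul_assoc]
  rw [← mul_assoc (rep τ w⁻¹) (rep τ w), rep_inv_mul, one_mul]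

lemma continuousOn_cotMat (hN : 3 ≤ N) (v : Fin N → ℝ) :
    ContinuousOn (fun θ => cotMat τ θ v) (angleChamber hN) := by
  unfold cotMat
  refine continuousOn_finsetSum _ fun i _ => continuousOn_finsetSum _ fun j _ => ?_
  suffices hs : ContinuousOn (fun θ : Fin N → ℝ =>
      (((v i - v j) / 2 * halfCot (θ i - θ j) : ℝ) : ℂ)) (angleChamber hN) from
    hs.smul continuousOn_const
  refine Complex.continuous_ofReal.comp_continuousOn (continuousOn_const.mul ?_)
  by_cases hij : i = j
  · subst hij; simpa using continuousOn_const
  · have hc : Continuous fun θ : Fin N → ℝ => (θ i - θ j) / 2 := by fun_prop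
    exact ((Real.continuous_cos.comp hc).continuousOn).div
      ((continuous_const.mul (Real.continuous_sin.comp hc)).continuousOn)
      fun θ hθ => mul_ne_zero two_ne_zero (sin_half_ne_zero hθ hij)

lemma SolvesAt.hasDerivAt_line {κ : ℝ} {F : (Fin N → ℝ) → Matrix (Fin n) (Fin n) ℂ}
    {θ v : Fin N → ℝ} {t : ℝ} (h : SolvesAt τ κ F (θ + t • v)) :
    HasDerivAt (fun t : ℝ => F (θ + t • v))
      ((κ : ℂ) • (F (θ + t • v) * angleCoeff τ (θ + t • v) v)) t := by
  obtain ⟨D, hD, hDv⟩ := h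
  have h1 : HasDerivAt (fun t : ℝ => θ + t • v) v t := by
    simpa using ((hasDerivAt_id t).smul_const v).const_add θ
  have := hD.comp_hasDerivAt t h1
  rwa [hDv] at this

lemma segment_mem_angleChamber {hN : 3 ≤ N} {θ θ' : Fin N → ℝ} (h : θ ∈ angleChamber hN)
    (h' : θ' ∈ angleChamber hN) {t : ℝ} (ht : t ∈ Icc (0 : ℝ) 1) :
    θ + t • (θ' - θ) ∈ angleChamber hN :=
  (convex_angleChamber hN).add_smul_sub_mem h h' ht

/-- The chamber is convex, so the segment from the base point stays inside, and the coefficients are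
bounded on it by compactness. The difference of two solutions then satisfies a homogeneous linear
differential inequality. -/
lemma SolvesAt.eq_of_eq_base {hN : 3 ≤ N} {κ : ℝ}
    {F G : (Fin N → ℝ) → Matrix (Fin n) (Fin n) ℂ} {θ₀ : Fin N → ℝ} (hθ₀ : θ₀ ∈ angleChamber hN)
    (hF : ∀ θ ∈ angleChamber hN, SolvesAt τ κ F θ) (hG : ∀ θ ∈ angleChamber hN, SolvesAt τ κ G θ)
    (h0 : F θ₀ = G θ₀) {θ : Fin N → ℝ} (hθ : θ ∈ angleChamber hN) : F θ = G θ := by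
  set v := θ - θ₀ with hv
  have hmem : ∀ t ∈ Icc (0 : ℝ) 1, θ₀ + t • v ∈ angleChamber hN := fun t ht =>
    segment_mem_angleChamber hθ₀ hθ ht
  have hc : ContinuousOn (fun t : ℝ => angleCoeff τ (θ₀ + t • v) v) (Icc 0 1) := by
    unfold angleCoeff
    exact ((continuousOn_cotMat τ hN v).comp (by fun_prop) hmem).add continuousOn_const
  obtain ⟨C, hC⟩ := isCompact_Icc.exists_bound_of_continuousOn hc
  have hd : ∀ t ∈ Icc (0 : ℝ) 1, HasDerivAt (fun t : ℝ => F (θ₀ + t • v) - G (θ₀ + t • v))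
      ((κ : ℂ) • ((F (θ₀ + t • v) - G (θ₀ + t • v)) * angleCoeff τ (θ₀ + t • v) v)) t := by
    intro t ht
    have := (hF _ (hmem t ht)).hasDerivAt_line.sub (hG _ (hmem t ht)).hasDerivAt_line
    rwa [← smul_sub, ← sub_mul] at this
  have h := eq_zero_of_norm_deriv_le_left (K := |κ| * C)
    (fun t ht => (hd t ht).continuousAt.continuousWithinAt)
    (fun t ht => hd t ⟨ht.1.le, ht.2.le⟩)
    (fun t ht => by
      rw [norm_smul, Complex.norm_real, Real.norm_eq_abs, mul_assoc, mul_comm C]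
      exact mul_le_mul_of_nonneg_left ((norm_mul_le _ _).trans
        (mul_le_mul_of_nonneg_left (hC t ⟨ht.1.le, ht.2.le⟩) (norm_nonneg _))) (abs_nonneg _))
    (by simp [h0]) 1 ⟨zero_le_one, le_rfl⟩
  rw [sub_eq_zero] at h
  simpa [hv] using h

end system

/-! ### Rotations of the chamber -/

section rotation

/-- The number of full turns by which the rotation of the chamber shifts the coordinates. -/
def turn (hN : 3 ≤ N) : Fin N → ℤ := fun i => if i = fstIdx hN then 1 else 0

/-- The rotation `(θ_1, …, θ_N) ↦ (θ_2, …, θ_N, θ_1 + 2π)`. -/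
def rotAngles (hN : 3 ≤ N) (θ : Fin N → ℝ) : Fin N → ℝ :=
  (fun i => θ i + turn hN i * (2 * Real.pi)) ∘ finRotate N

lemma finRotate_val (hN : 3 ≤ N) (i : Fin N) :
    ((finRotate N i : Fin N) : ℕ) = if (i : ℕ) + 1 = N then 0 else (i : ℕ) + 1 := by
  obtain ⟨M, rfl⟩ : ∃ M, N = M + 1 := ⟨N - 1, by omega⟩
  rw [coe_finRotate]
  simp [Fin.ext_iff]

lemma rotAngles_apply (hN : 3 ≤ N) (θ : Fin N → ℝ) (i : Fin N) :
    rotAngles hN θ i = if h : (i : ℕ) + 1 = N then θ (fstIdx hN) + 2 * Real.pi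
      else θ ⟨i + 1, by omega⟩ := by
  simp only [rotAngles, Function.comp_apply, turn]
  have h1 := finRotate_val hN i
  split_ifs with h2 h3 h3
  · simp [h2]
  · rw [Fin.ext_iff, h1, if_neg h3] at h2
    simp [fstIdx] at h2
  · rw [if_pos h3] at h1
    exact absurd (Fin.ext h1) h2
  · rw [if_neg h3] at h1
    have : finRotate N i = ⟨i + 1, by omega⟩ := Fin.ext h1
    rw [this]; simp

lemma rotAngles_mem {hN : 3 ≤ N} {θ : Fin N → ℝ} (h : θ ∈ angleChamber hN) :
    rotAngles hN θ ∈ angleChamber hN := by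
  rw [angleChamber_iff] at *
  intro i j hij
  have hij' : (i : ℕ) < j := hij
  rw [rotAngles_apply hN θ i, dif_neg (by omega), rotAngles_apply]
  split_ifs with h1
  · have := h (fstIdx hN) ⟨i + 1, by omega⟩ (by simp [Fin.lt_def, fstIdx])
    constructor <;> linarith
  · exact h _ _ (Fin.lt_def.2 (Nat.succ_lt_succ hij'))

lemma expPoint_add_two_pi (θ : Fin N → ℝ) (m : Fin N → ℤ) :
    expPoint (fun i => θ i + m i * (2 * Real.pi)) = expPoint θ := by
  ext i
  simp only [expPoint]
  rw [Complex.exp_eq_exp_iff_exists_int]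
  exact ⟨m i, by push_cast; ring⟩

lemma expPoint_comp (θ : Fin N → ℝ) (w : Equiv.Perm (Fin N)) :
    expPoint (θ ∘ w) = expPoint θ ∘ w := rfl

lemma expPoint_rotAngles (hN : 3 ≤ N) (θ : Fin N → ℝ) :
    expPoint (rotAngles hN θ) = expPoint θ ∘ finRotate N := by
  rw [rotAngles, expPoint_comp, expPoint_add_two_pi]

lemma rotAngles_baseAngles (hN : 3 ≤ N) :
    rotAngles hN (baseAngles N) = fun i => baseAngles N i + 2 * Real.pi / N := by
  have hN0 : (N : ℝ) ≠ 0 := by exact_mod_cast (by omega : N ≠ 0)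
  ext i
  rw [rotAngles_apply]
  split_ifs with h
  · simp only [baseAngles, fstIdx]
    have : ((i : ℕ) : ℝ) = N - 1 := by rw [eq_sub_iff_add_eq]; exact_mod_cast h
    rw [this]
    field_simp
    simp
  · simp only [baseAngles]
    push_cast
    ring

lemma finRotate_pow_fst (hN : 3 ≤ N) (k : ℕ) (hk : k < N) :
    ((finRotate N) ^ k) (fstIdx hN) = ⟨k, hk⟩ := by
  induction k with
  | zero => rfl
  | succ k ih =>
    rw [pow_succ', Equiv.Perm.mul_apply, ih (by omega)]
    refine Fin.ext ?_
    rw [finRotate_val hN, if_neg (by simp; omega)]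

end rotation

/-! ### The Hermitian form -/

section form

variable {τ : Equiv.Perm (Fin N) →* Matrix.orthogonalGroup (Fin n) ℝ}

/-- The matrix `L(x)^* H L(x)`. -/
def formMat (L : (Fin N → ℂ) → Matrix (Fin n) (Fin n) ℂ) (H : Matrix (Fin n) (Fin n) ℂ)
    (x : Fin N → ℂ) : Matrix (Fin n) (Fin n) ℂ :=
  (L x)ᴴ * H * L x

variable {hN : 3 ≤ N} {κ : ℝ} {L : (Fin N → ℂ) → Matrix (Fin n) (Fin n) ℂ}

/-- Conjugating by `τ(w₀)` the value of `L` at the rotated point again gives a solution on the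
chamber, so only the value at the base point has to be compared. -/
lemma fundamental_rotAngles (hn : 2 ≤ n) (hτ : (complexRep τ).IsIrreducible)
    (hL : IsFundamentalMatrix hN τ κ L) {θ : Fin N → ℝ} (hθ : θ ∈ angleChamber hN) :
    rep τ (finRotate N) * L (expPoint (rotAngles hN θ)) * rep τ (finRotate N)⁻¹ = L (expPoint θ) := by
  have hsol : ∀ θ ∈ angleChamber hN, SolvesAt τ κ (fun θ => L (expPoint θ)) θ := fun θ h =>
    solvesAt_of_isFundamentalMatrix τ hL h
  have hrot : ∀ θ ∈ angleChamber hN, SolvesAt τ κ (fun θ => rep τ (finRotate N) *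
      L (expPoint (rotAngles hN θ)) * rep τ (finRotate N)⁻¹) θ := fun θ h =>
    SolvesAt.rep_conj τ (F := fun θ => L (expPoint θ)) (finRotate N) (turn hN)
      (hsol _ (rotAngles_mem h))
  refine SolvesAt.eq_of_eq_base τ (baseAngles_mem hN) hrot hsol ?_ hθ
  -- Rotating the base angles adds `2π/N` to each of them, a move in a constant direction, along
  -- which `L` is constant by `angleCoeff_const`.
  have h1 : L (expPoint (rotAngles hN (baseAngles N))) = L (expPoint (baseAngles N)) := by
    have hline : ∀ t : ℝ, baseAngles N + t • (fun _ : Fin N => 2 * Real.pi / N)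
        ∈ angleChamber hN := by
      intro t
      have := baseAngles_mem hN
      rw [angleChamber_iff] at *
      intro i j hij
      simpa using this i j hij
    have hd : ∀ t : ℝ, HasDerivAt
        (fun t : ℝ => L (expPoint (baseAngles N + t • (fun _ : Fin N => 2 * Real.pi / N)))) 0 t := by
      intro t
      have := (hsol _ (hline t)).hasDerivAt_line
      rwa [angleCoeff_const τ hn hN hτ, mul_zero, smul_zero] at this
    have := is_const_of_deriv_eq_zero (fun t => (hd t).differentiableAt) (fun t => (hd t).deriv) 1 0
    simp only [one_smul, zero_smul, add_zero] at this
    rw [← this, rotAngles_baseAngles]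
    rfl
  rw [h1, expPoint_baseAngles, hL.base, mul_one, rep_mul_inv]

variable {H : Matrix (Fin n) (Fin n) ℂ}

/-- In `L^* H L` the inner factors `υ` are absorbed by `H`, which commutes with `υ`; only the outer
ones remain. -/
lemma formMat_comp_finRotate (hn : 2 ≤ n) (hτ : (complexRep τ).IsIrreducible)
    (hL : IsFundamentalMatrix hN τ κ L) (hυ : Commute (upsilon τ) H) {x : Fin N → ℂ}
    (hx : x ∈ chamber hN) :
    x ∘ finRotate N ∈ chamber hN ∧
    formMat L H (x ∘ finRotate N)
      = rep τ (finRotate N)⁻¹ * formMat L H x * rep τ (finRotate N) := by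
  rw [chamber_eq_image] at hx
  obtain ⟨θ, hθ, rfl⟩ := hx
  rw [← expPoint_rotAngles hN]
  refine ⟨expPoint_mem_chamber (rotAngles_mem hθ), ?_⟩
  have h := fundamental_rotAngles hn hτ hL hθ
  have h1 := rep_inv_mul τ (finRotate N)
  have h1' := rep_mul_inv τ (finRotate N)
  have hυ' : rep τ (finRotate N)⁻¹ * H * rep τ (finRotate N) = H := by
    have : rep τ (finRotate N) * H = H * rep τ (finRotate N) := hυ
    rw [mul_assoc, ← this, ← mul_assoc, h1, one_mul]
  rw [formMat, formMat, ← h]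
  simp only [Matrix.conjTranspose_mul, rep_conjTranspose, inv_inv]
  set Y := L (expPoint (rotAngles hN θ))
  set c := rep τ (finRotate N)
  set c' := rep τ (finRotate N)⁻¹
  calc Yᴴ * H * Y = Yᴴ * (c' * H * c) * Y := by rw [hυ']
    _ = (c' * c) * (Yᴴ * (c' * H * c) * Y) * (c' * c) := by rw [h1]; simp
    _ = _ := by simp only [mul_assoc]

lemma formMat_comp_of_mem_chamber (hn : 2 ≤ n) (hτ : (complexRep τ).IsIrreducible)
    (hL : IsFundamentalMatrix hN τ κ L) (hυ : Commute (upsilon τ) H) {x : Fin N → ℂ}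
    (hx : x ∈ chamber hN) (w : Equiv.Perm (Fin N)) :
    formMat L H (x ∘ w) = rep τ w⁻¹ * formMat L H x * rep τ w := by
  have hpow : ∀ k : ℕ, x ∘ ((finRotate N) ^ k : Equiv.Perm (Fin N)) ∈ chamber hN ∧
      formMat L H (x ∘ ((finRotate N) ^ k : Equiv.Perm (Fin N)))
        = rep τ (finRotate N ^ k)⁻¹ * formMat L H x * rep τ (finRotate N ^ k) := by
    intro k
    induction k with
    | zero => simpa using hx
    | succ k ih =>
      obtain ⟨h1, h2⟩ := formMat_comp_finRotate hn hτ hL hυ ih.1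
      have e : x ∘ ((finRotate N) ^ (k + 1) : Equiv.Perm (Fin N))
          = (x ∘ ((finRotate N) ^ k : Equiv.Perm (Fin N))) ∘ finRotate N := by
        rw [pow_succ]; rfl
      rw [e]
      refine ⟨h1, ?_⟩
      rw [h2, ih.2, pow_succ, mul_inv_rev, rep_mul, rep_mul]
      simp only [mul_assoc]
  -- Split `w` as `c * (c⁻¹ * w)` with `c` the power of the cycle that agrees with `w` at the first
  -- index. The second factor fixes that index, so the rule extending `L` applies to it.
  obtain ⟨k, hk⟩ : ∃ k : ℕ, (finRotate N ^ k) (fstIdx hN) = w (fstIdx hN) :=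
    ⟨w (fstIdx hN), finRotate_pow_fst hN _ (w (fstIdx hN)).2⟩
  obtain ⟨h1, h2⟩ := hpow k
  set c := finRotate N ^ k with hc
  have hext := hL.extend (x ∘ w) (c⁻¹ * w)
    (by rw [Equiv.Perm.mul_apply, ← hk]; simp)
    (by
      have : (x ∘ w) ∘ ((c⁻¹ * w)⁻¹ : Equiv.Perm (Fin N)) = x ∘ c := by
        ext i; simp
      rwa [this])
  have e : (x ∘ w) ∘ ((c⁻¹ * w)⁻¹ : Equiv.Perm (Fin N)) = x ∘ c := by
    ext i; simp
  rw [e] at hext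
  have h3 : formMat L H (x ∘ w) = rep τ (c⁻¹ * w)⁻¹ * formMat L H (x ∘ c) * rep τ (c⁻¹ * w) := by
    rw [formMat, hext, formMat, Matrix.conjTranspose_mul, rep_conjTranspose]
    simp only [mul_assoc]
  rw [h3, h2]
  simp only [mul_inv_rev, inv_inv, rep_mul, mul_assoc]
  rw [← mul_assoc (rep τ c) (rep τ c⁻¹), rep_mul_inv, one_mul, ← mul_assoc (rep τ c) (rep τ c⁻¹),
    rep_mul_inv, one_mul]

/-- Every regular point of the torus can be moved into the chamber, with a prescribed last
coordinate. -/
lemma exists_perm_mem_angleChamber (hN : 3 ≤ N) {θ : Fin N → ℝ}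
    (hθ : Function.Injective (expPoint θ)) (j : Fin N) :
    ∃ (w : Equiv.Perm (Fin N)) (m : Fin N → ℤ),
      (fun i => θ i + m i * (2 * Real.pi)) ∘ w ∈ angleChamber hN ∧ w (lstIdx hN) = j ∧ m j = 0 ∧
      ∀ i, θ i + m i * (2 * Real.pi) ∈ Ioc (θ j - 2 * Real.pi) (θ j) := by
  have hp : 0 < 2 * Real.pi := Real.two_pi_pos
  -- All angles are moved into the half-open period ending at `θ j`. Then `θ j` is the largest of
  -- them, and sorting puts the index `j` last.
  set m : Fin N → ℤ := fun i => -toIocDiv hp (θ j - 2 * Real.pi) (θ i) with hm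
  set t : Fin N → ℝ := fun i => θ i + m i * (2 * Real.pi) with ht
  have htmem : ∀ i, t i ∈ Ioc (θ j - 2 * Real.pi) (θ j) := by
    intro i
    have := toIocMod_mem_Ioc hp (θ j - 2 * Real.pi) (θ i)
    rw [sub_add_cancel, ← self_sub_toIocDiv_zsmul] at this
    simpa [ht, hm, sub_eq_add_neg] using this
  have hmj : m j = 0 := by
    simp [hm]
  have htinj : Function.Injective t := by
    intro a b hab
    apply hθ
    rw [← expPoint_add_two_pi θ m]
    simp only [expPoint]
    change Complex.exp (t a * _) = Complex.exp (t b * _)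
    rw [hab]
  have hmono : StrictMono (t ∘ Tuple.sort t) :=
    (Tuple.monotone_sort t).strictMono_of_injective (htinj.comp (Tuple.sort t).injective)
  refine ⟨Tuple.sort t, m, ⟨hmono, ?_⟩, ?_, hmj, htmem⟩
  · have h1 := htmem (Tuple.sort t (lstIdx hN))
    have h2 := htmem (Tuple.sort t (fstIdx hN))
    change t _ < t _ + _
    linarith [h1.2, h2.1]
  · apply htinj
    apply le_antisymm
    · have : t j = θ j := by simp [ht, hmj]
      rw [this]
      exact (htmem _).2
    · obtain ⟨a, ha⟩ := (Tuple.sort t).surjective j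
      rw [← ha]
      exact hmono.monotone (by rw [Fin.le_def]; simp only [lstIdx]; omega)

/-- Move the point into the chamber by some `w`, then compare the rules for `w⁻¹` and `w⁻¹ * v`
there. -/
lemma formMat_comp (hn : 2 ≤ n) (hτ : (complexRep τ).IsIrreducible)
    (hL : IsFundamentalMatrix hN τ κ L) (hυ : Commute (upsilon τ) H) {θ : Fin N → ℝ}
    (hθ : Function.Injective (expPoint θ)) (v : Equiv.Perm (Fin N)) :
    formMat L H (expPoint θ ∘ v) = rep τ v⁻¹ * formMat L H (expPoint θ) * rep τ v := by
  obtain ⟨w, m, hw, -⟩ := exists_perm_mem_angleChamber hN hθ (lstIdx hN)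
  have hx := expPoint_mem_chamber hw
  rw [expPoint_comp, expPoint_add_two_pi] at hx
  have h1 := formMat_comp_of_mem_chamber hn hτ hL hυ hx (w⁻¹ * v)
  have h2 := formMat_comp_of_mem_chamber hn hτ hL hυ hx w⁻¹
  have e1 : (expPoint θ ∘ w) ∘ (w⁻¹ * v : Equiv.Perm (Fin N)) = expPoint θ ∘ v := by
    ext i; simp
  have e2 : (expPoint θ ∘ w) ∘ (w⁻¹ : Equiv.Perm (Fin N)) = expPoint θ := by
    ext i; simp
  rw [e1] at h1
  rw [e2] at h2
  rw [h1, h2]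
  simp only [mul_inv_rev, inv_inv, rep_mul, mul_assoc]

/-- `κ (P K + K P + i (K R - R K))`: the derivative of the form `K` in the direction `v`. -/
def formDeriv (τ : Equiv.Perm (Fin N) →* Matrix.orthogonalGroup (Fin n) ℝ) (κ : ℝ)
    (θ v : Fin N → ℝ) (K : Matrix (Fin n) (Fin n) ℂ) : Matrix (Fin n) (Fin n) ℂ :=
  (κ : ℂ) • (cotMat τ θ v * K + K * cotMat τ θ v
    + Complex.I • (K * constMat τ v - constMat τ v * K))

/-- In the product rule the Hermitian matrix `cotMat` enters on both sides with a plus sign. The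
part `i (constMat - scalar)` is skew-Hermitian, so it yields a commutator, from which the scalar
drops out. -/
lemma hasFDerivAt_formMat_of_mem (hL : IsFundamentalMatrix hN τ κ L) {θ : Fin N → ℝ}
    (hθ : θ ∈ angleChamber hN) :
    ∃ D : (Fin N → ℝ) →L[ℝ] Matrix (Fin n) (Fin n) ℂ,
      HasFDerivAt (fun θ => formMat L H (expPoint θ)) D θ ∧
      ∀ v, D v = formDeriv τ κ θ v (formMat L H (expPoint θ)) := by
  obtain ⟨D, hD, hDv⟩ := solvesAt_of_isFundamentalMatrix τ hL hθ
  have hs : HasFDerivAt (fun θ => (L (expPoint θ))ᴴ) _ θ := hD.star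
  refine ⟨_, (hs.mul_const' H).mul' hD, fun v => ?_⟩
  simp only [_root_.add_apply, _root_.smul_apply, smul_eq_mul,
    MulOpposite.smul_eq_mul_unop, MulOpposite.unop_op, ContinuousLinearMap.comp_apply, hDv]
  have e : ((starL' ℝ : Matrix (Fin n) (Fin n) ℂ ≃L[ℝ] Matrix (Fin n) (Fin n) ℂ) :
      Matrix (Fin n) (Fin n) ℂ →L[ℝ] Matrix (Fin n) (Fin n) ℂ)
      ((κ : ℂ) • (L (expPoint θ) * angleCoeff τ θ v))
      = (κ : ℂ) • ((angleCoeff τ θ v)ᴴ * (L (expPoint θ))ᴴ) := by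
    change ((κ : ℂ) • (L (expPoint θ) * angleCoeff τ θ v))ᴴ = _
    simp [Matrix.conjTranspose_smul, Matrix.conjTranspose_mul]
  rw [e, formDeriv, formMat, angleCoeff]
  simp only [Matrix.conjTranspose_add, Matrix.conjTranspose_smul, Matrix.conjTranspose_sub,
    cotMat_conjTranspose, constMat_conjTranspose, Matrix.conjTranspose_one, smul_mul_assoc,
    mul_smul_comm, mul_add, add_mul, mul_sub, sub_mul, mul_one, one_mul, neg_mul, smul_add, smul_sub,
    mul_assoc, RCLike.star_def, Complex.conj_I, Complex.conj_ofReal, neg_smul, smul_neg]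
  abel

/-- Near any regular point `K` is the conjugate by `τ(w)` of its restriction to the chamber, and the
coefficient matrices are conjugated in the same way. -/
lemma hasFDerivAt_formMat (hn : 2 ≤ n) (hτ : (complexRep τ).IsIrreducible)
    (hL : IsFundamentalMatrix hN τ κ L) (hυ : Commute (upsilon τ) H) {θ : Fin N → ℝ}
    (hθ : Function.Injective (expPoint θ)) :
    ∃ D : (Fin N → ℝ) →L[ℝ] Matrix (Fin n) (Fin n) ℂ,
      HasFDerivAt (fun θ => formMat L H (expPoint θ)) D θ ∧
      ∀ v, D v = formDeriv τ κ θ v (formMat L H (expPoint θ)) := by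
  obtain ⟨w, m, hw, -⟩ := exists_perm_mem_angleChamber hN hθ (lstIdx hN)
  obtain ⟨D, hD, hDv⟩ := hasFDerivAt_formMat_of_mem (H := H) hL hw
  have hrot : HasFDerivAt (𝕜 := ℝ)
      (fun θ : Fin N → ℝ => (fun i => θ i + m i * (2 * Real.pi)) ∘ w)
      (ContinuousLinearMap.pi fun j =>
        ContinuousLinearMap.proj (R := ℝ) (φ := fun _ : Fin N => ℝ) (w j)) θ := by
    rw [hasFDerivAt_pi']
    intro j
    exact (hasFDerivAt_apply (𝕜 := ℝ) (w j) θ).add_const _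
  obtain ⟨D', h1, hD'⟩ := exists_hasFDerivAt_mul_mul (hD.comp θ hrot) (rep τ w) (rep τ w⁻¹)
  have hpt : ∀ η : Fin N → ℝ, (fun i => η i + m i * (2 * Real.pi)) ∘ w ∈ angleChamber hN →
      formMat L H (expPoint η) = rep τ w *
        formMat L H (expPoint ((fun i => η i + m i * (2 * Real.pi)) ∘ w)) * rep τ w⁻¹ := by
    intro η hη
    have h2 := formMat_comp_of_mem_chamber hn hτ hL hυ (expPoint_mem_chamber hη) w⁻¹
    rw [inv_inv] at h2
    rw [← h2]
    congr 1
    rw [expPoint_comp, expPoint_add_two_pi]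
    ext i; simp
  have hev : (fun θ => formMat L H (expPoint θ)) =ᶠ[𝓝 θ] fun η => rep τ w *
        formMat L H (expPoint ((fun i => η i + m i * (2 * Real.pi)) ∘ w)) * rep τ w⁻¹ := by
    filter_upwards [hrot.continuousAt.preimage_mem_nhds ((isOpen_angleChamber hN).mem_nhds hw)]
      with η hη using hpt η hη
  refine ⟨_, HasFDerivAt.congr_of_eventuallyEq h1 hev, fun v => ?_⟩
  have hv : (ContinuousLinearMap.pi fun j =>
        ContinuousLinearMap.proj (R := ℝ) (φ := fun _ : Fin N => ℝ) (w j)) v = v ∘ w := rfl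
  rw [hD', ContinuousLinearMap.comp_apply, hv, hDv]
  rw [hpt θ hw]
  set Y := formMat L H (expPoint ((fun i => θ i + m i * (2 * Real.pi)) ∘ w))
  have e1 := rep_mul_cotMat τ w (fun i => θ i + m i * (2 * Real.pi)) v
  rw [cotMat_add_two_pi] at e1
  have e2 := rep_mul_constMat τ w v
  set P := cotMat τ ((fun i => θ i + m i * (2 * Real.pi)) ∘ w) (v ∘ w)
  have e1' : cotMat τ θ v = rep τ w * P * rep τ w⁻¹ := by
    rw [e1, mul_assoc, rep_mul_inv, mul_one]
  have e2' : constMat τ v = rep τ w * constMat τ (v ∘ w) * rep τ w⁻¹ := by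
    rw [e2, mul_assoc, rep_mul_inv, mul_one]
  have hc : ∀ A B : Matrix (Fin n) (Fin n) ℂ, (rep τ w * A * rep τ w⁻¹) * (rep τ w * B * rep τ w⁻¹)
      = rep τ w * (A * B) * rep τ w⁻¹ := by
    intro A B
    calc _ = rep τ w * A * (rep τ w⁻¹ * rep τ w) * (B * rep τ w⁻¹) := by simp only [mul_assoc]
      _ = _ := by rw [rep_inv_mul]; simp only [mul_assoc, one_mul]
  simp only [formDeriv, e1', e2', hc]
  simp only [mul_add, add_mul, mul_sub, sub_mul, mul_smul_comm, smul_mul_assoc]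
  rfl

end form

end

end TorusDunkl

namespace TorusDunkl

noncomputable section

open scoped Matrix.Norms.L2Operator
open Set Filter Topology

variable {N n : ℕ}

/-! ### Growth of the fundamental matrix -/

lemma sum_sum_eq_add_sum_Ioi {E : Type*} [AddCommMonoid E] (F : Fin N → Fin N → E)
    (hF : ∀ i j, F i j = F j i) (h0 : ∀ i, F i i = 0) :
    ∑ i, ∑ j, F i j = (∑ i, ∑ j ∈ Finset.Ioi i, F i j) + ∑ i, ∑ j ∈ Finset.Ioi i, F i j := by
  have h1 : ∀ i : Fin N, (∑ j, F i j)
      = (∑ j ∈ Finset.Ioi i, F i j) + ∑ j ∈ Finset.Iio i, F i j := by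
    intro i
    rw [← Finset.add_sum_erase _ _ (Finset.mem_univ i), h0, zero_add, ← Finset.sum_union]
    · congr 1
      ext j
      simp [eq_comm]
    · rw [Finset.disjoint_left]
      intro j h1 h2
      simp at h1 h2
      exact absurd h1 (not_lt.2 h2.le)
  simp_rw [h1, Finset.sum_add_distrib]
  congr 1
  rw [Finset.sum_comm' (t' := Finset.univ) (s' := fun j => Finset.Ioi j) (by simp)]
  simp_rw [fun x y => hF y x]

lemma sum_sum_eq_two_mul_sum_Ioi (F : Fin N → Fin N → ℝ) (hF : ∀ i j, F i j = F j i)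
    (h0 : ∀ i, F i i = 0) : ∑ i, ∑ j, F i j = 2 * ∑ i, ∑ j ∈ Finset.Ioi i, F i j := by
  rw [sum_sum_eq_add_sum_Ioi F hF h0, two_mul]

lemma sum_Ioi_const (c : ℝ) :
    ∑ i : Fin N, ∑ _j ∈ Finset.Ioi i, c = (N * (N - 1) / 2 : ℝ) * c := by
  have h := sum_sum_eq_two_mul_sum_Ioi (fun i j : Fin N => if i = j then 0 else c)
    (fun i j => by simp [eq_comm]) (by simp)
  have h1 : ∀ i : Fin N, ∑ j ∈ Finset.Ioi i, (if i = j then 0 else c)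
      = ∑ j ∈ Finset.Ioi i, c :=
    fun i => Finset.sum_congr rfl fun j hj => if_neg (Finset.mem_Ioi.1 hj).ne
  have h2 : ∀ i : Fin N, ∑ j, (if i = j then 0 else c) = (N - 1) * c := by
    intro i
    have : ∀ j, (if i = j then 0 else c) = c - if i = j then c else 0 := by
      intro j; split_ifs <;> simp
    simp_rw [this, Finset.sum_sub_distrib]
    simp
    ring
  simp_rw [h1, h2] at h
  simp only [Finset.sum_const, Finset.card_univ, Fintype.card_fin, nsmul_eq_mul] at h ⊢
  linarith

/-- On `(0, π]` this is `x ≤ tan x`, and the reflection `a ↦ 2π - a` covers the rest. The right side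
is the derivative of `log a - log (2π - a)`, so the growth estimate can be integrated explicitly. -/
lemma abs_halfCot_le {a : ℝ} (h0 : 0 < a) (h1 : a < 2 * Real.pi) :
    |halfCot a| ≤ 1 / a + 1 / (2 * Real.pi - a) := by
  have key : ∀ b, 0 < b → b ≤ Real.pi → |halfCot b| ≤ 1 / b := by
    intro b hb hb'
    have hs : 0 < Real.sin (b / 2) :=
      Real.sin_pos_of_pos_of_lt_pi (by linarith) (by linarith)
    have hc : 0 ≤ Real.cos (b / 2) :=
      Real.cos_nonneg_of_neg_pi_div_two_le_of_le (by linarith) (by linarith)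
    rw [halfCot, abs_of_nonneg (by positivity), div_le_div_iff₀ (by positivity) hb]
    rcases hb'.eq_or_lt with rfl | hlt
    · rw [Real.cos_pi_div_two]; linarith
    · have ht := Real.le_tan (x := b / 2) (by linarith) (by linarith)
      have hc' : 0 < Real.cos (b / 2) :=
        Real.cos_pos_of_mem_Ioo ⟨by linarith, by linarith⟩
      rw [Real.tan_eq_sin_div_cos, le_div_iff₀ hc'] at ht
      linarith
  have hp : 0 < 1 / a := by positivity
  have hp' : 0 < 1 / (2 * Real.pi - a) := by
    have : 0 < 2 * Real.pi - a := by linarith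
    positivity
  rcases le_total a Real.pi with h | h
  · linarith [key a h0 h]
  · have h2 := key (2 * Real.pi - a) (by linarith) (by linarith)
    have h3 : halfCot (2 * Real.pi - a) = -halfCot a := by
      rw [← halfCot_neg, ← halfCot_add_two_pi (-a)]; congr 1; ring
    rw [h3, abs_neg] at h2
    linarith

lemma cotMat_eq_sum_Ioi (τ : Equiv.Perm (Fin N) →* Matrix.orthogonalGroup (Fin n) ℝ)
    (θ v : Fin N → ℝ) : cotMat τ θ v = ∑ i, ∑ j ∈ Finset.Ioi i,
      (((v j - v i) * halfCot (θ j - θ i) : ℝ) : ℂ) • rep τ (Equiv.swap i j) := by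
  rw [cotMat, sum_sum_eq_add_sum_Ioi]
  · simp_rw [← Finset.sum_add_distrib, ← add_smul]
    refine Finset.sum_congr rfl fun i _ => Finset.sum_congr rfl fun j _ => ?_
    congr 1
    rw [← neg_sub (θ j), halfCot_neg]
    push_cast
    ring
  · intro i j
    rw [Equiv.swap_comm, ← neg_sub (θ j), halfCot_neg]
    congr 2
    ring
  · simp

lemma norm_sum_Ioi_smul_rep_le (τ : Equiv.Perm (Fin N) →* Matrix.orthogonalGroup (Fin n) ℝ)
    (c : Fin N → Fin N → ℝ) :
    ‖∑ i, ∑ j ∈ Finset.Ioi i, (c i j : ℂ) • rep τ (Equiv.swap i j)‖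
      ≤ ∑ i, ∑ j ∈ Finset.Ioi i, |c i j| := by
  refine (norm_sum_le _ _).trans (Finset.sum_le_sum fun i _ =>
    (norm_sum_le _ _).trans (Finset.sum_le_sum fun j _ => ?_))
  refine (norm_smul_le _ _).trans ((mul_le_of_le_one_right (norm_nonneg _)
    (norm_rep_le τ _)).trans ?_)
  rw [Complex.norm_real, Real.norm_eq_abs]

lemma norm_cotMat_le_sum_Ioi (τ : Equiv.Perm (Fin N) →* Matrix.orthogonalGroup (Fin n) ℝ)
    (θ v : Fin N → ℝ) :
    ‖cotMat τ θ v‖ ≤ ∑ i, ∑ j ∈ Finset.Ioi i, |v j - v i| * |halfCot (θ j - θ i)| := by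
  rw [cotMat_eq_sum_Ioi]
  refine (norm_sum_Ioi_smul_rep_le τ _).trans (le_of_eq ?_)
  simp_rw [abs_mul]

lemma norm_angleCoeff_le (τ : Equiv.Perm (Fin N) →* Matrix.orthogonalGroup (Fin n) ℝ)
    (θ v : Fin N → ℝ) {R : ℝ} (hv : ∀ i, |v i| ≤ R) :
    ‖angleCoeff τ θ v‖ ≤ (∑ i, ∑ j ∈ Finset.Ioi i, |v j - v i| * |halfCot (θ j - θ i)|)
      + (N * (N * R) + |gam τ + 1 / 2| * (N * R)) := by
  have h1 : ‖constMat τ v‖ ≤ N * (N * R) := by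
    refine (norm_constMat_le τ v).trans ?_
    have : ∀ i j : Fin N, |v i + v j| / 4 ≤ R := by
      intro i j
      have := abs_add_le (v i) (v j)
      have := hv i
      have := hv j
      have := abs_nonneg (v i)
      linarith
    calc _ ≤ ∑ i : Fin N, ∑ j : Fin N, R :=
          Finset.sum_le_sum fun i _ => Finset.sum_le_sum fun j _ => this i j
      _ = _ := by simp
  have h2 : ‖(((gam τ + 1 / 2) * ∑ i, v i : ℝ) : ℂ) • (1 : Matrix (Fin n) (Fin n) ℂ)‖
      ≤ |gam τ + 1 / 2| * (N * R) := by
    refine (norm_smul_le _ _).trans ((mul_le_of_le_one_right (norm_nonneg _) norm_one_le).trans ?_)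
    rw [Complex.norm_real, Real.norm_eq_abs, abs_mul]
    refine mul_le_mul_of_nonneg_left ((Finset.abs_sum_le_sum_abs _ _).trans ?_) (abs_nonneg _)
    calc _ ≤ ∑ i : Fin N, R := Finset.sum_le_sum fun i _ => hv i
      _ = _ := by simp
  rw [angleCoeff]
  refine (norm_add_le _ _).trans (add_le_add (norm_cotMat_le_sum_Ioi τ θ v) ?_)
  rw [norm_smul, Complex.norm_I, one_mul]
  exact (norm_sub_le _ _).trans (add_le_add h1 h2)

/-- Comparison with `exp (b t + t)`: the extra `t` makes the logarithmic derivative strictly larger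
than `c`, as the strict comparison theorem needs. Its price is the `+ 1` in the exponent. -/
lemma norm_le_of_linear_growth {E : Type*} [NormedAddCommGroup E] [NormedSpace ℝ E]
    {f f' : ℝ → E} {b c : ℝ → ℝ} (hf : ∀ t ∈ Icc (0 : ℝ) 1, HasDerivAt f (f' t) t)
    (hb : ∀ t ∈ Icc (0 : ℝ) 1, HasDerivAt b (c t) t) (h0 : ‖f 0‖ ≤ Real.exp (b 0))
    (hle : ∀ t ∈ Icc (0 : ℝ) 1, ‖f' t‖ ≤ c t * ‖f t‖) : ‖f 1‖ ≤ Real.exp (b 1 + 1) := by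
  have hB : ∀ t ∈ Icc (0 : ℝ) 1, HasDerivAt (fun t => Real.exp (b t + t))
      (Real.exp (b t + t) * (c t + 1)) t := fun t ht => ((hb t ht).add (hasDerivAt_id t)).exp
  refine image_norm_le_of_norm_deriv_right_lt_deriv_boundary' (f := f) (f' := f') (a := 0) (b := 1)
    (B := fun t => Real.exp (b t + t)) (B' := fun t => Real.exp (b t + t) * (c t + 1))
    (fun t ht => (hf t ht).continuousAt.continuousWithinAt)
    (fun t ht => (hf t ⟨ht.1, ht.2.le⟩).hasDerivWithinAt) (by simpa using h0)
    (fun t ht => (hB t ht).continuousAt.continuousWithinAt)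
    (fun t ht => (hB t ⟨ht.1, ht.2.le⟩).hasDerivWithinAt) ?_ ⟨zero_le_one, le_rfl⟩
  intro t ht hft
  have h1 := hle t ⟨ht.1, ht.2.le⟩
  rw [hft] at h1
  have h2 := Real.exp_pos (b t + t)
  linarith

variable {τ : Equiv.Perm (Fin N) →* Matrix.orthogonalGroup (Fin n) ℝ} {hN : 3 ≤ N} {κ : ℝ}
  {L : (Fin N → ℂ) → Matrix (Fin n) (Fin n) ℂ}

lemma abs_baseAngles_le (i : Fin N) : |baseAngles N i| ≤ 2 * Real.pi := by
  have h1 : ((i : ℕ) : ℝ) ≤ N := by exact_mod_cast i.2.le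
  have h2 : (0 : ℝ) < N := by exact_mod_cast (Nat.zero_le _).trans_lt i.2
  have := Real.pi_pos
  rw [baseAngles, abs_of_nonneg (by positivity), div_le_iff₀ h2]
  gcongr

/-- Along the segment from the base point every gap is affine, hence monotone, so the integral of
its cotangent term is bounded by the change of `log a - log (2π - a)`. That change is at most `-log
δ` up to a constant. The `N (N-1) / 2` pairs contribute a factor `δ^(-|κ|)` each. -/
lemma exists_norm_fundamental_le (hL : IsFundamentalMatrix hN τ κ L) (R : ℝ) :
    ∃ C : ℝ, 0 ≤ C ∧ ∀ θ ∈ angleChamber hN, (∀ i, |θ i| ≤ R) → ∀ δ : ℝ, 0 < δ →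
      (∀ i j, i < j → δ ≤ θ j - θ i ∧ θ j - θ i ≤ 2 * Real.pi - δ) →
      ‖L (expPoint θ)‖ ≤ C * δ ^ (-(|κ| * (N * (N - 1) / 2))) := by
  set lam : ℝ → ℝ := fun a => Real.log a - Real.log (2 * Real.pi - a) with hlam
  set Λ : ℝ := ∑ i : Fin N, ∑ j ∈ Finset.Ioi i, |lam (baseAngles N j - baseAngles N i)| with hΛ
  set C₁ : ℝ := N * (N * (R + 2 * Real.pi)) + |gam τ + 1 / 2| * (N * (R + 2 * Real.pi)) with hC₁
  set M : ℝ := N * (N - 1) / 2 with hM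
  refine ⟨Real.exp (|κ| * (M * Real.log (2 * Real.pi) + Λ + C₁) + 1), (Real.exp_pos _).le, ?_⟩
  intro θ hθ hR δ hδ hgap
  set v := θ - baseAngles N with hv
  have hvR : ∀ i, |v i| ≤ R + 2 * Real.pi := fun i =>
    (abs_sub _ _).trans (add_le_add (hR i) (abs_baseAngles_le i))
  set η : ℝ → Fin N → ℝ := fun t => baseAngles N + t • v with hη
  have hmem : ∀ t ∈ Icc (0 : ℝ) 1, η t ∈ angleChamber hN := fun t ht =>
    segment_mem_angleChamber (baseAngles_mem hN) hθ ht
  have h1 : η 1 = θ := by simp [hη, hv]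
  have h0 : η 0 = baseAngles N := by simp [hη]
  -- The sign of the slope of the gap `(i, j)`; multiplied by it, the change of `lam` becomes a
  -- total variation.
  set s : Fin N → Fin N → ℝ := fun i j => SignType.sign (v j - v i) with hs
  have hsabs : ∀ i j, |s i j| ≤ 1 := by
    intro i j
    simp only [hs]
    rcases lt_trichotomy (v j - v i) 0 with h | h | h <;> simp [h, sign_neg, sign_pos]
  set b : ℝ → ℝ := fun t => |κ| * ((∑ i, ∑ j ∈ Finset.Ioi i,
    s i j * (lam (η t j - η t i) - lam (baseAngles N j - baseAngles N i))) + C₁ * t) with hb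
  have hlamd : ∀ i j, i < j → ∀ t ∈ Icc (0 : ℝ) 1, HasDerivAt
      (fun t => s i j * (lam (η t j - η t i) - lam (baseAngles N j - baseAngles N i)))
      (|v j - v i| * (1 / (η t j - η t i) + 1 / (2 * Real.pi - (η t j - η t i)))) t := by
    intro i j hij t ht
    have hm := (angleChamber_iff.1 (hmem t ht)) i j hij
    have ha : HasDerivAt (fun t => η t j - η t i) (v j - v i) t := by
      have e : (fun t => η t j - η t i)
          = fun t => (baseAngles N j - baseAngles N i) + t * (v j - v i) := by
        ext t; simp [hη]; ring
      rw [e]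
      simpa using ((hasDerivAt_id t).mul_const (v j - v i)).const_add
        (baseAngles N j - baseAngles N i)
    have hd := ((ha.log hm.1.ne').sub ((ha.const_sub (2 * Real.pi)).log (by linarith))).sub_const
      (lam (baseAngles N j - baseAngles N i)) |>.const_mul (s i j)
    refine hd.congr_deriv ?_
    have hsv : s i j * (v j - v i) = |v j - v i| := by
      simp only [hs]; exact sign_mul_self _
    rw [← hsv]
    ring
  have hbd : ∀ t ∈ Icc (0 : ℝ) 1, HasDerivAt b (|κ| * ((∑ i, ∑ j ∈ Finset.Ioi i,
      |v j - v i| * (1 / (η t j - η t i) + 1 / (2 * Real.pi - (η t j - η t i)))) + C₁)) t := by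
    intro t ht
    have h1 : HasDerivAt (fun t => ∑ i, ∑ j ∈ Finset.Ioi i,
      s i j * (lam (η t j - η t i) - lam (baseAngles N j - baseAngles N i))) (∑ i, ∑ j ∈ Finset.Ioi i,
      |v j - v i| * (1 / (η t j - η t i) + 1 / (2 * Real.pi - (η t j - η t i)))) t :=
      HasDerivAt.fun_sum fun i _ => HasDerivAt.fun_sum fun j hj =>
        hlamd i j (Finset.mem_Ioi.1 hj) t ht
    have h2 : HasDerivAt (fun t : ℝ => C₁ * t) C₁ t := by
      simpa using (hasDerivAt_id t).const_mul C₁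
    exact (h1.add h2).const_mul _
  have hfd : ∀ t ∈ Icc (0 : ℝ) 1, HasDerivAt (fun t => L (expPoint (η t)))
      ((κ : ℂ) • (L (expPoint (η t)) * angleCoeff τ (η t) v)) t := fun t ht =>
    (solvesAt_of_isFundamentalMatrix τ hL (hmem t ht)).hasDerivAt_line
  have hfin := norm_le_of_linear_growth hfd hbd
    (by
      simp only [hb, h0, sub_self, mul_zero, Finset.sum_const_zero, add_zero, Real.exp_zero,
        expPoint_baseAngles, hL.base]
      exact norm_one_le)
    (by
      intro t ht
      rw [norm_smul, Complex.norm_real, Real.norm_eq_abs, mul_assoc]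
      refine mul_le_mul_of_nonneg_left ?_ (abs_nonneg _)
      rw [mul_comm _ ‖L _‖]
      refine (norm_mul_le _ _).trans (mul_le_mul_of_nonneg_left ?_ (norm_nonneg _))
      refine (norm_angleCoeff_le τ (η t) v hvR).trans (add_le_add_left ?_ _)
      refine Finset.sum_le_sum fun i _ => Finset.sum_le_sum fun j hj => ?_
      have hm := (angleChamber_iff.1 (hmem t ht)) i j (Finset.mem_Ioi.1 hj)
      exact mul_le_mul_of_nonneg_left (abs_halfCot_le hm.1 hm.2) (abs_nonneg _))
  rw [h1] at hfin
  refine hfin.trans ?_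
  rw [Real.rpow_def_of_pos hδ, ← Real.exp_add, Real.exp_le_exp]
  have hsum : (∑ i, ∑ j ∈ Finset.Ioi i,
      s i j * (lam (η 1 j - η 1 i) - lam (baseAngles N j - baseAngles N i)))
      ≤ M * (Real.log (2 * Real.pi) - Real.log δ) + Λ := by
    rw [hM, ← sum_Ioi_const, hΛ, ← Finset.sum_add_distrib]
    refine Finset.sum_le_sum fun i _ => ?_
    rw [← Finset.sum_add_distrib]
    refine Finset.sum_le_sum fun j hj => ?_
    have hg := hgap i j (Finset.mem_Ioi.1 hj)
    have hlam1 : |lam (η 1 j - η 1 i)| ≤ Real.log (2 * Real.pi) - Real.log δ := by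
      rw [h1, abs_le]
      simp only [hlam]
      have a1 := Real.log_le_log hδ hg.1
      have a2 : Real.log (θ j - θ i) ≤ Real.log (2 * Real.pi) :=
        Real.log_le_log (by linarith) (by linarith)
      have a3 : Real.log δ ≤ Real.log (2 * Real.pi - (θ j - θ i)) :=
        Real.log_le_log hδ (by linarith)
      have a4 : Real.log (2 * Real.pi - (θ j - θ i)) ≤ Real.log (2 * Real.pi) :=
        Real.log_le_log (by linarith) (by linarith)
      constructor <;> linarith
    refine (le_abs_self _).trans ?_
    rw [abs_mul]
    refine (mul_le_of_le_one_left (abs_nonneg _) (hsabs i j)).trans ?_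
    exact (abs_sub _ _).trans (add_le_add_left hlam1 _)
  have hk := abs_nonneg κ
  have := mul_le_mul_of_nonneg_left hsum hk
  simp only [hb]
  linarith

/-- The exponent in the bound for the form. -/
def growthExp (N : ℕ) (κ : ℝ) : ℝ := |κ| * (N * (N - 1))

lemma exists_norm_formMat_le_of_mem (hL : IsFundamentalMatrix hN τ κ L)
    (H : Matrix (Fin n) (Fin n) ℂ) (R : ℝ) :
    ∃ C : ℝ, 0 ≤ C ∧ ∀ θ ∈ angleChamber hN, (∀ i, |θ i| ≤ R) → ∀ δ : ℝ, 0 < δ →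
      (∀ i j, i < j → δ ≤ θ j - θ i ∧ θ j - θ i ≤ 2 * Real.pi - δ) →
      ‖formMat L H (expPoint θ)‖ ≤ C * δ ^ (-growthExp N κ) := by
  obtain ⟨C, hC, h⟩ := exists_norm_fundamental_le hL R
  refine ⟨C * ‖H‖ * C, by positivity, fun θ hθ hR δ hδ hgap => ?_⟩
  have h1 := h θ hθ hR δ hδ hgap
  have e : δ ^ (-growthExp N κ) = δ ^ (-(|κ| * (N * (N - 1) / 2 : ℝ)))
      * δ ^ (-(|κ| * (N * (N - 1) / 2 : ℝ))) := by
    rw [← Real.rpow_add hδ]; congr 1; rw [growthExp]; ring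
  rw [formMat, e]
  set x := δ ^ (-(|κ| * (N * (N - 1) / 2 : ℝ)))
  calc _ ≤ ‖(L (expPoint θ))ᴴ * H‖ * ‖L (expPoint θ)‖ := norm_mul_le _ _
    _ ≤ ‖L (expPoint θ)‖ * ‖H‖ * ‖L (expPoint θ)‖ := by
        gcongr
        exact (norm_mul_le _ _).trans (by rw [Matrix.l2_opNorm_conjTranspose])
    _ ≤ (C * x) * ‖H‖ * (C * x) := by gcongr
    _ = _ := by ring

end

end TorusDunkl

namespace TorusDunkl

noncomputable section

open scoped Matrix.Norms.L2Operator
open Set Filter Topology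

variable {N n : ℕ}

/-! ### The form near the wall `θ_{N-1} = θ_N` -/

/-- The direction transversal to the wall `θ_{N-1} = θ_N`. -/
def wallDir (hN : 3 ≤ N) : Fin N → ℝ := fun i =>
  if i = lstIdx hN then 1 else if i = penIdx hN then -1 else 0

lemma penIdx_lt_lstIdx (hN : 3 ≤ N) : penIdx hN < lstIdx hN := by
  rw [Fin.lt_def]; simp only [penIdx, lstIdx]; omega

@[simp] lemma wallDir_lst (hN : 3 ≤ N) : wallDir hN (lstIdx hN) = 1 := by simp [wallDir]

@[simp] lemma wallDir_pen (hN : 3 ≤ N) : wallDir hN (penIdx hN) = -1 := by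
  simp [wallDir, (penIdx_lt_lstIdx hN).ne]

lemma wallDir_of_lt {hN : 3 ≤ N} {i : Fin N} (h : i < penIdx hN) : wallDir hN i = 0 := by
  simp [wallDir, h.ne, (h.trans (penIdx_lt_lstIdx hN)).ne]

lemma abs_wallDir_le {hN : 3 ≤ N} (i : Fin N) : |wallDir hN i| ≤ 1 := by
  unfold wallDir; split_ifs <;> simp

lemma lt_cases (hN : 3 ≤ N) {i j : Fin N} (h : i < j) :
    j < penIdx hN ∨ (i < penIdx hN ∧ (j = penIdx hN ∨ j = lstIdx hN)) ∨
      (i = penIdx hN ∧ j = lstIdx hN) := by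
  simp only [Fin.lt_def, Fin.ext_iff, penIdx, lstIdx] at *
  omega

lemma wallDir_comp_swap (hN : 3 ≤ N) :
    wallDir hN ∘ Equiv.swap (penIdx hN) (lstIdx hN) = -wallDir hN := by
  ext i
  rcases eq_or_ne i (penIdx hN) with rfl | h1
  · simp
  rcases eq_or_ne i (lstIdx hN) with rfl | h2
  · simp
  · simp [Equiv.swap_apply_of_ne_of_ne h1 h2, wallDir, h1, h2]

lemma comp_swap_of_eq {hN : 3 ≤ N} {q : Fin N → ℝ} (h : q (penIdx hN) = q (lstIdx hN)) :
    q ∘ Equiv.swap (penIdx hN) (lstIdx hN) = q := by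
  ext i
  rcases eq_or_ne i (penIdx hN) with rfl | h1
  · simp [h]
  rcases eq_or_ne i (lstIdx hN) with rfl | h2
  · simp [h]
  · simp [Equiv.swap_apply_of_ne_of_ne h1 h2]

/-- A point of the wall whose double coordinate has distance at least `d` from the others, which
have mutual distances at least `s`. -/
structure IsWallPoint (hN : 3 ≤ N) (d s : ℝ) (q : Fin N → ℝ) : Prop where
  eq : q (penIdx hN) = q (lstIdx hN)
  sep : ∀ i, i < penIdx hN → d ≤ q (lstIdx hN) - q i ∧ q (lstIdx hN) - q i ≤ 2 * Real.pi - d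
  rest : ∀ i j, i < j → j < penIdx hN → s ≤ q j - q i ∧ q j - q i ≤ 2 * Real.pi - s

lemma IsWallPoint.sep_add {hN : 3 ≤ N} {d s : ℝ} {q : Fin N → ℝ} (h : IsWallPoint hN (2 * d) s q)
    {t : ℝ} (ht : |t| ≤ d) {i j : Fin N} (hi : i < penIdx hN) (hj : j = penIdx hN ∨ j = lstIdx hN) :
    d ≤ (q + t • wallDir hN) j - (q + t • wallDir hN) i ∧
      (q + t • wallDir hN) j - (q + t • wallDir hN) i ≤ 2 * Real.pi - d := by
  have h1 := h.sep i hi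
  have h2 := abs_le.1 ht
  rcases hj with rfl | rfl
  · simp only [Pi.add_apply, Pi.smul_apply, wallDir_pen, wallDir_of_lt hi, h.eq, smul_eq_mul]
    constructor <;> linarith
  · simp only [Pi.add_apply, Pi.smul_apply, wallDir_lst, wallDir_of_lt hi, smul_eq_mul]
    constructor <;> linarith

/-- The double coordinate opens to a gap `2t`, and the other gaps remain at least `d` or `s`. So `t`
is a lower bound for all gaps, the parameter of the growth estimate. -/
lemma IsWallPoint.gap_add {hN : 3 ≤ N} {d s : ℝ} {q : Fin N → ℝ} (h : IsWallPoint hN (2 * d) s q)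
    {t : ℝ} (ht : 0 < t) (hts : t ≤ s) (htd : t ≤ d) (ht1 : t ≤ 1) {i j : Fin N} (hij : i < j) :
    t ≤ (q + t • wallDir hN) j - (q + t • wallDir hN) i ∧
      (q + t • wallDir hN) j - (q + t • wallDir hN) i ≤ 2 * Real.pi - t := by
  rcases lt_cases hN hij with h1 | ⟨h1, h2⟩ | ⟨rfl, rfl⟩
  · have := h.rest i j hij h1
    simp only [Pi.add_apply, Pi.smul_apply, wallDir_of_lt h1, wallDir_of_lt (hij.trans h1),
      smul_eq_mul]
    constructor <;> linarith
  · have := h.sep_add (t := t) (by rwa [abs_of_pos ht]) h1 h2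
    constructor <;> linarith
  · simp only [Pi.add_apply, Pi.smul_apply, wallDir_lst, wallDir_pen, h.eq, smul_eq_mul]
    have := Real.pi_gt_three
    constructor <;> linarith

lemma IsWallPoint.mem_angleChamber {hN : 3 ≤ N} {d s : ℝ} {q : Fin N → ℝ}
    (h : IsWallPoint hN (2 * d) s q) {t : ℝ} (ht : 0 < t) (hts : t ≤ s) (htd : t ≤ d)
    (ht1 : t ≤ 1) : q + t • wallDir hN ∈ angleChamber hN := by
  rw [angleChamber_iff]
  intro i j hij
  have := h.gap_add ht hts htd ht1 hij
  constructor <;> linarith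

/-- The part of `K` that does not commute with `σ`. -/
def defect (hN : 3 ≤ N) (τ : Equiv.Perm (Fin N) →* Matrix.orthogonalGroup (Fin n) ℝ)
    (K : Matrix (Fin n) (Fin n) ℂ) : Matrix (Fin n) (Fin n) ℂ :=
  K - sigma hN τ * K * sigma hN τ

lemma norm_sigma_mul_mul_le (hN : 3 ≤ N)
    (τ : Equiv.Perm (Fin N) →* Matrix.orthogonalGroup (Fin n) ℝ) (K : Matrix (Fin n) (Fin n) ℂ) :
    ‖sigma hN τ * K * sigma hN τ‖ ≤ ‖K‖ :=
  (norm_mul_rep_le τ _ _).trans (norm_rep_mul_le τ _ _)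

lemma norm_defect_le (hN : 3 ≤ N) (τ : Equiv.Perm (Fin N) →* Matrix.orthogonalGroup (Fin n) ℝ)
    (K : Matrix (Fin n) (Fin n) ℂ) : ‖defect hN τ K‖ ≤ 2 * ‖K‖ := by
  refine (norm_sub_le _ _).trans ?_
  linarith [norm_sigma_mul_mul_le hN τ K]

lemma hasDerivAt_defect {hN : 3 ≤ N} {τ : Equiv.Perm (Fin N) →* Matrix.orthogonalGroup (Fin n) ℝ}
    {F : ℝ → Matrix (Fin n) (Fin n) ℂ} {F' : Matrix (Fin n) (Fin n) ℂ} {t : ℝ}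
    (h : HasDerivAt F F' t) :
    HasDerivAt (fun t => defect hN τ (F t)) (defect hN τ F') t :=
  h.sub ((h.const_mul (sigma hN τ)).mul_const (sigma hN τ))

/-- The coefficient matrix without the term of the wall `θ_{N-1} = θ_N`. -/
def cotMatRest (hN : 3 ≤ N) (τ : Equiv.Perm (Fin N) →* Matrix.orthogonalGroup (Fin n) ℝ)
    (θ v : Fin N → ℝ) : Matrix (Fin n) (Fin n) ℂ :=
  ∑ i, ∑ j ∈ Finset.Ioi i, ((if i = penIdx hN ∧ j = lstIdx hN then 0
    else (v j - v i) * halfCot (θ j - θ i) : ℝ) : ℂ) • rep τ (Equiv.swap i j)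

lemma cotMat_eq_add_cotMatRest (hN : 3 ≤ N)
    (τ : Equiv.Perm (Fin N) →* Matrix.orthogonalGroup (Fin n) ℝ) (θ v : Fin N → ℝ) :
    cotMat τ θ v = (((v (lstIdx hN) - v (penIdx hN)) *
      halfCot (θ (lstIdx hN) - θ (penIdx hN)) : ℝ) : ℂ) • sigma hN τ + cotMatRest hN τ θ v := by
  have h1 : (((v (lstIdx hN) - v (penIdx hN)) *
      halfCot (θ (lstIdx hN) - θ (penIdx hN)) : ℝ) : ℂ) • sigma hN τ
      = ∑ i, ∑ j ∈ Finset.Ioi i, ((if i = penIdx hN ∧ j = lstIdx hN then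
        (v j - v i) * halfCot (θ j - θ i) else 0 : ℝ) : ℂ) • rep τ (Equiv.swap i j) := by
    rw [Finset.sum_eq_single (penIdx hN), Finset.sum_eq_single (lstIdx hN)]
    · simp [sigma]
    · intro j _ hj
      simp [hj]
    · intro h
      exact absurd (Finset.mem_Ioi.2 (penIdx_lt_lstIdx hN)) h
    · intro i _ hi
      exact Finset.sum_eq_zero fun j _ => by simp [hi]
    · simp
  rw [h1, cotMat_eq_sum_Ioi, cotMatRest, ← Finset.sum_add_distrib]
  refine Finset.sum_congr rfl fun i _ => ?_
  rw [← Finset.sum_add_distrib]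
  refine Finset.sum_congr rfl fun j _ => ?_
  rw [← add_smul]
  split_ifs <;> simp

lemma sum_Ioi_le {c : Fin N → Fin N → ℝ} {B : ℝ} (hB : 0 ≤ B)
    (h : ∀ i j, i < j → c i j ≤ B) : ∑ i, ∑ j ∈ Finset.Ioi i, c i j ≤ N * (N * B) := by
  calc _ ≤ ∑ i : Fin N, ∑ j ∈ Finset.Ioi i, B := Finset.sum_le_sum fun i _ =>
        Finset.sum_le_sum fun j hj => h i j (Finset.mem_Ioi.1 hj)
    _ ≤ ∑ i : Fin N, ∑ j : Fin N, B := Finset.sum_le_sum fun i _ =>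
        Finset.sum_le_sum_of_subset_of_nonneg (Finset.subset_univ _) fun _ _ _ => hB
    _ = _ := by simp

lemma norm_constMat_le_of_abs_le (τ : Equiv.Perm (Fin N) →* Matrix.orthogonalGroup (Fin n) ℝ)
    {v : Fin N → ℝ} {R : ℝ} (hv : ∀ i, |v i| ≤ R) : ‖constMat τ v‖ ≤ N * (N * R) := by
  refine (norm_constMat_le τ v).trans ?_
  have : ∀ i j : Fin N, |v i + v j| / 4 ≤ R := by
    intro i j
    have := abs_add_le (v i) (v j)
    have := hv i
    have := hv j
    have := abs_nonneg (v i)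
    linarith
  calc _ ≤ ∑ i : Fin N, ∑ j : Fin N, R :=
        Finset.sum_le_sum fun i _ => Finset.sum_le_sum fun j _ => this i j
    _ = _ := by simp

variable {τ : Equiv.Perm (Fin N) →* Matrix.orthogonalGroup (Fin n) ℝ} {hN : 3 ≤ N} {κ : ℝ}
  {L : (Fin N → ℂ) → Matrix (Fin n) (Fin n) ℂ}

lemma hasDerivAt_formMat_line (hL : IsFundamentalMatrix hN τ κ L) (H : Matrix (Fin n) (Fin n) ℂ)
    {θ v : Fin N → ℝ} {t : ℝ} (h : θ + t • v ∈ angleChamber hN) :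
    HasDerivAt (fun t : ℝ => formMat L H (expPoint (θ + t • v)))
      (formDeriv τ κ (θ + t • v) v (formMat L H (expPoint (θ + t • v)))) t := by
  obtain ⟨D, hD, hDv⟩ := hasFDerivAt_formMat_of_mem (H := H) hL h
  have h1 : HasDerivAt (fun t : ℝ => θ + t • v) v t := by
    simpa using ((hasDerivAt_id t).smul_const v).const_add θ
  have := hD.comp_hasDerivAt t h1
  rwa [hDv] at this

/-- Pairs among the first `N - 2` coordinates have equal velocities in this direction, so their
distance, which may be as small as `s`, does not enter. All other pairs except the wall pair stay at
least `d` apart. -/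
lemma norm_cotMatRest_wallDir_le {d s : ℝ} {q : Fin N → ℝ} (hd : 0 < d)
    (h : IsWallPoint hN (2 * d) s q) {t : ℝ} (ht : |t| ≤ d) :
    ‖cotMatRest hN τ (q + t • wallDir hN) (wallDir hN)‖ ≤ N * (N * (4 / d)) := by
  refine (norm_sum_Ioi_smul_rep_le τ _).trans (sum_Ioi_le (by positivity) fun i j hij => ?_)
  rcases lt_cases hN hij with h1 | ⟨h1, h2⟩ | h1
  · rw [wallDir_of_lt h1, wallDir_of_lt (hij.trans h1)]
    simp
    positivity
  · rw [if_neg (fun h => h1.ne h.1), abs_mul]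
    have hg := h.sep_add ht h1 h2
    have hh := abs_halfCot_le (a := (q + t • wallDir hN) j - (q + t • wallDir hN) i)
      (by linarith) (by linarith)
    have e1 : 1 / ((q + t • wallDir hN) j - (q + t • wallDir hN) i) ≤ 1 / d :=
      one_div_le_one_div_of_le hd hg.1
    have e2 : 1 / (2 * Real.pi - ((q + t • wallDir hN) j - (q + t • wallDir hN) i)) ≤ 1 / d :=
      one_div_le_one_div_of_le hd (by linarith)
    have e3 : |wallDir hN j - wallDir hN i| ≤ 2 :=
      (abs_sub _ _).trans (by linarith [abs_wallDir_le (hN := hN) i, abs_wallDir_le (hN := hN) j])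
    calc _ ≤ 2 * (1 / d + 1 / d) := by
          refine mul_le_mul e3 (by linarith) (abs_nonneg _) (by norm_num)
      _ = 4 / d := by ring
  · rw [if_pos h1, abs_zero]
    positivity

/-- The singular cotangent multiplies `σK + Kσ`, which commutes with `σ` and is therefore
annihilated by `defect`. What remains has coefficients of order `1/d`. -/
lemma norm_defect_formDeriv_wallDir_le {d s : ℝ} {q : Fin N → ℝ} (hd : 0 < d) (hd1 : d ≤ 1)
    (h : IsWallPoint hN (2 * d) s q) {t : ℝ} (ht : |t| ≤ d) (K : Matrix (Fin n) (Fin n) ℂ) :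
    ‖defect hN τ (formDeriv τ κ (q + t • wallDir hN) (wallDir hN) K)‖
      ≤ (20 * |κ| * (N * N)) / d * ‖K‖ := by
  set θ := q + t • wallDir hN
  set v := wallDir hN
  set c : ℂ := (((v (lstIdx hN) - v (penIdx hN)) *
      halfCot (θ (lstIdx hN) - θ (penIdx hN)) : ℝ) : ℂ)
  set P := cotMatRest hN τ θ v with hP
  set σ := sigma hN τ with hσ
  have hσσ : σ * σ = 1 := sigma_mul_self τ hN
  have hdec : defect hN τ (formDeriv τ κ θ v K)
      = defect hN τ ((κ : ℂ) • (P * K + K * P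
        + Complex.I • (K * constMat τ v - constMat τ v * K))) := by
    have e0 : formDeriv τ κ θ v K = (κ : ℂ) • (P * K + K * P
        + Complex.I • (K * constMat τ v - constMat τ v * K)) + ((κ : ℂ) * c) • (σ * K + K * σ) := by
      rw [formDeriv, cotMat_eq_add_cotMatRest hN τ θ v]
      simp only [add_mul, mul_add, smul_mul_assoc, mul_smul_comm, smul_add, mul_smul]
      abel
    have e1 : defect hN τ (σ * K + K * σ) = 0 := by
      rw [defect, ← hσ, mul_add, add_mul, ← mul_assoc, hσσ, one_mul, mul_assoc σ (K * σ),
        mul_assoc K, hσσ, mul_one]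
      abel
    have e2 : defect hN τ (((κ : ℂ) * c) • (σ * K + K * σ)) = 0 := by
      have : defect hN τ (((κ : ℂ) * c) • (σ * K + K * σ))
          = ((κ : ℂ) * c) • defect hN τ (σ * K + K * σ) := by
        simp only [defect, mul_smul_comm, smul_mul_assoc, smul_sub]
      rw [this, e1, smul_zero]
    have e3 : ∀ A B, defect hN τ (A + B) = defect hN τ A + defect hN τ B := by
      intro A B
      simp only [defect, mul_add, add_mul]; abel
    rw [e0, e3, e2, add_zero]
  rw [hdec]
  refine (norm_defect_le hN τ _).trans ?_
  have hPn : ‖P‖ ≤ N * (N * (4 / d)) := norm_cotMatRest_wallDir_le hd h ht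
  have hRn : ‖constMat τ v‖ ≤ N * (N * 1) := norm_constMat_le_of_abs_le τ abs_wallDir_le
  have hRn' : ‖constMat τ v‖ ≤ N * (N * (1 / d)) := hRn.trans (by
    gcongr
    rw [le_div_iff₀ hd]; linarith)
  have hX : ‖P * K + K * P + Complex.I • (K * constMat τ v - constMat τ v * K)‖
      ≤ 2 * ‖P‖ * ‖K‖ + 2 * ‖constMat τ v‖ * ‖K‖ := by
    refine (norm_add_le _ _).trans (add_le_add ?_ ?_)
    · refine (norm_add_le _ _).trans ?_
      linarith [norm_mul_le P K, norm_mul_le K P]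
    · rw [norm_smul, Complex.norm_I, one_mul]
      refine (norm_sub_le _ _).trans ?_
      linarith [norm_mul_le (constMat τ v) K, norm_mul_le K (constMat τ v)]
  rw [norm_smul, Complex.norm_real, Real.norm_eq_abs]
  have hk := abs_nonneg κ
  -- The constant is `20 = 2 (2·4 + 2·1)`: the outer `2` comes from `norm_defect_le`, the `4` from
  -- `cotMatRest`, the `1` from `constMat`.
  calc 2 * (|κ| * ‖P * K + K * P + Complex.I • (K * constMat τ v - constMat τ v * K)‖)
      ≤ 2 * (|κ| * (2 * (N * (N * (4 / d))) * ‖K‖ + 2 * (N * (N * (1 / d))) * ‖K‖)) := by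
        gcongr
        exact hX.trans (by gcongr)
    _ = (20 * |κ| * (N * N)) / d * ‖K‖ := by ring

/-- If the form commutes with `σ` in the limit at a wall point, then the defect is small near
this point. -/
lemma exists_norm_defect_le (hp : growthExp N κ < 1) (hL : IsFundamentalMatrix hN τ κ L)
    (H : Matrix (Fin n) (Fin n) ℂ) (R : ℝ) :
    ∃ C : ℝ, 0 ≤ C ∧ ∀ (q : Fin N → ℝ) (d s : ℝ), 0 < s → s ≤ d → d ≤ 1 → (∀ i, |q i| ≤ R) →
      IsWallPoint hN (2 * d) s q →
      Tendsto (fun t : ℝ => defect hN τ (formMat L H (expPoint (q + t • wallDir hN))))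
        (𝓝[>] 0) (𝓝 0) →
      ‖defect hN τ (formMat L H (expPoint (q + s • wallDir hN)))‖
        ≤ C / d * s ^ (1 - growthExp N κ) := by
  obtain ⟨C₀, hC₀, hbd⟩ := exists_norm_formMat_le_of_mem hL H (R + 1)
  set p := growthExp N κ with hpdef
  have hp0 : 0 < 1 - p := by linarith
  refine ⟨20 * |κ| * (N * N) * C₀ / (1 - p), by positivity, ?_⟩
  intro q d s hs hsd hd1 hR hq hlim
  have hd : 0 < d := hs.trans_le hsd
  -- Chosen so that `A t^(1-p)` is a primitive of the bound `O(t^(-p))` for the derivative of the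
  -- defect.
  set A : ℝ := (20 * |κ| * (N * N)) / d * C₀ / (1 - p) with hA
  set E : ℝ → Matrix (Fin n) (Fin n) ℂ := fun t =>
    defect hN τ (formMat L H (expPoint (q + t • wallDir hN))) with hE
  have hA0 : 0 ≤ A := by positivity
  have hmem : ∀ t ∈ Ioc (0 : ℝ) s, q + t • wallDir hN ∈ angleChamber hN := fun t ht =>
    hq.mem_angleChamber ht.1 ht.2 (ht.2.trans hsd) (ht.2.trans (hsd.trans hd1))
  have hEd : ∀ t ∈ Ioc (0 : ℝ) s, HasDerivAt E (defect hN τ (formDeriv τ κ (q + t • wallDir hN)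
      (wallDir hN) (formMat L H (expPoint (q + t • wallDir hN))))) t := fun t ht =>
    hasDerivAt_defect (hasDerivAt_formMat_line hL H (hmem t ht))
  have hEn : ∀ t ∈ Ioc (0 : ℝ) s, ‖defect hN τ (formDeriv τ κ (q + t • wallDir hN)
      (wallDir hN) (formMat L H (expPoint (q + t • wallDir hN))))‖
        ≤ A * ((1 - p) * t ^ (-p)) := by
    intro t ht
    refine (norm_defect_formDeriv_wallDir_le hd hd1 hq
      (by rw [abs_of_pos ht.1]; exact ht.2.trans hsd) _).trans ?_
    have hK := hbd _ (hmem t ht) (fun i => by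
      have h1 : |(q + t • wallDir hN) i| ≤ |q i| + t * |wallDir hN i| := by
        refine (abs_add_le _ _).trans ?_
        simp [abs_mul, abs_of_pos ht.1]
      have h2 : t * |wallDir hN i| ≤ 1 * 1 :=
        mul_le_mul (ht.2.trans (hsd.trans hd1)) (abs_wallDir_le i) (abs_nonneg _) zero_le_one
      linarith [hR i]) t ht.1
      (fun i j hij => hq.gap_add ht.1 ht.2 (ht.2.trans hsd) (ht.2.trans (hsd.trans hd1)) hij)
    calc _ ≤ (20 * |κ| * (N * N)) / d * (C₀ * t ^ (-p)) := by gcongr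
      _ = A * ((1 - p) * t ^ (-p)) := by rw [hA]; field_simp
  -- The estimate starts at an interior point `r`, because the derivative is unbounded at the wall;
  -- the limit `r → 0` uses both the assumed vanishing of the defect and `1 - p > 0`.
  have hkey : ∀ r ∈ Ioo (0 : ℝ) s, ‖E s‖ ≤ ‖E r‖ + A * (s ^ (1 - p) - r ^ (1 - p)) := by
    intro r hr
    refine image_norm_le_of_norm_deriv_right_le_deriv_boundary' (f := E) (a := r) (b := s)
      (B := fun t => ‖E r‖ + A * (t ^ (1 - p) - r ^ (1 - p)))
      (B' := fun t => A * ((1 - p) * t ^ (-p)))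
      (fun t ht => (hEd t ⟨hr.1.trans_le ht.1, ht.2⟩).continuousAt.continuousWithinAt)
      (fun t ht => (hEd t ⟨hr.1.trans_le ht.1, ht.2.le⟩).hasDerivWithinAt) (by simp)
      ?_ ?_ (fun t ht => hEn t ⟨hr.1.trans_le ht.1, ht.2.le⟩) ⟨hr.2.le, le_rfl⟩
    · exact continuousOn_const.add (continuousOn_const.mul
        ((continuousOn_id.rpow_const fun t ht => Or.inr hp0.le).sub continuousOn_const))
    · intro t ht
      have ht0 : t ≠ 0 := (hr.1.trans_le ht.1).ne'
      have h1 := (Real.hasDerivAt_rpow_const (x := t) (p := 1 - p) (Or.inl ht0)).sub_const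
        (r ^ (1 - p)) |>.const_mul A |>.const_add ‖E r‖
      have e : 1 - p - 1 = -p := by ring
      rw [e] at h1
      exact h1.hasDerivWithinAt
  have hlim2 : Tendsto (fun r => ‖E r‖ + A * (s ^ (1 - p) - r ^ (1 - p))) (𝓝[>] 0)
      (𝓝 (‖(0 : Matrix (Fin n) (Fin n) ℂ)‖ + A * (s ^ (1 - p) - 0 ^ (1 - p)))) := by
    refine hlim.norm.add (tendsto_const_nhds.mul (tendsto_const_nhds.sub ?_))
    exact ((Real.continuousAt_rpow_const 0 (1 - p) (Or.inr hp0.le)).tendsto).mono_left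
      nhdsWithin_le_nhds
  have hfin : ‖E s‖ ≤ _ := ge_of_tendsto hlim2 (by
    filter_upwards [Ioo_mem_nhdsGT hs] with r hr using hkey r hr)
  rw [norm_zero, Real.zero_rpow hp0.ne', zero_add, sub_zero] at hfin
  refine hfin.trans (le_of_eq ?_)
  rw [hA]
  field_simp

end

end TorusDunkl

namespace TorusDunkl

noncomputable section

open scoped Matrix.Norms.L2Operator
open Set Filter Topology

variable {N n : ℕ}

/-! ### Transport along the wall -/

/-- The difference of the cotangents is the sine of half the difference divided by the product of
the two sines, and both of these are at least `sin (d/2)`. -/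
lemma abs_halfCot_sub_le {d a b : ℝ} (hd : 0 < d) (ha : d ≤ a) (ha' : a ≤ 2 * Real.pi - d)
    (hb : d ≤ b) (hb' : b ≤ 2 * Real.pi - d) :
    |halfCot a - halfCot b| ≤ |a - b| / (4 * Real.sin (d / 2) ^ 2) := by
  have key : ∀ x, d ≤ x → x ≤ 2 * Real.pi - d → Real.sin (d / 2) ≤ Real.sin (x / 2) := by
    intro x h1 h2
    rcases le_total x Real.pi with h | h
    · exact Real.sin_le_sin_of_le_of_le_pi_div_two (by linarith) (by linarith) (by linarith)
    · rw [← Real.sin_pi_sub (x / 2)]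
      exact Real.sin_le_sin_of_le_of_le_pi_div_two (by linarith) (by linarith) (by linarith)
  have hm : 0 < Real.sin (d / 2) := Real.sin_pos_of_pos_of_lt_pi (by linarith) (by linarith)
  have hsa := hm.trans_le (key a ha ha')
  have hsb := hm.trans_le (key b hb hb')
  have e : halfCot a - halfCot b
      = Real.sin ((b - a) / 2) / (2 * (Real.sin (a / 2) * Real.sin (b / 2))) := by
    have : (b - a) / 2 = b / 2 - a / 2 := by ring
    rw [this, Real.sin_sub, halfCot, halfCot]
    field_simp
  rw [e, abs_div, abs_of_pos (a := 2 * (Real.sin (a / 2) * Real.sin (b / 2))) (by positivity)]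
  have h1 : |Real.sin ((b - a) / 2)| ≤ |a - b| / 2 := by
    refine (Real.abs_sin_le_abs).trans (le_of_eq ?_)
    rw [abs_div, abs_two, abs_sub_comm]
  have h2 : 2 * Real.sin (d / 2) ^ 2 ≤ 2 * (Real.sin (a / 2) * Real.sin (b / 2)) := by
    have := mul_le_mul (key a ha ha') (key b hb hb') hm.le hsa.le
    rw [sq]; linarith
  calc _ ≤ (|a - b| / 2) / (2 * Real.sin (d / 2) ^ 2) := by
        refine div_le_div₀ (by positivity) h1 (by positivity) h2
    _ = _ := by ring

lemma IsWallPoint.segment {hN : 3 ≤ N} {d s : ℝ} {q₀ q₁ : Fin N → ℝ} (h₀ : IsWallPoint hN d s q₀)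
    (h₁ : IsWallPoint hN d s q₁) {t : ℝ} (ht : t ∈ Icc (0 : ℝ) 1) :
    IsWallPoint hN d s (q₀ + t • (q₁ - q₀)) := by
  have e : ∀ i j, (q₀ + t • (q₁ - q₀)) j - (q₀ + t • (q₁ - q₀)) i
      = (q₀ j - q₀ i) + t • ((q₁ j - q₁ i) - (q₀ j - q₀ i)) := by
    intro i j; simp; ring
  refine ⟨by simp [h₀.eq, h₁.eq], fun i hi => ?_, fun i j hij hj => ?_⟩
  · rw [e]
    exact (convex_Icc d (2 * Real.pi - d)).add_smul_sub_mem (h₀.sep i hi) (h₁.sep i hi) ht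
  · rw [e]
    exact (convex_Icc s (2 * Real.pi - s)).add_smul_sub_mem (h₀.rest i j hij hj)
      (h₁.rest i j hij hj) ht

lemma IsWallPoint.gap_add_of_not_pair {hN : 3 ≤ N} {d : ℝ} {q : Fin N → ℝ}
    (h : IsWallPoint hN (2 * d) d q) {t : ℝ} (ht : |t| ≤ d) {i j : Fin N} (hij : i < j)
    (hne : ¬(i = penIdx hN ∧ j = lstIdx hN)) :
    d ≤ (q + t • wallDir hN) j - (q + t • wallDir hN) i ∧
      (q + t • wallDir hN) j - (q + t • wallDir hN) i ≤ 2 * Real.pi - d := by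
  rcases lt_cases hN hij with h1 | ⟨h1, h2⟩ | h1
  · have := h.rest i j hij h1
    simpa only [Pi.add_apply, Pi.smul_apply, wallDir_of_lt h1, wallDir_of_lt (hij.trans h1),
      smul_zero, add_zero] using this
  · exact h.sep_add ht h1 h2
  · exact absurd h1 hne

variable {τ : Equiv.Perm (Fin N) →* Matrix.orthogonalGroup (Fin n) ℝ} {hN : 3 ≤ N} {κ : ℝ}
  {L : (Fin N → ℂ) → Matrix (Fin n) (Fin n) ℂ}

/-- A direction tangent to the wall does not feel the singular term of that wall. -/
lemma cotMat_of_eq {θ v : Fin N → ℝ} (hv : v (penIdx hN) = v (lstIdx hN)) :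
    cotMat τ θ v = cotMatRest hN τ θ v := by
  rw [cotMat_eq_add_cotMatRest hN, hv]
  simp

lemma norm_cotMat_tangential_le {d V : ℝ} {q v : Fin N → ℝ} (hd : 0 < d) (hV : ∀ i, |v i| ≤ V)
    (hV0 : 0 ≤ V) (hv : v (penIdx hN) = v (lstIdx hN))
    (h : IsWallPoint hN (2 * d) d q) {t : ℝ} (ht : |t| ≤ d) :
    ‖cotMat τ (q + t • wallDir hN) v‖ ≤ N * (N * (4 * V / d)) := by
  rw [cotMat_of_eq hv]
  refine (norm_sum_Ioi_smul_rep_le τ _).trans (sum_Ioi_le (by positivity) fun i j hij => ?_)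
  split_ifs with hc
  · rw [abs_zero]; positivity
  · have hg := h.gap_add_of_not_pair ht hij hc
    have hh := abs_halfCot_le (a := (q + t • wallDir hN) j - (q + t • wallDir hN) i)
      (by linarith) (by linarith)
    have e1 : 1 / ((q + t • wallDir hN) j - (q + t • wallDir hN) i) ≤ 1 / d :=
      one_div_le_one_div_of_le hd hg.1
    have e2 : 1 / (2 * Real.pi - ((q + t • wallDir hN) j - (q + t • wallDir hN) i)) ≤ 1 / d :=
      one_div_le_one_div_of_le hd (by linarith)
    have e3 : |v j - v i| ≤ 2 * V := (abs_sub _ _).trans (by linarith [hV i, hV j])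
    rw [abs_mul]
    calc _ ≤ (2 * V) * (1 / d + 1 / d) :=
          mul_le_mul e3 (by linarith) (abs_nonneg _) (by positivity)
      _ = 4 * V / d := by ring

/-- Passing from `t` to `-t` changes each gap by at most `4t`, and the cotangents that occur are
Lipschitz because their arguments stay `d` away from the poles. -/
lemma norm_cotMat_sub_tangential_le {d V : ℝ} {q v : Fin N → ℝ} (hd : 0 < d)
    (hV : ∀ i, |v i| ≤ V) (hV0 : 0 ≤ V) (hv : v (penIdx hN) = v (lstIdx hN))
    (h : IsWallPoint hN (2 * d) d q) {t : ℝ} (ht0 : 0 ≤ t) (ht : t ≤ d) :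
    ‖cotMat τ (q + t • wallDir hN) v - cotMat τ (q + (-t) • wallDir hN) v‖
      ≤ N * (N * (2 * V / Real.sin (d / 2) ^ 2)) * t := by
  rw [cotMat_of_eq hv, cotMat_of_eq hv, cotMatRest, cotMatRest, ← Finset.sum_sub_distrib]
  simp_rw [← Finset.sum_sub_distrib, ← sub_smul, ← Complex.ofReal_sub]
  have hB : N * (N * (2 * V / Real.sin (d / 2) ^ 2)) * t
    = N * (N * (2 * V / Real.sin (d / 2) ^ 2 * t)) := by ring
  rw [hB]
  refine (norm_sum_Ioi_smul_rep_le τ _).trans (sum_Ioi_le (by positivity) fun i j hij => ?_)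
  split_ifs with hc
  · rw [sub_self, abs_zero]; positivity
  · have hg := h.gap_add_of_not_pair (t := t) (by rwa [abs_of_nonneg ht0]) hij hc
    have hg' := h.gap_add_of_not_pair (t := -t) (by rwa [abs_neg, abs_of_nonneg ht0]) hij hc
    have hh := abs_halfCot_sub_le hd hg.1 hg.2 hg'.1 hg'.2
    have e3 : |v j - v i| ≤ 2 * V := (abs_sub _ _).trans (by linarith [hV i, hV j])
    have e4 : |(q + t • wallDir hN) j - (q + t • wallDir hN) i
        - ((q + (-t) • wallDir hN) j - (q + (-t) • wallDir hN) i)| ≤ 4 * t := by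
      have : (q + t • wallDir hN) j - (q + t • wallDir hN) i
        - ((q + (-t) • wallDir hN) j - (q + (-t) • wallDir hN) i)
        = (2 * t) * (wallDir hN j - wallDir hN i) := by simp; ring
      rw [this, abs_mul, abs_of_nonneg (by positivity)]
      have : |wallDir hN j - wallDir hN i| ≤ 2 := (abs_sub _ _).trans
        (by linarith [abs_wallDir_le (hN := hN) i, abs_wallDir_le (hN := hN) j])
      nlinarith
    rw [← mul_sub, abs_mul]
    calc _ ≤ (2 * V) * ((4 * t) / (4 * Real.sin (d / 2) ^ 2)) := by
          refine mul_le_mul e3 (hh.trans ?_) (abs_nonneg _) (by positivity)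
          gcongr
      _ = _ := by ring

/-- Since `σ` exchanges the points at `t` and `-t`, it conjugates `cotMat` at `t` to `cotMat` at
`-t`. The derivative of the defect is thus linear in the defect itself, with an inhomogeneous term
containing the small difference of these two matrices. -/
lemma defect_formDeriv_tangential {q v : Fin N → ℝ} (hq : q (penIdx hN) = q (lstIdx hN))
    (hv : v (penIdx hN) = v (lstIdx hN)) (t : ℝ) (K : Matrix (Fin n) (Fin n) ℂ) :
    defect hN τ (formDeriv τ κ (q + t • wallDir hN) v K)
      = (κ : ℂ) • ((cotMat τ (q + t • wallDir hN) v * defect hN τ K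
          + defect hN τ K * cotMat τ (q + t • wallDir hN) v)
        + ((cotMat τ (q + t • wallDir hN) v - cotMat τ (q + (-t) • wallDir hN) v)
            * (sigma hN τ * K * sigma hN τ)
          + (sigma hN τ * K * sigma hN τ)
            * (cotMat τ (q + t • wallDir hN) v - cotMat τ (q + (-t) • wallDir hN) v))
        + Complex.I • (defect hN τ K * constMat τ v - constMat τ v * defect hN τ K)) := by
  set w := Equiv.swap (penIdx hN) (lstIdx hN) with hw
  have hθ : (q + (-t) • wallDir hN) ∘ w = q + t • wallDir hN := by
    ext i
    have h1 := congrFun (comp_swap_of_eq hq) i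
    have h2 := congrFun (wallDir_comp_swap hN) i
    simp only [Function.comp_apply, Pi.neg_apply] at h1 h2
    simp [hw, h1, h2]
  have hvw : v ∘ w = v := comp_swap_of_eq hv
  have e1 := rep_mul_cotMat τ w (q + (-t) • wallDir hN) v
  have e2 := rep_mul_constMat τ w v
  rw [hθ, hvw] at e1
  rw [hvw] at e2
  change sigma hN τ * _ = _ * sigma hN τ at e1 e2
  set σ := sigma hN τ with hσ
  have hσσ : σ * σ = 1 := sigma_mul_self τ hN
  set P := cotMat τ (q + t • wallDir hN) v
  set P' := cotMat τ (q + (-t) • wallDir hN) v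
  set R := constMat τ v
  have e1' : P * σ = σ * P' := by
    calc P * σ = (σ * σ) * P * σ := by rw [hσσ, one_mul]
      _ = σ * (σ * P) * σ := by simp only [mul_assoc]
      _ = σ * P' * (σ * σ) := by rw [e1]; simp only [mul_assoc]
      _ = σ * P' := by rw [hσσ, mul_one]
  have f1 : σ * (P * K) * σ = P' * (σ * K * σ) := by
    rw [← mul_assoc σ P, e1]; simp only [mul_assoc]
  have f2 : σ * (K * P) * σ = (σ * K * σ) * P' := by
    rw [mul_assoc, mul_assoc K, e1']; simp only [mul_assoc]
  have f3 : σ * (R * K) * σ = R * (σ * K * σ) := by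
    rw [← mul_assoc σ R, e2]; simp only [mul_assoc]
  have f4 : σ * (K * R) * σ = (σ * K * σ) * R := by
    rw [mul_assoc, mul_assoc K, ← e2]; simp only [mul_assoc]
  have hlin : defect hN τ (formDeriv τ κ (q + t • wallDir hN) v K)
      = (κ : ℂ) • (P * K + K * P + Complex.I • (K * R - R * K)
        - (σ * (P * K) * σ + σ * (K * P) * σ
          + Complex.I • (σ * (K * R) * σ - σ * (R * K) * σ))) := by
    rw [defect, formDeriv, ← hσ]
    simp only [mul_smul_comm, smul_mul_assoc, ← smul_sub, mul_add, add_mul, mul_sub, sub_mul]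
    rfl
  rw [hlin, f1, f2, f3, f4, defect, ← hσ]
  set Y := σ * K * σ
  congr 1
  simp only [mul_sub, sub_mul, smul_sub]
  abel

/-- If the form commutes with `σ` in the limit at one point of the wall, then it does so at every
point of the wall. -/
lemma tendsto_defect_of_isWallPoint (hp : growthExp N κ < 1) (hL : IsFundamentalMatrix hN τ κ L)
    (H : Matrix (Fin n) (Fin n) ℂ) {q₀ q₁ : Fin N → ℝ} {d : ℝ} (hd : 0 < d) (hd1 : d ≤ 1)
    (h₀ : IsWallPoint hN (2 * d) d q₀) (h₁ : IsWallPoint hN (2 * d) d q₁)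
    (hlim : Tendsto (fun t : ℝ => defect hN τ (formMat L H (expPoint (q₀ + t • wallDir hN))))
        (𝓝[>] 0) (𝓝 0)) :
    Tendsto (fun t : ℝ => defect hN τ (formMat L H (expPoint (q₁ + t • wallDir hN))))
        (𝓝[>] 0) (𝓝 0) := by
  obtain ⟨V₀, hV₀⟩ : ∃ V₀ : ℝ, ∀ i, |q₀ i| ≤ V₀ :=
    ⟨∑ i, |q₀ i|, fun i => Finset.single_le_sum (f := fun i => |q₀ i|) (fun i _ => abs_nonneg _)
      (Finset.mem_univ i)⟩
  obtain ⟨V₁, hV₁⟩ : ∃ V₁ : ℝ, ∀ i, |q₁ i| ≤ V₁ :=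
    ⟨∑ i, |q₁ i|, fun i => Finset.single_le_sum (f := fun i => |q₁ i|) (fun i _ => abs_nonneg _)
      (Finset.mem_univ i)⟩
  set v := q₁ - q₀ with hvdef
  set V : ℝ := V₀ + V₁ with hVdef
  have hVi : ∀ i, |v i| ≤ V := fun i => (abs_sub _ _).trans (by linarith [hV₀ i, hV₁ i])
  have hV0 : 0 ≤ V := (abs_nonneg _).trans (hVi (lstIdx hN))
  have hv : v (penIdx hN) = v (lstIdx hN) := by simp [hvdef, h₀.eq, h₁.eq]
  obtain ⟨C₀, hC₀, hbd⟩ := exists_norm_formMat_le_of_mem hL H (V₀ + V + 1)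
  set p := growthExp N κ with hpdef
  have hp0 : 0 < 1 - p := by linarith
  -- The `+ 1` keeps the Gronwall constant non-zero, so that the closed formula for the Gronwall
  -- bound with an inhomogeneous term applies.
  set A : ℝ := |κ| * (2 * (N * (N * (4 * V / d))) + 2 * (N * (N * V))) + 1 with hA
  have hA0 : 0 < A := by positivity
  set B : ℝ := |κ| * (2 * (N * (N * (2 * V / Real.sin (d / 2) ^ 2)))) * C₀ with hB
  have hB0 : 0 ≤ B := by positivity
  -- Gronwall's inequality at fixed distance `s` from the wall. The inhomogeneous term is `O(s)`
  -- from the coefficients times `O(s^(-p))` from the form, which tends to zero with `s`.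
  have hkey : ∀ s ∈ Ioc (0 : ℝ) d,
      ‖defect hN τ (formMat L H (expPoint (q₁ + s • wallDir hN)))‖
      ≤ ‖defect hN τ (formMat L H (expPoint (q₀ + s • wallDir hN)))‖ * Real.exp (A * 1)
        + B * s ^ (1 - p) / A * (Real.exp (A * 1) - 1) := by
    intro s hs
    have hs1 : s ≤ 1 := hs.2.trans hd1
    set η : ℝ → Fin N → ℝ := fun t => (q₀ + s • wallDir hN) + t • v with hη
    have hηq : ∀ t, η t = (q₀ + t • v) + s • wallDir hN := by
      intro t; simp only [hη]; abel
    have hw : ∀ t ∈ Icc (0 : ℝ) 1, IsWallPoint hN (2 * d) d (q₀ + t • v) := fun t ht =>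
      h₀.segment h₁ ht
    have hmem : ∀ t ∈ Icc (0 : ℝ) 1, η t ∈ angleChamber hN := fun t ht => by
      rw [hηq]; exact (hw t ht).mem_angleChamber hs.1 hs.2 hs.2 hs1
    have hEd : ∀ t ∈ Icc (0 : ℝ) 1, HasDerivAt (fun t => defect hN τ (formMat L H (expPoint (η t))))
        (defect hN τ (formDeriv τ κ (η t) v (formMat L H (expPoint (η t))))) t := fun t ht =>
      hasDerivAt_defect (hasDerivAt_formMat_line hL H (hmem t ht))
    have hg := norm_le_gronwallBound_of_norm_deriv_right_le (a := 0) (b := 1) (K := A)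
      (ε := B * s ^ (1 - p))
      (fun t ht => (hEd t ht).continuousAt.continuousWithinAt)
      (fun t ht => (hEd t ⟨ht.1, ht.2.le⟩).hasDerivWithinAt) le_rfl
      (by
        intro t ht
        have ht' : t ∈ Icc (0 : ℝ) 1 := ⟨ht.1, ht.2.le⟩
        have hK := hbd _ (hmem t ht') (fun i => by
          have e1 : |η t i| ≤ |q₀ i| + s * |wallDir hN i| + t * |v i| := by
            simp only [hη, Pi.add_apply, Pi.smul_apply, smul_eq_mul]
            refine (abs_add_le _ _).trans ?_
            rw [abs_mul t, abs_of_nonneg ht.1]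
            refine add_le_add_left ((abs_add_le _ _).trans ?_) _
            rw [abs_mul, abs_of_pos hs.1]
          have e2 : s * |wallDir hN i| ≤ 1 * 1 :=
            mul_le_mul hs1 (abs_wallDir_le i) (abs_nonneg _) zero_le_one
          have e3 : t * |v i| ≤ 1 * V := mul_le_mul ht.2.le (hVi i) (abs_nonneg _) zero_le_one
          linarith [hV₀ i]) s hs.1
          (fun i j hij => by
            rw [hηq]; exact (hw t ht').gap_add hs.1 hs.2 hs.2 hs1 hij)
        set K := formMat L H (expPoint (η t)) with hKdef
        have hP : ‖cotMat τ (η t) v‖ ≤ N * (N * (4 * V / d)) := by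
          rw [hηq]
          exact norm_cotMat_tangential_le hd hVi hV0 hv (hw t ht') (by rw [abs_of_pos hs.1]; exact hs.2)
        have hPP : ‖cotMat τ (η t) v - cotMat τ ((q₀ + t • v) + (-s) • wallDir hN) v‖
            ≤ N * (N * (2 * V / Real.sin (d / 2) ^ 2)) * s := by
          rw [hηq]
          exact norm_cotMat_sub_tangential_le hd hVi hV0 hv (hw t ht') hs.1.le hs.2
        have hR : ‖constMat τ v‖ ≤ N * (N * V) := norm_constMat_le_of_abs_le τ hVi
        have hform : defect hN τ (formDeriv τ κ (η t) v K) = (κ : ℂ) • ((cotMat τ (η t) v * defect hN τ K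
          + defect hN τ K * cotMat τ (η t) v)
          + ((cotMat τ (η t) v - cotMat τ ((q₀ + t • v) + (-s) • wallDir hN) v)
              * (sigma hN τ * K * sigma hN τ)
            + (sigma hN τ * K * sigma hN τ)
              * (cotMat τ (η t) v - cotMat τ ((q₀ + t • v) + (-s) • wallDir hN) v))
          + Complex.I • (defect hN τ K * constMat τ v - constMat τ v * defect hN τ K)) := by
          rw [hηq]
          exact defect_formDeriv_tangential (hw t ht').eq hv s K
        rw [hform]
        set P := cotMat τ (η t) v
        set Q := cotMat τ (η t) v - cotMat τ ((q₀ + t • v) + (-s) • wallDir hN) v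
        set Z := constMat τ v
        set E := defect hN τ K
        set Y := sigma hN τ * K * sigma hN τ
        have hY : ‖Y‖ ≤ C₀ * s ^ (-p) := (norm_sigma_mul_mul_le hN τ K).trans hK
        have n1 : ‖P * E + E * P‖ ≤ 2 * (N * (N * (4 * V / d))) * ‖E‖ := by
          refine (norm_add_le _ _).trans ?_
          have := norm_mul_le P E
          have := norm_mul_le E P
          have := mul_le_mul_of_nonneg_right hP (norm_nonneg E)
          linarith
        have n2 : ‖Q * Y + Y * Q‖ ≤ 2 * (N * (N * (2 * V / Real.sin (d / 2) ^ 2)) * s)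
            * (C₀ * s ^ (-p)) := by
          refine (norm_add_le _ _).trans ?_
          have := norm_mul_le Q Y
          have := norm_mul_le Y Q
          have := mul_le_mul hPP hY (norm_nonneg Y) ((norm_nonneg _).trans hPP)
          linarith
        have n3 : ‖Complex.I • (E * Z - Z * E)‖ ≤ 2 * (N * (N * V)) * ‖E‖ := by
          rw [norm_smul, Complex.norm_I, one_mul]
          refine (norm_sub_le _ _).trans ?_
          have := norm_mul_le Z E
          have := norm_mul_le E Z
          have := mul_le_mul_of_nonneg_right hR (norm_nonneg E)
          linarith
        rw [norm_smul, Complex.norm_real, Real.norm_eq_abs]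
        have hsp : s ^ (1 - p) = s * s ^ (-p) := by
          rw [sub_eq_add_neg, Real.rpow_add hs.1, Real.rpow_one]
        calc |κ| * ‖(P * E + E * P) + (Q * Y + Y * Q) + Complex.I • (E * Z - Z * E)‖
            ≤ |κ| * (2 * (N * (N * (4 * V / d))) * ‖E‖
              + 2 * (N * (N * (2 * V / Real.sin (d / 2) ^ 2)) * s) * (C₀ * s ^ (-p))
              + 2 * (N * (N * V)) * ‖E‖) := by
              refine mul_le_mul_of_nonneg_left ?_ (abs_nonneg _)
              exact (norm_add_le _ _).trans (add_le_add ((norm_add_le _ _).trans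
                (add_le_add n1 n2)) n3)
          _ = (A - 1) * ‖E‖ + B * s ^ (1 - p) := by rw [hA, hB, hsp]; ring
          _ ≤ A * ‖E‖ + B * s ^ (1 - p) := by
              have := norm_nonneg E
              nlinarith) 1 ⟨zero_le_one, le_rfl⟩
    rw [gronwallBound_of_K_ne_0 hA0.ne'] at hg
    have e1 : η 1 = q₁ + s • wallDir hN := by
      simp only [hη, hvdef, one_smul]; abel
    have e0 : η 0 = q₀ + s • wallDir hN := by simp [hη]
    simpa only [e1, e0, sub_zero] using hg
  rw [tendsto_zero_iff_norm_tendsto_zero] at hlim ⊢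
  have hl : Tendsto (fun s : ℝ => ‖defect hN τ (formMat L H (expPoint (q₀ + s • wallDir hN)))‖
      * Real.exp (A * 1) + B * s ^ (1 - p) / A * (Real.exp (A * 1) - 1)) (𝓝[>] 0) (𝓝 0) := by
    have h1 : Tendsto (fun s : ℝ => s ^ (1 - p)) (𝓝[>] 0) (𝓝 0) := by
      have := ((Real.continuousAt_rpow_const 0 (1 - p) (Or.inr hp0.le)).tendsto).mono_left
        (nhdsWithin_le_nhds (s := Ioi (0 : ℝ)))
      rwa [Real.zero_rpow hp0.ne'] at this
    have h2 := (hlim.mul_const (Real.exp (A * 1))).add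
      (((h1.const_mul B).div_const A).mul_const (Real.exp (A * 1) - 1))
    simpa using h2
  refine squeeze_zero' (Eventually.of_forall fun s => norm_nonneg _) ?_ hl
  filter_upwards [Ioc_mem_nhdsGT hd] with s hs using hkey s hs

end

end TorusDunkl

namespace TorusDunkl

noncomputable section

open scoped Matrix.Norms.L2Operator
open Set Filter Topology

variable {N n : ℕ}

/-! ### Formal power series with matrix coefficients -/

section formal

variable {R : Type*} [Ring R]

/-- The Euler operator `z d/dz` on formal power series. -/
def eulerOp (f : PowerSeries R) : PowerSeries R :=
  PowerSeries.mk fun k => k • PowerSeries.coeff k f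

lemma eulerOp_sub (f g : PowerSeries R) : eulerOp (f - g) = eulerOp f - eulerOp g := by
  ext k; simp [eulerOp, mul_sub]

lemma eulerOp_mul (f g : PowerSeries R) : eulerOp (f * g) = eulerOp f * g + f * eulerOp g := by
  ext k
  simp only [eulerOp, PowerSeries.coeff_mk, map_add, PowerSeries.coeff_mul, Finset.smul_sum,
    ← Finset.sum_add_distrib]
  refine Finset.sum_congr rfl fun ij hij => ?_
  rw [← Finset.HasAntidiagonal.mem_antidiagonal.1 hij]
  simp only [nsmul_eq_mul, Nat.cast_add, add_mul]
  rw [mul_assoc, ← mul_assoc _ ((ij.2 : ℕ) : R), ← (Nat.cast_commute ij.2 _).eq, mul_assoc]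

end formal

lemma eulerOp_smul (c : ℂ) (f : PowerSeries (Matrix (Fin n) (Fin n) ℂ)) :
    eulerOp (c • f) = c • eulerOp f := by
  ext1 k
  simp [eulerOp]

/-- A matrix `Y` with `k Y + κ [σ, Y] = 0` vanishes when `2 |κ| < k`. -/
lemma eq_zero_of_smul_add_commutator {σ Y : Matrix (Fin n) (Fin n) ℂ} (hσ : ‖σ‖ ≤ 1) {κ : ℝ}
    {k : ℕ} (hκ : 2 * |κ| < k) (h : (k : ℂ) • Y + (κ : ℂ) • (σ * Y - Y * σ) = 0) : Y = 0 := by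
  have h1 : (k : ℂ) • Y = -((κ : ℂ) • (σ * Y - Y * σ)) := eq_neg_of_add_eq_zero_left h
  have h2 := congrArg norm h1
  rw [norm_neg, norm_smul, norm_smul, Complex.norm_natCast, Complex.norm_real,
    Real.norm_eq_abs] at h2
  have h3 : ‖σ * Y - Y * σ‖ ≤ 2 * ‖Y‖ := by
    refine (norm_sub_le _ _).trans ?_
    have := (norm_mul_le σ Y).trans (mul_le_of_le_one_left (norm_nonneg _) hσ)
    have := (norm_mul_le Y σ).trans (mul_le_of_le_one_right (norm_nonneg _) hσ)
    linarith
  have h4 := mul_le_mul_of_nonneg_left h3 (abs_nonneg κ)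
  by_contra hY
  have : 0 < ‖Y‖ := norm_pos_iff.2 hY
  nlinarith

/-- A solution of the recursion `k Y_k + κ [σ, Y_k] = κ ∑ Y_i B_j` (`i + j = k - 1`) with zero
initial term vanishes. -/
lemma eq_zero_of_recursion {σ : Matrix (Fin n) (Fin n) ℂ} (hσ : ‖σ‖ ≤ 1) {κ : ℝ}
    (hκ : 2 * |κ| < 1) {Y B : ℕ → Matrix (Fin n) (Fin n) ℂ} (h0 : Y 0 = 0)
    (h : ∀ k, ((k + 1 : ℕ) : ℂ) • Y (k + 1) + (κ : ℂ) • (σ * Y (k + 1) - Y (k + 1) * σ)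
      = (κ : ℂ) • ∑ ij ∈ Finset.HasAntidiagonal.antidiagonal k, Y ij.1 * B ij.2) (k : ℕ) : Y k = 0 := by
  induction k using Nat.strong_induction_on with
  | _ k ih =>
    cases k with
    | zero => exact h0
    | succ k =>
      refine eq_zero_of_smul_add_commutator hσ (k := k + 1) (κ := κ) ?_ ?_
      · refine hκ.trans_le ?_
        push_cast
        linarith [Nat.cast_nonneg (α := ℝ) k]
      · rw [h, Finset.sum_eq_zero, smul_zero]
        intro ij hij
        rw [ih ij.1 (by have := Finset.HasAntidiagonal.mem_antidiagonal.1 hij; omega), zero_mul]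

/-- The compatibility of the recursion in `z` with the derivative in `u`. -/
lemma deriv_coeff_eq_of_recursion {σ : Matrix (Fin n) (Fin n) ℂ} (hσ : ‖σ‖ ≤ 1) {κ : ℝ}
    (hκ : 2 * |κ| < 1) {c : ℂ} {α α' a B : ℕ → Matrix (Fin n) (Fin n) ℂ}
    (h0 : α' 0 = (c * κ) • (α 0 * a 0))
    (hα : ∀ k, ((k + 1 : ℕ) : ℂ) • α (k + 1) + (κ : ℂ) • (σ * α (k + 1) - α (k + 1) * σ)
      = (κ : ℂ) • ∑ ij ∈ Finset.HasAntidiagonal.antidiagonal k, α ij.1 * B ij.2)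
    (hσ0 : σ * α 0 = α 0 * σ)
    (hα' : ∀ k, ((k + 1 : ℕ) : ℂ) • α' (k + 1) + (κ : ℂ) • (σ * α' (k + 1) - α' (k + 1) * σ)
      = (κ : ℂ) • ∑ ij ∈ Finset.HasAntidiagonal.antidiagonal k, (α' ij.1 * B ij.2
        + α ij.1 * ((c * ((ij.2 + 1 : ℕ) : ℂ)) • a (ij.2 + 1))))
    (hσa : σ * a 0 = a 0 * σ)
    (hcomm : ∀ k, (∑ ij ∈ Finset.HasAntidiagonal.antidiagonal k, (a ij.1 * B ij.2 - B ij.2 * a ij.1))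
      + (a (k + 1) * σ - σ * a (k + 1)) = 0) (k : ℕ) :
    α' k = (c * κ) • ∑ ij ∈ Finset.HasAntidiagonal.antidiagonal k, α ij.1 * a ij.2 := by
  set S := PowerSeries.C σ with hS
  set Ψ := PowerSeries.mk α with hΨ
  set Ψ' := PowerSeries.mk α' with hΨ'
  set A := PowerSeries.mk a with hA
  -- `T` is `z B(z)`, and `W` is the Euler derivative of `A(z)`. In these terms the recursions
  -- become Euler differential equations in `z`.
  set T := PowerSeries.mk B * PowerSeries.X with hT
  set W := PowerSeries.mk (fun j => ((j + 1 : ℕ) : ℂ) • a (j + 1)) * PowerSeries.X with hW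
  have hcS : ∀ (f : PowerSeries (Matrix (Fin n) (Fin n) ℂ)) k,
      PowerSeries.coeff k (S * f) = σ * PowerSeries.coeff k f := fun f k =>
    PowerSeries.coeff_C_mul k f σ
  have hcS' : ∀ (f : PowerSeries (Matrix (Fin n) (Fin n) ℂ)) k,
      PowerSeries.coeff k (f * S) = PowerSeries.coeff k f * σ := fun f k =>
    PowerSeries.coeff_mul_C k f σ
  have hcE : ∀ (f : PowerSeries (Matrix (Fin n) (Fin n) ℂ)) k,
      PowerSeries.coeff k (eulerOp f) = (k : ℂ) • PowerSeries.coeff k f := fun f k => by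
    rw [eulerOp, PowerSeries.coeff_mk, Nat.cast_smul_eq_nsmul]
  have hcX : ∀ (f : PowerSeries (Matrix (Fin n) (Fin n) ℂ)) (b : ℕ → Matrix (Fin n) (Fin n) ℂ) k,
      PowerSeries.coeff (k + 1) (f * (PowerSeries.mk b * PowerSeries.X))
        = ∑ ij ∈ Finset.HasAntidiagonal.antidiagonal k, PowerSeries.coeff ij.1 f * b ij.2 :=
    fun f b k => by
      rw [← mul_assoc, PowerSeries.coeff_succ_mul_X, PowerSeries.coeff_mul]
      simp only [PowerSeries.coeff_mk]
  have hcX0 : ∀ (f : PowerSeries (Matrix (Fin n) (Fin n) ℂ)) (b : ℕ → Matrix (Fin n) (Fin n) ℂ),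
      PowerSeries.coeff 0 (f * (PowerSeries.mk b * PowerSeries.X)) = 0 := fun f b => by
    rw [← mul_assoc, PowerSeries.coeff_zero_mul_X]
  have hEA : eulerOp A = W := by
    ext1 k
    cases k with
    | zero => rw [hcE, hW, PowerSeries.coeff_zero_mul_X, Nat.cast_zero, zero_smul]
    | succ k => simp only [hcE, hW, hA, PowerSeries.coeff_mk, PowerSeries.coeff_succ_mul_X]
  have r1 : eulerOp Ψ = (κ : ℂ) • (Ψ * T) - (κ : ℂ) • (S * Ψ - Ψ * S) := by
    rw [eq_sub_iff_add_eq]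
    ext1 k
    simp only [map_add, map_sub, PowerSeries.coeff_smul, hcE, hcS, hcS']
    cases k with
    | zero => simp only [hT, hcX0, hΨ, PowerSeries.coeff_mk, hσ0, Nat.cast_zero, zero_smul, sub_self,
        smul_zero, add_zero]
    | succ k => simpa only [hT, hcX, hΨ, PowerSeries.coeff_mk] using hα k
  -- This is `r1` differentiated in the second variable, the derivative of `T` being `c` times the
  -- Euler derivative of `A`.
  have r2 : eulerOp Ψ' = (κ : ℂ) • (Ψ' * T + c • (Ψ * eulerOp A))
      - (κ : ℂ) • (S * Ψ' - Ψ' * S) := by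
    rw [eq_sub_iff_add_eq, hEA]
    ext1 k
    simp only [map_add, map_sub, PowerSeries.coeff_smul, hcE, hcS, hcS']
    cases k with
    | zero =>
      have : σ * α' 0 = α' 0 * σ := by
        rw [h0, mul_smul_comm, smul_mul_assoc, ← mul_assoc, hσ0, mul_assoc, hσa, mul_assoc]
      simp only [hT, hW, hcX0, hΨ', PowerSeries.coeff_mk, this, Nat.cast_zero, zero_smul, sub_self,
        smul_zero, add_zero]
    | succ k =>
      have := hα' k
      simp only [Finset.sum_add_distrib, mul_smul, mul_smul_comm, ← Finset.smul_sum] at this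
      simpa only [hT, hW, hcX, hΨ, hΨ', PowerSeries.coeff_mk, mul_smul_comm] using this
  -- The hypothesis `hcomm` as an identity of generating series; it is the compatibility of the two
  -- differential equations.
  have r3 : A * T = T * A + S * A - A * S := by
    have h1 : T * A = PowerSeries.mk B * A * PowerSeries.X := by
      rw [hT, mul_assoc, mul_assoc, PowerSeries.X_mul]
    rw [h1]
    ext1 k
    simp only [map_add, map_sub, hcS, hcS']
    cases k with
    | zero => simp only [hT, hcX0, PowerSeries.coeff_zero_mul_X, hA, PowerSeries.coeff_mk, hσa,
        zero_add, sub_self]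
    | succ k =>
      have := hcomm k
      rw [Finset.sum_sub_distrib] at this
      have h2 : PowerSeries.coeff k (PowerSeries.mk B * A)
          = ∑ x ∈ Finset.HasAntidiagonal.antidiagonal k, B x.2 * a x.1 := by
        rw [PowerSeries.coeff_mul, ← Finset.Nat.sum_antidiagonal_swap]
        simp only [hA, PowerSeries.coeff_mk, Prod.fst_swap, Prod.snd_swap]
      rw [PowerSeries.coeff_succ_mul_X, h2]
      simp only [hT, hcX, hA, PowerSeries.coeff_mk]
      rw [← sub_eq_zero, ← this]
      abel
  -- The error `Y` satisfies the homogeneous equation with zero initial coefficient, so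
  -- `eq_zero_of_recursion` kills it.
  set Y := Ψ' - (c * κ) • (Ψ * A) with hY
  have r4 : eulerOp Y + (κ : ℂ) • (S * Y - Y * S) = (κ : ℂ) • (Y * T) := by
    have e : Ψ * (A * T) = Ψ * (T * A) + Ψ * (S * A) - Ψ * (A * S) := by
      rw [r3, mul_sub, mul_add]
    rw [hY, eulerOp_sub, eulerOp_smul, eulerOp_mul, r2, r1]
    simp only [mul_sub, sub_mul, mul_smul_comm, smul_mul_assoc, mul_assoc, e]
    module
  have r5 : ∀ k, PowerSeries.coeff k Y = 0 := by
    refine eq_zero_of_recursion (B := B) hσ hκ ?_ ?_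
    · simp [hY, hΨ', hΨ, hA, h0]
    · intro k
      have := congrArg (PowerSeries.coeff (k + 1)) r4
      simpa only [map_add, map_sub, PowerSeries.coeff_smul, hcE, hcS, hcS', hT, hcX] using this
  have := r5 k
  rw [hY, map_sub, sub_eq_zero, PowerSeries.coeff_smul, PowerSeries.coeff_mul] at this
  simpa [hΨ', hΨ, hA] using this

end

end TorusDunkl

namespace TorusDunkl

noncomputable section

open scoped Matrix.Norms.L2Operator
open Set Filter Topology

variable {N n : ℕ}

/-! ### The coefficients of the series -/

/-- Expand over pairs `(j, l)`. For `j ≠ l` the factors commute. For `j = l` the braid relation and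
`σ² = 1` reduce the commutator to `t j * σ - σ * t j`, and the exponents add. -/
lemma sum_braid_commutator {ι : Type*} [Fintype ι] [DecidableEq ι] (σ : Matrix (Fin n) (Fin n) ℂ)
    (hσ : σ * σ = 1) (t : ι → Matrix (Fin n) (Fin n) ℂ)
    (hbraid : ∀ j, t j * σ * t j = σ * t j * σ)
    (hcomm : ∀ j l, j ≠ l → σ * t j * σ * t l = t l * (σ * t j * σ)) (w : ι → ℂ) (i k : ℕ) :
    σ * (∑ j, w j ^ (i + 1) • t j) * σ * (∑ j, w j ^ (k + 1) • t j)
        - (∑ j, w j ^ (k + 1) • t j) * (σ * (∑ j, w j ^ (i + 1) • t j) * σ)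
      = (∑ j, w j ^ (i + k + 2) • t j) * σ - σ * ∑ j, w j ^ (i + k + 2) • t j := by
  have h : ∀ j l, σ * t j * σ * t l - t l * (σ * t j * σ)
      = if l = j then t j * σ - σ * t j else 0 := by
    intro j l
    split_ifs with hjl
    · subst hjl
      have h1 : σ * t l * σ * t l = t l * σ := by
        rw [mul_assoc, mul_assoc, ← mul_assoc (t l), hbraid, ← mul_assoc, ← mul_assoc, hσ, one_mul]
      have h2 : t l * (σ * t l * σ) = σ * t l := by
        rw [← mul_assoc, ← mul_assoc, hbraid, mul_assoc, hσ, mul_one]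
      rw [h1, h2]
    · rw [hcomm j l (Ne.symm hjl), sub_self]
  have e1 : σ * (∑ j, w j ^ (i + 1) • t j) * σ * (∑ j, w j ^ (k + 1) • t j)
      = ∑ j, ∑ l, (w j ^ (i + 1) * w l ^ (k + 1)) • (σ * t j * σ * t l) := by
    simp only [Finset.mul_sum, Finset.sum_mul, mul_smul_comm, smul_mul_assoc, mul_smul]
    simp only [Finset.smul_sum]
    rw [Finset.sum_comm]
    refine Finset.sum_congr rfl fun j _ => Finset.sum_congr rfl fun l _ => smul_comm _ _ _
  have e2 : (∑ j, w j ^ (k + 1) • t j) * (σ * (∑ j, w j ^ (i + 1) • t j) * σ)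
      = ∑ j, ∑ l, (w j ^ (i + 1) * w l ^ (k + 1)) • (t l * (σ * t j * σ)) := by
    simp only [Finset.mul_sum, Finset.sum_mul, mul_smul_comm, smul_mul_assoc, mul_smul,
      Finset.smul_sum]
  rw [e1, e2, ← Finset.sum_sub_distrib, Finset.sum_mul, Finset.mul_sum, ← Finset.sum_sub_distrib]
  refine Finset.sum_congr rfl fun j _ => ?_
  rw [← Finset.sum_sub_distrib, Finset.sum_eq_single j]
  · rw [← smul_sub, h, if_pos rfl, smul_mul_assoc, mul_smul_comm, ← smul_sub, ← pow_add]
    congr 2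
    omega
  · intro l _ hl
    rw [← smul_sub, h, if_neg hl, smul_zero]
  · simp

/-- `A_k = (-1)^k β_k + σ β_k σ`. -/
def bigA (hN : 3 ≤ N) (τ : Equiv.Perm (Fin N) →* Matrix.orthogonalGroup (Fin n) ℝ) (k : ℕ)
    (p : (Fin (N - 2) → ℂ) × ℂ) : Matrix (Fin n) (Fin n) ℂ :=
  (-1 : ℂ) ^ k • beta hN τ k p + sigma hN τ * beta hN τ k p * sigma hN τ

lemma inIdx_ne_lst (hN : 3 ≤ N) (j : Fin (N - 2)) : inIdx j ≠ lstIdx hN := by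
  have := j.2
  simp only [inIdx, lstIdx, ne_eq, Fin.mk.injEq]
  omega

lemma inIdx_ne_pen (hN : 3 ≤ N) (j : Fin (N - 2)) : inIdx j ≠ penIdx hN := by
  have := j.2
  simp only [inIdx, penIdx, ne_eq, Fin.mk.injEq]
  omega

lemma inIdx_injective : Function.Injective (inIdx (N := N)) := fun i j h => by
  simpa [inIdx, Fin.ext_iff] using h

section rep

variable (hN : 3 ≤ N) (τ : Equiv.Perm (Fin N) →* Matrix.orthogonalGroup (Fin n) ℝ)

lemma sigma_mul_swap_lst_mul_sigma (j : Fin (N - 2)) :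
    sigma hN τ * rep τ (Equiv.swap (inIdx j) (lstIdx hN)) * sigma hN τ
      = rep τ (Equiv.swap (inIdx j) (penIdx hN)) := by
  rw [sigma, rep_mul_swap, mul_assoc, ← sigma, sigma_mul_self, mul_one, Equiv.swap_apply_right,
    Equiv.swap_apply_of_ne_of_ne (inIdx_ne_pen hN j) (inIdx_ne_lst hN j)]

lemma swap_lst_mul_sigma_mul_swap_lst (j : Fin (N - 2)) :
    rep τ (Equiv.swap (inIdx j) (lstIdx hN)) * sigma hN τ
        * rep τ (Equiv.swap (inIdx j) (lstIdx hN))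
      = sigma hN τ * rep τ (Equiv.swap (inIdx j) (lstIdx hN)) * sigma hN τ := by
  rw [sigma_mul_swap_lst_mul_sigma, sigma, rep_mul_swap, mul_assoc, rep_swap_mul_self, mul_one,
    Equiv.swap_apply_right, Equiv.swap_apply_of_ne_of_ne (inIdx_ne_pen hN j).symm
      (penIdx_lt_lstIdx hN).ne, Equiv.swap_comm]

lemma swap_pen_mul_swap_lst {j l : Fin (N - 2)} (h : j ≠ l) :
    rep τ (Equiv.swap (inIdx j) (penIdx hN)) * rep τ (Equiv.swap (inIdx l) (lstIdx hN))
      = rep τ (Equiv.swap (inIdx l) (lstIdx hN)) * rep τ (Equiv.swap (inIdx j) (penIdx hN)) := by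
  rw [rep_mul_swap, Equiv.swap_apply_of_ne_of_ne (fun e => h (inIdx_injective e).symm)
    (inIdx_ne_pen hN l), Equiv.swap_apply_of_ne_of_ne (inIdx_ne_lst hN j).symm
      (penIdx_lt_lstIdx hN).ne']

lemma sigma_beta_sigma (k : ℕ) (p : (Fin (N - 2) → ℂ) × ℂ) :
    sigma hN τ * beta hN τ k p * sigma hN τ = ∑ j : Fin (N - 2),
      (1 / (p.2 - p.1 j) ^ (k + 1)) • rep τ (Equiv.swap (inIdx j) (penIdx hN)) := by
  simp only [beta, Finset.mul_sum, Finset.sum_mul, mul_smul_comm, smul_mul_assoc,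
    sigma_mul_swap_lst_mul_sigma]

lemma beta_eq (k : ℕ) (p : (Fin (N - 2) → ℂ) × ℂ) :
    beta hN τ k p = ∑ j : Fin (N - 2),
      (1 / (p.2 - p.1 j)) ^ (k + 1) • rep τ (Equiv.swap (inIdx j) (lstIdx hN)) := by
  simp only [beta, one_div, inv_pow]

lemma beta_commutator (i k : ℕ) (p : (Fin (N - 2) → ℂ) × ℂ) :
    sigma hN τ * beta hN τ i p * sigma hN τ * beta hN τ k p
        - beta hN τ k p * (sigma hN τ * beta hN τ i p * sigma hN τ)
      = beta hN τ (i + k + 1) p * sigma hN τ - sigma hN τ * beta hN τ (i + k + 1) p := by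
  simp only [beta_eq]
  refine sum_braid_commutator _ (sigma_mul_self τ hN) _ (swap_lst_mul_sigma_mul_swap_lst hN τ)
    (fun j l h => ?_) _ i k
  rw [sigma_mul_swap_lst_mul_sigma, swap_pen_mul_swap_lst hN τ h]

lemma sum_antidiagonal_neg_one_pow (m : ℕ) :
    2 * ∑ ij ∈ Finset.HasAntidiagonal.antidiagonal m, (-1 : ℂ) ^ ij.2 = 1 + (-1) ^ m := by
  induction m with
  | zero => norm_num
  | succ m ih =>
    rw [Finset.Nat.sum_antidiagonal_succ, mul_add, ih, pow_succ]
    ring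

/-- Write `A = Q + P` and `B = Q - P`. After the sum is symmetrized only twice the sum of the
commutators `[P_i, Q_j]` survives, and by `beta_commutator` each of them is a sign times the same
matrix `C`. The alternating sum of the signs gives exactly the negative of the commutator of
`A_{m+1}` with `σ`. -/
lemma sum_commutator_bigA_bigB (m : ℕ) (p : (Fin (N - 2) → ℂ) × ℂ) :
    (∑ ij ∈ Finset.HasAntidiagonal.antidiagonal m, (bigA hN τ ij.1 p * bigB hN τ ij.2 p
        - bigB hN τ ij.2 p * bigA hN τ ij.1 p))
      + (bigA hN τ (m + 1) p * sigma hN τ - sigma hN τ * bigA hN τ (m + 1) p) = 0 := by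
  set P : ℕ → Matrix (Fin n) (Fin n) ℂ := fun k => sigma hN τ * beta hN τ k p * sigma hN τ with hP
  set Q : ℕ → Matrix (Fin n) (Fin n) ℂ := fun k => (-1 : ℂ) ^ k • beta hN τ k p with hQ
  set C := beta hN τ (m + 1) p * sigma hN τ - sigma hN τ * beta hN τ (m + 1) p with hC
  have hA : ∀ k, bigA hN τ k p = Q k + P k := fun k => rfl
  have hB : ∀ k, bigB hN τ k p = Q k - P k := fun k => rfl
  have s1 : ∑ ij ∈ Finset.HasAntidiagonal.antidiagonal m, bigB hN τ ij.2 p * bigA hN τ ij.1 p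
      = ∑ ij ∈ Finset.HasAntidiagonal.antidiagonal m, bigB hN τ ij.1 p * bigA hN τ ij.2 p :=
    (Finset.Nat.sum_antidiagonal_swap (f := fun ij => bigB hN τ ij.1 p * bigA hN τ ij.2 p))
  have s2 : ∑ ij ∈ Finset.HasAntidiagonal.antidiagonal m, Q ij.1 * P ij.2
      = ∑ ij ∈ Finset.HasAntidiagonal.antidiagonal m, Q ij.2 * P ij.1 :=
    (Finset.Nat.sum_antidiagonal_swap (f := fun ij => Q ij.2 * P ij.1))
  have s3 : ∑ ij ∈ Finset.HasAntidiagonal.antidiagonal m, (P ij.1 * Q ij.2 - Q ij.2 * P ij.1)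
      = (∑ ij ∈ Finset.HasAntidiagonal.antidiagonal m, (-1 : ℂ) ^ ij.2) • C := by
    rw [Finset.sum_smul]
    refine Finset.sum_congr rfl fun ij hij => ?_
    rw [hC, ← Finset.HasAntidiagonal.mem_antidiagonal.1 hij, ← beta_commutator]
    simp only [hP, hQ, mul_smul_comm, smul_mul_assoc, smul_sub]
  have s2' : ∑ ij ∈ Finset.HasAntidiagonal.antidiagonal m, (P ij.1 * Q ij.2 - Q ij.2 * P ij.1)
      = ∑ ij ∈ Finset.HasAntidiagonal.antidiagonal m, (P ij.1 * Q ij.2 - Q ij.1 * P ij.2) := by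
    rw [Finset.sum_sub_distrib, Finset.sum_sub_distrib, s2]
  have s4 : ∑ ij ∈ Finset.HasAntidiagonal.antidiagonal m, (bigA hN τ ij.1 p * bigB hN τ ij.2 p
        - bigB hN τ ij.2 p * bigA hN τ ij.1 p) = (1 + (-1 : ℂ) ^ m) • C := by
    rw [← sum_antidiagonal_neg_one_pow, mul_smul, ← s3, Finset.sum_sub_distrib, s1,
      ← Finset.sum_sub_distrib, s2', Finset.smul_sum]
    refine Finset.sum_congr rfl fun ij _ => ?_
    rw [hA, hB, hA, hB, two_smul]
    noncomm_ring
  have s5 : P (m + 1) * sigma hN τ - sigma hN τ * P (m + 1) = -C := by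
    simp only [hP, hC]
    rw [mul_assoc, sigma_mul_self, ← mul_assoc, ← mul_assoc, sigma_mul_self]
    simp
  have s6 : Q (m + 1) * sigma hN τ - sigma hN τ * Q (m + 1) = -((-1 : ℂ) ^ m • C) := by
    simp only [hQ, hC, pow_succ, mul_smul_comm, smul_mul_assoc, ← smul_sub]
    module
  have s7 : bigA hN τ (m + 1) p * sigma hN τ - sigma hN τ * bigA hN τ (m + 1) p
      = -((-1 : ℂ) ^ m • C) - C := by
    rw [sub_eq_add_neg _ C, ← s5, ← s6, hA]
    noncomm_ring
  rw [s4, s7]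
  module

/-- Conjugation by `σ` exchanges `β_k` and `σ β_k σ`, so `B_k` has parity `(-1)^(k+1)`. The `α_k`
inherit a parity from this. -/
lemma bigB_mul_sigma (k : ℕ) (p : (Fin (N - 2) → ℂ) × ℂ) :
    bigB hN τ k p * sigma hN τ = (-1 : ℂ) ^ (k + 1) • (sigma hN τ * bigB hN τ k p) := by
  have h1 : sigma hN τ * (sigma hN τ * beta hN τ k p * sigma hN τ)
      = beta hN τ k p * sigma hN τ := by
    rw [← mul_assoc, ← mul_assoc, sigma_mul_self, one_mul]
  have h2 : sigma hN τ * beta hN τ k p * sigma hN τ * sigma hN τ = sigma hN τ * beta hN τ k p := by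
    rw [mul_assoc, sigma_mul_self, mul_one]
  rw [bigB, sub_mul, mul_sub, h1, h2, smul_mul_assoc, mul_smul_comm]
  have h3 : (-1 : ℂ) ^ k * (-1) ^ k = 1 := by rw [← mul_pow]; norm_num
  rw [smul_sub, smul_smul, pow_succ, mul_right_comm, h3]
  module

lemma sigma_mul_bigA_zero (p : (Fin (N - 2) → ℂ) × ℂ) :
    sigma hN τ * bigA hN τ 0 p = bigA hN τ 0 p * sigma hN τ := by
  rw [bigA, pow_zero, one_smul, mul_add, add_mul, ← mul_assoc, ← mul_assoc, sigma_mul_self,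
    one_mul, mul_assoc _ (sigma hN τ) (sigma hN τ), sigma_mul_self, mul_one, add_comm]

/-! ### The matrices `ρ(a, b)` -/

/-- `(1 - σ)/2` and `(1 + σ)/2` are complementary projections, because `σ² = 1`. -/
lemma rho_mul_rho (a b c d : ℂ) :
    rho hN τ a b * rho hN τ c d = rho hN τ (a * c) (b * d) := by
  have h : (1 - sigma hN τ) * (1 - sigma hN τ) = (2 : ℂ) • (1 - sigma hN τ) := by
    have := sigma_mul_self τ hN
    rw [mul_sub, sub_mul, sub_mul, this]; simp only [one_mul, mul_one]; module
  have h' : (1 + sigma hN τ) * (1 + sigma hN τ) = (2 : ℂ) • (1 + sigma hN τ) := by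
    have := sigma_mul_self τ hN
    rw [mul_add, add_mul, add_mul, this]; simp only [one_mul, mul_one]; module
  have h2 : (1 - sigma hN τ) * (1 + sigma hN τ) = 0 := by
    have := sigma_mul_self τ hN
    rw [mul_add, sub_mul, sub_mul, this]; simp
  have h3 : (1 + sigma hN τ) * (1 - sigma hN τ) = 0 := by
    have := sigma_mul_self τ hN
    rw [mul_sub, add_mul, add_mul, this]; simp [add_comm]
  rw [rho, rho, rho, mul_add, add_mul, add_mul]
  simp only [smul_mul_assoc, mul_smul_comm, h, h', h2, h3]
  module

lemma rho_self (a : ℂ) : rho hN τ a a = a • 1 := by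
  rw [rho]; module

lemma rho_neg_one_one : rho hN τ (-1) 1 = sigma hN τ := by
  rw [rho]; module

lemma sigma_mul_rho (a b : ℂ) : sigma hN τ * rho hN τ a b = rho hN τ a b * sigma hN τ := by
  rw [← rho_neg_one_one, rho_mul_rho, rho_mul_rho, mul_comm, mul_comm b]

/-! ### The recursion -/

variable (κ : ℝ) (α₀ : (Fin (N - 2) → ℂ) × ℂ → Matrix (Fin n) (Fin n) ℂ)

/-- `α_k` is a matrix depending only on `k` times `S_k = ∑ α_i B_j`. -/
lemma alpha_succ (p : (Fin (N - 2) → ℂ) × ℂ) (k : ℕ) :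
    alpha hN τ κ α₀ p (k + 1)
      = (if Even (k + 1) then ((κ : ℂ) / ((k + 1 : ℕ) : ℂ)) • 1
          else rho hN τ ((κ : ℂ) / (((k + 1 : ℕ) : ℂ) - 2 * κ))
            ((κ : ℂ) / (((k + 1 : ℕ) : ℂ) + 2 * κ)))
        * ∑ ij ∈ Finset.HasAntidiagonal.antidiagonal k,
            alpha hN τ κ α₀ p ij.1 * bigB hN τ ij.2 p := by
  have h : ∑ i : Fin (k + 1), alpha hN τ κ α₀ p (k - i) * bigB hN τ i p
      = ∑ ij ∈ Finset.HasAntidiagonal.antidiagonal k,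
            alpha hN τ κ α₀ p ij.1 * bigB hN τ ij.2 p := by
    rw [← Finset.Nat.sum_antidiagonal_swap, Finset.Nat.sum_antidiagonal_eq_sum_range_succ_mk,
      Finset.sum_range]
    rfl
  rw [alpha]
  simp only [h]
  split_ifs
  · rw [smul_mul_assoc, one_mul]
  · rfl

variable {κ α₀}

/-- Induction: the signs of `α_i` and `B_j` with `i + j = k` multiply to `(-1)^(k+1)`, and the
factor in front of the sum commutes with `σ`. -/
lemma alpha_mul_sigma {p : (Fin (N - 2) → ℂ) × ℂ}
    (h0 : sigma hN τ * α₀ p = α₀ p * sigma hN τ) (k : ℕ) :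
    alpha hN τ κ α₀ p k * sigma hN τ = (-1 : ℂ) ^ k • (sigma hN τ * alpha hN τ κ α₀ p k) := by
  induction k using Nat.strong_induction_on with
  | _ k ih =>
    cases k with
    | zero => rw [alpha, pow_zero, one_smul, h0]
    | succ k =>
      have hS : (∑ ij ∈ Finset.HasAntidiagonal.antidiagonal k,
            alpha hN τ κ α₀ p ij.1 * bigB hN τ ij.2 p) * sigma hN τ
          = (-1 : ℂ) ^ (k + 1) • (sigma hN τ * ∑ ij ∈ Finset.HasAntidiagonal.antidiagonal k,
            alpha hN τ κ α₀ p ij.1 * bigB hN τ ij.2 p) := by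
        rw [Finset.mul_sum, Finset.sum_mul, Finset.smul_sum]
        refine Finset.sum_congr rfl fun ij hij => ?_
        have hk := Finset.HasAntidiagonal.mem_antidiagonal.1 hij
        rw [mul_assoc, bigB_mul_sigma, mul_smul_comm, ← mul_assoc, ih ij.1 (by omega),
          smul_mul_assoc, smul_smul, ← pow_add, mul_assoc]
        congr 2
        omega
      rw [alpha_succ, mul_assoc, hS, mul_smul_comm, ← mul_assoc, ← mul_assoc]
      congr 2
      split_ifs
      · simp
      · rw [sigma_mul_rho]

/-- By parity the commutator with `σ` vanishes for even index. For odd index it is `2σ` times the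
matrix, so the left side is multiplication by `ρ(k+1-2κ, k+1+2κ)`, which the factor in the
definition inverts up to `κ`. The bound on `κ` keeps the denominators away from zero. -/
lemma alpha_recursion (hκ : 2 * |κ| < 1) {p : (Fin (N - 2) → ℂ) × ℂ}
    (h0 : sigma hN τ * α₀ p = α₀ p * sigma hN τ) (k : ℕ) :
    ((k + 1 : ℕ) : ℂ) • alpha hN τ κ α₀ p (k + 1)
        + (κ : ℂ) • (sigma hN τ * alpha hN τ κ α₀ p (k + 1)
          - alpha hN τ κ α₀ p (k + 1) * sigma hN τ)
      = (κ : ℂ) • ∑ ij ∈ Finset.HasAntidiagonal.antidiagonal k,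
          alpha hN τ κ α₀ p ij.1 * bigB hN τ ij.2 p := by
  have hk : ((k + 1 : ℕ) : ℂ) ≠ 0 := by exact_mod_cast Nat.succ_ne_zero k
  rw [alpha_mul_sigma hN τ h0]
  by_cases he : Even (k + 1)
  · rw [he.neg_one_pow, one_smul, sub_self, smul_zero, add_zero, alpha_succ, if_pos he,
      smul_mul_assoc, one_mul, smul_smul, mul_div_cancel₀ _ hk]
  · have ho := Nat.not_even_iff_odd.1 he
    have hκ' := abs_lt.1 (show |2 * κ| < 1 by rwa [abs_mul, abs_of_pos (two_pos)])
    have hk0 := Nat.cast_nonneg (α := ℝ) k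
    have h1 : ((k + 1 : ℕ) : ℂ) - 2 * κ ≠ 0 := by
      intro h
      have : ((k + 1 : ℕ) : ℝ) - 2 * κ = 0 := by exact_mod_cast h
      push_cast at this
      linarith
    have h2 : ((k + 1 : ℕ) : ℂ) + 2 * κ ≠ 0 := by
      intro h
      have : ((k + 1 : ℕ) : ℝ) + 2 * κ = 0 := by exact_mod_cast h
      push_cast at this
      linarith
    have e : ∀ X : Matrix (Fin n) (Fin n) ℂ, ((k + 1 : ℕ) : ℂ) • X
        + (κ : ℂ) • (sigma hN τ * X - (-1 : ℂ) ^ (k + 1) • (sigma hN τ * X))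
        = rho hN τ (((k + 1 : ℕ) : ℂ) - 2 * κ) (((k + 1 : ℕ) : ℂ) + 2 * κ) * X := by
      intro X
      rw [ho.neg_one_pow, rho, add_mul, smul_mul_assoc, smul_mul_assoc, sub_mul, add_mul, one_mul]
      module
    rw [e, alpha_succ, if_neg he, ← mul_assoc, rho_mul_rho, mul_div_cancel₀ _ h1,
      mul_div_cancel₀ _ h2, rho_self, smul_mul_assoc, one_mul]

end rep

end

end TorusDunkl

namespace TorusDunkl

noncomputable section

open scoped Matrix.Norms.L2Operator
open Set Filter Topology

variable {N n : ℕ}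

section rep

variable (hN : 3 ≤ N) (τ : Equiv.Perm (Fin N) →* Matrix.orthogonalGroup (Fin n) ℝ)

/-! ### Estimates for the coefficients -/

lemma norm_beta_le {p : (Fin (N - 2) → ℂ) × ℂ} {d : ℝ} (hd : 0 < d)
    (h : ∀ j, d ≤ ‖p.2 - p.1 j‖) (k : ℕ) : ‖beta hN τ k p‖ ≤ N * d⁻¹ ^ (k + 1) := by
  rw [beta_eq]
  refine (norm_sum_le_of_le _ (fun j _ => (?_ : _ ≤ d⁻¹ ^ (k + 1)))).trans ?_
  · rw [norm_smul]
    refine (mul_le_of_le_one_right (norm_nonneg _) (norm_rep_le τ _)).trans ?_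
    rw [norm_pow, norm_div, norm_one, one_div]
    gcongr
    exact h j
  · rw [Finset.sum_const, nsmul_eq_mul, Finset.card_univ, Fintype.card_fin]
    gcongr
    omega

lemma norm_bigA_le {p : (Fin (N - 2) → ℂ) × ℂ} {d : ℝ} (hd : 0 < d)
    (h : ∀ j, d ≤ ‖p.2 - p.1 j‖) (k : ℕ) : ‖bigA hN τ k p‖ ≤ 2 * N * d⁻¹ ^ (k + 1) := by
  have h1 := norm_beta_le hN τ hd h k
  refine (norm_add_le _ _).trans ?_
  rw [norm_smul, norm_pow, norm_neg, norm_one, one_pow, one_mul]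
  linarith [norm_sigma_mul_mul_le hN τ (beta hN τ k p)]

lemma norm_bigB_le {p : (Fin (N - 2) → ℂ) × ℂ} {d : ℝ} (hd : 0 < d)
    (h : ∀ j, d ≤ ‖p.2 - p.1 j‖) (k : ℕ) : ‖bigB hN τ k p‖ ≤ 2 * N * d⁻¹ ^ (k + 1) := by
  have h1 := norm_beta_le hN τ hd h k
  refine (norm_sub_le _ _).trans ?_
  rw [norm_smul, norm_pow, norm_neg, norm_one, one_pow, one_mul]
  linarith [norm_sigma_mul_mul_le hN τ (beta hN τ k p)]

variable {κ : ℝ} {α₀ : (Fin (N - 2) → ℂ) × ℂ → Matrix (Fin n) (Fin n) ℂ}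

/-- Strong induction. The sum has `k + 1` terms, each at most `2N` times the claimed bound, and
`4N|κ| ≤ 1` reduces this to half of `k + 1`. The commutator costs at most `‖X‖ / 2`, which is
absorbed by the left side. Hence the series converges for `|z| < d`. -/
lemma norm_alpha_le (hκ : 4 * (N * |κ|) ≤ 1) {p : (Fin (N - 2) → ℂ) × ℂ} {d : ℝ} (hd : 0 < d)
    (h : ∀ j, d ≤ ‖p.2 - p.1 j‖) (h0 : sigma hN τ * α₀ p = α₀ p * sigma hN τ) (k : ℕ) :
    ‖alpha hN τ κ α₀ p k‖ ≤ ‖α₀ p‖ * d⁻¹ ^ k := by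
  have hN' : (3 : ℝ) ≤ N := by exact_mod_cast hN
  have hκ0 := abs_nonneg κ
  have hκ3 : 3 * |κ| ≤ N * |κ| := mul_le_mul_of_nonneg_right hN' hκ0
  have hκ2 : 2 * |κ| < 1 := by linarith
  induction k using Nat.strong_induction_on with
  | _ k ih =>
    cases k with
    | zero => rw [alpha, pow_zero, mul_one]
    | succ k =>
      have h1 := alpha_recursion hN τ hκ2 h0 k
      set X := alpha hN τ κ α₀ p (k + 1) with hX
      set S := ∑ ij ∈ Finset.HasAntidiagonal.antidiagonal k,
          alpha hN τ κ α₀ p ij.1 * bigB hN τ ij.2 p with hS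
      have h2 : ‖S‖ ≤ (k + 1) * (2 * N * (‖α₀ p‖ * d⁻¹ ^ (k + 1))) := by
        refine (norm_sum_le_of_le _ (fun ij hij =>
          (?_ : _ ≤ 2 * N * (‖α₀ p‖ * d⁻¹ ^ (k + 1))))).trans ?_
        · have hk := Finset.HasAntidiagonal.mem_antidiagonal.1 hij
          refine (norm_mul_le _ _).trans ((mul_le_mul (ih ij.1 (by omega))
            (norm_bigB_le hN τ hd h ij.2) (norm_nonneg _) (by positivity)).trans ?_)
          rw [← hk, add_assoc, pow_add]
          exact le_of_eq (by ring)
        · rw [Finset.sum_const, nsmul_eq_mul, Finset.Nat.card_antidiagonal]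
          push_cast
          rfl
      have h3 : ‖sigma hN τ * X - X * sigma hN τ‖ ≤ 2 * ‖X‖ := by
        refine (norm_sub_le _ _).trans ?_
        have h4 : ‖sigma hN τ * X‖ ≤ ‖X‖ := norm_rep_mul_le τ _ X
        have h5 : ‖X * sigma hN τ‖ ≤ ‖X‖ := norm_mul_rep_le τ _ X
        linarith
      have h4 : (k + 1) * ‖X‖ ≤ |κ| * ‖S‖ + |κ| * (2 * ‖X‖) := by
        have h5 := eq_sub_of_add_eq h1
        have h6 := congrArg norm h5
        rw [norm_smul, Complex.norm_natCast] at h6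
        push_cast at h6
        rw [h6]
        refine (norm_sub_le _ _).trans ?_
        rw [norm_smul, norm_smul, Complex.norm_real, Real.norm_eq_abs]
        gcongr
      have hY : 0 ≤ ‖α₀ p‖ * d⁻¹ ^ (k + 1) := by positivity
      set Y := ‖α₀ p‖ * d⁻¹ ^ (k + 1) with hYd
      have hk0 := Nat.cast_nonneg (α := ℝ) k
      have h5 : |κ| * ‖S‖ ≤ (k + 1) / 2 * Y := by
        calc |κ| * ‖S‖ ≤ |κ| * ((k + 1) * (2 * N * Y)) := by gcongr
          _ = (4 * (N * |κ|)) * ((k + 1) / 2 * Y) := by ring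
          _ ≤ 1 * ((k + 1) / 2 * Y) := by gcongr
          _ = _ := one_mul _
      have h6 : |κ| * (2 * ‖X‖) ≤ 1 / 2 * ‖X‖ := by
        nlinarith [norm_nonneg X]
      have h7 : (k + 1) / 2 * ‖X‖ ≤ (k + 1) / 2 * Y := by
        nlinarith [norm_nonneg X]
      exact le_of_mul_le_mul_left h7 (by positivity)

/-! ### Derivatives with respect to `u` -/

lemma hasDerivAt_beta {y : Fin (N - 2) → ℂ} {u : ℝ → ℂ} {u' : ℂ} {s : ℝ}
    (hu : HasDerivAt u u' s) (hy : ∀ j, u s - y j ≠ 0) (k : ℕ) :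
    HasDerivAt (fun r => beta hN τ k (y, u r))
      ((u' * (-((k + 1 : ℕ) : ℂ))) • beta hN τ (k + 1) (y, u s)) s := by
  simp only [beta_eq, Finset.smul_sum]
  refine HasDerivAt.fun_sum fun j _ => ?_
  have h1 : HasDerivAt (fun r => (1 / (u r - y j)) ^ (k + 1))
      (u' * (-((k + 1 : ℕ) : ℂ)) * (1 / (u s - y j)) ^ (k + 1 + 1)) s := by
    have h2 := ((hu.sub_const (y j)).fun_inv (hy j)).fun_pow (k + 1)
    simp only [one_div]
    refine h2.congr_deriv ?_
    rw [Nat.add_sub_cancel, div_eq_mul_inv, ← inv_pow]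
    ring
  have h3 := h1.smul_const (rep τ (Equiv.swap (inIdx j) (lstIdx hN)))
  rwa [mul_smul] at h3

/-- Differentiation brings a factor `-(k + 1)` and raises the index. Absorbing the sign in `(-1)^k`
turns the minus sign in `bigB` into the plus sign of `bigA`. -/
lemma hasDerivAt_bigB {y : Fin (N - 2) → ℂ} {u : ℝ → ℂ} {u' : ℂ} {s : ℝ}
    (hu : HasDerivAt u u' s) (hy : ∀ j, u s - y j ≠ 0) (k : ℕ) :
    HasDerivAt (fun r => bigB hN τ k (y, u r))
      ((u' * ((k + 1 : ℕ) : ℂ)) • bigA hN τ (k + 1) (y, u s)) s := by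
  have h := hasDerivAt_beta hN τ hu hy k
  have h1 := (h.const_smul ((-1 : ℂ) ^ k)).sub
    ((h.const_mul (sigma hN τ)).mul_const (sigma hN τ))
  refine h1.congr_deriv ?_
  rw [bigA, mul_smul_comm, smul_mul_assoc, pow_succ]
  module

lemma differentiableAt_alpha {y : Fin (N - 2) → ℂ} {u : ℝ → ℂ} {s : ℝ}
    (hu : DifferentiableAt ℝ u s) (hy : ∀ j, u s - y j ≠ 0)
    (hα₀ : DifferentiableAt ℝ (fun r => α₀ (y, u r)) s) (k : ℕ) :
    DifferentiableAt ℝ (fun r => alpha hN τ κ α₀ (y, u r) k) s := by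
  induction k using Nat.strong_induction_on with
  | _ k ih =>
    cases k with
    | zero => simpa only [alpha] using hα₀
    | succ k =>
      simp only [alpha_succ]
      refine DifferentiableAt.const_mul (DifferentiableAt.fun_sum fun ij hij => ?_) _
      have hk := Finset.HasAntidiagonal.mem_antidiagonal.1 hij
      exact (ih ij.1 (by omega)).mul (hasDerivAt_bigB hN τ hu.hasDerivAt hy ij.2).differentiableAt

/-- The recursion holds along the whole curve near `s`, since `α₀` commutes with `σ` there, so both
sides may be differentiated. -/
lemma deriv_alpha_recursion (hκ : 2 * |κ| < 1) {y : Fin (N - 2) → ℂ} {u : ℝ → ℂ} {u' : ℂ} {s : ℝ}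
    (hu : HasDerivAt u u' s) (hy : ∀ j, u s - y j ≠ 0)
    (h0 : ∀ᶠ r in 𝓝 s, sigma hN τ * α₀ (y, u r) = α₀ (y, u r) * sigma hN τ)
    {α' : ℕ → Matrix (Fin n) (Fin n) ℂ}
    (hα' : ∀ k, HasDerivAt (fun r => alpha hN τ κ α₀ (y, u r) k) (α' k) s) (k : ℕ) :
    ((k + 1 : ℕ) : ℂ) • α' (k + 1)
        + (κ : ℂ) • (sigma hN τ * α' (k + 1) - α' (k + 1) * sigma hN τ)
      = (κ : ℂ) • ∑ ij ∈ Finset.HasAntidiagonal.antidiagonal k,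
        (α' ij.1 * bigB hN τ ij.2 (y, u s) + alpha hN τ κ α₀ (y, u s) ij.1 *
          ((u' * ((ij.2 + 1 : ℕ) : ℂ)) • bigA hN τ (ij.2 + 1) (y, u s))) := by
  have h1 := (((hα' (k + 1)).const_mul (sigma hN τ)).fun_sub
    ((hα' (k + 1)).mul_const (sigma hN τ))).fun_const_smul (κ : ℂ)
  have h2 := ((hα' (k + 1)).fun_const_smul ((k + 1 : ℕ) : ℂ)).fun_add h1
  have h3 : HasDerivAt (fun r => (κ : ℂ) • ∑ ij ∈ Finset.HasAntidiagonal.antidiagonal k,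
      alpha hN τ κ α₀ (y, u r) ij.1 * bigB hN τ ij.2 (y, u r)) _ s :=
    (HasDerivAt.fun_sum fun ij _ => (hα' ij.1).mul (hasDerivAt_bigB hN τ hu hy ij.2)).fun_const_smul
      (κ : ℂ)
  have h4 := h3.congr_of_eventuallyEq (h0.mono fun r hr => alpha_recursion hN τ hκ hr k)
  exact h2.unique h4

/-- Differentiability follows from the recursive definition. The value of the derivative is then
forced by the differentiated recursion and the compatibility identity, through the formal argument.
-/
lemma hasDerivAt_alpha (hκ : 2 * |κ| < 1) {y : Fin (N - 2) → ℂ} {u : ℝ → ℂ} {u' : ℂ} {s : ℝ}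
    (hu : HasDerivAt u u' s) (hy : ∀ j, u s - y j ≠ 0)
    (hα₀ : HasDerivAt (fun r => α₀ (y, u r)) ((u' * κ) • (α₀ (y, u s) * bigA hN τ 0 (y, u s))) s)
    (h0 : ∀ᶠ r in 𝓝 s, sigma hN τ * α₀ (y, u r) = α₀ (y, u r) * sigma hN τ) (k : ℕ) :
    HasDerivAt (fun r => alpha hN τ κ α₀ (y, u r) k)
      ((u' * κ) • ∑ ij ∈ Finset.HasAntidiagonal.antidiagonal k,
        alpha hN τ κ α₀ (y, u s) ij.1 * bigA hN τ ij.2 (y, u s)) s := by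
  have hda : ∀ k, HasDerivAt (fun r => alpha hN τ κ α₀ (y, u r) k)
      (deriv (fun r => alpha hN τ κ α₀ (y, u r) k) s) s := fun k =>
    (differentiableAt_alpha hN τ hu.differentiableAt hy hα₀.differentiableAt k).hasDerivAt
  have hz : ∀ r, alpha hN τ κ α₀ (y, u r) 0 = α₀ (y, u r) := fun r => by rw [alpha]
  have e0 : deriv (fun r => alpha hN τ κ α₀ (y, u r) 0) s
      = (u' * κ) • (alpha hN τ κ α₀ (y, u s) 0 * bigA hN τ 0 (y, u s)) := by
    simp only [hz]
    exact hα₀.deriv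
  have e1 : sigma hN τ * alpha hN τ κ α₀ (y, u s) 0 = alpha hN τ κ α₀ (y, u s) 0 * sigma hN τ := by
    simpa only [hz] using h0.self_of_nhds
  exact (hda k).congr_deriv (deriv_coeff_eq_of_recursion (σ := sigma hN τ) (c := u')
    (α := alpha hN τ κ α₀ (y, u s)) (α' := fun k => deriv (fun r => alpha hN τ κ α₀ (y, u r) k) s)
    (a := fun k => bigA hN τ k (y, u s)) (B := fun k => bigB hN τ k (y, u s))
    (norm_rep_le τ _) hκ e0
    (alpha_recursion hN τ hκ h0.self_of_nhds) e1 (deriv_alpha_recursion hN τ hκ hu hy h0 hda)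
    (sigma_mul_bigA_zero hN τ _) (fun k => sum_commutator_bigA_bigB hN τ k _) k)

end rep

end

end TorusDunkl

namespace TorusDunkl

noncomputable section

open scoped Matrix.Norms.L2Operator
open Set Filter Topology

variable {N n : ℕ}

section rep

variable (hN : 3 ≤ N) (τ : Equiv.Perm (Fin N) →* Matrix.orthogonalGroup (Fin n) ℝ)

/-! ### Summation of the series -/

/-- `∑_{j ≤ N-2} τ((j,i)) / (x - y_j)`. -/
def poleSum (i : Fin N) (y : Fin (N - 2) → ℂ) (x : ℂ) : Matrix (Fin n) (Fin n) ℂ :=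
  ∑ j : Fin (N - 2), (1 / (x - y j)) • rep τ (Equiv.swap (inIdx j) i)

lemma hasSum_pow_mul_pow {a z : ℂ} (h : ‖z‖ < ‖a‖) :
    HasSum (fun k : ℕ => z ^ k * (1 / a ^ (k + 1))) (1 / (a - z)) := by
  have ha : a ≠ 0 := norm_pos_iff.1 ((norm_nonneg z).trans_lt h)
  have haz : a - z ≠ 0 := fun e => by rw [sub_eq_zero.1 e] at h; exact lt_irrefl _ h
  have h1 := (hasSum_geometric_of_norm_lt_one (ξ := z / a)
    (by rwa [norm_div, div_lt_one ((norm_nonneg z).trans_lt h)])).mul_left (1 / a)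
  have e1 : 1 / a * (1 - z / a)⁻¹ = 1 / (a - z) := by
    rw [one_div, one_div, ← mul_inv, mul_sub, mul_one, mul_div_cancel₀ _ ha]
  rw [e1] at h1
  refine h1.congr_fun fun k => ?_
  rw [div_pow, pow_succ]
  field_simp

lemma hasSum_smul_sigma_beta_sigma {y : Fin (N - 2) → ℂ} {u z : ℂ} (h : ∀ j, ‖z‖ < ‖u - y j‖) :
    HasSum (fun k : ℕ => z ^ k • (sigma hN τ * beta hN τ k (y, u) * sigma hN τ))
      (poleSum τ (penIdx hN) y (u - z)) := by
  simp only [sigma_beta_sigma, Finset.smul_sum, smul_smul]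
  refine hasSum_sum fun j _ => HasSum.smul_const ?_ _
  rw [show u - z - y j = u - y j - z by ring]
  exact hasSum_pow_mul_pow (h j)

/-- The sign `(-1)^k` replaces `z` by `-z` in the geometric series and so produces the pole in `u +
z`. -/
lemma hasSum_smul_beta {y : Fin (N - 2) → ℂ} {u z : ℂ} (h : ∀ j, ‖z‖ < ‖u - y j‖) :
    HasSum (fun k : ℕ => z ^ k • ((-1 : ℂ) ^ k • beta hN τ k (y, u)))
      (poleSum τ (lstIdx hN) y (u + z)) := by
  simp only [beta, Finset.smul_sum, smul_smul]
  refine hasSum_sum fun j _ => HasSum.smul_const ?_ _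
  rw [show u + z - y j = u - y j - -z by ring]
  have h1 := hasSum_pow_mul_pow (a := u - y j) (z := -z) (by rw [norm_neg]; exact h j)
  refine h1.congr_fun ?_
  intro k
  rw [neg_pow]
  ring

lemma hasSum_smul_bigA {y : Fin (N - 2) → ℂ} {u z : ℂ} (h : ∀ j, ‖z‖ < ‖u - y j‖) :
    HasSum (fun k : ℕ => z ^ k • bigA hN τ k (y, u))
      (poleSum τ (lstIdx hN) y (u + z) + poleSum τ (penIdx hN) y (u - z)) := by
  simp only [bigA, smul_add]
  exact (hasSum_smul_beta hN τ h).add (hasSum_smul_sigma_beta_sigma hN τ h)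

lemma hasSum_smul_bigB {y : Fin (N - 2) → ℂ} {u z : ℂ} (h : ∀ j, ‖z‖ < ‖u - y j‖) :
    HasSum (fun k : ℕ => z ^ k • bigB hN τ k (y, u))
      (poleSum τ (lstIdx hN) y (u + z) - poleSum τ (penIdx hN) y (u - z)) := by
  simp only [bigB, smul_sub]
  exact (hasSum_smul_beta hN τ h).sub (hasSum_smul_sigma_beta_sigma hN τ h)

variable {κ : ℝ} {α₀ : (Fin (N - 2) → ℂ) × ℂ → Matrix (Fin n) (Fin n) ℂ}

lemma hasSum_smul_sum_antidiagonal {z : ℂ} {a b : ℕ → Matrix (Fin n) (Fin n) ℂ}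
    {a' b' : Matrix (Fin n) (Fin n) ℂ}
    (ha : HasSum (fun k => z ^ k • a k) a') (hb : HasSum (fun k => z ^ k • b k) b')
    (hsa : Summable fun k => ‖z ^ k • a k‖) (hsb : Summable fun k => ‖z ^ k • b k‖) :
    HasSum (fun k => z ^ k • ∑ ij ∈ Finset.HasAntidiagonal.antidiagonal k, a ij.1 * b ij.2)
      (a' * b') := by
  have e : ∀ k, z ^ k • ∑ ij ∈ Finset.HasAntidiagonal.antidiagonal k, a ij.1 * b ij.2
      = ∑ ij ∈ Finset.HasAntidiagonal.antidiagonal k, (z ^ ij.1 • a ij.1) * (z ^ ij.2 • b ij.2) := by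
    intro k
    rw [Finset.smul_sum]
    refine Finset.sum_congr rfl fun ij hij => ?_
    rw [← Finset.HasAntidiagonal.mem_antidiagonal.1 hij, smul_mul_assoc, mul_smul_comm, smul_smul,
      pow_add]
  simp only [e]
  have h1 := (summable_norm_sum_mul_antidiagonal_of_summable_norm hsa hsb).of_norm.hasSum
  rwa [← tsum_mul_tsum_eq_tsum_sum_antidiagonal_of_summable_norm hsa hsb, ha.tsum_eq,
    hb.tsum_eq] at h1

lemma norm_pow_smul_le {z : ℂ} {q d C : ℝ} (hd : 0 < d) (hz : ‖z‖ ≤ q * d)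
    {a : Matrix (Fin n) (Fin n) ℂ} {k : ℕ} (ha : ‖a‖ ≤ C * d⁻¹ ^ k) : ‖z ^ k • a‖ ≤ C * q ^ k := by
  have hC : 0 ≤ C := by
    by_contra! hC
    have h1 : 0 < d⁻¹ ^ k := by positivity
    have := (norm_nonneg a).trans ha
    nlinarith
  rw [norm_smul, norm_pow]
  have hqd : 0 ≤ q * d := (norm_nonneg z).trans hz
  calc ‖z‖ ^ k * ‖a‖ ≤ (q * d) ^ k * (C * d⁻¹ ^ k) := by gcongr
    _ = C * q ^ k * (d * d⁻¹) ^ k := by rw [mul_pow, mul_pow]; ring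
    _ = C * q ^ k := by rw [mul_inv_cancel₀ hd.ne', one_pow, mul_one]

lemma norm_pow_smul_alpha_le (hκ : 4 * (N * |κ|) ≤ 1) {y : Fin (N - 2) → ℂ} {u z : ℂ} {d q : ℝ}
    (hd : 0 < d) (h : ∀ j, d ≤ ‖u - y j‖) (hz : ‖z‖ ≤ q * d)
    (h0 : sigma hN τ * α₀ (y, u) = α₀ (y, u) * sigma hN τ) (k : ℕ) :
    ‖z ^ k • alpha hN τ κ α₀ (y, u) k‖ ≤ ‖α₀ (y, u)‖ * q ^ k :=
  norm_pow_smul_le hd hz (norm_alpha_le hN τ hκ hd h h0 k)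

/-- The sum `∑ α_k(x(u,0)) z^k`. -/
def alphaSum (κ : ℝ) (α₀ : (Fin (N - 2) → ℂ) × ℂ → Matrix (Fin n) (Fin n) ℂ)
    (y : Fin (N - 2) → ℂ) (u z : ℂ) : Matrix (Fin n) (Fin n) ℂ :=
  ∑' k : ℕ, z ^ k • alpha hN τ κ α₀ (y, u) k

lemma summable_norm_alpha (hκ : 4 * (N * |κ|) ≤ 1) {y : Fin (N - 2) → ℂ} {u z : ℂ} {d q : ℝ}
    (hd : 0 < d) (hq0 : 0 ≤ q) (hq : q < 1) (h : ∀ j, d ≤ ‖u - y j‖) (hz : ‖z‖ ≤ q * d)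
    (h0 : sigma hN τ * α₀ (y, u) = α₀ (y, u) * sigma hN τ) :
    Summable fun k => ‖z ^ k • alpha hN τ κ α₀ (y, u) k‖ :=
  Summable.of_nonneg_of_le (fun _ => norm_nonneg _)
    (norm_pow_smul_alpha_le hN τ hκ hd h hz h0)
    ((summable_geometric_of_lt_one hq0 hq).mul_left _)

lemma summable_norm_of_norm_le {a : ℕ → Matrix (Fin n) (Fin n) ℂ} {z : ℂ} {d q C : ℝ}
    (hd : 0 < d) (hq0 : 0 ≤ q) (hq : q < 1) (hz : ‖z‖ ≤ q * d)
    (ha : ∀ k, ‖a k‖ ≤ C * d⁻¹ ^ (k + 1)) : Summable fun k => ‖z ^ k • a k‖ := by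
  refine Summable.of_nonneg_of_le (fun _ => norm_nonneg _) (fun k => norm_pow_smul_le
    (C := C * d⁻¹) hd hz ((ha k).trans (le_of_eq ?_)))
    ((summable_geometric_of_lt_one hq0 hq).mul_left (C * d⁻¹))
  rw [pow_succ]
  ring

lemma hasSum_smul_sum_alpha_bigA (hκ : 4 * (N * |κ|) ≤ 1) {y : Fin (N - 2) → ℂ} {u z : ℂ}
    {d q : ℝ} (hd : 0 < d) (hq0 : 0 ≤ q) (hq : q < 1) (h : ∀ j, d ≤ ‖u - y j‖) (hz : ‖z‖ ≤ q * d)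
    (h0 : sigma hN τ * α₀ (y, u) = α₀ (y, u) * sigma hN τ) :
    HasSum (fun k => z ^ k • ∑ ij ∈ Finset.HasAntidiagonal.antidiagonal k,
        alpha hN τ κ α₀ (y, u) ij.1 * bigA hN τ ij.2 (y, u))
      (alphaSum hN τ κ α₀ y u z
        * (poleSum τ (lstIdx hN) y (u + z) + poleSum τ (penIdx hN) y (u - z))) := by
  have hs := summable_norm_alpha hN τ hκ hd hq0 hq h hz h0
  have hlt : ∀ j, ‖z‖ < ‖u - y j‖ := fun j => by nlinarith [h j]
  exact hasSum_smul_sum_antidiagonal (a := alpha hN τ κ α₀ (y, u))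
    (b := fun k => bigA hN τ k (y, u)) hs.of_norm.hasSum (hasSum_smul_bigA hN τ hlt) hs
    (summable_norm_of_norm_le hd hq0 hq hz (norm_bigA_le hN τ (p := (y, u)) hd h))

/-- The recursion multiplied by `z^(k+1)` and summed: this is the equation for `z ∂/∂z` of the
series. The term of index zero drops out because `α₀` commutes with `σ`. -/
lemma hasSum_natCast_mul_pow_smul_alpha (hκ : 4 * (N * |κ|) ≤ 1) {y : Fin (N - 2) → ℂ} {u z : ℂ}
    {d q : ℝ} (hd : 0 < d) (hq0 : 0 ≤ q) (hq : q < 1) (h : ∀ j, d ≤ ‖u - y j‖) (hz : ‖z‖ ≤ q * d)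
    (h0 : sigma hN τ * α₀ (y, u) = α₀ (y, u) * sigma hN τ) :
    HasSum (fun k : ℕ => ((k : ℂ) * z ^ k) • alpha hN τ κ α₀ (y, u) k)
      ((κ * z) • (alphaSum hN τ κ α₀ y u z
        * (poleSum τ (lstIdx hN) y (u + z) - poleSum τ (penIdx hN) y (u - z)))
      - (κ : ℂ) • (sigma hN τ * alphaSum hN τ κ α₀ y u z
        - alphaSum hN τ κ α₀ y u z * sigma hN τ)) := by
  have hN' : (3 : ℝ) ≤ N := by exact_mod_cast hN
  have hκ3 : 3 * |κ| ≤ N * |κ| := mul_le_mul_of_nonneg_right hN' (abs_nonneg κ)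
  have hκ2 : 2 * |κ| < 1 := by linarith [abs_nonneg κ]
  have hs := summable_norm_alpha hN τ hκ hd hq0 hq h hz h0
  have hlt : ∀ j, ‖z‖ < ‖u - y j‖ := fun j => by nlinarith [h j]
  have hΨ : HasSum (fun k => z ^ k • alpha hN τ κ α₀ (y, u) k) (alphaSum hN τ κ α₀ y u z) :=
    hs.of_norm.hasSum
  have h1 := (hasSum_smul_sum_antidiagonal (a := alpha hN τ κ α₀ (y, u))
    (b := fun k => bigB hN τ k (y, u)) hΨ (hasSum_smul_bigB hN τ hlt) hs
    (summable_norm_of_norm_le hd hq0 hq hz (norm_bigB_le hN τ (p := (y, u)) hd h))).const_smul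
      ((κ : ℂ) * z)
  have h2 := ((hΨ.mul_left (sigma hN τ)).sub (hΨ.mul_right (sigma hN τ))).const_smul (κ : ℂ)
  have h3 := (hasSum_nat_add_iff' 1).2 h2
  rw [Finset.sum_range_one] at h3
  have e0 : sigma hN τ * (z ^ 0 • alpha hN τ κ α₀ (y, u) 0)
      - z ^ 0 • alpha hN τ κ α₀ (y, u) 0 * sigma hN τ = 0 := by
    rw [pow_zero, one_smul, alpha, h0, sub_self]
  rw [e0, smul_zero, sub_zero] at h3
  have h4 := h1.sub h3
  rw [← hasSum_nat_add_iff' 1, Finset.sum_range_one]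
  simp only [Nat.cast_zero, zero_mul, zero_smul, sub_zero]
  refine h4.congr_fun fun k => ?_
  have h5 := congrArg (fun M => z ^ (k + 1) • M) (alpha_recursion hN τ hκ2 h0 k)
  simp only [smul_add, mul_smul_comm, smul_mul_assoc, ← smul_sub] at h5 ⊢
  rw [mul_comm, mul_smul, eq_sub_of_add_eq h5, smul_comm (z ^ (k + 1)) (κ : ℂ),
    smul_comm (z ^ (k + 1)) (κ : ℂ), pow_succ', mul_smul, mul_smul, mul_smul (κ : ℂ) z]

/-- The derivative of `∑ α_k(x(u,0)) z^k` along a curve. -/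
lemma hasDerivAt_alphaSum (hκ : 4 * (N * |κ|) ≤ 1) {y : Fin (N - 2) → ℂ} {u z u' z' : ℝ → ℂ}
    {I : Set ℝ} (hI : IsOpen I) (hI' : IsPreconnected I) {q d₀ A : ℝ} (hq0 : 0 < q) (hq : q < 1)
    (hd₀ : 0 < d₀) (hu : ∀ s ∈ I, HasDerivAt u (u' s) s) (hz : ∀ s ∈ I, HasDerivAt z (z' s) s)
    (hu' : ∀ s ∈ I, ‖u' s‖ ≤ 1) (hz' : ∀ s ∈ I, ‖z' s‖ ≤ 1) (hz0 : ∀ s ∈ I, z s ≠ 0)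
    (hd : ∀ s ∈ I, ∃ d, d₀ ≤ d ∧ (∀ j, d ≤ ‖u s - y j‖) ∧ ‖z s‖ ≤ q * d)
    (hA : ∀ s ∈ I, ‖α₀ (y, u s)‖ ≤ A)
    (hα₀ : ∀ s ∈ I, HasDerivAt (fun r => α₀ (y, u r))
      ((u' s * κ) • (α₀ (y, u s) * bigA hN τ 0 (y, u s))) s)
    (h0 : ∀ s ∈ I, sigma hN τ * α₀ (y, u s) = α₀ (y, u s) * sigma hN τ) {s : ℝ} (hs : s ∈ I) :
    HasDerivAt (fun r => alphaSum hN τ κ α₀ y (u r) (z r))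
      ((κ : ℂ) • (alphaSum hN τ κ α₀ y (u s) (z s)
          * ((u' s + z' s) • poleSum τ (lstIdx hN) y (u s + z s)
            + (u' s - z' s) • poleSum τ (penIdx hN) y (u s - z s)))
        - (κ * (z' s / z s)) • (sigma hN τ * alphaSum hN τ κ α₀ y (u s) (z s)
            - alphaSum hN τ κ α₀ y (u s) (z s) * sigma hN τ)) s := by
  have hN' : (3 : ℝ) ≤ N := by exact_mod_cast hN
  have hκ3 : 3 * |κ| ≤ N * |κ| := mul_le_mul_of_nonneg_right hN' (abs_nonneg κ)
  have hκ2 : 2 * |κ| < 1 := by linarith [abs_nonneg κ]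
  set g' : ℕ → ℝ → Matrix (Fin n) (Fin n) ℂ := fun k s =>
    z s ^ k • ((u' s * κ) • ∑ ij ∈ Finset.HasAntidiagonal.antidiagonal k,
        alpha hN τ κ α₀ (y, u s) ij.1 * bigA hN τ ij.2 (y, u s))
      + (k * z s ^ (k - 1) * z' s) • alpha hN τ κ α₀ (y, u s) k with hg'
  have hder : ∀ k, ∀ s ∈ I, HasDerivAt (fun r => z r ^ k • alpha hN τ κ α₀ (y, u r) k)
      (g' k s) s := by
    intro k s hs
    obtain ⟨d, hd1, hd2, hd3⟩ := hd s hs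
    have hy : ∀ j, u s - y j ≠ 0 := fun j =>
      norm_pos_iff.1 (hd₀.trans_le (hd1.trans (hd2 j)))
    exact ((hz s hs).fun_pow k).fun_smul (hasDerivAt_alpha hN τ hκ2 (hu s hs) hy (hα₀ s hs)
      (Filter.mem_of_superset (hI.mem_nhds hs) h0) k)
  -- One factor `d⁻¹` is left over after the powers of `z` have been estimated by `q d`. It is at
  -- most `d₀⁻¹`, so the majorant `(k+1) q^k` is uniform on `I` and the series may be differentiated
  -- termwise.
  have hbound : ∀ k, ∀ s ∈ I, ‖g' k s‖ ≤ A * (1 / (d₀ * q) + 1 / d₀) * ((k + 1 : ℕ) * q ^ k) := by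
    intro k s hs
    obtain ⟨d, hd1, hd2, hd3⟩ := hd s hs
    have hd0 := hd₀.trans_le hd1
    have hα := norm_alpha_le hN τ hκ (p := (y, u s)) hd0 hd2 (h0 s hs)
    have hA' := hA s hs
    have hA0 : 0 ≤ A := (norm_nonneg _).trans hA'
    have hdd : d⁻¹ ≤ d₀⁻¹ := by gcongr
    have b1 : ‖z s ^ k • ((u' s * κ) • ∑ ij ∈ Finset.HasAntidiagonal.antidiagonal k,
        alpha hN τ κ α₀ (y, u s) ij.1 * bigA hN τ ij.2 (y, u s))‖
        ≤ (k + 1 : ℕ) * (A * d₀⁻¹) * q ^ k := by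
      refine norm_pow_smul_le hd0 hd3 ?_
      rw [norm_smul, norm_mul, Complex.norm_real, Real.norm_eq_abs]
      have b2 : ‖∑ ij ∈ Finset.HasAntidiagonal.antidiagonal k,
          alpha hN τ κ α₀ (y, u s) ij.1 * bigA hN τ ij.2 (y, u s)‖
          ≤ (k + 1 : ℕ) * (2 * N * (A * d₀⁻¹ * d⁻¹ ^ k)) := by
        refine (norm_sum_le_of_le _ (fun ij hij =>
          (?_ : _ ≤ 2 * N * (A * d₀⁻¹ * d⁻¹ ^ k)))).trans ?_
        · refine (norm_mul_le _ _).trans ((mul_le_mul (hα ij.1)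
            (norm_bigA_le hN τ hd0 hd2 ij.2) (norm_nonneg _) (by positivity)).trans ?_)
          calc ‖α₀ (y, u s)‖ * d⁻¹ ^ ij.1 * (2 * N * d⁻¹ ^ (ij.2 + 1))
              = 2 * N * (‖α₀ (y, u s)‖ * d⁻¹ * d⁻¹ ^ (ij.1 + ij.2)) := by ring
            _ ≤ 2 * N * (A * d₀⁻¹ * d⁻¹ ^ (ij.1 + ij.2)) := by gcongr
            _ = _ := by rw [Finset.HasAntidiagonal.mem_antidiagonal.1 hij]
        · rw [Finset.sum_const, nsmul_eq_mul, Finset.Nat.card_antidiagonal]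
      calc ‖u' s‖ * |κ| * ‖∑ ij ∈ Finset.HasAntidiagonal.antidiagonal k,
          alpha hN τ κ α₀ (y, u s) ij.1 * bigA hN τ ij.2 (y, u s)‖
          ≤ 1 * |κ| * ((k + 1 : ℕ) * (2 * N * (A * d₀⁻¹ * d⁻¹ ^ k))) := by
            gcongr
            exact hu' s hs
        _ = (2 * (N * |κ|)) * ((k + 1 : ℕ) * (A * d₀⁻¹) * d⁻¹ ^ k) := by ring
        _ ≤ 1 * ((k + 1 : ℕ) * (A * d₀⁻¹) * d⁻¹ ^ k) := by
            gcongr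
            linarith
        _ = _ := one_mul _
    have b3 : ‖(k * z s ^ (k - 1) * z' s) • alpha hN τ κ α₀ (y, u s) k‖
        ≤ (k + 1 : ℕ) * (A * (1 / (d₀ * q))) * q ^ k := by
      cases k with
      | zero =>
        rw [Nat.cast_zero, zero_mul, zero_mul, zero_smul, norm_zero]
        positivity
      | succ k =>
        have b4 : ‖z s ^ k • alpha hN τ κ α₀ (y, u s) (k + 1)‖ ≤ (A * d₀⁻¹) * q ^ k := by
          refine norm_pow_smul_le hd0 hd3 ((hα (k + 1)).trans ?_)
          calc ‖α₀ (y, u s)‖ * d⁻¹ ^ (k + 1) = ‖α₀ (y, u s)‖ * d⁻¹ * d⁻¹ ^ k := by ring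
            _ ≤ A * d₀⁻¹ * d⁻¹ ^ k := by gcongr
        rw [Nat.add_sub_cancel, mul_comm, mul_smul, mul_smul, norm_smul, norm_smul,
          Complex.norm_natCast]
        calc ‖z' s‖ * ((k + 1 : ℕ) * ‖z s ^ k • alpha hN τ κ α₀ (y, u s) (k + 1)‖)
            ≤ 1 * ((k + 1 + 1 : ℕ) * ((A * d₀⁻¹) * q ^ k)) := by
              gcongr
              · exact hz' s hs
              · omega
          _ = _ := by
              rw [pow_succ]
              field_simp
    refine (norm_add_le _ _).trans ((add_le_add b1 b3).trans (le_of_eq ?_))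
    rw [one_div d₀]
    ring
  have hsum : Summable fun k : ℕ => A * (1 / (d₀ * q) + 1 / d₀) * ((k + 1 : ℕ) * q ^ k) := by
    refine Summable.mul_left _ ?_
    have h1 := summable_pow_mul_geometric_of_norm_lt_one 1 (r := q)
      (by rwa [Real.norm_of_nonneg hq0.le])
    refine (h1.add (summable_geometric_of_lt_one hq0.le hq)).congr fun k => ?_
    push_cast
    ring
  obtain ⟨d, hd1, hd2, hd3⟩ := hd s hs
  have hd0 := hd₀.trans_le hd1
  have hmain := hasDerivAt_tsum_of_isPreconnected hsum hI hI' hder hbound hs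
    (summable_norm_alpha hN τ hκ hd0 hq0.le hq hd2 hd3 (h0 s hs)).of_norm hs
  refine hmain.congr_deriv ?_
  -- `t1` sums the contribution of the `u`-derivative and `t2` that of the `z`-derivative. The
  -- latter is known for `z ∂/∂z`, whence the factor `z'/z`.
  have t1 := (hasSum_smul_sum_alpha_bigA hN τ hκ hd0 hq0.le hq hd2 hd3 (h0 s hs)).const_smul
    (u' s * κ)
  have t2 := (hasSum_natCast_mul_pow_smul_alpha hN τ hκ hd0 hq0.le hq hd2 hd3
    (h0 s hs)).const_smul (z' s / z s)
  have t3 := t1.add t2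
  have t4 : HasSum (fun k => g' k s) _ := t3.congr_fun fun k => by
    have hzs := hz0 s hs
    simp only [hg', smul_smul]
    congr 2
    · ring
    · cases k with
      | zero => simp
      | succ k =>
        rw [Nat.add_sub_cancel, pow_succ]
        field_simp
  rw [t4.tsum_eq]
  have hzs := hz0 s hs
  have e : z' s / z s * (κ * z s) = z' s * κ := by field_simp
  rw [smul_sub, smul_smul, e, smul_smul]
  simp only [mul_add, mul_sub, mul_smul_comm]
  module

end rep

end

end TorusDunkl

namespace TorusDunkl

noncomputable section

open scoped Matrix.Norms.L2Operator
open Set Filter Topology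

variable {N n : ℕ}

/-! ### The coefficient matrix in the direction across the wall -/

lemma erase_eq_insert_image (hN : 3 ≤ N) {a b : Fin N}
    (h : (a = lstIdx hN ∧ b = penIdx hN) ∨ (a = penIdx hN ∧ b = lstIdx hN)) :
    (Finset.univ.erase a : Finset (Fin N)) = insert b (Finset.univ.image inIdx) := by
  ext i
  simp only [Finset.mem_erase, Finset.mem_univ, and_true, Finset.mem_insert, Finset.mem_image,
    true_and]
  constructor
  · intro hi
    by_cases hib : i = b
    · exact Or.inl hib
    · right
      refine ⟨⟨i, ?_⟩, rfl⟩
      have h1 := i.2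
      have h2 : (lstIdx hN : ℕ) = N - 1 := rfl
      have h3 : (penIdx hN : ℕ) = N - 2 := rfl
      rw [ne_eq, Fin.ext_iff] at hi
      rw [Fin.ext_iff] at hib
      rcases h with ⟨rfl, rfl⟩ | ⟨rfl, rfl⟩ <;> omega
  · rintro (rfl | ⟨j, rfl⟩)
    · rcases h with ⟨rfl, rfl⟩ | ⟨rfl, rfl⟩
      · exact (penIdx_lt_lstIdx hN).ne
      · exact (penIdx_lt_lstIdx hN).ne'
    · rcases h with ⟨rfl, rfl⟩ | ⟨rfl, rfl⟩
      · exact inIdx_ne_lst hN j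
      · exact inIdx_ne_pen hN j

lemma sum_erase_eq (hN : 3 ≤ N) {E : Type*} [AddCommMonoid E] (f : Fin N → E) {a b : Fin N}
    (h : (a = lstIdx hN ∧ b = penIdx hN) ∨ (a = penIdx hN ∧ b = lstIdx hN)) :
    ∑ j ∈ Finset.univ.erase a, f j = f b + ∑ j : Fin (N - 2), f (inIdx j) := by
  rw [erase_eq_insert_image hN h, Finset.sum_insert, Finset.sum_image]
  · exact inIdx_injective.injOn
  · simp only [Finset.mem_image, Finset.mem_univ, true_and, not_exists]
    intro j
    rcases h with ⟨_, rfl⟩ | ⟨_, rfl⟩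
    · exact inIdx_ne_pen hN j
    · exact inIdx_ne_lst hN j

lemma sum_wallDir_smul (hN : 3 ≤ N) {E : Type*} [AddCommGroup E] [Module ℂ E] (f : Fin N → E) :
    ∑ i, (wallDir hN i : ℂ) • f i = f (lstIdx hN) - f (penIdx hN) := by
  have h1 := Finset.add_sum_erase Finset.univ (fun i => (wallDir hN i : ℂ) • f i)
    (Finset.mem_univ (lstIdx hN))
  rw [← h1, sum_erase_eq hN _ (Or.inl ⟨rfl, rfl⟩), Finset.sum_eq_zero]
  · simp [sub_eq_add_neg]
  · intro j _
    rw [wallDir_of_lt (by have := j.2; simp only [Fin.lt_def, inIdx, penIdx]; omega)]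
    simp

section rep

variable (hN : 3 ≤ N) (τ : Equiv.Perm (Fin N) →* Matrix.orthogonalGroup (Fin n) ℝ)

/-- Only the rows of the last two indices occur. Taking the term of the wall pair out of both rows
leaves the pole sums and combines the two singular terms into one multiple of `σ`. -/
lemma angleCoeff_wallDir {θ : Fin N → ℝ} (hθ : Function.Injective (expPoint θ)) :
    angleCoeff τ θ (wallDir hN)
      = (Complex.I * expPoint θ (lstIdx hN)) •
          poleSum τ (lstIdx hN) (fun j => expPoint θ (inIdx j)) (expPoint θ (lstIdx hN))
        + (-(Complex.I * expPoint θ (penIdx hN))) •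
          poleSum τ (penIdx hN) (fun j => expPoint θ (inIdx j)) (expPoint θ (penIdx hN))
        + (Complex.I * (expPoint θ (lstIdx hN) + expPoint θ (penIdx hN))
            / (expPoint θ (lstIdx hN) - expPoint θ (penIdx hN))) • sigma hN τ := by
  have key : ∀ a b : Fin N, ((a = lstIdx hN ∧ b = penIdx hN) ∨ (a = penIdx hN ∧ b = lstIdx hN)) →
      (∑ j ∈ Finset.univ.erase a,
        ((halfCot (θ a - θ j) : ℂ) + Complex.I / 2) • rep τ (Equiv.swap a j))
      = (Complex.I * expPoint θ a / (expPoint θ a - expPoint θ b)) • sigma hN τ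
        + (Complex.I * expPoint θ a) •
          poleSum τ a (fun j => expPoint θ (inIdx j)) (expPoint θ a) := by
    intro a b hab
    have h1 : ∀ j ∈ Finset.univ.erase a,
        ((halfCot (θ a - θ j) : ℂ) + Complex.I / 2) • rep τ (Equiv.swap a j)
        = (Complex.I * expPoint θ a / (expPoint θ a - expPoint θ j)) •
            rep τ (Equiv.swap a j) := by
      intro j hj
      have hne : expPoint θ a ≠ expPoint θ j := fun e => (Finset.ne_of_mem_erase hj) (hθ e).symm
      rw [← I_mul_exp_div (a := θ a) (b := θ j) hne, mul_div_assoc]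
      rfl
    rw [Finset.sum_congr rfl h1, sum_erase_eq hN _ hab, poleSum, Finset.smul_sum]
    congr 1
    · congr 1
      rcases hab with ⟨rfl, rfl⟩ | ⟨rfl, rfl⟩
      · rw [Equiv.swap_comm, sigma]
      · rw [sigma]
    · refine Finset.sum_congr rfl fun j _ => ?_
      rw [smul_smul, Equiv.swap_comm, mul_one_div]
  rw [angleCoeff_eq, sum_wallDir_smul, key _ _ (Or.inl ⟨rfl, rfl⟩), key _ _ (Or.inr ⟨rfl, rfl⟩)]
  have e : Complex.I * (expPoint θ (lstIdx hN) + expPoint θ (penIdx hN))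
            / (expPoint θ (lstIdx hN) - expPoint θ (penIdx hN))
      = Complex.I * expPoint θ (lstIdx hN) / (expPoint θ (lstIdx hN) - expPoint θ (penIdx hN))
        - Complex.I * expPoint θ (penIdx hN)
          / (expPoint θ (penIdx hN) - expPoint θ (lstIdx hN)) := by
    rw [← neg_sub (expPoint θ (lstIdx hN)), div_neg, sub_neg_eq_add, ← add_div, mul_add]
  rw [e]
  module

end rep

/-! ### The arc from the wall to the base point -/

/-- The angle `(2N - 3) π / N` of the midpoint of the last two coordinates of `x₀`. -/
def midAngle (N : ℕ) : ℝ := (2 * N - 3) * Real.pi / N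

/-- The angles of the wall point from which `x₀` is reached in the direction `wallDir`. -/
def wallBase (N : ℕ) : Fin N → ℝ := fun i =>
  if (i : ℕ) < N - 2 then baseAngles N i else midAngle N

/-- The arc from the wall to `x₀`, in angles. -/
def arc (hN : 3 ≤ N) (s : ℝ) : Fin N → ℝ := wallBase N + s • wallDir hN

lemma wallBase_lst (hN : 3 ≤ N) : wallBase N (lstIdx hN) = midAngle N := by
  have : ¬ N - 1 < N - 2 := by omega
  simp [wallBase, lstIdx, this]

lemma wallBase_pen (hN : 3 ≤ N) : wallBase N (penIdx hN) = midAngle N := by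
  simp [wallBase, penIdx]

lemma wallBase_of_lt {hN : 3 ≤ N} {i : Fin N} (h : i < penIdx hN) :
    wallBase N i = baseAngles N i :=
  if_pos h

lemma arc_lst (hN : 3 ≤ N) (s : ℝ) : arc hN s (lstIdx hN) = midAngle N + s := by
  simp [arc, wallBase_lst]

lemma arc_pen (hN : 3 ≤ N) (s : ℝ) : arc hN s (penIdx hN) = midAngle N - s := by
  simp [arc, wallBase_pen, sub_eq_add_neg]

lemma inIdx_lt_penIdx (hN : 3 ≤ N) (j : Fin (N - 2)) : inIdx j < penIdx hN := j.2

lemma arc_inIdx (hN : 3 ≤ N) (s : ℝ) (j : Fin (N - 2)) :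
    arc hN s (inIdx j) = baseAngles N (inIdx j) := by
  simp [arc, wallBase_of_lt (inIdx_lt_penIdx hN j), wallDir_of_lt (inIdx_lt_penIdx hN j)]

lemma baseAngles_sub (i j : Fin N) :
    baseAngles N j - baseAngles N i = 2 * Real.pi / N * (((j : ℕ) : ℝ) - ((i : ℕ) : ℝ)) := by
  simp only [baseAngles]; ring

lemma natCast_pen (hN : 3 ≤ N) : ((penIdx hN : ℕ) : ℝ) = N - 2 := by
  simp [penIdx, Nat.cast_sub (by omega : 2 ≤ N)]

lemma midAngle_sub (i : Fin N) :
    midAngle N - baseAngles N i = Real.pi / N * (2 * N - 3 - 2 * ((i : ℕ) : ℝ)) := by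
  simp only [baseAngles, midAngle]; ring

lemma midAngle_sub_mem {hN : 3 ≤ N} {i : Fin N} (h : i < penIdx hN) :
    3 * (Real.pi / N) ≤ midAngle N - baseAngles N i ∧
      midAngle N - baseAngles N i ≤ 2 * Real.pi - 3 * (Real.pi / N) := by
  have hN0 : (0 : ℝ) < N := by exact_mod_cast (by omega : 0 < N)
  have hπ : 0 < Real.pi / N := div_pos Real.pi_pos hN0
  have e : 2 * Real.pi = Real.pi / N * (2 * N) := by field_simp
  have h1 : ((i : ℕ) : ℝ) + 1 ≤ N - 2 := by
    rw [← natCast_pen hN]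
    exact_mod_cast h
  have h2 := Nat.cast_nonneg (α := ℝ) (i : ℕ)
  rw [midAngle_sub, e]
  constructor <;> nlinarith

lemma isWallPoint_wallBase (hN : 3 ≤ N) {d s : ℝ} (hd : d ≤ 3 * (Real.pi / N))
    (hs : s ≤ 2 * (Real.pi / N)) : IsWallPoint hN d s (wallBase N) where
  eq := by rw [wallBase_pen, wallBase_lst]
  sep i hi := by
    rw [wallBase_lst, wallBase_of_lt hi]
    have := midAngle_sub_mem hi
    constructor <;> linarith
  rest i j hij hj := by
    have hN0 : (0 : ℝ) < N := by exact_mod_cast (by omega : 0 < N)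
    have hπ : 0 < Real.pi / N := div_pos Real.pi_pos hN0
    have e : 2 * Real.pi = Real.pi / N * (2 * N) := by field_simp
    rw [wallBase_of_lt hj, wallBase_of_lt (hij.trans hj), baseAngles_sub]
    have h1 : ((j : ℕ) : ℝ) + 1 ≤ N - 2 := by
      rw [← natCast_pen hN]
      exact_mod_cast hj
    have h2 : ((i : ℕ) : ℝ) + 1 ≤ ((j : ℕ) : ℝ) := by exact_mod_cast hij
    have h3 := Nat.cast_nonneg (α := ℝ) (i : ℕ)
    have e2 : 2 * Real.pi / N = 2 * (Real.pi / N) := by ring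
    rw [e2, e]
    constructor <;> nlinarith

lemma pi_div_pos (hN : 3 ≤ N) : 0 < Real.pi / N :=
  div_pos Real.pi_pos (by exact_mod_cast (by omega : 0 < N))

lemma pi_div_le (hN : 3 ≤ N) : Real.pi / N ≤ Real.pi / 3 := by
  have : (3 : ℝ) ≤ N := by exact_mod_cast hN
  have := Real.pi_pos
  gcongr

lemma arc_mem_angleChamber (hN : 3 ≤ N) {s : ℝ} (h0 : 0 < s) (h1 : s ≤ Real.pi / N) :
    arc hN s ∈ angleChamber hN := by
  have hπ := pi_div_pos hN
  have hπ3 := pi_div_le hN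
  have hw := isWallPoint_wallBase hN le_rfl le_rfl
  rw [angleChamber_iff]
  intro i j hij
  rcases lt_cases hN hij with h | ⟨hi, hj⟩ | ⟨rfl, rfl⟩
  · have := hw.rest i j hij h
    simp only [arc, Pi.add_apply, Pi.smul_apply, wallDir_of_lt h, wallDir_of_lt (hij.trans h),
      smul_zero, add_zero]
    constructor <;> linarith
  · have h3 := hw.sep i hi
    rw [wallBase_lst] at h3
    have h4 : arc hN s i = wallBase N i := by simp [arc, wallDir_of_lt hi]
    rw [h4]
    rcases hj with rfl | rfl
    · rw [arc_pen]; constructor <;> linarith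
    · rw [arc_lst]; constructor <;> linarith
  · rw [arc_pen, arc_lst]
    constructor <;> linarith [Real.pi_pos]

lemma arc_end (hN : 3 ≤ N) : arc hN (Real.pi / N) = baseAngles N := by
  have hN0 : (N : ℝ) ≠ 0 := by exact_mod_cast (by omega : N ≠ 0)
  ext i
  rcases lt_trichotomy i (penIdx hN) with h | rfl | h
  · simp [arc, wallBase_of_lt h, wallDir_of_lt h]
  · rw [arc_pen, baseAngles, natCast_pen, midAngle]
    field_simp
    ring
  · have : i = lstIdx hN := by
      have := i.2
      simp only [Fin.lt_def, penIdx, Fin.ext_iff, lstIdx] at *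
      omega
    subst this
    have h1 : ((lstIdx hN : ℕ) : ℝ) = N - 1 := by
      simp [lstIdx, Nat.cast_sub (by omega : 1 ≤ N)]
    rw [arc_lst, baseAngles, h1, midAngle]
    field_simp
    ring

/-- The coordinate `u` along the arc. -/
def arcU (N : ℕ) (s : ℝ) : ℂ := Complex.exp (midAngle N * Complex.I) * Real.cos s

/-- The coordinate `z` along the arc. -/
def arcZ (N : ℕ) (s : ℝ) : ℂ := Real.sin s * (Complex.I * Complex.exp (midAngle N * Complex.I))

lemma expPoint_arc_lst (hN : 3 ≤ N) (s : ℝ) :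
    expPoint (arc hN s) (lstIdx hN) = arcU N s + arcZ N s := by
  rw [expPoint, arc_lst, arcU, arcZ]
  push_cast
  rw [add_mul, Complex.exp_add, Complex.exp_mul_I (s : ℂ)]
  ring

lemma expPoint_arc_pen (hN : 3 ≤ N) (s : ℝ) :
    expPoint (arc hN s) (penIdx hN) = arcU N s - arcZ N s := by
  rw [expPoint, arc_pen, arcU, arcZ]
  push_cast
  rw [sub_mul, sub_eq_add_neg, Complex.exp_add, ← neg_mul, Complex.exp_mul_I (-(s : ℂ)),
    Complex.cos_neg, Complex.sin_neg]
  ring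

lemma expPoint_arc_inIdx (hN : 3 ≤ N) (s : ℝ) :
    (fun j => expPoint (arc hN s) (inIdx j)) = faceY N := by
  ext j
  simp only [expPoint, arc_inIdx]
  exact congrFun (expPoint_baseAngles (N := N)) (inIdx j)

lemma uCoord_arc (hN : 3 ≤ N) (s : ℝ) : uCoord hN (expPoint (arc hN s)) = arcU N s := by
  rw [uCoord, expPoint_arc_lst, expPoint_arc_pen]; ring

lemma zCoord_arc (hN : 3 ≤ N) (s : ℝ) : zCoord hN (expPoint (arc hN s)) = arcZ N s := by
  rw [zCoord, expPoint_arc_lst, expPoint_arc_pen]; ring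

lemma prod_expPoint_arc (hN : 3 ≤ N) (s : ℝ) :
    ∏ j, expPoint (arc hN s) j = ∏ j, expPoint (wallBase N) j := by
  simp only [expPoint, ← Complex.exp_sum, ← Finset.sum_mul]
  have : ∑ i, (arc hN s i : ℂ) = ∑ i, (wallBase N i : ℂ) := by
    have h := sum_wallDir_smul hN (fun _ : Fin N => (s : ℂ))
    simp only [smul_eq_mul, sub_self] at h
    simp only [arc, Pi.add_apply, Pi.smul_apply, smul_eq_mul, Complex.ofReal_add,
      Complex.ofReal_mul, Finset.sum_add_distrib, mul_comm (s : ℂ), h, add_zero]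
  rw [this]

lemma arcU_zero (hN : 3 ≤ N) : arcU N 0 = faceU N := by
  have hN0 : (N : ℂ) ≠ 0 := by exact_mod_cast (by omega : N ≠ 0)
  rw [arcU, Real.cos_zero, Complex.ofReal_one, mul_one, faceU, omegaPow,
    ← Complex.exp_periodic (2 * Real.pi * (-3 / 2 : ℝ) / N * Complex.I)]
  congr 1
  rw [midAngle]
  push_cast
  field_simp
  ring

lemma arcU_end (hN : 3 ≤ N) : arcU N (Real.pi / N) = uCoord hN (basePoint N) := by
  rw [← expPoint_baseAngles, ← arc_end hN, uCoord_arc]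

/-- Along the arc `u` is a fixed unit number times `cos s`, so it runs monotonically through the
prescribed segment. The parameter `t` is read off from `cos s = (1 - t) + t cos (π/N)`. -/
lemma arcU_mem_segment (hN : 3 ≤ N) {s : ℝ} (h0 : 0 ≤ s) (h1 : s ≤ Real.pi / N) :
    (faceY N, arcU N s) ∈ segment ℝ (faceY N, faceU N) (faceY N, uCoord hN (basePoint N)) := by
  have hπ := pi_div_pos hN
  have hπ3 := pi_div_le hN
  have hp := Real.pi_pos
  have hc1 : Real.cos (Real.pi / N) < 1 := by
    rw [← Real.cos_zero]
    exact Real.cos_lt_cos_of_nonneg_of_le_pi le_rfl (by linarith) hπ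
  have hc2 : Real.cos (Real.pi / N) ≤ Real.cos s :=
    Real.cos_le_cos_of_nonneg_of_le_pi h0 (by linarith) h1
  have hc3 : Real.cos s ≤ 1 := Real.cos_le_one s
  rw [← arcU_zero hN, ← arcU_end hN]
  set c := Real.cos (Real.pi / N) with hc
  set t := (1 - Real.cos s) / (1 - c) with ht
  have ht0 : 1 - c ≠ 0 := by linarith
  refine ⟨1 - t, t, ?_, ?_, by ring, ?_⟩
  · rw [ht, sub_nonneg, div_le_one (by linarith)]; linarith
  · exact div_nonneg (by linarith) (by linarith)
  · rw [Prod.smul_mk, Prod.smul_mk, Prod.mk_add_mk]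
    congr 1
    · rw [← add_smul]; simp
    · have e : Real.cos s = (1 - t) * 1 + t * c := by
        rw [ht]; field_simp; ring
      simp only [arcU, Real.cos_zero, ← hc]
      rw [e, Complex.real_smul, Complex.real_smul]
      push_cast
      ring

lemma hasDerivAt_arcU (s : ℝ) :
    HasDerivAt (arcU N) (-(Complex.exp (midAngle N * Complex.I) * Real.sin s)) s := by
  have := ((Real.hasDerivAt_cos s).ofReal_comp).const_mul (Complex.exp (midAngle N * Complex.I))
  refine this.congr_deriv ?_
  push_cast
  ring

lemma hasDerivAt_arcZ (s : ℝ) :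
    HasDerivAt (arcZ N) (Real.cos s * (Complex.I * Complex.exp (midAngle N * Complex.I))) s :=
  ((Real.hasDerivAt_sin s).ofReal_comp).mul_const _

lemma norm_arcZ (s : ℝ) : ‖arcZ N s‖ = |Real.sin s| := by
  rw [arcZ, norm_mul, norm_mul, Complex.norm_I, Complex.norm_exp_ofReal_mul_I, Complex.norm_real,
    Real.norm_eq_abs, mul_one, mul_one]

lemma norm_sub_exp_sq (φ ψ c : ℝ) :
    ‖Complex.exp (φ * Complex.I) * c - Complex.exp (ψ * Complex.I)‖ ^ 2
      = c ^ 2 + 1 - 2 * c * Real.cos (φ - ψ) := by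
  rw [Complex.sq_norm, Complex.normSq_apply, Real.cos_sub]
  simp only [Complex.exp_mul_I, ← Complex.ofReal_cos, ← Complex.ofReal_sin, Complex.sub_re,
    Complex.sub_im, Complex.mul_re, Complex.mul_im, Complex.add_re, Complex.add_im,
    Complex.ofReal_re, Complex.ofReal_im, Complex.I_re, Complex.I_im]
  nlinarith [Real.sin_sq_add_cos_sq φ, Real.sin_sq_add_cos_sq ψ]

/-- Along the arc, `|z|` stays away from the distances `|u - x_j|`. -/
lemma exists_arc_bound (hN : 3 ≤ N) : ∃ c > 0, ∀ s ∈ Icc 0 (Real.pi / N), ∀ j,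
    Real.sin s ^ 2 + c ≤ ‖arcU N s - faceY N j‖ ^ 2 := by
  have hπ := pi_div_pos hN
  have hπ3 := pi_div_le hN
  have hp := Real.pi_pos
  have hc0 : 0 < Real.cos (Real.pi / N) := Real.cos_pos_of_mem_Ioo ⟨by linarith, by linarith⟩
  have hc1 : Real.cos (3 * (Real.pi / N)) < Real.cos (Real.pi / N) :=
    Real.cos_lt_cos_of_nonneg_of_le_pi hπ.le (by linarith) (by linarith)
  -- Here `|u - x_j|² - sin² s = 2 cos s (cos s - cos ψ)`, where `s ≤ π/N` and `ψ` is at least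
  -- `3π/N` away from the multiples of `2π`.
  refine ⟨2 * Real.cos (Real.pi / N) * (Real.cos (Real.pi / N) - Real.cos (3 * (Real.pi / N))),
    by nlinarith [mul_pos hc0 (sub_pos.2 hc1)], fun s hs j => ?_⟩
  have hy : faceY N j = Complex.exp (baseAngles N (inIdx j) * Complex.I) :=
    (congrFun (expPoint_baseAngles (N := N)) (inIdx j)).symm
  have hm := midAngle_sub_mem (inIdx_lt_penIdx hN j)
  set ψ := midAngle N - baseAngles N (inIdx j) with hψ
  have hcos : Real.cos ψ ≤ Real.cos (3 * (Real.pi / N)) := by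
    rcases le_total ψ Real.pi with h | h
    · exact Real.cos_le_cos_of_nonneg_of_le_pi (by linarith) h hm.1
    · rw [← Real.cos_two_pi_sub]
      exact Real.cos_le_cos_of_nonneg_of_le_pi (by linarith) (by linarith) (by linarith [hm.2])
  have hcs : Real.cos (Real.pi / N) ≤ Real.cos s :=
    Real.cos_le_cos_of_nonneg_of_le_pi hs.1 (by linarith) hs.2
  rw [hy, arcU, norm_sub_exp_sq, ← hψ]
  have h1 := Real.sin_sq_add_cos_sq s
  have h2 : 2 * Real.cos (Real.pi / N) * (Real.cos (Real.pi / N) - Real.cos (3 * (Real.pi / N)))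
      ≤ 2 * Real.cos s * (Real.cos s - Real.cos ψ) := by
    have h3 : 0 ≤ Real.cos (Real.pi / N) - Real.cos (3 * (Real.pi / N)) := by linarith
    have h4 : Real.cos (Real.pi / N) - Real.cos (3 * (Real.pi / N)) ≤ Real.cos s - Real.cos ψ := by
      linarith
    have h5 : 2 * Real.cos (Real.pi / N) ≤ 2 * Real.cos s := by linarith
    exact mul_le_mul h5 h4 h3 (by linarith)
  nlinarith

end

end TorusDunkl

namespace TorusDunkl

noncomputable section

open scoped Matrix.Norms.L2Operator
open Set Filter Topology

variable {N n : ℕ}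

section series

variable {hN : 3 ≤ N} {τ : Equiv.Perm (Fin N) →* Matrix.orthogonalGroup (Fin n) ℝ} {κ : ℝ}
  {D : Set ((Fin (N - 2) → ℂ) × ℂ)} {α₀ : (Fin (N - 2) → ℂ) × ℂ → Matrix (Fin n) (Fin n) ℂ}

/-! ### The series along the arc -/

lemma hasDerivAt_leadingCoeff_arc (hα₀ : IsLeadingCoeff hN τ κ D α₀) {s : ℝ}
    (hs : s ∈ Icc 0 (Real.pi / N)) :
    HasDerivAt (fun r => α₀ (faceY N, arcU N r))
      ((-(Complex.exp (midAngle N * Complex.I) * Real.sin s) * κ) •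
        (α₀ (faceY N, arcU N s) * bigA hN τ 0 (faceY N, arcU N s))) s := by
  have h1 := hα₀.deriv_u _ (hα₀.segment_subset (arcU_mem_segment hN hs.1 hs.2))
  have h2 := h1.scomp s (hasDerivAt_arcU (N := N) s)
  refine h2.congr_deriv ?_
  rw [mul_smul, bigA, pow_zero, one_smul]

lemma arcU_ne_faceY (hN : 3 ≤ N) {s : ℝ} (hs : s ∈ Icc 0 (Real.pi / N)) (j : Fin (N - 2)) :
    arcU N s - faceY N j ≠ 0 := by
  obtain ⟨c, hc, h⟩ := exists_arc_bound hN
  intro e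
  have := h s hs j
  rw [e, norm_zero] at this
  nlinarith [sq_nonneg (Real.sin s)]

lemma continuousOn_bigA_zero_arc (hN : 3 ≤ N)
    (τ : Equiv.Perm (Fin N) →* Matrix.orthogonalGroup (Fin n) ℝ) :
    ContinuousOn (fun s => bigA hN τ 0 (faceY N, arcU N s)) (Icc 0 (Real.pi / N)) := by
  intro s hs
  have h := (hasDerivAt_beta hN τ (hasDerivAt_arcU (N := N) s) (arcU_ne_faceY hN hs) 0).continuousAt
  simp only [bigA, pow_zero, one_smul]
  exact (h.add ((continuousAt_const.mul h).mul continuousAt_const)).continuousWithinAt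

/-- The commutator with `σ` satisfies the same linear equation as `α₀`, because `σ` commutes with
`A_0`, and it vanishes at the initial point where `α₀ = I`. -/
lemma leadingCoeff_arc_commute (hα₀ : IsLeadingCoeff hN τ κ D α₀) {s : ℝ}
    (hs : s ∈ Icc 0 (Real.pi / N)) :
    sigma hN τ * α₀ (faceY N, arcU N s) = α₀ (faceY N, arcU N s) * sigma hN τ := by
  obtain ⟨C, hC⟩ := isCompact_Icc.exists_bound_of_continuousOn (continuousOn_bigA_zero_arc hN τ)
  have hd : ∀ s ∈ Icc 0 (Real.pi / N), HasDerivAt (fun s => sigma hN τ * α₀ (faceY N, arcU N s)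
      - α₀ (faceY N, arcU N s) * sigma hN τ)
      ((-(Complex.exp (midAngle N * Complex.I) * Real.sin s) * κ) •
        ((sigma hN τ * α₀ (faceY N, arcU N s) - α₀ (faceY N, arcU N s) * sigma hN τ)
          * bigA hN τ 0 (faceY N, arcU N s))) s := by
    intro s hs
    have h := hasDerivAt_leadingCoeff_arc hα₀ hs
    refine ((h.const_mul (sigma hN τ)).fun_sub (h.mul_const (sigma hN τ))).congr_deriv ?_
    rw [sub_mul, mul_assoc, mul_assoc, sigma_mul_bigA_zero, mul_smul_comm, smul_mul_assoc,
      smul_sub, mul_assoc]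
  refine sub_eq_zero.1 (eq_zero_of_norm_deriv_le_left (K := |κ| * C)
    (fun s hs => (hd s hs).continuousAt.continuousWithinAt)
    (fun s hs => hd s ⟨hs.1.le, hs.2.le⟩) (fun s hs => ?_) ?_ s hs)
  · have hC0 := hC s ⟨hs.1.le, hs.2.le⟩
    rw [norm_smul, norm_mul, norm_neg, norm_mul, Complex.norm_exp_ofReal_mul_I, one_mul,
      Complex.norm_real, Complex.norm_real, Real.norm_eq_abs, Real.norm_eq_abs]
    set Y := sigma hN τ * α₀ (faceY N, arcU N s) - α₀ (faceY N, arcU N s) * sigma hN τ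
    calc |Real.sin s| * |κ| * ‖Y * bigA hN τ 0 (faceY N, arcU N s)‖
        ≤ 1 * |κ| * (‖Y‖ * C) := by
          gcongr
          · exact Real.abs_sin_le_one s
          · exact (norm_mul_le _ _).trans (mul_le_mul_of_nonneg_left hC0 (norm_nonneg _))
      _ = |κ| * C * ‖Y‖ := by ring
  · rw [arcU_zero hN, hα₀.base, mul_one, one_mul, sub_self]

/-- Uniform geometric bounds along the arc. -/
lemma exists_arc_ratio (hN : 3 ≤ N) : ∃ q d₀ : ℝ, 0 < q ∧ q < 1 ∧ 0 < d₀ ∧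
    ∀ s ∈ Icc 0 (Real.pi / N), ∃ d, d₀ ≤ d ∧ (∀ j, d ≤ ‖arcU N s - faceY N j‖) ∧
      ‖arcZ N s‖ ≤ q * d := by
  obtain ⟨c, hc, h⟩ := exists_arc_bound hN
  -- With `d² = sin² s + c` and `|z|² = sin² s`, the ratio `|z|²/d²` is largest for `sin² s = 1`;
  -- this gives `q² = 1/(1 + c)`.
  refine ⟨Real.sqrt (1 / (1 + c)), Real.sqrt c, Real.sqrt_pos.2 (by positivity), ?_,
    Real.sqrt_pos.2 hc, fun s hs => ⟨Real.sqrt (Real.sin s ^ 2 + c),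
    Real.sqrt_le_sqrt (by nlinarith [sq_nonneg (Real.sin s)]), fun j => ?_, ?_⟩⟩
  · rw [Real.sqrt_lt' one_pos, div_lt_iff₀ (by positivity)]
    linarith
  · rw [Real.sqrt_le_left (norm_nonneg _)]
    exact h s hs j
  · rw [norm_arcZ, ← Real.sqrt_sq_eq_abs, ← Real.sqrt_mul (by positivity)]
    refine Real.sqrt_le_sqrt ?_
    rw [one_div, ← div_eq_inv_mul, le_div_iff₀ (by positivity)]
    nlinarith [Real.sin_sq_le_one s]

lemma exists_norm_leadingCoeff_arc_le (hα₀ : IsLeadingCoeff hN τ κ D α₀) :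
    ∃ A, ∀ s ∈ Icc 0 (Real.pi / N), ‖α₀ (faceY N, arcU N s)‖ ≤ A :=
  isCompact_Icc.exists_bound_of_continuousOn fun _ hs =>
    (hasDerivAt_leadingCoeff_arc hα₀ hs).continuousAt.continuousWithinAt

variable (hN τ κ α₀) in
/-- The sum `∑ α_k(x(u,0)) z^k` along the arc. -/
def arcSum (s : ℝ) : Matrix (Fin n) (Fin n) ℂ :=
  alphaSum hN τ κ α₀ (faceY N) (arcU N s) (arcZ N s)

lemma sin_pos_of_mem {s : ℝ} (hN : 3 ≤ N) (h0 : 0 < s) (h1 : s ≤ Real.pi / N) :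
    0 < Real.sin s :=
  Real.sin_pos_of_pos_of_lt_pi h0 (by linarith [pi_div_le hN, Real.pi_pos])

/-- On the arc `u' ± z' = ± i (u ± z)` and `z'/z = cot s`, so the pole sums become those of
`angleCoeff_wallDir`. Its term `cot s · σ` uses up half of the commutator, and only `-κ cot s · σ`
acting from the left remains. -/
lemma hasDerivAt_arcSum (hκ : 4 * (N * |κ|) ≤ 1) (hα₀ : IsLeadingCoeff hN τ κ D α₀) {s : ℝ}
    (hs : s ∈ Ioo 0 (Real.pi / N)) :
    HasDerivAt (arcSum hN τ κ α₀)
      ((κ : ℂ) • (arcSum hN τ κ α₀ s * angleCoeff τ (arc hN s) (wallDir hN))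
        - ((κ : ℂ) * (Real.cos s / Real.sin s)) • (sigma hN τ * arcSum hN τ κ α₀ s)) s := by
  obtain ⟨q, d₀, hq0, hq, hd₀, hd⟩ := exists_arc_ratio hN
  obtain ⟨A, hA⟩ := exists_norm_leadingCoeff_arc_le hα₀
  have hsub : Ioo 0 (Real.pi / N) ⊆ Icc 0 (Real.pi / N) := Ioo_subset_Icc_self
  have he : Complex.exp (midAngle N * Complex.I) ≠ 0 := Complex.exp_ne_zero _
  have hsin : ∀ s ∈ Ioo 0 (Real.pi / N), (Real.sin s : ℂ) ≠ 0 := fun s hs => by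
    exact_mod_cast (sin_pos_of_mem hN hs.1 hs.2.le).ne'
  have h := hasDerivAt_alphaSum hN τ hκ (y := faceY N) (I := Ioo 0 (Real.pi / N)) isOpen_Ioo
    isPreconnected_Ioo hq0 hq hd₀ (fun s _ => hasDerivAt_arcU s) (fun s _ => hasDerivAt_arcZ s)
    (fun s _ => by
      rw [norm_neg, norm_mul, Complex.norm_exp_ofReal_mul_I, one_mul, Complex.norm_real]
      exact Real.abs_sin_le_one s)
    (fun s _ => by
      rw [norm_mul, norm_mul, Complex.norm_I, Complex.norm_exp_ofReal_mul_I, Complex.norm_real,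
        mul_one, mul_one]
      exact Real.abs_cos_le_one s)
    (fun s hs => mul_ne_zero (hsin s hs) (mul_ne_zero Complex.I_ne_zero he))
    (fun s hs => hd s (hsub hs)) (fun s hs => hA s (hsub hs))
    (fun s hs => hasDerivAt_leadingCoeff_arc hα₀ (hsub hs))
    (fun s hs => leadingCoeff_arc_commute hα₀ (hsub hs)) hs
  refine h.congr_deriv ?_
  have hreg : Function.Injective (expPoint (arc hN s)) :=
    expPoint_injective_iff.2 fun i j hij => sin_half_ne_zero (arc_mem_angleChamber hN hs.1 hs.2.le) hij
  rw [angleCoeff_wallDir hN τ hreg, expPoint_arc_inIdx, expPoint_arc_lst, expPoint_arc_pen]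
  have hs0 := hsin s hs
  have e1 : -(Complex.exp (midAngle N * Complex.I) * Real.sin s)
      + Real.cos s * (Complex.I * Complex.exp (midAngle N * Complex.I))
      = Complex.I * (arcU N s + arcZ N s) := by
    rw [arcU, arcZ]
    linear_combination (Complex.exp (midAngle N * Complex.I) * Real.sin s) * (-Complex.I_sq)
  have e2 : -(Complex.exp (midAngle N * Complex.I) * Real.sin s)
      - Real.cos s * (Complex.I * Complex.exp (midAngle N * Complex.I))
      = -(Complex.I * (arcU N s - arcZ N s)) := by
    rw [arcU, arcZ]
    linear_combination (Complex.exp (midAngle N * Complex.I) * Real.sin s) * (-Complex.I_sq)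
  have e3 : Real.cos s * (Complex.I * Complex.exp (midAngle N * Complex.I)) / arcZ N s
      = Real.cos s / Real.sin s := by
    rw [arcZ]
    field_simp
  have e4 : Complex.I * (arcU N s + arcZ N s + (arcU N s - arcZ N s))
      / (arcU N s + arcZ N s - (arcU N s - arcZ N s)) = Real.cos s / Real.sin s := by
    have h2 : (2 * (Complex.I * Complex.exp (midAngle N * Complex.I))) ≠ 0 :=
      mul_ne_zero two_ne_zero (mul_ne_zero Complex.I_ne_zero he)
    rw [← mul_div_mul_left (Real.cos s : ℂ) _ h2, arcU, arcZ]
    congr 1 <;> ring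
  rw [e1, e2, e3, e4, ← arcSum]
  generalize (Real.cos s / Real.sin s : ℂ) = t
  simp only [mul_add, mul_smul_comm]
  module

lemma continuousOn_arcSum (hκ : 4 * (N * |κ|) ≤ 1) (hα₀ : IsLeadingCoeff hN τ κ D α₀) :
    ContinuousOn (arcSum hN τ κ α₀) (Icc 0 (Real.pi / N)) := by
  obtain ⟨q, d₀, hq0, hq, hd₀, hd⟩ := exists_arc_ratio hN
  obtain ⟨A, hA⟩ := exists_norm_leadingCoeff_arc_le hα₀
  refine continuousOn_tsum (u := fun k => A * q ^ k) (fun k s hs => ?_)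
    ((summable_geometric_of_lt_one hq0.le hq).mul_left A) fun k s hs => ?_
  · have h1 := differentiableAt_alpha hN τ (κ := κ) (hasDerivAt_arcU (N := N) s).differentiableAt
      (arcU_ne_faceY hN hs) (hasDerivAt_leadingCoeff_arc hα₀ hs).differentiableAt k
    exact (((hasDerivAt_arcZ s).continuousAt.pow k).smul h1.continuousAt).continuousWithinAt
  · obtain ⟨d, hd1, hd2, hd3⟩ := hd s hs
    refine (norm_pow_smul_alpha_le hN τ hκ (hd₀.trans_le hd1) hd2 hd3
      (leadingCoeff_arc_commute hα₀ hs) k).trans ?_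
    gcongr
    exact hA s hs

/-- All terms after the first contain a factor `z`, whose modulus on the arc is `|sin s|`. -/
lemma exists_norm_arcSum_sub_le (hκ : 4 * (N * |κ|) ≤ 1) (hα₀ : IsLeadingCoeff hN τ κ D α₀) :
    ∃ C, ∀ s ∈ Icc 0 (Real.pi / N),
      ‖arcSum hN τ κ α₀ s - α₀ (faceY N, arcU N s)‖ ≤ C * |Real.sin s| := by
  obtain ⟨q, d₀, hq0, hq, hd₀, hd⟩ := exists_arc_ratio hN
  obtain ⟨A, hA⟩ := exists_norm_leadingCoeff_arc_le hα₀
  refine ⟨A * d₀⁻¹ * (1 - q)⁻¹, fun s hs => ?_⟩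
  obtain ⟨d, hd1, hd2, hd3⟩ := hd s hs
  have hd0 := hd₀.trans_le hd1
  have hA0 : 0 ≤ A := (norm_nonneg _).trans (hA s hs)
  have hsum := (summable_norm_alpha hN τ hκ hd0 hq0.le hq hd2 hd3
    (leadingCoeff_arc_commute hα₀ hs)).of_norm
  rw [arcSum, alphaSum, hsum.tsum_eq_zero_add, pow_zero, one_smul, alpha, add_sub_cancel_left]
  refine (tsum_of_norm_bounded (g := fun k => A * d₀⁻¹ * |Real.sin s| * q ^ k)
    ((hasSum_geometric_of_lt_one hq0.le hq).mul_left _) fun k => ?_).trans (le_of_eq (by ring))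
  rw [pow_succ', mul_smul, norm_smul, norm_arcZ]
  have h1 : ‖arcZ N s ^ k • alpha hN τ κ α₀ (faceY N, arcU N s) (k + 1)‖ ≤ A * d₀⁻¹ * q ^ k := by
    refine norm_pow_smul_le hd0 hd3 ((norm_alpha_le hN τ hκ (p := (faceY N, arcU N s)) hd0 hd2
      (leadingCoeff_arc_commute hα₀ hs) (k + 1)).trans ?_)
    calc ‖α₀ (faceY N, arcU N s)‖ * d⁻¹ ^ (k + 1)
        = ‖α₀ (faceY N, arcU N s)‖ * d⁻¹ * d⁻¹ ^ k := by ring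
      _ ≤ A * d₀⁻¹ * d⁻¹ ^ k := by
        gcongr
        exact hA s hs
  calc |Real.sin s| * ‖arcZ N s ^ k • alpha hN τ κ α₀ (faceY N, arcU N s) (k + 1)‖
      ≤ |Real.sin s| * (A * d₀⁻¹ * q ^ k) := by gcongr
    _ = _ := by ring

lemma arcSum_zero (hα₀ : IsLeadingCoeff hN τ κ D α₀) (hκ : 4 * (N * |κ|) ≤ 1) :
    arcSum hN τ κ α₀ 0 = 1 := by
  obtain ⟨C, hC⟩ := exists_norm_arcSum_sub_le hκ hα₀
  have := hC 0 ⟨le_rfl, (pi_div_pos hN).le⟩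
  rw [Real.sin_zero, abs_zero, mul_zero, arcU_zero hN, hα₀.base] at this
  exact sub_eq_zero.1 (norm_le_zero_iff.1 this)

/-! ### The factor `ρ(z^{-κ}, z^κ)` -/

lemma ofReal_mul_cpow {r : ℝ} (hr : 0 < r) {c : ℂ} (hc : c ≠ 0) (k : ℝ) :
    ((r : ℂ) * c) ^ (k : ℂ) = ((r ^ k : ℝ) : ℂ) * c ^ (k : ℂ) := by
  have hr' : (r : ℂ) ≠ 0 := by exact_mod_cast hr.ne'
  rw [Complex.cpow_def_of_ne_zero (mul_ne_zero hr' hc), Complex.cpow_def_of_ne_zero hc,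
    Complex.log_ofReal_mul hr hc, add_mul, Complex.exp_add, Real.rpow_def_of_pos hr,
    Complex.ofReal_exp]
  push_cast
  rfl

variable (hN τ κ) in
/-- The factor `ρ(z^{-κ}, z^κ)` along the arc. -/
def arcRho (s : ℝ) : Matrix (Fin n) (Fin n) ℂ :=
  rho hN τ (arcZ N s ^ (-(κ : ℂ))) (arcZ N s ^ (κ : ℂ))

lemma hasDerivAt_arcZ_cpow (hN : 3 ≤ N) (k : ℝ) {s : ℝ} (h0 : 0 < s) (h1 : s ≤ Real.pi / N) :
    HasDerivAt (fun s => arcZ N s ^ (k : ℂ))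
      ((k * (Real.cos s / Real.sin s)) * arcZ N s ^ (k : ℂ)) s := by
  have hc : Complex.I * Complex.exp (midAngle N * Complex.I) ≠ 0 :=
    mul_ne_zero Complex.I_ne_zero (Complex.exp_ne_zero _)
  have hs := sin_pos_of_mem hN h0 h1
  have hev : (fun s => arcZ N s ^ (k : ℂ)) =ᶠ[𝓝 s] fun s => ((Real.sin s ^ k : ℝ) : ℂ)
      * (Complex.I * Complex.exp (midAngle N * Complex.I)) ^ (k : ℂ) :=
    ((Real.continuous_sin.continuousAt).eventually (lt_mem_nhds hs)).mono fun r hr =>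
      ofReal_mul_cpow hr hc k
  have h2 := (((Real.hasDerivAt_sin s).rpow_const (p := k) (Or.inl hs.ne')).ofReal_comp).mul_const
    ((Complex.I * Complex.exp (midAngle N * Complex.I)) ^ (k : ℂ))
  refine (h2.congr_of_eventuallyEq hev).congr_deriv ?_
  rw [arcZ, ofReal_mul_cpow hs hc, Real.rpow_sub_one hs.ne']
  push_cast
  ring

lemma hasDerivAt_arcRho (hN : 3 ≤ N) (τ : Equiv.Perm (Fin N) →* Matrix.orthogonalGroup (Fin n) ℝ)
    (κ : ℝ) {s : ℝ} (h0 : 0 < s) (h1 : s ≤ Real.pi / N) :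
    HasDerivAt (arcRho hN τ κ)
      (((κ : ℂ) * (Real.cos s / Real.sin s)) • (arcRho hN τ κ s * sigma hN τ)) s := by
  have ha := hasDerivAt_arcZ_cpow hN (-κ) h0 h1
  have hb := hasDerivAt_arcZ_cpow hN κ h0 h1
  have h2 := ((ha.div_const 2).smul_const (1 - sigma hN τ)).fun_add
    ((hb.div_const 2).smul_const (1 + sigma hN τ))
  simp only [Complex.ofReal_neg] at h2
  refine h2.congr_deriv ?_
  rw [arcRho, rho, add_mul, smul_mul_assoc, smul_mul_assoc, sub_mul, add_mul, sigma_mul_self,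
    one_mul]
  generalize (Real.cos s / Real.sin s : ℂ) = t
  module

lemma isUnit_arcRho (hN : 3 ≤ N) (τ : Equiv.Perm (Fin N) →* Matrix.orthogonalGroup (Fin n) ℝ)
    (κ : ℝ) {s : ℝ} (h0 : 0 < s) (h1 : s ≤ Real.pi / N) :
    IsUnit (arcRho hN τ κ s) := by
  have hz : arcZ N s ≠ 0 := by
    have hs := sin_pos_of_mem hN h0 h1
    rw [← norm_pos_iff, norm_arcZ]
    exact abs_pos.2 hs.ne'
  have e : arcRho hN τ κ s * rho hN τ (arcZ N s ^ (κ : ℂ)) (arcZ N s ^ (-(κ : ℂ))) = 1 := by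
    rw [arcRho, rho_mul_rho, Complex.cpow_neg, inv_mul_cancel₀, mul_inv_cancel₀, rho_self, one_smul]
    all_goals exact fun h => hz (Complex.cpow_eq_zero_iff _ _ |>.1 h).1
  exact (Matrix.isUnit_iff_isUnit_det _).2 (Matrix.isUnit_det_of_right_inverse e)

lemma exists_norm_arcRho_le (hN : 3 ≤ N)
    (τ : Equiv.Perm (Fin N) →* Matrix.orthogonalGroup (Fin n) ℝ) (κ : ℝ) :
    ∃ C, 0 ≤ C ∧ ∀ s, 0 < s → s ≤ Real.pi / N →
      ‖arcRho hN τ κ s‖ ≤ C * Real.sin s ^ (-|κ|) := by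
  set c := Complex.I * Complex.exp (midAngle N * Complex.I) with hcd
  have hc : c ≠ 0 := mul_ne_zero Complex.I_ne_zero (Complex.exp_ne_zero _)
  refine ⟨‖c ^ ((-κ : ℝ) : ℂ)‖ + ‖c ^ (κ : ℂ)‖, by positivity, fun s h0 h1 => ?_⟩
  have hs := sin_pos_of_mem hN h0 h1
  have hz : ∀ k : ℝ, |k| = |κ| → ‖arcZ N s ^ (k : ℂ)‖ ≤ ‖c ^ (k : ℂ)‖ * Real.sin s ^ (-|κ|) := by
    intro k hk
    rw [arcZ, ofReal_mul_cpow hs hc, norm_mul, mul_comm, Complex.norm_real,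
      Real.norm_of_nonneg (by positivity)]
    refine mul_le_mul_of_nonneg_left ?_ (norm_nonneg _)
    exact Real.rpow_le_rpow_of_exponent_ge hs (Real.sin_le_one s) (by rw [← hk]; exact neg_abs_le k)
  have hσ : ‖sigma hN τ‖ ≤ 1 := norm_rep_le τ _
  have h1n : ‖(1 : Matrix (Fin n) (Fin n) ℂ)‖ ≤ 1 := norm_one_le
  have hm : ‖1 - sigma hN τ‖ ≤ 2 := (norm_sub_le _ _).trans (by linarith)
  have hp : ‖1 + sigma hN τ‖ ≤ 2 := (norm_add_le _ _).trans (by linarith)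
  have h2 := hz (-κ) (abs_neg κ)
  have h3 := hz κ rfl
  rw [arcRho, rho]
  refine (norm_add_le _ _).trans ?_
  rw [norm_smul, norm_smul, norm_div, norm_div, Complex.norm_ofNat]
  rw [Complex.ofReal_neg] at h2 ⊢
  nlinarith [norm_nonneg (arcZ N s ^ (-(κ : ℂ))), norm_nonneg (arcZ N s ^ (κ : ℂ))]

end series

end

end TorusDunkl

namespace TorusDunkl

noncomputable section

open scoped Matrix.Norms.L2Operator
open Set Filter Topology

variable {N n : ℕ}

section series

variable {hN : 3 ≤ N} {τ : Equiv.Perm (Fin N) →* Matrix.orthogonalGroup (Fin n) ℝ} {κ : ℝ}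
  {D : Set ((Fin (N - 2) → ℂ) × ℂ)} {α₀ : (Fin (N - 2) → ℂ) × ℂ → Matrix (Fin n) (Fin n) ℂ}
  {L : (Fin N → ℂ) → Matrix (Fin n) (Fin n) ℂ}

/-! ### Comparison of the series with `L` along the arc -/

variable (hN τ κ α₀) in
/-- The product `ρ(z^{-κ}, z^κ) ∑ α_k(x(u,0)) z^k` along the arc. -/
def arcSol (s : ℝ) : Matrix (Fin n) (Fin n) ℂ := arcRho hN τ κ s * arcSum hN τ κ α₀ s

lemma seriesSol_arc (s : ℝ) : seriesSol hN τ κ α₀ (expPoint (arc hN s))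
    = (∏ j, expPoint (wallBase N) j) ^ (-(gam τ : ℂ) * κ) • arcSol hN τ κ α₀ s := by
  rw [seriesSol, prod_expPoint_arc, uCoord_arc, zCoord_arc, expPoint_arc_inIdx]
  rfl

/-- The factor `ρ(z^(-κ), z^κ)` is designed for this: its derivative `κ cot s · ρσ` cancels the
leftover term in `hasDerivAt_arcSum`. -/
lemma hasDerivAt_arcSol (hκ : 4 * (N * |κ|) ≤ 1) (hα₀ : IsLeadingCoeff hN τ κ D α₀) {s : ℝ}
    (hs : s ∈ Ioo 0 (Real.pi / N)) :
    HasDerivAt (arcSol hN τ κ α₀)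
      ((κ : ℂ) • (arcSol hN τ κ α₀ s * angleCoeff τ (arc hN s) (wallDir hN))) s := by
  have h := (hasDerivAt_arcRho hN τ κ hs.1 hs.2.le).fun_mul (hasDerivAt_arcSum hκ hα₀ hs)
  refine h.congr_deriv ?_
  rw [arcSol, mul_sub, mul_smul_comm, mul_smul_comm, smul_mul_assoc, ← mul_assoc, ← mul_assoc]
  module

lemma continuousOn_arcSol (hκ : 4 * (N * |κ|) ≤ 1) (hα₀ : IsLeadingCoeff hN τ κ D α₀) :
    ContinuousOn (arcSol hN τ κ α₀) (Ioc 0 (Real.pi / N)) :=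
  ContinuousOn.mul (fun _ hs => (hasDerivAt_arcRho hN τ κ hs.1 hs.2).continuousAt.continuousWithinAt)
    ((continuousOn_arcSum hκ hα₀).mono Ioc_subset_Icc_self)

/-- Both sides solve the same linear equation and agree at the end of the arc, where `L = I`.
Uniqueness is applied backwards from there, since the coefficients are singular at the wall. -/
lemma arcSol_eq (hκ : 4 * (N * |κ|) ≤ 1) (hα₀ : IsLeadingCoeff hN τ κ D α₀)
    (hL : IsFundamentalMatrix hN τ κ L) {s : ℝ} (h0 : 0 < s) (h1 : s ≤ Real.pi / N) :
    arcSol hN τ κ α₀ s = arcSol hN τ κ α₀ (Real.pi / N) * L (expPoint (arc hN s)) := by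
  set X := arcSol hN τ κ α₀ (Real.pi / N) with hX
  have hmem : ∀ t ∈ Icc s (Real.pi / N), arc hN t ∈ angleChamber hN := fun t ht =>
    arc_mem_angleChamber hN (h0.trans_le ht.1) ht.2
  have hdL : ∀ t ∈ Icc s (Real.pi / N), HasDerivAt (fun t => L (expPoint (arc hN t)))
      ((κ : ℂ) • (L (expPoint (arc hN t)) * angleCoeff τ (arc hN t) (wallDir hN))) t := fun t ht =>
    (solvesAt_of_isFundamentalMatrix τ hL (hmem t ht)).hasDerivAt_line
  have hc : ContinuousOn (fun t : ℝ => angleCoeff τ (arc hN t) (wallDir hN))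
      (Icc s (Real.pi / N)) := by
    unfold angleCoeff
    exact ((continuousOn_cotMat τ hN (wallDir hN)).comp (by unfold arc; fun_prop) hmem).add
      continuousOn_const
  obtain ⟨C, hC⟩ := isCompact_Icc.exists_bound_of_continuousOn hc
  have h := eq_zero_of_norm_deriv_le_right (K := |κ| * C) (a := s) (b := Real.pi / N)
    (f := fun t => arcSol hN τ κ α₀ t - X * L (expPoint (arc hN t)))
    (((continuousOn_arcSol hκ hα₀).mono fun t ht => ⟨h0.trans_le ht.1, ht.2⟩).sub
      (continuousOn_const.mul fun t ht => (hdL t ht).continuousAt.continuousWithinAt))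
    (f' := fun t => (κ : ℂ) • ((arcSol hN τ κ α₀ t - X * L (expPoint (arc hN t)))
      * angleCoeff τ (arc hN t) (wallDir hN)))
    (fun t ht => by
      refine ((hasDerivAt_arcSol hκ hα₀ ⟨h0.trans ht.1, ht.2⟩).fun_sub
        ((hdL t ⟨ht.1.le, ht.2.le⟩).const_mul X)).congr_deriv ?_
      rw [mul_smul_comm, ← smul_sub, sub_mul, mul_assoc])
    (fun t ht => by
      rw [norm_smul, Complex.norm_real, Real.norm_eq_abs, mul_assoc, mul_comm C]
      exact mul_le_mul_of_nonneg_left ((norm_mul_le _ _).trans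
        (mul_le_mul_of_nonneg_left (hC t ⟨ht.1.le, ht.2.le⟩) (norm_nonneg _))) (abs_nonneg _))
    (by rw [arc_end, expPoint_baseAngles, hL.base, mul_one, sub_self]) s ⟨le_rfl, h1⟩
  exact sub_eq_zero.1 h

/-- Near the wall the sum is close to `I` and `ρ` is invertible, so the series solution is
invertible at some small `s`. There it is a multiple of its value at the end of the arc, which must
then be invertible too. -/
lemma isUnit_arcSol_end (hκ : 4 * (N * |κ|) ≤ 1) (hα₀ : IsLeadingCoeff hN τ κ D α₀)
    (hL : IsFundamentalMatrix hN τ κ L) : IsUnit (arcSol hN τ κ α₀ (Real.pi / N)) := by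
  have hπ := pi_div_pos hN
  have h1 : Tendsto (arcSum hN τ κ α₀) (𝓝[>] 0) (𝓝 1) := by
    have h2 := (continuousOn_arcSum hκ hα₀) 0 ⟨le_rfl, hπ.le⟩
    rw [ContinuousWithinAt, arcSum_zero hα₀ hκ] at h2
    refine h2.mono_left ?_
    rw [← nhdsWithin_Ioo_eq_nhdsGT hπ]
    exact nhdsWithin_mono _ Ioo_subset_Icc_self
  have h3 : ∀ᶠ s in 𝓝[>] 0, IsUnit (arcSum hN τ κ α₀ s) :=
    h1.eventually (Units.isOpen.mem_nhds isUnit_one)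
  obtain ⟨s, hs, h0, h4⟩ := (h3.and (Ioo_mem_nhdsGT hπ)).exists
  have h5 : IsUnit (arcSol hN τ κ α₀ s) := (isUnit_arcRho hN τ κ h0 h4.le).mul hs
  rw [arcSol_eq hκ hα₀ hL h0 h4.le] at h5
  exact isUnit_of_mul_isUnit_left h5

/-- By uniqueness `L₁ = L₁(x₀) L` on the arc, the power of the product of coordinates being constant
there. Since `L₁(x₀)` is invertible, `L` can be eliminated from `L^* H L`. -/
lemma formMat_arc (hκ : 4 * (N * |κ|) ≤ 1) (hα₀ : IsLeadingCoeff hN τ κ D α₀)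
    (hL : IsFundamentalMatrix hN τ κ L) (H : Matrix (Fin n) (Fin n) ℂ) {s : ℝ} (h0 : 0 < s)
    (h1 : s ≤ Real.pi / N) :
    formMat L H (expPoint (arc hN s))
      = (seriesSol hN τ κ α₀ (expPoint (arc hN s)))ᴴ *
        (((seriesSol hN τ κ α₀ (basePoint N))ᴴ)⁻¹ * H * (seriesSol hN τ κ α₀ (basePoint N))⁻¹)
        * seriesSol hN τ κ α₀ (expPoint (arc hN s)) := by
  have e1 : seriesSol hN τ κ α₀ (expPoint (arc hN s))
      = seriesSol hN τ κ α₀ (basePoint N) * L (expPoint (arc hN s)) := by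
    rw [← expPoint_baseAngles, ← arc_end hN, seriesSol_arc, seriesSol_arc, arcSol_eq hκ hα₀ hL h0 h1,
      smul_mul_assoc]
  have hp : ∏ j, expPoint (wallBase N) j ≠ 0 :=
    Finset.prod_ne_zero_iff.2 fun j _ => Complex.exp_ne_zero _
  have e2 : IsUnit (seriesSol hN τ κ α₀ (basePoint N)).det := by
    rw [← Matrix.isUnit_iff_isUnit_det, ← expPoint_baseAngles, ← arc_end hN, seriesSol_arc]
    have hc : (∏ j, expPoint (wallBase N) j) ^ (-(gam τ : ℂ) * κ) ≠ 0 := fun h =>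
      hp (Complex.cpow_eq_zero_iff _ _ |>.1 h).1
    exact (isUnit_arcSol_end hκ hα₀ hL).smul (Units.mk0 _ hc)
  set X := seriesSol hN τ κ α₀ (basePoint N) with hX
  have e3 : IsUnit (Xᴴ).det := by
    rw [Matrix.det_conjTranspose]
    exact e2.star
  rw [e1, formMat, Matrix.conjTranspose_mul]
  have e4 : Xᴴ * (Xᴴ)⁻¹ = 1 := Matrix.mul_nonsing_inv _ e3
  have e5 : X⁻¹ * X = 1 := Matrix.nonsing_inv_mul _ e2
  calc (L (expPoint (arc hN s)))ᴴ * H * L (expPoint (arc hN s))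
      = (L (expPoint (arc hN s)))ᴴ * 1 * H * 1 * L (expPoint (arc hN s)) := by
        rw [mul_one, mul_one]
    _ = (L (expPoint (arc hN s)))ᴴ * (Xᴴ * (Xᴴ)⁻¹) * H * (X⁻¹ * X) * L (expPoint (arc hN s)) := by
        rw [e4, e5]
    _ = _ := by simp only [mul_assoc]

/-- Conjugation by `σ` fixes `W` and replaces `Ψ` by `σΨσ`. As `Z` commutes with `σ`, the difference
of these two is at most `2 ‖Ψ - Z‖`. -/
lemma norm_defect_conj_le {Ψ Z W : Matrix (Fin n) (Fin n) ℂ}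
    (hW : sigma hN τ * W = W * sigma hN τ) (hZ : sigma hN τ * Z = Z * sigma hN τ) :
    ‖defect hN τ (Ψᴴ * W * Ψ)‖ ≤ 4 * ‖W‖ * ‖Ψ‖ * ‖Ψ - Z‖ := by
  set S := sigma hN τ with hS
  have hSS : S * S = 1 := sigma_mul_self τ hN
  have hSH : Sᴴ = S := sigma_conjTranspose τ hN
  set Φ := S * Ψ * S with hΦ
  have h1 : S * (Ψᴴ * W * Ψ) * S = Φᴴ * W * Φ := by
    rw [hΦ, Matrix.conjTranspose_mul, Matrix.conjTranspose_mul, hSH]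
    calc S * (Ψᴴ * W * Ψ) * S = S * Ψᴴ * (1 * W) * Ψ * S := by simp only [mul_assoc, one_mul]
      _ = S * Ψᴴ * (S * S * W) * Ψ * S := by rw [hSS]
      _ = S * Ψᴴ * (S * W * S) * Ψ * S := by rw [mul_assoc S S, mul_assoc S W, hW]
      _ = _ := by simp only [mul_assoc]
  have h2 : defect hN τ (Ψᴴ * W * Ψ) = Ψᴴ * W * (Ψ - Φ) + (Ψ - Φ)ᴴ * W * Φ := by
    rw [defect, ← hS, h1, Matrix.conjTranspose_sub]
    noncomm_ring
  have hΦn : ‖Φ‖ ≤ ‖Ψ‖ := norm_sigma_mul_mul_le hN τ Ψ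
  have h3 : Ψ - Φ = (Ψ - Z) - S * (Ψ - Z) * S := by
    rw [mul_sub, sub_mul, hZ, mul_assoc Z, hSS, mul_one]
    abel
  have h4 : ‖Ψ - Φ‖ ≤ 2 * ‖Ψ - Z‖ := by
    rw [h3]
    refine (norm_sub_le _ _).trans ?_
    linarith [norm_sigma_mul_mul_le hN τ (Ψ - Z)]
  rw [h2]
  refine (norm_add_le _ _).trans ?_
  have h5 : ‖Ψᴴ * W * (Ψ - Φ)‖ ≤ ‖Ψ‖ * ‖W‖ * (2 * ‖Ψ - Z‖) := by
    refine (norm_mul_le _ _).trans (mul_le_mul ((norm_mul_le _ _).trans ?_) h4 (norm_nonneg _)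
      (by positivity))
    rw [Matrix.l2_opNorm_conjTranspose]
  have h6 : ‖(Ψ - Φ)ᴴ * W * Φ‖ ≤ 2 * ‖Ψ - Z‖ * ‖W‖ * ‖Ψ‖ := by
    refine (norm_mul_le _ _).trans (mul_le_mul ((norm_mul_le _ _).trans ?_) hΦn (norm_nonneg _)
      (by positivity))
    rw [Matrix.l2_opNorm_conjTranspose]
    gcongr
  linarith

lemma arcRho_commute (s : ℝ) : sigma hN τ * arcRho hN τ κ s = arcRho hN τ κ s * sigma hN τ :=
  sigma_mul_rho hN τ _ _

/-- If `(L₁(x₀)^*)⁻¹ H L₁(x₀)⁻¹` commutes with `σ`, then `K - σKσ` tends to zero at the wall. -/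
lemma tendsto_defect_wallBase (hκ : 4 * (N * |κ|) ≤ 1) (hα₀ : IsLeadingCoeff hN τ κ D α₀)
    (hL : IsFundamentalMatrix hN τ κ L) {H : Matrix (Fin n) (Fin n) ℂ}
    (hσ : Commute (((seriesSol hN τ κ α₀ (basePoint N))ᴴ)⁻¹ * H *
        (seriesSol hN τ κ α₀ (basePoint N))⁻¹) (sigma hN τ)) :
    Tendsto (fun t : ℝ => defect hN τ (formMat L H (expPoint (wallBase N + t • wallDir hN))))
        (𝓝[>] 0) (𝓝 0) := by
  have hπ := pi_div_pos hN
  have hN' : (3 : ℝ) ≤ N := by exact_mod_cast hN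
  have hκ2 : 0 < 1 - 2 * |κ| := by
    have : 3 * |κ| ≤ N * |κ| := mul_le_mul_of_nonneg_right hN' (abs_nonneg κ)
    linarith [abs_nonneg κ]
  set M := ((seriesSol hN τ κ α₀ (basePoint N))ᴴ)⁻¹ * H * (seriesSol hN τ κ α₀ (basePoint N))⁻¹
    with hM
  set c := (∏ j, expPoint (wallBase N) j) ^ (-(gam τ : ℂ) * κ) with hc
  obtain ⟨C₁, hC₁0, hC₁⟩ := exists_norm_arcRho_le hN τ κ
  obtain ⟨C₂, hC₂⟩ := exists_norm_arcSum_sub_le hκ hα₀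
  obtain ⟨C₃, hC₃⟩ := isCompact_Icc.exists_bound_of_continuousOn (continuousOn_arcSum hκ hα₀)
  have hC₃0 : 0 ≤ C₃ := (norm_nonneg _).trans (hC₃ 0 ⟨le_rfl, hπ.le⟩)
  have hbound : ∀ s ∈ Ioo 0 (Real.pi / N),
      ‖defect hN τ (formMat L H (expPoint (wallBase N + s • wallDir hN)))‖
      ≤ 4 * (‖c‖ * ‖c‖ * ‖M‖ * C₁ ^ 2) * C₃ * C₂ * Real.sin s ^ (1 - 2 * |κ|) := by
    intro s hs
    have hsin := sin_pos_of_mem hN hs.1 hs.2.le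
    have hs' : s ∈ Icc 0 (Real.pi / N) := ⟨hs.1.le, hs.2.le⟩
    set E := arcRho hN τ κ s with hE
    set Ψ := arcSum hN τ κ α₀ s with hΨ
    -- All factors commuting with `σ` are collected in `W`, of size `sin(s)^(-2|κ|)`. The series is
    -- within `O(sin s)` of `α₀`, which commutes with `σ`, so the defect is `O(sin(s)^(1-2|κ|))`.
    set W := (star c * c) • (Eᴴ * M * E) with hW
    have hSE : sigma hN τ * E = E * sigma hN τ := arcRho_commute s
    have hSE' : sigma hN τ * Eᴴ = Eᴴ * sigma hN τ := by
      have := congrArg Matrix.conjTranspose hSE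
      rw [Matrix.conjTranspose_mul, Matrix.conjTranspose_mul, sigma_conjTranspose] at this
      exact this.symm
    have e1 : formMat L H (expPoint (wallBase N + s • wallDir hN)) = Ψᴴ * W * Ψ := by
      have := formMat_arc hκ hα₀ hL H hs.1 hs.2.le
      rw [arc] at this
      rw [this, ← arc, seriesSol_arc, ← hc, arcSol, ← hE, ← hΨ, Matrix.conjTranspose_smul,
        Matrix.conjTranspose_mul, hW, ← hM]
      simp only [smul_mul_assoc, mul_smul_comm, smul_smul, mul_assoc, mul_comm]
    have hWc : sigma hN τ * W = W * sigma hN τ := by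
      rw [hW, mul_smul_comm, smul_mul_assoc]
      congr 1
      calc sigma hN τ * (Eᴴ * M * E) = (sigma hN τ * Eᴴ) * M * E := by simp only [mul_assoc]
        _ = Eᴴ * (sigma hN τ * M) * E := by rw [hSE']; simp only [mul_assoc]
        _ = Eᴴ * M * (sigma hN τ * E) := by rw [← hσ.eq]; simp only [mul_assoc]
        _ = _ := by rw [hSE]; simp only [mul_assoc]
    rw [e1]
    refine (norm_defect_conj_le hWc (leadingCoeff_arc_commute hα₀ hs')).trans ?_
    have hEn := hC₁ s hs.1 hs.2.le
    have hWn : ‖W‖ ≤ ‖c‖ * ‖c‖ * ‖M‖ * C₁ ^ 2 * (Real.sin s ^ (-|κ|)) ^ 2 := by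
      rw [hW, norm_smul, norm_mul, norm_star]
      have h2 : ‖Eᴴ * M * E‖ ≤ ‖E‖ * ‖M‖ * ‖E‖ := by
        refine (norm_mul_le _ _).trans (mul_le_mul_of_nonneg_right ((norm_mul_le _ _).trans ?_)
          (norm_nonneg _))
        rw [Matrix.l2_opNorm_conjTranspose]
      have h3 : ‖E‖ * ‖M‖ * ‖E‖ ≤ (C₁ * Real.sin s ^ (-|κ|)) * ‖M‖ * (C₁ * Real.sin s ^ (-|κ|)) := by
        have : 0 ≤ Real.sin s ^ (-|κ|) := Real.rpow_nonneg hsin.le _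
        gcongr
      calc ‖c‖ * ‖c‖ * ‖Eᴴ * M * E‖
          ≤ ‖c‖ * ‖c‖ * ((C₁ * Real.sin s ^ (-|κ|)) * ‖M‖ * (C₁ * Real.sin s ^ (-|κ|))) := by
            gcongr
            exact h2.trans h3
        _ = _ := by ring
    have h4 : ‖Ψ - α₀ (faceY N, arcU N s)‖ ≤ C₂ * Real.sin s := by
      have := hC₂ s hs'
      rwa [abs_of_pos hsin] at this
    have h5 := hC₃ s hs'
    have hr : (Real.sin s ^ (-|κ|)) ^ 2 * Real.sin s = Real.sin s ^ (1 - 2 * |κ|) := by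
      rw [← Real.rpow_natCast, ← Real.rpow_mul hsin.le, ← Real.rpow_add_one hsin.ne']
      congr 1
      push_cast
      ring
    have : 0 ≤ Real.sin s ^ (-|κ|) := Real.rpow_nonneg hsin.le _
    calc 4 * ‖W‖ * ‖Ψ‖ * ‖Ψ - α₀ (faceY N, arcU N s)‖
        ≤ 4 * (‖c‖ * ‖c‖ * ‖M‖ * C₁ ^ 2 * (Real.sin s ^ (-|κ|)) ^ 2) * C₃ * (C₂ * Real.sin s) := by
          gcongr
      _ = 4 * (‖c‖ * ‖c‖ * ‖M‖ * C₁ ^ 2) * C₃ * C₂ * ((Real.sin s ^ (-|κ|)) ^ 2 * Real.sin s) := by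
          ring
      _ = _ := by rw [hr]
  have hlim : Tendsto (fun s : ℝ => 4 * (‖c‖ * ‖c‖ * ‖M‖ * C₁ ^ 2) * C₃ * C₂ *
      Real.sin s ^ (1 - 2 * |κ|)) (𝓝[>] 0) (𝓝 0) := by
    have h1 : Tendsto (fun s : ℝ => Real.sin s ^ (1 - 2 * |κ|)) (𝓝 0) (𝓝 0) := by
      have := (Real.continuous_sin.tendsto 0).rpow_const (p := 1 - 2 * |κ|) (Or.inr hκ2.le)
      rwa [Real.sin_zero, Real.zero_rpow hκ2.ne'] at this
    have h2 := (h1.mono_left (nhdsWithin_le_nhds (s := Ioi 0))).const_mul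
      (4 * (‖c‖ * ‖c‖ * ‖M‖ * C₁ ^ 2) * C₃ * C₂)
    rwa [mul_zero] at h2
  refine squeeze_zero_norm' ?_ hlim
  filter_upwards [Ioo_mem_nhdsGT hπ] with s hs using hbound s hs

/-- The decay of `K - σKσ` near every wall point. -/
lemma exists_norm_defect_le_of_commute (hκ : 4 * (N * |κ|) ≤ 1) (hp : growthExp N κ < 1)
    (hα₀ : IsLeadingCoeff hN τ κ D α₀)
    (hL : IsFundamentalMatrix hN τ κ L) {H : Matrix (Fin n) (Fin n) ℂ}
    (hσ : Commute (((seriesSol hN τ κ α₀ (basePoint N))ᴴ)⁻¹ * H *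
        (seriesSol hN τ κ α₀ (basePoint N))⁻¹) (sigma hN τ)) (R : ℝ) :
    ∃ C, 0 ≤ C ∧ ∀ (q : Fin N → ℝ) (d s : ℝ), 0 < s → s ≤ d → d ≤ 1 → d ≤ Real.pi / N →
      (∀ i, |q i| ≤ R) → IsWallPoint hN (2 * d) s q →
      ‖defect hN τ (formMat L H (expPoint (q + s • wallDir hN)))‖
        ≤ C / d * s ^ (1 - growthExp N κ) := by
  obtain ⟨C, hC0, hC⟩ := exists_norm_defect_le hp hL H R
  have hπ := pi_div_pos hN
  refine ⟨C, hC0, fun q d s hs hsd hd1 hdπ hq hw => hC q d s hs hsd hd1 hq hw ?_⟩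
  -- Transport along the wall needs a single separation for all pairs, so `d` is weakened to `s`.
  -- Only a limit is taken from it; the rate with the original `d` comes from `hC`.
  have hw' : IsWallPoint hN (2 * s) s q :=
    ⟨hw.eq, fun i hi => ⟨by linarith [(hw.sep i hi).1], by linarith [(hw.sep i hi).2]⟩, hw.rest⟩
  exact tendsto_defect_of_isWallPoint hp hL H hs (hsd.trans hd1)
    (isWallPoint_wallBase hN (by linarith) (by linarith)) hw'
    (tendsto_defect_wallBase hκ hα₀ hL hσ)

end series

end

end TorusDunkl

namespace TorusDunkl

noncomputable section

open scoped Matrix.Norms.L2Operator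
open Set Filter Topology

variable {N n : ℕ}

/-! ### Bounds in terms of the chords between the coordinates -/

/-- Half the distance of the points `x_a` and `x_b` of the unit circle. -/
def chord (θ : Fin N → ℝ) (a b : Fin N) : ℝ := |Real.sin ((θ a - θ b) / 2)|

lemma chord_comm (θ : Fin N → ℝ) (a b : Fin N) : chord θ a b = chord θ b a := by
  rw [chord, chord, ← neg_sub, neg_div, Real.sin_neg, abs_neg]

lemma chord_nonneg (θ : Fin N → ℝ) (a b : Fin N) : 0 ≤ chord θ a b := abs_nonneg _

lemma chord_comp (θ : Fin N → ℝ) (w : Equiv.Perm (Fin N)) (a b : Fin N) :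
    chord (θ ∘ w) a b = chord θ (w a) (w b) := rfl

lemma chord_add_two_pi (θ : Fin N → ℝ) (m : Fin N → ℤ) (a b : Fin N) :
    chord (fun i => θ i + m i * (2 * Real.pi)) a b = chord θ a b := by
  have e : (θ a + m a * (2 * Real.pi) - (θ b + m b * (2 * Real.pi))) / 2
      = (θ a - θ b) / 2 + ((m a - m b : ℤ) : ℝ) * Real.pi := by push_cast; ring
  rw [chord, chord, e, Real.sin_add_int_mul_pi, abs_mul]
  simp

lemma expPoint_injective_of_chord {θ : Fin N → ℝ} (h : ∀ a b, a ≠ b → 0 < chord θ a b) :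
    Function.Injective (expPoint θ) :=
  expPoint_injective_iff.2 fun a b hab => abs_pos.1 (h a b hab)

lemma gap_of_le_abs_sin {g ε : ℝ} (h0 : 0 < g) (h1 : g < 2 * Real.pi)
    (h : ε ≤ |Real.sin (g / 2)|) : 2 * ε ≤ g ∧ g ≤ 2 * Real.pi - 2 * ε := by
  have hpos : 0 < Real.sin (g / 2) :=
    Real.sin_pos_of_pos_of_lt_pi (by linarith) (by linarith)
  rw [abs_of_pos hpos] at h
  have h2 : Real.sin (g / 2) ≤ g / 2 := Real.sin_le (by linarith)
  have h3 : Real.sin (Real.pi - g / 2) ≤ Real.pi - g / 2 := Real.sin_le (by linarith)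
  rw [Real.sin_pi_sub] at h3
  constructor <;> linarith

lemma gap_of_le_chord {hN : 3 ≤ N} {θ : Fin N → ℝ} (hθ : θ ∈ angleChamber hN) {ε : ℝ}
    {i j : Fin N} (hij : i < j) (h : ε ≤ chord θ j i) :
    2 * ε ≤ θ j - θ i ∧ θ j - θ i ≤ 2 * Real.pi - 2 * ε := by
  have h1 := angleChamber_iff.1 hθ i j hij
  exact gap_of_le_abs_sin h1.1 h1.2 h

lemma norm_rep_inv_mul_mul (τ : Equiv.Perm (Fin N) →* Matrix.orthogonalGroup (Fin n) ℝ)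
    (w : Equiv.Perm (Fin N)) (K : Matrix (Fin n) (Fin n) ℂ) :
    ‖rep τ w⁻¹ * K * rep τ w‖ = ‖K‖ := by
  refine le_antisymm ((norm_mul_rep_le τ _ _).trans (norm_rep_mul_le τ _ _)) ?_
  have e : K = rep τ w * (rep τ w⁻¹ * K * rep τ w) * rep τ w⁻¹ := by
    rw [mul_assoc, mul_assoc _ _ (rep τ w⁻¹), rep_mul_inv, mul_one, ← mul_assoc, rep_mul_inv,
      one_mul]
  conv_lhs => rw [e]
  exact (norm_mul_rep_le τ _ _).trans (norm_rep_mul_le τ _ _)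

lemma abs_le_of_mem_Ioc {x y : ℝ} (hy : |y| ≤ Real.pi) (h : x ∈ Ioc (y - 2 * Real.pi) y) :
    |x| ≤ 3 * Real.pi := by
  have := abs_le.1 hy
  rw [abs_le]
  constructor <;> linarith [h.1, h.2, Real.pi_pos]

section bounds

variable {hN : 3 ≤ N} {τ : Equiv.Perm (Fin N) →* Matrix.orthogonalGroup (Fin n) ℝ} {κ : ℝ}
  {L : (Fin N → ℂ) → Matrix (Fin n) (Fin n) ℂ} {H : Matrix (Fin n) (Fin n) ℂ}

/-- Equivariance moves the point into the chamber without changing the norm. The representatives of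
the angles stay within `3π`, so one constant suffices, and chords of length `ε` give gaps of at
least `2ε`. -/
lemma exists_norm_formMat_le (hn : 2 ≤ n) (hτ : (complexRep τ).IsIrreducible)
    (hL : IsFundamentalMatrix hN τ κ L) (hυ : Commute (upsilon τ) H) :
    ∃ C : ℝ, 0 ≤ C ∧ ∀ θ : Fin N → ℝ, (∀ i, |θ i| ≤ Real.pi) → ∀ ε : ℝ, 0 < ε →
      (∀ a b, a ≠ b → ε ≤ chord θ a b) →
      ‖formMat L H (expPoint θ)‖ ≤ C * ε ^ (-growthExp N κ) := by
  obtain ⟨C, hC, h⟩ := exists_norm_formMat_le_of_mem hL H (3 * Real.pi)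
  refine ⟨C * 2 ^ (-growthExp N κ), by positivity, fun θ hθ ε hε hch => ?_⟩
  have hinj := expPoint_injective_of_chord fun a b hab => hε.trans_le (hch a b hab)
  obtain ⟨w, m, hw, -, -, hIoc⟩ := exists_perm_mem_angleChamber hN hinj (lstIdx hN)
  have h1 := h _ hw (fun i => abs_le_of_mem_Ioc (hθ _) (hIoc (w i))) (2 * ε) (by positivity)
    fun i j hij => gap_of_le_chord hw hij (by
      rw [chord_comp, chord_add_two_pi]
      exact hch _ _ fun e => hij.ne' (w.injective e))
  rw [expPoint_comp, expPoint_add_two_pi, formMat_comp hn hτ hL hυ hinj, norm_rep_inv_mul_mul,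
    Real.mul_rpow zero_le_two hε.le, ← mul_assoc] at h1
  exact h1

/-- Two rounds: the linear lower bound for the sine gives `s ≤ 3ε`, and then the cubic one improves
the constant to `2`. -/
lemma le_of_sin_le {s ε : ℝ} (h0 : 0 < s) (h1 : s ≤ Real.pi / 2) (hε : ε ≤ 1 / 36)
    (h : Real.sin s ^ 2 ≤ 2 * ε ^ 2) (hε0 : 0 < ε) : s ≤ 2 * ε := by
  have hs0 : 0 ≤ Real.sin s := Real.sin_nonneg_of_nonneg_of_le_pi h0.le (by linarith [Real.pi_pos])
  have h2 : Real.sin s ≤ 3 / 2 * ε := by nlinarith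
  have h3 : 2 / Real.pi * s ≤ Real.sin s := Real.mul_le_sin h0.le h1
  have h4 : s ≤ 3 * ε := by
    have h5 : 1 / 2 * s ≤ 2 / Real.pi * s := by
      refine mul_le_mul_of_nonneg_right ?_ h0.le
      rw [div_le_div_iff₀ two_pos Real.pi_pos]
      linarith [Real.pi_le_four]
    linarith
  have h5 := Real.sin_gt_sub_cube h0
  nlinarith [mul_pos h0 h0]

/-- Near the wall `x_a = x_b` and away from the other walls, the matrix `K` almost commutes with
`τ((a,b))`. -/
lemma exists_norm_formMat_sub_le (hκ : 4 * (N * |κ|) ≤ 1) (hp : growthExp N κ < 1)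
    {D : Set ((Fin (N - 2) → ℂ) × ℂ)} {α₀ : (Fin (N - 2) → ℂ) × ℂ → Matrix (Fin n) (Fin n) ℂ}
    (hα₀ : IsLeadingCoeff hN τ κ D α₀) (hn : 2 ≤ n) (hτ : (complexRep τ).IsIrreducible)
    (hL : IsFundamentalMatrix hN τ κ L) (hυ : Commute (upsilon τ) H)
    (hσ : Commute (((seriesSol hN τ κ α₀ (basePoint N))ᴴ)⁻¹ * H *
        (seriesSol hN τ κ α₀ (basePoint N))⁻¹) (sigma hN τ)) :
    ∃ C ε₀ : ℝ, 0 ≤ C ∧ 0 < ε₀ ∧ ∀ θ : Fin N → ℝ, (∀ i, |θ i| ≤ Real.pi) → ∀ ε : ℝ, 0 < ε →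
      ε ≤ ε₀ → (∀ a b, a ≠ b → ε ≤ chord θ a b) → ∀ a b, a ≠ b → chord θ a b ^ 2 ≤ 2 * ε ^ 2 →
      (∀ k, k ≠ a → k ≠ b → √ε ≤ chord θ a k ∧ √ε ≤ chord θ b k) →
      ‖formMat L H (expPoint θ)
          - rep τ (Equiv.swap a b) * formMat L H (expPoint θ) * rep τ (Equiv.swap a b)‖
        ≤ C * ε ^ (1 / 2 - growthExp N κ) := by
  obtain ⟨C, hC, hdef⟩ := exists_norm_defect_le_of_commute hκ hp hα₀ hL hσ (3 * Real.pi + 1)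
  have hπN := pi_div_pos hN
  have hpp := Real.pi_pos
  set p := growthExp N κ with hpd
  -- The bound `1/100` yields `10 ε ≤ √ε`, which separates the two scales; `(π/N)²` makes `√ε / 2`
  -- an admissible value of `d`.
  refine ⟨2 * C * 2 ^ (1 - p), min (1 / 100) ((Real.pi / N) ^ 2), by positivity,
    lt_min (by norm_num) (by positivity), fun θ hθ ε hε hε₀ hch a b hab hclose hfar => ?_⟩
  have hε1 : ε ≤ 1 / 100 := hε₀.trans (min_le_left _ _)
  have hε2 : ε ≤ (Real.pi / N) ^ 2 := hε₀.trans (min_le_right _ _)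
  have hinj := expPoint_injective_of_chord fun a b hab => hε.trans_le (hch a b hab)
  have hsq0 : 0 < √ε := Real.sqrt_pos.2 hε
  have hsq : √ε * √ε = ε := Real.mul_self_sqrt hε.le
  have hsq1 : √ε ≤ 1 / 10 := by nlinarith
  have hsq2 : 10 * ε ≤ √ε := by nlinarith
  have hsqN : √ε ≤ Real.pi / N := Real.sqrt_le_iff.2 ⟨hπN.le, hε2⟩
  -- the case where `a` lies just before `b` on the circle
  have key : ∀ a b, a ≠ b → chord θ a b ^ 2 ≤ 2 * ε ^ 2 →
      (∀ k, k ≠ a → k ≠ b → √ε ≤ chord θ a k ∧ √ε ≤ chord θ b k) →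
      (∃ m : Fin N → ℤ, ∃ w : Equiv.Perm (Fin N),
        (fun i => θ i + m i * (2 * Real.pi)) ∘ w ∈ angleChamber hN ∧ w (lstIdx hN) = b ∧
        (∀ i, |θ i + m i * (2 * Real.pi)| ≤ 3 * Real.pi) ∧
        (θ b + m b * (2 * Real.pi)) - (θ a + m a * (2 * Real.pi)) ≤ Real.pi) →
      ‖formMat L H (expPoint θ)
          - rep τ (Equiv.swap a b) * formMat L H (expPoint θ) * rep τ (Equiv.swap a b)‖
        ≤ 2 * C * 2 ^ (1 - p) * ε ^ (1 / 2 - p) := by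
    intro a b hab hclose hfar ⟨m, w, hw, hwb, hbd, hle⟩
    set θ' : Fin N → ℝ := (fun i => θ i + m i * (2 * Real.pi)) ∘ w with hθ'
    have hchord : ∀ i j, chord θ' i j = chord θ (w i) (w j) := fun i j => by
      rw [hθ', chord_comp, chord_add_two_pi]
    have hia : w (w⁻¹ a) = a := w.apply_symm_apply a
    have hlt : w⁻¹ a < lstIdx hN := by
      refine lt_of_le_of_ne (Nat.le_sub_one_of_lt (w⁻¹ a).2) fun e => hab ?_
      rw [← hia, e, hwb]
    have hgap : θ' (lstIdx hN) - θ' (w⁻¹ a) ≤ Real.pi := by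
      simp only [hθ', Function.comp_apply, hia, hwb]
      exact hle
    have hgap0 := (angleChamber_iff.1 hw _ _ hlt).1
    have hsmall : (θ' (lstIdx hN) - θ' (w⁻¹ a)) / 2 ≤ 2 * ε := by
      refine le_of_sin_le (by linarith) (by linarith) (by linarith) ?_ hε
      have h1 := hchord (w⁻¹ a) (lstIdx hN)
      rw [hia, hwb, chord_comm, chord] at h1
      rw [← sq_abs, h1]
      exact hclose
    -- Otherwise another coordinate would lie between `a` and `b` on the circle, with chord to `b`
    -- at most `2ε`, less than `√ε`.
    have hpen : w⁻¹ a = penIdx hN := by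
      by_contra hne
      have h1 : w⁻¹ a < penIdx hN := by
        have e1 : (lstIdx hN : ℕ) = N - 1 := rfl
        have e2 : (penIdx hN : ℕ) = N - 2 := rfl
        have hne' : (w⁻¹ a : ℕ) ≠ penIdx hN := fun e => hne (Fin.ext e)
        rw [Fin.lt_def] at hlt ⊢
        omega
      have h2 := (angleChamber_iff.1 hw _ _ h1).1
      have hpl := (angleChamber_iff.1 hw _ _ (penIdx_lt_lstIdx hN)).1
      have h3 := (hfar (w (penIdx hN)) (fun e => hne (by rw [← e]; exact w.symm_apply_apply _))
        (fun e => (penIdx_lt_lstIdx hN).ne (w.injective (e.trans hwb.symm)))).2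
      rw [← hwb, ← hchord] at h3
      have h4 : chord θ' (lstIdx hN) (penIdx hN) ≤ (θ' (lstIdx hN) - θ' (penIdx hN)) / 2 := by
        rw [chord]
        exact (Real.abs_sin_le_abs).trans (le_of_eq (abs_of_pos (by linarith)))
      linarith
    rw [hpen] at hgap hgap0 hsmall
    have hwa : w (penIdx hN) = a := by rw [← hpen, hia]
    set s := (θ' (lstIdx hN) - θ' (penIdx hN)) / 2 with hs
    set q := θ' - s • wallDir hN with hq
    have hs0 : 0 < s := by linarith
    have hqlst : q (lstIdx hN) = θ' (lstIdx hN) - s := by simp [hq]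
    have hqpen : q (penIdx hN) = θ' (lstIdx hN) - s := by
      simp only [hq, Pi.sub_apply, Pi.smul_apply, wallDir_pen, smul_eq_mul]
      rw [hs]
      ring
    have hqlt : ∀ i, i < penIdx hN → q i = θ' i := fun i hi => by
      simp [hq, wallDir_of_lt hi]
    have hqθ : q + s • wallDir hN = θ' := by rw [hq, sub_add_cancel]
    have hwall : IsWallPoint hN (2 * (√ε / 2)) s q := by
      refine ⟨by rw [hqlst, hqpen], fun i hi => ?_, fun i j hij hj => ?_⟩
      · rw [hqlst, hqlt i hi]
        have hil : i < lstIdx hN := hi.trans (penIdx_lt_lstIdx hN)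
        have h1 := gap_of_le_chord hw (ε := √ε) hil (by
          rw [hchord, hwb]
          exact (hfar (w i) (fun e => hi.ne (w.injective (e.trans hwa.symm)))
            (fun e => hil.ne (w.injective (e.trans hwb.symm)))).2)
        constructor <;> linarith
      · rw [hqlt i (hij.trans hj), hqlt j hj]
        have h1 := gap_of_le_chord hw (ε := ε) hij (by
          rw [hchord]
          exact hch _ _ fun e => hij.ne' (w.injective e))
        constructor <;> linarith
    -- The wall point is the configuration with `a` and `b` moved to their midpoint. With `d` of
    -- order `√ε` and `s ≤ 2ε` the bound `s^(1-p)/d` becomes `ε^(1/2-p)`.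
    have h1 := hdef q (√ε / 2) s hs0 (by linarith) (by linarith) (by linarith) (fun i => by
      have h2 : |θ' i| ≤ 3 * Real.pi := hbd (w i)
      have h3 : |s * wallDir hN i| ≤ 1 := by
        rw [abs_mul, abs_of_pos hs0]
        nlinarith [abs_wallDir_le (hN := hN) i, abs_nonneg (wallDir hN i)]
      calc |q i| = |θ' i - s * wallDir hN i| := rfl
        _ ≤ |θ' i| + |s * wallDir hN i| := abs_sub _ _
        _ ≤ _ := by linarith) hwall
    have e1 : defect hN τ (formMat L H (expPoint θ'))
        = rep τ w⁻¹ * (formMat L H (expPoint θ)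
          - rep τ (Equiv.swap a b) * formMat L H (expPoint θ) * rep τ (Equiv.swap a b))
          * rep τ w := by
      have e2 : rep τ w * sigma hN τ = rep τ (Equiv.swap a b) * rep τ w := by
        rw [sigma, rep_mul_swap, hwa, hwb]
      have e3 : sigma hN τ * rep τ w⁻¹ = rep τ w⁻¹ * rep τ (Equiv.swap a b) := by
        have h4 : w⁻¹ a = penIdx hN := hpen
        have h5 : w⁻¹ b = lstIdx hN := by rw [← hwb]; exact w.symm_apply_apply _
        rw [rep_mul_swap, h4, h5, sigma]
      rw [hθ', expPoint_comp, expPoint_add_two_pi, formMat_comp hn hτ hL hυ hinj, defect, mul_sub,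
        sub_mul]
      congr 1
      calc sigma hN τ * (rep τ w⁻¹ * formMat L H (expPoint θ) * rep τ w) * sigma hN τ
          = (sigma hN τ * rep τ w⁻¹) * formMat L H (expPoint θ) * (rep τ w * sigma hN τ) := by
            simp only [mul_assoc]
        _ = _ := by rw [e2, e3]; simp only [mul_assoc]
    rw [hqθ, e1, norm_rep_inv_mul_mul] at h1
    refine h1.trans ?_
    have hp1 : 0 ≤ 1 - p := by linarith
    have h2 : s ^ (1 - p) ≤ 2 ^ (1 - p) * ε ^ (1 - p) := by
      rw [← Real.mul_rpow zero_le_two hε.le]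
      exact Real.rpow_le_rpow hs0.le hsmall hp1
    have h3 : ε ^ (1 - p) = √ε * ε ^ (1 / 2 - p) := by
      rw [Real.sqrt_eq_rpow, ← Real.rpow_add hε]
      congr 1
      ring
    calc C / (√ε / 2) * s ^ (1 - p) ≤ C / (√ε / 2) * (2 ^ (1 - p) * ε ^ (1 - p)) := by gcongr
      _ = 2 * C * 2 ^ (1 - p) * ε ^ (1 / 2 - p) := by
        rw [h3]
        field_simp
  obtain ⟨w, m, hw, hwb, hmb, hIoc⟩ := exists_perm_mem_angleChamber hN hinj b
  -- If `a` is not within `π` before `b` on the circle, then `b` is within `π` before `a`. The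
  -- assertion is symmetric in the two, so their roles are exchanged.
  by_cases hle : (θ b + m b * (2 * Real.pi)) - (θ a + m a * (2 * Real.pi)) ≤ Real.pi
  · exact key a b hab hclose hfar ⟨m, w, hw, hwb, fun i => abs_le_of_mem_Ioc (hθ b) (hIoc i), hle⟩
  · obtain ⟨w', m', hw', hwa', hma', hIoc'⟩ := exists_perm_mem_angleChamber hN hinj a
    rw [Equiv.swap_comm]
    refine key b a hab.symm (by rwa [chord_comm]) (fun k hb ha => (hfar k ha hb).symm)
      ⟨m', w', hw', hwa', fun i => abs_le_of_mem_Ioc (hθ a) (hIoc' i), ?_⟩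
    rw [hma']
    rw [hmb] at hle
    simp only [Int.cast_zero, zero_mul, add_zero] at hle ⊢
    have h1 := hIoc a
    have h2 := hIoc' b
    -- the two representatives of `x_a - x_b` differ by a multiple of `2π`
    have h3 : ((m a + m' b : ℤ) : ℝ) * (2 * Real.pi) < Real.pi := by
      push_cast
      linarith [h2.2]
    have h4 : -(4 * Real.pi) < ((m a + m' b : ℤ) : ℝ) * (2 * Real.pi) := by
      push_cast
      linarith [h1.1, h2.1]
    have h5 : m a + m' b < 1 := by
      by_contra! hge
      have : (1 : ℝ) ≤ ((m a + m' b : ℤ) : ℝ) := by exact_mod_cast hge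
      nlinarith
    have h6 : -2 < m a + m' b := by
      by_contra! hge
      have : ((m a + m' b : ℤ) : ℝ) ≤ -2 := by exact_mod_cast hge
      nlinarith
    have h7 : m' b = -1 - m a ∨ m' b = -m a := by omega
    rcases h7 with h7 | h7 <;> rw [h7] <;> push_cast <;> linarith [Real.pi_pos]

end bounds

end

end TorusDunkl

namespace TorusDunkl

noncomputable section

open scoped Matrix.Norms.L2Operator
open Set Filter Topology

variable {N n : ℕ}

/-! ### The measure of neighbourhoods of the walls -/

section box

open MeasureTheory

/-- Lebesgue measure on the angles `-π < θ_j ≤ π`. -/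
def boxMeasure (N : ℕ) : Measure (Fin N → ℝ) :=
  volume.restrict (univ.pi fun _ => Ioc (-Real.pi) Real.pi)

lemma boxMeasure_eq_pi : boxMeasure N =
    Measure.pi fun _ : Fin N => (volume : Measure ℝ).restrict (Ioc (-Real.pi) Real.pi) := by
  rw [boxMeasure, volume_pi, Measure.restrict_pi_pi]

instance : IsFiniteMeasure (boxMeasure N) := by
  rw [boxMeasure_eq_pi]
  infer_instance

lemma ae_boxMeasure_abs_le : ∀ᵐ θ ∂boxMeasure N, ∀ i, |θ i| ≤ Real.pi := by
  have hm : MeasurableSet (univ.pi fun _ : Fin N => Ioc (-Real.pi) Real.pi) :=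
    MeasurableSet.univ_pi fun _ => measurableSet_Ioc
  filter_upwards [ae_restrict_mem hm] with θ hθ i
  exact abs_le.2 ⟨(hθ i trivial).1.le, (hθ i trivial).2⟩

lemma measurePreserving_comp_perm (w : Equiv.Perm (Fin N)) :
    MeasurePreserving (fun θ : Fin N → ℝ => θ ∘ w) (boxMeasure N) (boxMeasure N) := by
  rw [boxMeasure_eq_pi]
  have h := measurePreserving_piCongrLeft
    (fun _ : Fin N => (volume : Measure ℝ).restrict (Ioc (-Real.pi) Real.pi)) w.symm
  convert h using 1
  ext θ i
  simp [MeasurableEquiv.coe_piCongrLeft, Equiv.piCongrLeft_apply_eq_cast]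

lemma continuous_chord (a b : Fin N) : Continuous fun θ : Fin N → ℝ => chord θ a b := by
  unfold chord
  fun_prop

/-- The linear lower bound for the sine puts `t` within `πρ` of a translate of `a` by a multiple of
`2π`. Three translates can meet the interval, and each accounts for a length `2πρ`. -/
lemma volume_sin_le (a : ℝ) {ρ : ℝ} (hρ : 0 ≤ ρ) :
    volume.restrict (Ioc (-Real.pi) Real.pi) {t : ℝ | |Real.sin ((a - t) / 2)| ≤ ρ}
      ≤ ENNReal.ofReal (6 * Real.pi * ρ) := by
  have hpi := Real.pi_pos
  -- the set lies in three intervals around the translates of a representative of `a`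
  obtain ⟨m, hm⟩ : ∃ m : ℤ, a + m * (2 * Real.pi) ∈ Ico (-Real.pi) (-Real.pi + 2 * Real.pi) := by
    obtain ⟨m, hm, -⟩ := existsUnique_add_zsmul_mem_Ico Real.two_pi_pos a (-Real.pi)
    exact ⟨m, by simpa using hm⟩
  set a' := a + m * (2 * Real.pi) with ha'
  have hsub : {t : ℝ | |Real.sin ((a - t) / 2)| ≤ ρ} ∩ Ioc (-Real.pi) Real.pi ⊆
      (Icc (a' - Real.pi * ρ) (a' + Real.pi * ρ) ∪
        Icc (a' + 2 * Real.pi - Real.pi * ρ) (a' + 2 * Real.pi + Real.pi * ρ)) ∪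
        Icc (a' - 2 * Real.pi - Real.pi * ρ) (a' - 2 * Real.pi + Real.pi * ρ) := by
    rintro t ⟨ht, ht1, ht2⟩
    have key : ∀ k : ℤ, |(a' - t) / 2 + k * Real.pi| ≤ Real.pi / 2 →
        |a' - t + 2 * (k * Real.pi)| ≤ Real.pi * ρ := fun k hk => by
      have h1 := Real.mul_abs_le_abs_sin hk
      have e : (a' - t) / 2 + k * Real.pi = (a - t) / 2 + ((m + k : ℤ) : ℝ) * Real.pi := by
        rw [ha']
        push_cast
        ring
      have h2 : |Real.sin ((a' - t) / 2 + k * Real.pi)| ≤ ρ := by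
        rw [e, Real.sin_add_int_mul_pi, abs_mul]
        simpa using ht
      have h3 := h1.trans h2
      rw [div_mul_eq_mul_div, div_le_iff₀ hpi] at h3
      calc |a' - t + 2 * (k * Real.pi)| = |2 * ((a' - t) / 2 + k * Real.pi)| := by
            congr 1
            ring
        _ = 2 * |(a' - t) / 2 + k * Real.pi| := by rw [abs_mul, abs_two]
        _ ≤ Real.pi * ρ := by linarith
    have hlow := hm.1
    have hupp := hm.2
    rcases le_or_gt (a' - t) Real.pi with h1 | h1
    · rcases le_or_gt (-Real.pi) (a' - t) with h2 | h2
      · have h3 := abs_le.1 (key 0 (by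
          rw [abs_le]
          constructor <;> push_cast <;> linarith))
        push_cast at h3
        left; left
        constructor <;> linarith [h3.1, h3.2]
      · have h3 := abs_le.1 (key 1 (by
          rw [abs_le]
          constructor <;> push_cast <;> linarith))
        push_cast at h3
        left; right
        constructor <;> linarith [h3.1, h3.2]
    · have h3 := abs_le.1 (key (-1) (by
        rw [abs_le]
        constructor <;> push_cast <;> linarith))
      push_cast at h3
      right
      constructor <;> linarith [h3.1, h3.2]
  rw [Measure.restrict_apply' measurableSet_Ioc]
  refine (measure_mono hsub).trans ((measure_union_le _ _).trans
    ((add_le_add_left (measure_union_le _ _) _).trans ?_))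
  rw [Real.volume_Icc, Real.volume_Icc, Real.volume_Icc, ← ENNReal.ofReal_add, ← ENNReal.ofReal_add]
  · exact ENNReal.ofReal_le_ofReal (by linarith)
  all_goals nlinarith [mul_nonneg hpi.le hρ]

/-- A function that does not depend on `θ_k` has on the strip `{chord θ a k ≤ ρ}` at most `3ρ` times
its integral. -/
lemma lintegral_indicator_strip_le {g : (Fin N → ℝ) → ENNReal} (hg : Measurable g) {a k : Fin N}
    (hak : a ≠ k) (hgk : ∀ θ t, g (Function.update θ k t) = g θ) {ρ : ℝ} (hρ : 0 ≤ ρ) :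
    ∫⁻ θ, {θ | chord θ a k ≤ ρ}.indicator g θ ∂boxMeasure N
      ≤ ENNReal.ofReal (3 * ρ) * ∫⁻ θ, g θ ∂boxMeasure N := by
  have hS : MeasurableSet {θ : Fin N → ℝ | chord θ a k ≤ ρ} :=
    measurableSet_le (continuous_chord a k).measurable measurable_const
  rw [← lintegral_const_mul _ hg, boxMeasure_eq_pi]
  -- Only the integration over `θ k` is compared: the strip has length at most `6πρ` there, which is
  -- `3ρ` times the full period.
  refine lintegral_le_of_lmarginal_le {k} (hg.indicator hS) (hg.const_mul _) fun θ => ?_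
  rw [lmarginal_singleton, lmarginal_singleton]
  have e1 : ∀ t, {θ : Fin N → ℝ | chord θ a k ≤ ρ}.indicator g (Function.update θ k t)
      = {t : ℝ | |Real.sin ((θ a - t) / 2)| ≤ ρ}.indicator (fun _ => g θ) t := fun t => by
    simp only [indicator, mem_ofPred_eq, hgk, chord, Function.update_self,
      Function.update_of_ne hak]
  have hT : MeasurableSet {t : ℝ | |Real.sin ((θ a - t) / 2)| ≤ ρ} :=
    measurableSet_le (by fun_prop) measurable_const
  simp only [e1, hgk]
  rw [lintegral_indicator_const hT, lintegral_const, Measure.restrict_apply_univ, Real.volume_Ioc,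
    mul_comm (ENNReal.ofReal (3 * ρ)), mul_assoc, ← ENNReal.ofReal_mul (by positivity)]
  refine mul_le_mul_right ((volume_sin_le _ hρ).trans (ENNReal.ofReal_le_ofReal (le_of_eq ?_))) _
  ring

lemma boxMeasure_inter_strip_le {S : Set (Fin N → ℝ)} (hS : MeasurableSet S) {a k : Fin N}
    (hak : a ≠ k) (hSk : ∀ θ t, Function.update θ k t ∈ S ↔ θ ∈ S) {ρ : ℝ} (hρ : 0 ≤ ρ) :
    boxMeasure N (S ∩ {θ | chord θ a k ≤ ρ}) ≤ ENNReal.ofReal (3 * ρ) * boxMeasure N S := by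
  have h := lintegral_indicator_strip_le (g := S.indicator 1) (measurable_one.indicator hS) hak
    (fun θ t => by by_cases h : θ ∈ S <;> simp [h, hSk θ t]) hρ
  have hT : MeasurableSet {θ : Fin N → ℝ | chord θ a k ≤ ρ} :=
    measurableSet_le (continuous_chord a k).measurable measurable_const
  rw [indicator_indicator, inter_comm, lintegral_indicator_one (hS.inter hT),
    lintegral_indicator_one hS] at h
  exact h

lemma real_strip_le {a b : Fin N} (hab : a ≠ b) {ρ : ℝ} (hρ : 0 ≤ ρ) :
    (boxMeasure N).real {θ | chord θ a b ≤ ρ} ≤ 3 * ρ * (boxMeasure N).real univ := by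
  have h := boxMeasure_inter_strip_le (N := N) MeasurableSet.univ hab (by simp) hρ
  rw [univ_inter] at h
  have := ENNReal.toReal_mono (by finiteness) h
  rwa [ENNReal.toReal_mul, ENNReal.toReal_ofReal (by positivity)] at this

/-- The first strip does not involve `θ k`, so the estimates for the two strips multiply. This
supplies the additional factor `√ε` where two walls come close. -/
lemma real_strip_inter_strip_le {a b c k : Fin N} (hab : a ≠ b) (hka : k ≠ a) (hkb : k ≠ b)
    (hck : c ≠ k) {ρ ρ' : ℝ} (hρ : 0 ≤ ρ) (hρ' : 0 ≤ ρ') :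
    (boxMeasure N).real ({θ | chord θ a b ≤ ρ} ∩ {θ | chord θ c k ≤ ρ'})
      ≤ 3 * ρ' * (3 * ρ * (boxMeasure N).real univ) := by
  have hS : MeasurableSet {θ : Fin N → ℝ | chord θ a b ≤ ρ} :=
    measurableSet_le (continuous_chord a b).measurable measurable_const
  have h := boxMeasure_inter_strip_le hS hck (fun θ t => by
    simp [chord, Function.update_of_ne hka.symm, Function.update_of_ne hkb.symm]) hρ'
  have h1 := ENNReal.toReal_mono (by finiteness) h
  rw [ENNReal.toReal_mul, ENNReal.toReal_ofReal (by positivity)] at h1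
  exact h1.trans (mul_le_mul_of_nonneg_left (real_strip_le hab hρ) (by positivity))

/-- The angles of the points with pairwise distinct coordinates. -/
def regAngles (N : ℕ) : Set (Fin N → ℝ) := {θ | ∀ a b, a ≠ b → 0 < chord θ a b}

lemma isOpen_regAngles : IsOpen (regAngles N) := by
  simp only [regAngles, ofPred_forall]
  exact isOpen_iInter_of_finite fun a => isOpen_iInter_of_finite fun b =>
    isOpen_iInter_of_finite fun _ => isOpen_lt continuous_const (continuous_chord a b)

lemma ae_mem_regAngles : ∀ᵐ θ ∂boxMeasure N, θ ∈ regAngles N := by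
  simp only [regAngles, mem_ofPred_eq]
  refine ae_all_iff.2 fun a => ae_all_iff.2 fun b => ?_
  by_cases hab : a = b
  · simp [hab]
  have h0 : (boxMeasure N).real {θ | chord θ a b ≤ 0} ≤ 0 := by
    simpa using real_strip_le hab le_rfl
  have h1 : boxMeasure N {θ | chord θ a b ≤ 0} = 0 :=
    (measureReal_eq_zero_iff (by finiteness)).1 (le_antisymm h0 measureReal_nonneg)
  have h2 : ∀ᵐ θ ∂boxMeasure N, 0 < chord θ a b := by
    rw [ae_iff]
    simpa using h1
  filter_upwards [h2] with θ h _ using h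

lemma aestronglyMeasurable_of_continuousOn {E : Type*} [NormedAddCommGroup E]
    [SecondCountableTopology E] {h : (Fin N → ℝ) → E} (hc : ContinuousOn h (regAngles N)) :
    AEStronglyMeasurable h (boxMeasure N) := by
  have h1 : AEStronglyMeasurable h ((boxMeasure N).restrict (regAngles N)) :=
    hc.aestronglyMeasurable isOpen_regAngles.measurableSet
  rwa [Measure.restrict_eq_self_of_ae_mem ae_mem_regAngles] at h1

/-- A function that grows at the walls at most like the inverse square root of the distance is
integrable. -/
lemma integrable_of_norm_le {E : Type*} [NormedAddCommGroup E]
    {h : (Fin N → ℝ) → E} (hm : AEStronglyMeasurable h (boxMeasure N)) {C : ℝ}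
    (hC : ∀ θ : Fin N → ℝ, (∀ i, |θ i| ≤ Real.pi) → ∀ ε : ℝ, 0 < ε → ε ≤ 1 →
      (∀ a b, a ≠ b → ε ≤ chord θ a b) → ‖h θ‖ ≤ C * ε ^ (-(1 / 2) : ℝ)) :
    Integrable h (boxMeasure N) := by
  wlog hC1 : 1 ≤ C generalizing C
  · refine this (C := max C 1) (fun θ hθ ε hε hε1 hch => (hC θ hθ ε hε hε1 hch).trans ?_)
      (le_max_right _ _)
    exact mul_le_mul_of_nonneg_right (le_max_left _ _) (by positivity)
  refine ⟨hm, ?_⟩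
  set M := (boxMeasure N).real univ with hM
  set A : ℝ := N * (N * (3 * (4 * C ^ 2) * M)) with hA
  have hM0 : 0 ≤ M := measureReal_nonneg
  -- the distribution function of the norm
  have hdist : ∀ t : ℝ, 2 * C < t →
      boxMeasure N {θ | t ≤ ‖h θ‖} ≤ ENNReal.ofReal (A * t ^ (-2 : ℝ)) := fun t ht => by
    have ht0 : 0 < t := by linarith
    -- Chosen so that `C ρ^(-1/2) = t/2`: where the norm is at least `t`, some chord has to be at
    -- most `ρ`.
    set ρ := (2 * C / t) ^ 2 with hρ
    have hρ0 : 0 < ρ := by positivity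
    have hρ1 : ρ ≤ 1 := by
      rw [hρ, sq_le_one_iff₀ (by positivity), div_le_one ht0]
      exact ht.le
    have hsub : {θ | t ≤ ‖h θ‖} ≤ᵐ[boxMeasure N]
        ⋃ a : Fin N, ⋃ b : Fin N, {θ | a ≠ b ∧ chord θ a b ≤ ρ} := by
      filter_upwards [ae_boxMeasure_abs_le] with θ hθ htθ
      by_contra hnot
      have h1 : ∀ a b, a ≠ b → ρ ≤ chord θ a b := fun a b hab => by
        by_contra! hlt
        exact hnot (mem_iUnion.2 ⟨a, mem_iUnion.2 ⟨b, hab, hlt.le⟩⟩)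
      have h2 := hC θ hθ ρ hρ0 hρ1 h1
      have h3 : C * ρ ^ (-(1 / 2) : ℝ) = t / 2 := by
        rw [Real.rpow_neg hρ0.le, ← Real.sqrt_eq_rpow, hρ, Real.sqrt_sq (by positivity)]
        field_simp
      have h4 : t ≤ ‖h θ‖ := htθ
      linarith
    refine (measure_mono_ae hsub).trans ((measure_iUnion_fintype_le _ _).trans ?_)
    have hstep : ∀ a b : Fin N, boxMeasure N {θ | a ≠ b ∧ chord θ a b ≤ ρ}
        ≤ ENNReal.ofReal (3 * ρ * M) := fun a b => by
      by_cases hab : a = b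
      · simp [hab]
      · have h1 := real_strip_le hab hρ0.le
        rw [measureReal_def, ← ENNReal.le_ofReal_iff_toReal_le (by finiteness) (by positivity)] at h1
        simpa [hab] using h1
    refine (Finset.sum_le_sum fun a _ => (measure_iUnion_fintype_le _ _).trans
      (Finset.sum_le_sum fun b _ => hstep a b)).trans (le_of_eq ?_)
    simp only [Finset.sum_const, Finset.card_univ, Fintype.card_fin, nsmul_eq_mul]
    rw [← ENNReal.ofReal_natCast, ← ENNReal.ofReal_mul (by positivity),
      ← ENNReal.ofReal_mul (by positivity)]
    congr 1
    rw [hA, hρ, Real.rpow_neg ht0.le, Real.rpow_two]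
    field_simp
    ring
  -- Layer cake formula: the distribution function is bounded for small `t` because the measure is
  -- finite, and decays like `t^(-2)` for large `t`.
  have hlc : ∫⁻ θ, ENNReal.ofReal ‖h θ‖ ∂boxMeasure N < ⊤ := by
    rw [lintegral_eq_lintegral_meas_le _ (Eventually.of_forall fun _ => norm_nonneg _)
      hm.norm.aemeasurable,
      ← Ioc_union_Ioi_eq_Ioi (show (0 : ℝ) ≤ 2 * C by linarith)]
    refine (lintegral_union_le _ _ _).trans_lt (ENNReal.add_lt_top.2 ⟨?_, ?_⟩)
    · refine (lintegral_mono fun t => measure_mono (subset_univ _)).trans_lt ?_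
      rw [lintegral_const, Measure.restrict_apply_univ, Real.volume_Ioc]
      finiteness
    · refine (setLIntegral_mono' measurableSet_Ioi hdist).trans_lt ?_
      have hi : IntegrableOn (fun t : ℝ => A * t ^ (-2 : ℝ)) (Ioi (2 * C)) :=
        (integrableOn_Ioi_rpow_of_lt (by norm_num) (by linarith)).const_mul A
      exact hi.lintegral_lt_top
  simpa [HasFiniteIntegral, ofReal_norm] using hlc

end box

end

end TorusDunkl

namespace TorusDunkl

noncomputable section

open scoped Matrix.Norms.L2Operator
open Set Filter Topology

variable {N n : ℕ}

/-! ### The sesquilinear form of a matrix -/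

/-- The number `u^* A v`. -/
def sesq (u : Fin n → ℂ) (A : Matrix (Fin n) (Fin n) ℂ) (v : Fin n → ℂ) : ℂ := star u ⬝ᵥ (A *ᵥ v)

/-- The entries of a matrix as continuous linear forms. -/
def entryCLM (k l : Fin n) : Matrix (Fin n) (Fin n) ℂ →L[ℝ] ℂ :=
  LinearMap.toContinuousLinearMap
    { toFun := fun A => A k l
      map_add' := fun _ _ => rfl
      map_smul' := fun _ _ => rfl }

@[simp] lemma entryCLM_apply (k l : Fin n) (A : Matrix (Fin n) (Fin n) ℂ) :
    entryCLM k l A = A k l := rfl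

lemma sesq_eq_sum (u : Fin n → ℂ) (A : Matrix (Fin n) (Fin n) ℂ) (v : Fin n → ℂ) :
    sesq u A v = ∑ k, ∑ l, star (u k) * entryCLM k l A * v l := by
  simp only [sesq, dotProduct, Matrix.mulVec, Finset.mul_sum, Pi.star_apply, entryCLM_apply,
    mul_assoc]

lemma exists_norm_sesq_le : ∃ C : ℝ, 0 ≤ C ∧ ∀ (u : Fin n → ℂ) (A : Matrix (Fin n) (Fin n) ℂ)
    (v : Fin n → ℂ), ‖sesq u A v‖ ≤ C * ‖u‖ * ‖A‖ * ‖v‖ := by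
  refine ⟨∑ k, ∑ l, ‖entryCLM (n := n) k l‖, by positivity, fun u A v => ?_⟩
  rw [sesq_eq_sum]
  simp only [Finset.sum_mul]
  refine (norm_sum_le _ _).trans (Finset.sum_le_sum fun k _ => (norm_sum_le _ _).trans
    (Finset.sum_le_sum fun l _ => ?_))
  rw [norm_mul, norm_mul, norm_star]
  calc ‖u k‖ * ‖entryCLM k l A‖ * ‖v l‖
      ≤ ‖u‖ * (‖entryCLM (n := n) k l‖ * ‖A‖) * ‖v‖ := by
        gcongr
        · exact norm_le_pi_norm u k
        · exact (entryCLM k l).le_opNorm A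
        · exact norm_le_pi_norm v l
    _ = _ := by ring

section algebra

variable (u v u' v' : Fin n → ℂ) (A B : Matrix (Fin n) (Fin n) ℂ) (c : ℂ)

lemma sesq_add_left : sesq (u + u') A v = sesq u A v + sesq u' A v := by
  simp [sesq, add_dotProduct]

lemma sesq_sub_left : sesq (u - u') A v = sesq u A v - sesq u' A v := by
  simp [sesq, sub_dotProduct]

lemma sesq_smul_left : sesq (c • u) A v = star c * sesq u A v := by
  simp [sesq, smul_dotProduct]

lemma sesq_sum_left {ι : Type*} (s : Finset ι) (w : ι → Fin n → ℂ) :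
    sesq (∑ j ∈ s, w j) A v = ∑ j ∈ s, sesq (w j) A v := by
  simp [sesq, star_sum, sum_dotProduct]

lemma sesq_add_right : sesq u A (v + v') = sesq u A v + sesq u A v' := by
  simp [sesq, Matrix.mulVec_add, dotProduct_add]

lemma sesq_sub_right : sesq u A (v - v') = sesq u A v - sesq u A v' := by
  simp [sesq, Matrix.mulVec_sub, dotProduct_sub]

lemma sesq_smul_right : sesq u A (c • v) = c * sesq u A v := by
  simp [sesq, Matrix.mulVec_smul, dotProduct_smul]

lemma sesq_sum_right {ι : Type*} (s : Finset ι) (w : ι → Fin n → ℂ) :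
    sesq u A (∑ j ∈ s, w j) = ∑ j ∈ s, sesq u A (w j) := by
  simp [sesq, Matrix.mulVec_sum, dotProduct_sum]

lemma sesq_sub_mid : sesq u (A - B) v = sesq u A v - sesq u B v := by
  simp [sesq, Matrix.sub_mulVec, dotProduct_sub]

lemma sesq_smul_mid : sesq u (c • A) v = c * sesq u A v := by
  simp [sesq, Matrix.smul_mulVec, dotProduct_smul]

lemma sesq_sum_mid {ι : Type*} (s : Finset ι) (W : ι → Matrix (Fin n) (Fin n) ℂ) :
    sesq u (∑ j ∈ s, W j) v = ∑ j ∈ s, sesq u (W j) v := by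
  simp [sesq, Matrix.sum_mulVec, dotProduct_sum]

lemma sesq_mulVec_left : sesq (B *ᵥ u) A v = sesq u (Bᴴ * A) v := by
  simp [sesq, Matrix.star_mulVec, ← Matrix.dotProduct_mulVec, Matrix.mulVec_mulVec]

lemma sesq_mulVec_right : sesq u A (B *ᵥ v) = sesq u (A * B) v := by
  simp [sesq, Matrix.mulVec_mulVec]

end algebra

lemma continuousOn_sesq {X : Type*} [TopologicalSpace X] {s : Set X} {F G : X → Fin n → ℂ}
    {K : X → Matrix (Fin n) (Fin n) ℂ} (hF : ContinuousOn F s) (hK : ContinuousOn K s)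
    (hG : ContinuousOn G s) : ContinuousOn (fun x => sesq (F x) (K x) (G x)) s := by
  simp only [sesq_eq_sum]
  refine continuousOn_finsetSum _ fun k _ => continuousOn_finsetSum _ fun l _ => ?_
  exact ((continuousOn_pi.1 hF k).star.mul ((entryCLM k l).continuous.comp_continuousOn hK)).mul
    (continuousOn_pi.1 hG l)

lemma hasFDerivAt_sesq {E : Type*} [NormedAddCommGroup E] [NormedSpace ℝ E] {F G : E → Fin n → ℂ}
    {K : E → Matrix (Fin n) (Fin n) ℂ} {F' G' : E →L[ℝ] Fin n → ℂ}
    {K' : E →L[ℝ] Matrix (Fin n) (Fin n) ℂ} {x : E} (hF : HasFDerivAt F F' x)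
    (hK : HasFDerivAt K K' x) (hG : HasFDerivAt G G' x) :
    ∃ D : E →L[ℝ] ℂ, HasFDerivAt (fun x => sesq (F x) (K x) (G x)) D x ∧
      ∀ v, D v = sesq (F' v) (K x) (G x) + sesq (F x) (K' v) (G x) + sesq (F x) (K x) (G' v) := by
  simp only [sesq_eq_sum]
  refine ⟨_, HasFDerivAt.fun_sum fun k _ => HasFDerivAt.fun_sum fun l _ =>
    ((hasFDerivAt_pi'.1 hF k).star.mul ((entryCLM k l).hasFDerivAt.comp x hK)).mul
      (hasFDerivAt_pi'.1 hG l), fun v => ?_⟩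
  simp only [_root_.sum_apply, ← Finset.sum_add_distrib]
  refine Finset.sum_congr rfl fun k _ => Finset.sum_congr rfl fun l _ => ?_
  simp
  ring

/-! ### The Dunkl operators in angular coordinates -/

/-- The factor `x_i / (x_i - x_j)`. -/
def dunklCoeff (θ : Fin N → ℝ) (i j : Fin N) : ℂ :=
  expPoint θ i / (expPoint θ i - expPoint θ j)

lemma expPoint_ne {θ : Fin N → ℝ} (hθ : θ ∈ regAngles N) {i j : Fin N} (hij : i ≠ j) :
    expPoint θ i ≠ expPoint θ j :=
  fun e => hij (expPoint_injective_of_chord hθ e)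

lemma dunklCoeff_eq {θ : Fin N → ℝ} (hθ : θ ∈ regAngles N) {i j : Fin N} (hij : i ≠ j) :
    dunklCoeff θ i j = 1 / 2 - Complex.I * halfCot (θ i - θ j) := by
  have h := I_mul_exp_div (expPoint_ne hθ hij)
  have h2 : dunklCoeff θ i j = -Complex.I * (Complex.I * dunklCoeff θ i j) := by
    rw [← mul_assoc, neg_mul, Complex.I_mul_I, neg_neg, one_mul]
  rw [h2]
  simp only [dunklCoeff, expPoint]
  rw [h]
  linear_combination -(1 / 2 : ℂ) * Complex.I_mul_I

lemma star_dunklCoeff {θ : Fin N → ℝ} (hθ : θ ∈ regAngles N) {i j : Fin N} (hij : i ≠ j) :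
    star (dunklCoeff θ i j) = 1 / 2 + Complex.I * halfCot (θ i - θ j) := by
  rw [dunklCoeff_eq hθ hij]
  simp

lemma norm_dunklCoeff (θ : Fin N → ℝ) (i j : Fin N) :
    ‖dunklCoeff θ i j‖ = (2 * chord θ i j)⁻¹ := by
  have h1 : ‖Complex.exp ((θ i + θ j) / 2 * Complex.I)‖ = 1 := by
    have := Complex.norm_exp_ofReal_mul_I ((θ i + θ j) / 2)
    push_cast at this
    exact this
  rw [dunklCoeff, norm_div, expPoint, expPoint, exp_sub_exp, Complex.norm_exp_ofReal_mul_I,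
    norm_mul, norm_mul, norm_mul, h1, Complex.norm_real, chord]
  simp

lemma mem_regAngles_comp {θ : Fin N → ℝ} (hθ : θ ∈ regAngles N) (w : Equiv.Perm (Fin N)) :
    θ ∘ w ∈ regAngles N := fun _ _ hab => hθ _ _ fun e => hab (w.injective e)

lemma dunklCoeff_comp_swap {θ : Fin N → ℝ} (hθ : θ ∈ regAngles N) {i j : Fin N} (hij : i ≠ j) :
    dunklCoeff (θ ∘ Equiv.swap i j) i j = star (dunklCoeff θ i j) := by
  rw [star_dunklCoeff hθ hij, dunklCoeff_eq (mem_regAngles_comp hθ _) hij]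
  simp only [Function.comp_apply, Equiv.swap_apply_left, Equiv.swap_apply_right]
  rw [← neg_sub (θ i), halfCot_neg]
  push_cast
  ring

lemma continuous_expPoint : Continuous (expPoint (N := N)) := by
  unfold expPoint
  fun_prop

lemma continuousOn_dunklCoeff {i j : Fin N} (hij : i ≠ j) :
    ContinuousOn (fun θ : Fin N → ℝ => dunklCoeff θ i j) (regAngles N) := by
  have h : ∀ k : Fin N, Continuous fun θ : Fin N → ℝ => expPoint θ k := fun k =>
    (continuous_apply k).comp continuous_expPoint
  exact (h i).continuousOn.div ((h i).sub (h j)).continuousOn fun θ hθ =>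
    sub_ne_zero.2 (expPoint_ne hθ hij)

/-- The operator `x_i 𝒟_i` in angular coordinates. -/
def angleDunkl (τ : Equiv.Perm (Fin N) →* Matrix.orthogonalGroup (Fin n) ℝ) (κ : ℝ) (i : Fin N)
    (F : (Fin N → ℝ) → Fin n → ℂ) (θ : Fin N → ℝ) : Fin n → ℂ :=
  (-Complex.I) • fderiv ℝ F θ (Pi.single i 1) + (κ : ℂ) • ∑ j ∈ Finset.univ.erase i,
    dunklCoeff θ i j • (rep τ (Equiv.swap i j) *ᵥ (F θ - F (θ ∘ Equiv.swap i j)))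

lemma coe_torusPoint (θ : Fin N → ℝ) (i : Fin N) : (torusPoint θ i : ℂ) = expPoint θ i := by
  rw [torusPoint, Circle.coe_exp, expPoint]

lemma torusPoint_add_two_pi (θ : Fin N → ℝ) (m : Fin N → ℤ) :
    torusPoint (fun i => θ i + m i * (2 * Real.pi)) = torusPoint θ := by
  ext i
  rw [coe_torusPoint, coe_torusPoint, expPoint_add_two_pi]

lemma xDunkl_torusPoint (τ : Equiv.Perm (Fin N) →* Matrix.orthogonalGroup (Fin n) ℝ) (κ : ℝ)
    (i : Fin N) {f : (Fin N → Circle) → Fin n → ℂ} (hf : IsC1 f) (θ : Fin N → ℝ) :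
    xDunkl τ κ i f (torusPoint θ) = angleDunkl τ κ i (fun θ => f (torusPoint θ)) θ := by
  have hd : HasFDerivAt (fun θ => f (torusPoint θ)) (fderiv ℝ (fun θ => f (torusPoint θ)) θ) θ :=
    (hf.differentiable one_ne_zero θ).hasFDerivAt
  have hline : HasDerivAt (fun t : ℝ => θ + t • (Pi.single i (1 : ℝ) : Fin N → ℝ))
      (Pi.single i (1 : ℝ)) 0 := by
    simpa using ((hasDerivAt_id (0 : ℝ)).smul_const (Pi.single i (1 : ℝ) : Fin N → ℝ)).const_add θ
  have hupd : ∀ t : ℝ, Function.update (torusPoint θ) i (torusPoint θ i * Circle.exp t)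
      = torusPoint (θ + t • (Pi.single i (1 : ℝ) : Fin N → ℝ)) := fun t => by
    ext j
    by_cases hj : j = i
    · subst hj
      simp [torusPoint, Circle.exp_add]
    · simp [torusPoint, hj]
  have h1 : HasDerivAt (fun t : ℝ => f (Function.update (torusPoint θ) i
      (torusPoint θ i * Circle.exp t))) (fderiv ℝ (fun θ => f (torusPoint θ)) θ (Pi.single i 1))
      0 := by
    simp only [hupd]
    have hd' : HasFDerivAt (fun θ => f (torusPoint θ)) (fderiv ℝ (fun θ => f (torusPoint θ)) θ)
        (θ + (0 : ℝ) • (Pi.single i (1 : ℝ) : Fin N → ℝ)) := by simpa using hd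
    exact hd'.comp_hasDerivAt 0 hline
  rw [xDunkl, xPartial, h1.deriv, angleDunkl]
  simp only [coe_torusPoint]
  rfl

lemma formDensity_torusPoint (L : (Fin N → ℂ) → Matrix (Fin n) (Fin n) ℂ)
    (H : Matrix (Fin n) (Fin n) ℂ) (f g : (Fin N → Circle) → Fin n → ℂ) (θ : Fin N → ℝ) :
    formDensity L H f g (torusPoint θ)
      = sesq (f (torusPoint θ)) (formMat L H (expPoint θ)) (g (torusPoint θ)) := by
  have e : (fun j => (torusPoint θ j : ℂ)) = expPoint θ := funext fun j => coe_torusPoint θ j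
  rw [formDensity, e, formMat, sesq]

/-- The part of `(x_i𝒟_i F)^* K G - F^* K x_i𝒟_i G` that is odd with respect to `(i,j)`. -/
def oddTerm (τ : Equiv.Perm (Fin N) →* Matrix.orthogonalGroup (Fin n) ℝ) (κ : ℝ)
    (K : (Fin N → ℝ) → Matrix (Fin n) (Fin n) ℂ) (F G : (Fin N → ℝ) → Fin n → ℂ) (i j : Fin N)
    (θ : Fin N → ℝ) : ℂ :=
  κ * (dunklCoeff θ i j
      * sesq (F θ) (K θ * rep τ (Equiv.swap i j)) (G (θ ∘ Equiv.swap i j))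
    - star (dunklCoeff θ i j)
      * sesq (F (θ ∘ Equiv.swap i j)) (rep τ (Equiv.swap i j) * K θ) (G θ))

/-! ### The difference of the two pairings as a derivative plus odd terms -/

section identity

variable {τ : Equiv.Perm (Fin N) →* Matrix.orthogonalGroup (Fin n) ℝ} {κ : ℝ}
  {K : (Fin N → ℝ) → Matrix (Fin n) (Fin n) ℂ} {F G : (Fin N → ℝ) → Fin n → ℂ}

/-- The transposition conjugates both the scalar coefficient and `K`, and it exchanges the two
arguments; thus the two summands change places. -/
lemma oddTerm_comp_swap {i j : Fin N} (hij : i ≠ j) {θ : Fin N → ℝ} (hθ : θ ∈ regAngles N)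
    (hK : K (θ ∘ Equiv.swap i j)
      = rep τ (Equiv.swap i j) * K θ * rep τ (Equiv.swap i j)) :
    oddTerm τ κ K F G i j (θ ∘ Equiv.swap i j) = -oddTerm τ κ K F G i j θ := by
  have e1 : (θ ∘ Equiv.swap i j) ∘ Equiv.swap i j = θ := by
    ext k
    simp
  rw [oddTerm, oddTerm, e1, dunklCoeff_comp_swap hθ hij, star_star, hK, mul_assoc,
    rep_swap_mul_self, mul_one, mul_assoc, ← mul_assoc (rep τ _) (rep τ _), rep_swap_mul_self,
    one_mul]
  ring

lemma cotMat_single (τ : Equiv.Perm (Fin N) →* Matrix.orthogonalGroup (Fin n) ℝ)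
    (θ : Fin N → ℝ) (i : Fin N) :
    cotMat τ θ (Pi.single i 1)
      = ∑ j ∈ Finset.univ.erase i, (halfCot (θ i - θ j) : ℂ) • rep τ (Equiv.swap i j) := by
  set M : Fin N → Matrix (Fin n) (Fin n) ℂ := fun j =>
    (halfCot (θ i - θ j) : ℂ) • rep τ (Equiv.swap i j) with hM
  have h : ∀ a b : Fin N, (((((Pi.single i 1 : Fin N → ℝ) a - (Pi.single i 1 : Fin N → ℝ) b) / 2
      * halfCot (θ a - θ b) : ℝ)) : ℂ) • rep τ (Equiv.swap a b)
      = (if a = i then (1 / 2 : ℂ) • M b else 0) + (if b = i then (1 / 2 : ℂ) • M a else 0) := by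
    intro a b
    by_cases ha : a = i <;> by_cases hb : b = i
    · subst ha; subst hb; simp [hM]
    · subst ha
      simp only [hM, hb, Pi.single_eq_same, Pi.single_eq_of_ne hb, if_true, if_false, add_zero,
        smul_smul]
      push_cast
      ring_nf
    · subst hb
      simp only [hM, ha, Pi.single_eq_same, Pi.single_eq_of_ne ha, if_true, if_false, zero_add,
        smul_smul]
      rw [Equiv.swap_comm, ← neg_sub (θ b), halfCot_neg]
      push_cast
      ring_nf
    · simp [ha, hb, Pi.single_eq_of_ne]
  have hMi : M i = 0 := by simp [hM]
  rw [cotMat]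
  simp only [h, Finset.sum_add_distrib, Finset.sum_ite_irrel, Finset.sum_ite_eq',
    Finset.mem_univ, if_true, Finset.sum_const_zero]
  rw [← Finset.smul_sum, ← add_smul, Finset.sum_erase _ hMi]
  norm_num

lemma constMat_single (τ : Equiv.Perm (Fin N) →* Matrix.orthogonalGroup (Fin n) ℝ) (i : Fin N) :
    constMat τ (Pi.single i 1)
      = (1 / 2 : ℂ) • ∑ j ∈ Finset.univ.erase i, rep τ (Equiv.swap i j) + (1 / 2 : ℂ) • 1 := by
  have h : ∀ a b : Fin N, (((((Pi.single i 1 : Fin N → ℝ) a + (Pi.single i 1 : Fin N → ℝ) b) / 4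
      : ℝ)) : ℂ) • rep τ (Equiv.swap a b)
      = (if a = i then (1 / 4 : ℂ) • rep τ (Equiv.swap i b) else 0)
        + (if b = i then (1 / 4 : ℂ) • rep τ (Equiv.swap i a) else 0) := by
    intro a b
    by_cases ha : a = i <;> by_cases hb : b = i
    · subst ha; subst hb
      simp only [Pi.single_eq_same, if_true, ← add_smul]
      norm_num
    · subst ha
      simp [hb]
    · subst hb
      simp [ha, Equiv.swap_comm]
    · simp [ha, hb, Pi.single_eq_of_ne]
  rw [constMat]
  simp only [h, Finset.sum_add_distrib, Finset.sum_ite_irrel, Finset.sum_ite_eq',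
    Finset.mem_univ, if_true, Finset.sum_const_zero]
  rw [← Finset.smul_sum, ← add_smul, ← Finset.add_sum_erase _ _ (Finset.mem_univ i),
    Equiv.swap_self, show Equiv.refl (Fin N) = 1 from rfl, rep_one, smul_add, add_comm]
  norm_num

/-- The coefficient `x_i / (x_i - x_j)` is `1/2 - i halfCot`: the constants assemble to the
commutator with `constMat` and the cotangents to the anticommutator with `cotMat`. The scalar part
of `constMat` does not contribute to the commutator. -/
lemma I_smul_formDeriv_single {θ : Fin N → ℝ} (hθ : θ ∈ regAngles N) (i : Fin N)
    (A : Matrix (Fin n) (Fin n) ℂ) :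
    Complex.I • formDeriv τ κ θ (Pi.single i 1) A
      = (κ : ℂ) • ∑ j ∈ Finset.univ.erase i,
        (star (dunklCoeff θ i j) • (rep τ (Equiv.swap i j) * A)
          - dunklCoeff θ i j • (A * rep τ (Equiv.swap i j))) := by
  have e : ∀ j ∈ Finset.univ.erase i,
      star (dunklCoeff θ i j) • (rep τ (Equiv.swap i j) * A)
          - dunklCoeff θ i j • (A * rep τ (Equiv.swap i j))
      = Complex.I • (((halfCot (θ i - θ j) : ℂ) • rep τ (Equiv.swap i j)) * A
          + A * ((halfCot (θ i - θ j) : ℂ) • rep τ (Equiv.swap i j)))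
        + (1 / 2 : ℂ) • (rep τ (Equiv.swap i j) * A - A * rep τ (Equiv.swap i j)) := fun j hj => by
    have hij : i ≠ j := (Finset.ne_of_mem_erase hj).symm
    rw [star_dunklCoeff hθ hij, dunklCoeff_eq hθ hij, smul_mul_assoc, mul_smul_comm]
    module
  rw [Finset.sum_congr rfl e, Finset.sum_add_distrib, ← Finset.smul_sum, ← Finset.smul_sum,
    Finset.sum_add_distrib, Finset.sum_sub_distrib, ← Finset.sum_mul, ← Finset.mul_sum,
    ← cotMat_single, ← Finset.sum_mul, ← Finset.mul_sum, formDeriv, constMat_single, smul_comm]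
  congr 1
  rw [smul_add, smul_smul, Complex.I_mul_I, mul_add, add_mul, smul_mul_assoc, mul_smul_comm,
    smul_mul_assoc, mul_smul_comm, one_mul, mul_one]
  module

/-- Up to odd terms, `(x_i𝒟_i F)^* K G - F^* K x_i𝒟_i G` is a derivative. -/
lemma sesq_angleDunkl_sub {θ : Fin N → ℝ} (hθ : θ ∈ regAngles N) (i : Fin N)
    (hF : DifferentiableAt ℝ F θ) (hG : DifferentiableAt ℝ G θ)
    (hK : ∃ D : (Fin N → ℝ) →L[ℝ] Matrix (Fin n) (Fin n) ℂ, HasFDerivAt K D θ ∧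
      ∀ v, D v = formDeriv τ κ θ v (K θ)) :
    ∃ D : (Fin N → ℝ) →L[ℝ] ℂ, HasFDerivAt (fun θ => sesq (F θ) (K θ) (G θ)) D θ ∧
      sesq (angleDunkl τ κ i F θ) (K θ) (G θ) - sesq (F θ) (K θ) (angleDunkl τ κ i G θ)
        = Complex.I * D (Pi.single i 1)
          + ∑ j ∈ Finset.univ.erase i, oddTerm τ κ K F G i j θ := by
  obtain ⟨K', hK', hKv⟩ := hK
  obtain ⟨D, hD, hDv⟩ := hasFDerivAt_sesq hF.hasFDerivAt hK' hG.hasFDerivAt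
  refine ⟨D, hD, ?_⟩
  -- The derivative of `K` cancels precisely those terms of the Dunkl operators in which `F` and `G`
  -- are both taken at `θ`. The terms with one permuted argument remain and form `oddTerm`.
  have e := I_smul_formDeriv_single (τ := τ) (κ := κ) hθ i (K θ)
  have e2 : Complex.I * sesq (F θ) (K' (Pi.single i 1)) (G θ)
      = κ * ∑ j ∈ Finset.univ.erase i,
        (star (dunklCoeff θ i j) * sesq (F θ) (rep τ (Equiv.swap i j) * K θ) (G θ)
          - dunklCoeff θ i j * sesq (F θ) (K θ * rep τ (Equiv.swap i j)) (G θ)) := by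
    rw [hKv, ← sesq_smul_mid, e, sesq_smul_mid, sesq_sum_mid]
    simp only [sesq_sub_mid, sesq_smul_mid]
  rw [hDv, mul_add, mul_add, e2, angleDunkl, angleDunkl]
  simp only [sesq_add_left, sesq_add_right, sesq_smul_left, sesq_smul_right, sesq_sum_left,
    sesq_sum_right, sesq_mulVec_left, sesq_mulVec_right, rep_swap_conjTranspose, sesq_sub_left,
    sesq_sub_right, oddTerm, ← Finset.mul_sum]
  simp only [Finset.mul_sum, mul_sub, Finset.sum_sub_distrib]
  simp
  ring

end identity

end

end TorusDunkl

namespace TorusDunkl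

noncomputable section

open scoped Matrix.Norms.L2Operator
open Set Filter Topology

variable {N n : ℕ}

/-! ### A cutoff function near the walls -/

section cutoff

open Real (smoothTransition)

lemma continuous_deriv_smoothTransition : Continuous (deriv smoothTransition) :=
  (Real.smoothTransition.contDiff (n := 1)).continuous_deriv le_rfl

lemma hasDerivAt_smoothTransition (y : ℝ) :
    HasDerivAt smoothTransition (deriv smoothTransition y) y :=
  ((Real.smoothTransition.contDiff (n := 1)).differentiable one_ne_zero y).hasDerivAt

lemma deriv_smoothTransition_of_neg {y : ℝ} (hy : y < 0) : deriv smoothTransition y = 0 := by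
  have h : smoothTransition =ᶠ[𝓝 y] fun _ => 0 := by
    filter_upwards [Iio_mem_nhds hy] with z hz
    exact Real.smoothTransition.zero_of_nonpos (le_of_lt hz)
  rw [h.deriv_eq, deriv_const]

lemma deriv_smoothTransition_of_one_lt {y : ℝ} (hy : 1 < y) : deriv smoothTransition y = 0 := by
  have h : smoothTransition =ᶠ[𝓝 y] fun _ => 1 := by
    filter_upwards [Ioi_mem_nhds hy] with z hz
    exact Real.smoothTransition.one_of_one_le (le_of_lt hz)
  rw [h.deriv_eq, deriv_const]

lemma exists_abs_deriv_smoothTransition_le :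
    ∃ M : ℝ, 0 ≤ M ∧ ∀ y, |deriv smoothTransition y| ≤ M := by
  obtain ⟨M, hM⟩ := isCompact_Icc.exists_bound_of_continuousOn
    (s := Icc (0 : ℝ) 1) continuous_deriv_smoothTransition.continuousOn
  refine ⟨M, (norm_nonneg _).trans (hM 0 (by simp)), fun y => ?_⟩
  have hM0 : 0 ≤ M := (norm_nonneg _).trans (hM 0 (by simp))
  rcases lt_or_ge y 0 with h | h
  · simpa [deriv_smoothTransition_of_neg h] using hM0
  rcases lt_or_ge 1 y with h1 | h1
  · simpa [deriv_smoothTransition_of_one_lt h1] using hM0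
  exact hM y ⟨h, h1⟩

/-- The sum over the pairs of coordinates of a function that is `1` where the chord is at most `ε`
and `0` where it is at least `√2 ε`. -/
def wallSum (ε : ℝ) (θ : Fin N → ℝ) : ℝ :=
  ∑ p ∈ (Finset.univ : Finset (Fin N)).offDiag, smoothTransition (2 - chord θ p.1 p.2 ^ 2 / ε ^ 2)

/-- A smooth function that vanishes near the walls. -/
def cutoff (ε : ℝ) (θ : Fin N → ℝ) : ℝ := smoothTransition (1 - wallSum ε θ)

/-- The contribution of the wall `x_i = x_j` to the derivative of `cutoff ε` with respect to
`θ_i`. -/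
def cutoffDeriv (ε : ℝ) (i j : Fin N) (θ : Fin N → ℝ) : ℝ :=
  deriv smoothTransition (1 - wallSum ε θ) *
    (2 * deriv smoothTransition (2 - chord θ i j ^ 2 / ε ^ 2)
      * (Real.sin ((θ i - θ j) / 2) * Real.cos ((θ i - θ j) / 2) / ε ^ 2))

lemma wallSum_comp (ε : ℝ) (θ : Fin N → ℝ) (w : Equiv.Perm (Fin N)) :
    wallSum ε (θ ∘ w) = wallSum ε θ := by
  rw [wallSum, wallSum]
  refine Finset.sum_equiv (w.prodCongr w) (fun p => ?_) fun p _ => rfl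
  simp

lemma cutoff_comp (ε : ℝ) (θ : Fin N → ℝ) (w : Equiv.Perm (Fin N)) :
    cutoff ε (θ ∘ w) = cutoff ε θ := by rw [cutoff, cutoff, wallSum_comp]

lemma wallSum_add_two_pi (ε : ℝ) (θ : Fin N → ℝ) (m : Fin N → ℤ) :
    wallSum ε (fun i => θ i + m i * (2 * Real.pi)) = wallSum ε θ := by
  simp only [wallSum, chord_add_two_pi]

lemma cutoff_nonneg (ε : ℝ) (θ : Fin N → ℝ) : 0 ≤ cutoff ε θ := Real.smoothTransition.nonneg _

lemma cutoff_le_one (ε : ℝ) (θ : Fin N → ℝ) : cutoff ε θ ≤ 1 := Real.smoothTransition.le_one _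

lemma two_mul_le_wallSum (ε : ℝ) (θ : Fin N → ℝ) {a b : Fin N} (hab : a ≠ b) :
    2 * smoothTransition (2 - chord θ a b ^ 2 / ε ^ 2) ≤ wallSum ε θ := by
  have h := Finset.sum_le_sum_of_subset_of_nonneg
    (s := {(a, b), (b, a)}) (t := (Finset.univ : Finset (Fin N)).offDiag)
    (f := fun p => smoothTransition (2 - chord θ p.1 p.2 ^ 2 / ε ^ 2)) (by
      intro p hp
      simp only [Finset.mem_insert, Finset.mem_singleton] at hp
      rcases hp with rfl | rfl <;> simp [hab, hab.symm]) fun p _ _ => Real.smoothTransition.nonneg _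
  rw [Finset.sum_pair (by simp [hab])] at h
  rw [two_mul]
  nth_rewrite 2 [chord_comm]
  exact h

/-- A pair with chord at most `ε` contributes the value `1` in each of its two orders, so `wallSum`
would be at least `2`. -/
lemma lt_chord_of_wallSum_le {ε : ℝ} (hε : 0 < ε) {θ : Fin N → ℝ} (h : wallSum ε θ ≤ 1)
    {a b : Fin N} (hab : a ≠ b) : ε < chord θ a b := by
  by_contra! hle
  have h1 : chord θ a b ^ 2 / ε ^ 2 ≤ 1 := by
    rw [div_le_one (by positivity)]
    exact pow_le_pow_left₀ (chord_nonneg θ a b) hle 2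
  have h2 := two_mul_le_wallSum ε θ hab
  rw [Real.smoothTransition.one_of_one_le (by linarith)] at h2
  linarith

lemma mem_regAngles_of_wallSum_le {ε : ℝ} (hε : 0 < ε) {θ : Fin N → ℝ} (h : wallSum ε θ ≤ 1) :
    θ ∈ regAngles N := fun _ _ hab => hε.trans (lt_chord_of_wallSum_le hε h hab)

lemma cutoff_of_le_wallSum {ε : ℝ} {θ : Fin N → ℝ} (h : 1 ≤ wallSum ε θ) : cutoff ε θ = 0 :=
  Real.smoothTransition.zero_of_nonpos (by linarith)

lemma cutoff_of_le_chord {ε : ℝ} (hε : 0 < ε) {θ : Fin N → ℝ}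
    (h : ∀ a b, a ≠ b → 2 * ε ≤ chord θ a b) : cutoff ε θ = 1 := by
  have h0 : wallSum ε θ = 0 := by
    refine Finset.sum_eq_zero fun p hp => Real.smoothTransition.zero_of_nonpos ?_
    have h1 := h p.1 p.2 (by simpa using hp)
    have h2 : 2 ≤ chord θ p.1 p.2 ^ 2 / ε ^ 2 := by
      rw [le_div_iff₀ (by positivity)]
      nlinarith
    linarith
  rw [cutoff, h0]
  exact Real.smoothTransition.one_of_one_le (by norm_num)

lemma tendsto_cutoff {θ : Fin N → ℝ} (hθ : θ ∈ regAngles N) :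
    Tendsto (fun ε => cutoff ε θ) (𝓝[>] 0) (𝓝 1) := by
  refine tendsto_const_nhds.congr' ?_
  have h : ∀ᶠ ε : ℝ in 𝓝 0, ∀ a b : Fin N, a ≠ b → 2 * ε < chord θ a b := by
    refine eventually_all.2 fun a => eventually_all.2 fun b => ?_
    by_cases hab : a = b
    · exact Eventually.of_forall fun ε h => absurd hab h
    have hc : Tendsto (fun ε : ℝ => 2 * ε) (𝓝 0) (𝓝 0) := by
      have : Continuous fun ε : ℝ => 2 * ε := by fun_prop
      simpa using this.tendsto 0
    filter_upwards [hc.eventually (gt_mem_nhds (hθ a b hab))] with ε h _ using h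
  filter_upwards [h.filter_mono nhdsWithin_le_nhds, self_mem_nhdsWithin] with ε h1 h2
  exact (cutoff_of_le_chord h2 fun a b hab => (h1 a b hab).le).symm

lemma continuous_wallSum (ε : ℝ) : Continuous (wallSum (N := N) ε) := by
  unfold wallSum
  refine continuous_finsetSum _ fun p _ => Real.smoothTransition.continuous.comp ?_
  exact continuous_const.sub (((continuous_chord p.1 p.2).pow 2).div_const _)

lemma continuous_cutoff (ε : ℝ) : Continuous (cutoff (N := N) ε) :=
  Real.smoothTransition.continuous.comp (continuous_const.sub (continuous_wallSum ε))

lemma continuous_cutoffDeriv (ε : ℝ) (i j : Fin N) : Continuous (cutoffDeriv ε i j) := by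
  unfold cutoffDeriv
  refine (continuous_deriv_smoothTransition.comp
    (continuous_const.sub (continuous_wallSum ε))).mul ((continuous_const.mul
      (continuous_deriv_smoothTransition.comp (continuous_const.sub
        (((continuous_chord i j).pow 2).div_const _)))).mul ?_)
  fun_prop

lemma wallSum_gt_one {ε : ℝ} (hε : 0 < ε) {θ : Fin N → ℝ} (h : θ ∉ regAngles N) :
    ∀ᶠ θ' in 𝓝 θ, 1 < wallSum ε θ' :=
  (continuous_wallSum ε).continuousAt.eventually (lt_mem_nhds (by
    by_contra! hle
    exact h (mem_regAngles_of_wallSum_le hε hle)))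

lemma cutoffDeriv_of_lt_wallSum {ε : ℝ} {i j : Fin N} {θ : Fin N → ℝ} (h : 1 < wallSum ε θ) :
    cutoffDeriv ε i j θ = 0 := by
  rw [cutoffDeriv, deriv_smoothTransition_of_neg (by linarith), zero_mul]

/-- A function that is continuous away from the walls becomes continuous when it is multiplied by a
function that vanishes near the walls. -/
lemma continuous_mul_of_wallSum {ε : ℝ} (hε : 0 < ε) {χ : (Fin N → ℝ) → ℝ} (hχ : Continuous χ)
    (h0 : ∀ θ, 1 < wallSum ε θ → χ θ = 0) {Ψ : (Fin N → ℝ) → ℂ}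
    (hΨ : ContinuousOn Ψ (regAngles N)) : Continuous fun θ => (χ θ : ℂ) * Ψ θ := by
  rw [continuous_iff_continuousAt]
  intro θ
  by_cases hθ : θ ∈ regAngles N
  · exact (Complex.continuous_ofReal.comp hχ).continuousAt.mul
      (hΨ.continuousAt (isOpen_regAngles.mem_nhds hθ))
  · refine (continuousAt_const (y := (0 : ℂ))).congr ?_
    filter_upwards [wallSum_gt_one hε hθ] with θ' h'
    rw [h0 θ' h', Complex.ofReal_zero, zero_mul]

/-- The product of sine and cosine is odd, and all other factors are symmetric. This oddness makes
the boundary term see only the defect of symmetry of the function it multiplies. -/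
lemma cutoffDeriv_comp_swap (ε : ℝ) (i j : Fin N) (θ : Fin N → ℝ) :
    cutoffDeriv ε i j (θ ∘ Equiv.swap i j) = -cutoffDeriv ε i j θ := by
  rw [cutoffDeriv, cutoffDeriv, wallSum_comp, chord_comp]
  simp only [Function.comp_apply, Equiv.swap_apply_left, Equiv.swap_apply_right]
  rw [chord_comm, ← neg_sub (θ i), neg_div, Real.sin_neg, Real.cos_neg]
  ring

lemma chord_of_cutoffDeriv_ne_zero {ε : ℝ} (hε : 0 < ε) {i j : Fin N} {θ : Fin N → ℝ}
    (h : cutoffDeriv ε i j θ ≠ 0) :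
    (∀ a b, a ≠ b → ε ≤ chord θ a b) ∧ chord θ i j ^ 2 ≤ 2 * ε ^ 2 := by
  constructor
  · intro a b hab
    have h1 : wallSum ε θ ≤ 1 := by
      by_contra! hlt
      exact h (cutoffDeriv_of_lt_wallSum hlt)
    exact (lt_chord_of_wallSum_le hε h1 hab).le
  · by_contra! hlt
    refine h ?_
    have h1 : 2 < chord θ i j ^ 2 / ε ^ 2 := by rwa [lt_div_iff₀ (by positivity)]
    rw [cutoffDeriv, deriv_smoothTransition_of_neg (y := 2 - _) (by linarith)]
    simp

/-- On the support the chord is at most `2ε`, so dividing the sine by `ε²` leaves order `1/ε`. -/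
lemma exists_abs_cutoffDeriv_le : ∃ C : ℝ, 0 ≤ C ∧ ∀ (N : ℕ) (i j : Fin N) (ε : ℝ), 0 < ε →
    ∀ θ : Fin N → ℝ, |cutoffDeriv ε i j θ| ≤ C / ε := by
  obtain ⟨M, hM, h⟩ := exists_abs_deriv_smoothTransition_le
  refine ⟨4 * M ^ 2, by positivity, fun N i j ε hε θ => ?_⟩
  by_cases h0 : cutoffDeriv ε i j θ = 0
  · rw [h0, abs_zero]
    positivity
  have h1 := (chord_of_cutoffDeriv_ne_zero hε h0).2
  have h2 : chord θ i j ≤ 2 * ε := by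
    have := chord_nonneg θ i j
    nlinarith
  have h3 := Real.abs_cos_le_one ((θ i - θ j) / 2)
  rw [cutoffDeriv, abs_mul, abs_mul, abs_mul, abs_div, abs_mul, abs_two,
    abs_of_pos (show (0 : ℝ) < ε ^ 2 by positivity)]
  calc _ ≤ M * (2 * M * (2 * ε * 1 / ε ^ 2)) := by
        gcongr
        · exact h _
        · exact h _
        · exact h2
    _ = _ := by
      field_simp
      ring

lemma hasFDerivAt_chord_sq (θ : Fin N → ℝ) (a b : Fin N) :
    HasFDerivAt (fun θ : Fin N → ℝ => chord θ a b ^ 2)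
      ((Real.sin ((θ a - θ b) / 2) * Real.cos ((θ a - θ b) / 2)) •
        (ContinuousLinearMap.proj (R := ℝ) (φ := fun _ : Fin N => ℝ) a
          - ContinuousLinearMap.proj (R := ℝ) (φ := fun _ : Fin N => ℝ) b)) θ := by
  have h1 : HasFDerivAt (fun θ : Fin N → ℝ => θ a - θ b)
      (ContinuousLinearMap.proj (R := ℝ) (φ := fun _ : Fin N => ℝ) a
          - ContinuousLinearMap.proj (R := ℝ) (φ := fun _ : Fin N => ℝ) b) θ :=
    (hasFDerivAt_apply a θ).sub (hasFDerivAt_apply b θ)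
  have h2 : HasDerivAt (fun t : ℝ => Real.sin (t / 2) ^ 2)
      (Real.sin ((θ a - θ b) / 2) * Real.cos ((θ a - θ b) / 2)) (θ a - θ b) := by
    have := (((hasDerivAt_id (θ a - θ b)).div_const 2).sin).fun_pow 2
    refine this.congr_deriv ?_
    simp
    ring
  have h3 := h2.comp_hasFDerivAt θ h1
  simp only [chord, sq_abs]
  exact h3

lemma hasFDerivAt_cutoff (ε : ℝ) (i : Fin N) (θ : Fin N → ℝ) :
    ∃ D : (Fin N → ℝ) →L[ℝ] ℝ, HasFDerivAt (cutoff ε) D θ ∧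
      D (Pi.single i 1) = ∑ j ∈ Finset.univ.erase i, cutoffDeriv ε i j θ := by
  set g : Fin N → Fin N → ℝ := fun a b => deriv smoothTransition (2 - chord θ a b ^ 2 / ε ^ 2)
      * (Real.sin ((θ a - θ b) / 2) * Real.cos ((θ a - θ b) / 2) / ε ^ 2) with hg
  have hterm : ∀ p : Fin N × Fin N, HasFDerivAt
      (fun θ : Fin N → ℝ => smoothTransition (2 - chord θ p.1 p.2 ^ 2 / ε ^ 2))
      ((-g p.1 p.2) • (ContinuousLinearMap.proj (R := ℝ) (φ := fun _ : Fin N => ℝ) p.1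
          - ContinuousLinearMap.proj (R := ℝ) (φ := fun _ : Fin N => ℝ) p.2)) θ := fun p => by
    have h := (hasDerivAt_smoothTransition _).comp_hasFDerivAt θ
      (((hasFDerivAt_chord_sq θ p.1 p.2).mul_const (ε ^ 2)⁻¹).const_sub 2)
    simp only [← div_eq_mul_inv] at h
    refine h.congr_fderiv ?_
    ext v
    simp [hg]
    ring
  have hV : HasFDerivAt (wallSum ε) _ θ := HasFDerivAt.fun_sum fun p _ => hterm p
  have hcut := (hasDerivAt_smoothTransition (1 - wallSum ε θ)).comp_hasFDerivAt θ (hV.const_sub 1)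
  refine ⟨_, hcut, ?_⟩
  have hganti : ∀ a b, g a b = -g b a := fun a b => by
    simp only [hg]
    rw [chord_comm, ← neg_sub (θ b), neg_div, Real.sin_neg, Real.cos_neg]
    ring
  -- Each wall through `i` occurs in both orders of its pair, and antisymmetry of `g` makes the two
  -- contributions equal; hence the factor `2`.
  have hsum : ∑ p ∈ (Finset.univ : Finset (Fin N)).offDiag,
      g p.1 p.2 * ((Pi.single i 1 : Fin N → ℝ) p.1 - (Pi.single i 1 : Fin N → ℝ) p.2)
      = ∑ j ∈ Finset.univ.erase i, 2 * g i j := by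
    have hgi : 2 * g i i = 0 := by simp [hg]
    rw [Finset.sum_subset (Finset.subset_univ _), Fintype.sum_prod_type,
      Finset.sum_erase (f := fun j => 2 * g i j) _ hgi]
    · simp only [mul_sub, Finset.sum_sub_distrib, Pi.single_apply, mul_ite, mul_one, mul_zero,
        Finset.sum_ite_eq', Finset.mem_univ, if_true]
      rw [Finset.sum_comm]
      simp only [Finset.sum_ite_eq', Finset.mem_univ, if_true]
      rw [← Finset.sum_sub_distrib]
      refine Finset.sum_congr rfl fun j _ => ?_
      rw [hganti j i]
      ring
    · intro p _ hp
      have : p.1 = p.2 := by simpa using hp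
      rw [this, sub_self, mul_zero]
  have e : ∀ j, cutoffDeriv ε i j θ
      = deriv smoothTransition (1 - wallSum ε θ) * (2 * g i j) := fun j => by
    simp only [cutoffDeriv, hg]
    ring
  simp only [e, ← Finset.mul_sum, ← hsum]
  simp

end cutoff

end

end TorusDunkl

namespace TorusDunkl

noncomputable section

open scoped Matrix.Norms.L2Operator
open Set Filter Topology

variable {N n : ℕ}

/-! ### Integration by parts on the torus -/

section torus

open MeasureTheory

lemma integrable_of_continuous {E : Type*} [NormedAddCommGroup E] [SecondCountableTopology E]
    {h : (Fin N → ℝ) → E} (hc : Continuous h) : Integrable h (boxMeasure N) := by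
  have h1 : IntegrableOn h (Icc (fun _ => -Real.pi) fun _ => Real.pi) := hc.integrableOn_Icc
  refine h1.mono_set fun θ hθ => ?_
  exact ⟨fun i => (hθ i trivial).1.le, fun i => (hθ i trivial).2⟩

lemma integral_comp_perm {h : (Fin N → ℝ) → ℂ} (hc : Continuous h) (w : Equiv.Perm (Fin N)) :
    ∫ θ, h (θ ∘ w) ∂boxMeasure N = ∫ θ, h θ ∂boxMeasure N := by
  have hm := measurePreserving_comp_perm w
  conv_rhs => rw [← hm.map_eq]
  rw [integral_map hm.measurable.aemeasurable hc.aestronglyMeasurable]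

/-- The integral of a derivative of a periodic function vanishes. -/
lemma integral_partial_eq_zero (i : Fin N) {Ψ Ψ' : (Fin N → ℝ) → ℂ}
    (hd : ∀ θ, ∃ D : (Fin N → ℝ) →L[ℝ] ℂ, HasFDerivAt Ψ D θ ∧ D (Pi.single i 1) = Ψ' θ)
    (hc : Continuous Ψ')
    (hper : ∀ (θ : Fin N → ℝ) (m : Fin N → ℤ), Ψ (fun i => θ i + m i * (2 * Real.pi)) = Ψ θ) :
    ∫ θ, Ψ' θ ∂boxMeasure N = 0 := by
  obtain ⟨m, rfl⟩ : ∃ m, N = m + 1 := ⟨N - 1, by have := i.2; omega⟩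
  choose D hD hDi using hd
  -- The divergence theorem for the vector field whose only component is `Ψ` in the direction `i`.
  -- The integrals over opposite faces of the cube cancel by periodicity.
  have hdiv := integral_divergence_of_hasFDerivAt_off_countable' (n := m)
    (fun _ => -Real.pi) (fun _ => Real.pi) (fun _ => by linarith [Real.pi_pos])
    (fun k => if k = i then Ψ else 0) (fun k θ => if k = i then D θ else 0) ∅ countable_empty
    (fun k => by
      by_cases hk : k = i
      · simp only [hk, if_true]
        exact fun θ _ => (hD θ).continuousAt.continuousWithinAt
      · simp only [hk, if_false]
        exact continuousOn_const)
    (fun θ _ k => by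
      by_cases hk : k = i
      · simpa only [hk, if_true] using hD θ
      · simp only [hk, if_false]
        exact hasFDerivAt_const (0 : ℂ) θ) ?_
  · have e1 : ∀ θ, ∑ k, (if k = i then D θ else 0) (Pi.single k 1) = Ψ' θ := fun θ => by
      rw [Finset.sum_eq_single i (fun k _ hk => by simp [hk]) (by simp)]
      simpa using hDi θ
    simp only [e1] at hdiv
    rw [boxMeasure, volume_pi, setIntegral_congr_set Measure.univ_pi_Ioc_ae_eq_Icc, ← volume_pi,
      hdiv]
    refine Finset.sum_eq_zero fun k _ => ?_
    by_cases hk : k = i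
    · subst hk
      simp only [if_true]
      rw [sub_eq_zero]
      refine integral_congr_ae (Eventually.of_forall fun x => ?_)
      change Ψ (k.insertNth Real.pi x) = Ψ (k.insertNth (-Real.pi) x)
      rw [← hper (k.insertNth (-Real.pi) x) (Pi.single k 1)]
      congr 1
      ext l
      refine k.succAboveCases ?_ (fun l => ?_) l
      · simp
        ring
      · simp [Fin.succAbove_ne]
    · simp [hk]
  · have e1 : ∀ θ, ∑ k, (if k = i then D θ else 0) (Pi.single k 1) = Ψ' θ := fun θ => by
      rw [Finset.sum_eq_single i (fun k _ hk => by simp [hk]) (by simp)]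
      simpa using hDi θ
    simp only [e1]
    exact hc.integrableOn_Icc

/-- The contribution of a wall to the derivative of the cutoff function tends to zero. -/
lemma exists_norm_integral_cutoffDeriv_le {i j : Fin N} (hij : i ≠ j) {Φ : (Fin N → ℝ) → ℂ}
    (hΦc : ContinuousOn Φ (regAngles N)) {C ε₀ p : ℝ} (hC : 0 ≤ C)
    (hbd : ∀ θ : Fin N → ℝ, (∀ i, |θ i| ≤ Real.pi) → ∀ ε : ℝ, 0 < ε → ε ≤ ε₀ →
      (∀ a b, a ≠ b → ε ≤ chord θ a b) → ‖Φ θ‖ ≤ C * ε ^ (-p))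
    (hsub : ∀ θ : Fin N → ℝ, (∀ i, |θ i| ≤ Real.pi) → ∀ ε : ℝ, 0 < ε → ε ≤ ε₀ →
      (∀ a b, a ≠ b → ε ≤ chord θ a b) → chord θ i j ^ 2 ≤ 2 * ε ^ 2 →
      (∀ k, k ≠ i → k ≠ j → √ε ≤ chord θ i k ∧ √ε ≤ chord θ j k) →
      ‖Φ θ - Φ (θ ∘ Equiv.swap i j)‖ ≤ C * ε ^ (1 / 2 - p)) :
    ∃ A : ℝ, ∀ ε : ℝ, 0 < ε → ε ≤ ε₀ →
      ‖∫ θ, (cutoffDeriv ε i j θ : ℂ) * Φ θ ∂boxMeasure N‖ ≤ A * ε ^ (1 / 2 - p) := by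
  obtain ⟨M, hM, hT⟩ := exists_abs_cutoffDeriv_le
  set V := (boxMeasure N).real univ with hV
  -- The `6` comes from the strip of measure at most `3·2ε·V`. The `72 N` comes from at most `N`
  -- further indices, two strips for each, the factor `2` in the crude bound, and measure at most
  -- `3√ε·3·2ε·V`.
  refine ⟨M * C * V * (6 + 72 * N), fun ε hε hε₀ => ?_⟩
  have hpow : 0 < ε ^ (-p) := Real.rpow_pos_of_pos hε _
  have hpow2 : ε ^ (1 / 2 - p) = √ε * ε ^ (-p) := by
    rw [Real.sqrt_eq_rpow, ← Real.rpow_add hε]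
    congr 1
  have hcont := continuous_mul_of_wallSum hε (continuous_cutoffDeriv ε i j)
    (fun θ h => cutoffDeriv_of_lt_wallSum h) hΦc
  have hswap := integral_comp_perm hcont (Equiv.swap i j)
  have hcont2 : Continuous fun θ : Fin N → ℝ =>
      (cutoffDeriv ε i j (θ ∘ Equiv.swap i j) : ℂ) * Φ (θ ∘ Equiv.swap i j) :=
    hcont.comp (f := fun θ : Fin N → ℝ => θ ∘ Equiv.swap i j)
      (continuous_pi fun k => continuous_apply _)
  -- Average the integral with its image under `(i,j)`; the factor in front is odd, so `Φ` is
  -- replaced by half of its difference with its reflection.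
  have hhalf : ∫ θ, (cutoffDeriv ε i j θ : ℂ) * Φ θ ∂boxMeasure N
      = (1 / 2 : ℂ) * ∫ θ, (cutoffDeriv ε i j θ : ℂ) * (Φ θ - Φ (θ ∘ Equiv.swap i j))
        ∂boxMeasure N := by
    have e : ∀ θ : Fin N → ℝ, (cutoffDeriv ε i j θ : ℂ) * (Φ θ - Φ (θ ∘ Equiv.swap i j))
        = (cutoffDeriv ε i j θ : ℂ) * Φ θ
          + (cutoffDeriv ε i j (θ ∘ Equiv.swap i j) : ℂ) * Φ (θ ∘ Equiv.swap i j) := fun θ => by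
      rw [cutoffDeriv_comp_swap]
      push_cast
      ring
    simp only [e]
    rw [integral_add (integrable_of_continuous hcont) (integrable_of_continuous hcont2), hswap]
    ring
  -- the strip around the wall and its intersections with the strips around the other walls
  set S : Set (Fin N → ℝ) := {θ | chord θ i j ≤ 2 * ε} with hS
  set W : Fin N → Fin N → Set (Fin N → ℝ) := fun c k => S ∩ {θ | chord θ c k ≤ √ε} with hW
  set others : Finset (Fin N) := (Finset.univ.erase i).erase j with hothers
  have hSm : MeasurableSet S :=
    measurableSet_le (continuous_chord i j).measurable measurable_const
  have hWm : ∀ c k, MeasurableSet (W c k) := fun c k =>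
    hSm.inter (measurableSet_le (continuous_chord c k).measurable measurable_const)
  -- The majorant combines the good bound on the whole strip with the crude bound on the places
  -- where a third coordinate comes within `√ε` of `x_i` or `x_j`.
  set b : (Fin N → ℝ) → ℝ := fun θ => S.indicator (fun _ => M / ε * (C * ε ^ (1 / 2 - p))) θ
    + ∑ k ∈ others, ((W i k).indicator (fun _ => M / ε * (2 * C * ε ^ (-p))) θ
      + (W j k).indicator (fun _ => M / ε * (2 * C * ε ^ (-p))) θ) with hb
  have hci : ∀ {s : Set (Fin N → ℝ)} (c : ℝ), MeasurableSet s →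
      Integrable (s.indicator fun _ => c) (boxMeasure N) := fun c hs =>
    (integrable_const c).indicator hs
  have hci2 : ∀ k, Integrable (fun θ => (W i k).indicator (fun _ => M / ε * (2 * C * ε ^ (-p))) θ
      + (W j k).indicator (fun _ => M / ε * (2 * C * ε ^ (-p))) θ) (boxMeasure N) := fun k =>
    (hci _ (hWm i k)).add (hci _ (hWm j k))
  have hbi : Integrable b (boxMeasure N) :=
    (hci _ hSm).add (integrable_finsetSum _ fun k _ => hci2 k)
  have hpt : ∀ᵐ θ ∂boxMeasure N,
      ‖(cutoffDeriv ε i j θ : ℂ) * (Φ θ - Φ (θ ∘ Equiv.swap i j))‖ ≤ b θ := by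
    filter_upwards [ae_boxMeasure_abs_le] with θ hθ
    have hind : ∀ (s : Set (Fin N → ℝ)) (c : ℝ), 0 ≤ c → 0 ≤ s.indicator (fun _ => c) θ :=
      fun s c hc => indicator_nonneg (fun _ _ => hc) θ
    have h0 : 0 ≤ M / ε * (2 * C * ε ^ (-p)) := by positivity
    have h0' : 0 ≤ M / ε * (C * ε ^ (1 / 2 - p)) := by positivity
    have hsum0 : ∀ k ∈ others, 0 ≤ (W i k).indicator (fun _ => M / ε * (2 * C * ε ^ (-p))) θ
        + (W j k).indicator (fun _ => M / ε * (2 * C * ε ^ (-p))) θ := fun k _ =>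
      add_nonneg (hind _ _ h0) (hind _ _ h0)
    by_cases hT0 : cutoffDeriv ε i j θ = 0
    · rw [hT0, Complex.ofReal_zero, zero_mul, norm_zero]
      exact add_nonneg (hind _ _ h0') (Finset.sum_nonneg hsum0)
    obtain ⟨hch, hcl⟩ := chord_of_cutoffDeriv_ne_zero hε hT0
    have hθS : θ ∈ S := by
      have := chord_nonneg θ i j
      change chord θ i j ≤ 2 * ε
      nlinarith
    have hTle := hT N i j ε hε θ
    rw [norm_mul, Complex.norm_real, Real.norm_eq_abs]
    by_cases hfar : ∀ k, k ≠ i → k ≠ j → √ε ≤ chord θ i k ∧ √ε ≤ chord θ j k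
    · calc _ ≤ M / ε * (C * ε ^ (1 / 2 - p)) :=
          mul_le_mul hTle (hsub θ hθ ε hε hε₀ hch hcl hfar) (norm_nonneg _) (by positivity)
        _ = S.indicator (fun _ => M / ε * (C * ε ^ (1 / 2 - p))) θ :=
          (indicator_of_mem hθS fun _ => _).symm
        _ ≤ b θ := le_add_of_nonneg_right (Finset.sum_nonneg hsum0)
    · push Not at hfar
      obtain ⟨k, hki, hkj, hk⟩ := hfar
      have hkm : k ∈ others := by simp [hothers, hki, hkj]
      have h1 : ‖Φ θ - Φ (θ ∘ Equiv.swap i j)‖ ≤ 2 * C * ε ^ (-p) := by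
        refine (norm_sub_le _ _).trans ?_
        have h2 := hbd θ hθ ε hε hε₀ hch
        have h3 := hbd (θ ∘ Equiv.swap i j) (fun l => hθ _) ε hε hε₀ fun a b hab =>
          hch _ _ fun e => hab ((Equiv.swap i j).injective e)
        linarith
      have h4 : M / ε * (2 * C * ε ^ (-p))
          ≤ (W i k).indicator (fun _ => M / ε * (2 * C * ε ^ (-p))) θ
            + (W j k).indicator (fun _ => M / ε * (2 * C * ε ^ (-p))) θ := by
        by_cases hik : chord θ i k ≤ √ε
        · rw [indicator_of_mem (show θ ∈ W i k from ⟨hθS, hik⟩)]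
          exact le_add_of_nonneg_right (hind _ _ h0)
        · have hjk : chord θ j k ≤ √ε := (hk (le_of_not_ge hik)).le
          rw [indicator_of_mem (show θ ∈ W j k from ⟨hθS, hjk⟩)]
          exact le_add_of_nonneg_left (hind _ _ h0)
      calc _ ≤ M / ε * (2 * C * ε ^ (-p)) :=
          mul_le_mul hTle h1 (norm_nonneg _) (by positivity)
        _ ≤ _ := h4
        _ ≤ _ := Finset.single_le_sum hsum0 hkm
        _ ≤ b θ := le_add_of_nonneg_left (hind _ _ h0')
  have hSr : (boxMeasure N).real S ≤ 3 * (2 * ε) * V := real_strip_le hij (by positivity)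
  have hWr : ∀ k ∈ others, ∀ c, c = i ∨ c = j →
      (boxMeasure N).real (W c k) ≤ 3 * √ε * (3 * (2 * ε) * V) := fun k hk c hc => by
    simp only [hothers, Finset.mem_erase, Finset.mem_univ, and_true] at hk
    refine real_strip_inter_strip_le hij hk.2 hk.1 ?_ (by positivity) (Real.sqrt_nonneg _)
    rcases hc with rfl | rfl
    · exact hk.2.symm
    · exact hk.1.symm
  have hbint : ∫ θ, b θ ∂boxMeasure N ≤ M / ε * (C * ε ^ (1 / 2 - p)) * (3 * (2 * ε) * V)
      + N * (2 * (M / ε * (2 * C * ε ^ (-p)) * (3 * √ε * (3 * (2 * ε) * V)))) := by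
    simp only [hb]
    rw [integral_add (hci _ hSm) (integrable_finsetSum _ fun k _ => hci2 k),
      integral_finsetSum _ fun k _ => hci2 k,
      integral_indicator_const _ hSm, smul_eq_mul, mul_comm]
    refine add_le_add (mul_le_mul_of_nonneg_left hSr (by positivity)) ?_
    have hterm : ∀ k ∈ others, ∫ θ, ((W i k).indicator (fun _ => M / ε * (2 * C * ε ^ (-p))) θ
        + (W j k).indicator (fun _ => M / ε * (2 * C * ε ^ (-p))) θ) ∂boxMeasure N
        ≤ 2 * (M / ε * (2 * C * ε ^ (-p)) * (3 * √ε * (3 * (2 * ε) * V))) := fun k hk => by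
      rw [integral_add (hci _ (hWm i k)) (hci _ (hWm j k)), integral_indicator_const _ (hWm i k),
        integral_indicator_const _ (hWm j k), smul_eq_mul, smul_eq_mul]
      have h0 : 0 ≤ M / ε * (2 * C * ε ^ (-p)) := by positivity
      linarith [mul_le_mul_of_nonneg_right (hWr k hk i (Or.inl rfl)) h0,
        mul_le_mul_of_nonneg_right (hWr k hk j (Or.inr rfl)) h0]
    refine (Finset.sum_le_sum hterm).trans ?_
    rw [Finset.sum_const, nsmul_eq_mul]
    refine mul_le_mul_of_nonneg_right ?_ (by positivity)
    exact_mod_cast (Finset.card_le_univ others).trans_eq (Fintype.card_fin N)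
  rw [hhalf, norm_mul]
  have hI := (norm_integral_le_of_norm_le hbi hpt).trans hbint
  have hhalf1 : ‖(1 / 2 : ℂ)‖ ≤ 1 := by norm_num
  calc _ ≤ 1 * _ := mul_le_mul hhalf1 hI (norm_nonneg _) zero_le_one
    _ = _ := by
      rw [hpow2]
      field_simp
      ring

/-- A function on the torus that is the sum of a derivative and of odd functions has integral zero,
if the differentiated function is almost symmetric near the walls. -/
theorem integral_eq_zero_of_odd_add_partial (i : Fin N) {Φ J : (Fin N → ℝ) → ℂ}
    {O : Fin N → (Fin N → ℝ) → ℂ}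
    (hΦ : ∀ θ ∈ regAngles N, ∃ D : (Fin N → ℝ) →L[ℝ] ℂ, HasFDerivAt Φ D θ ∧
      J θ = Complex.I * D (Pi.single i 1) + ∑ j ∈ Finset.univ.erase i, O j θ)
    (hJ : Integrable J (boxMeasure N)) (hJc : ContinuousOn J (regAngles N))
    (hOc : ∀ j, i ≠ j → ContinuousOn (O j) (regAngles N))
    (hO : ∀ j, i ≠ j → ∀ θ ∈ regAngles N, O j (θ ∘ Equiv.swap i j) = -O j θ)
    (hper : ∀ (θ : Fin N → ℝ) (m : Fin N → ℤ), Φ (fun i => θ i + m i * (2 * Real.pi)) = Φ θ)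
    {C ε₀ p : ℝ} (hC : 0 ≤ C) (hε₀ : 0 < ε₀) (hp : p < 1 / 2)
    (hbd : ∀ θ : Fin N → ℝ, (∀ i, |θ i| ≤ Real.pi) → ∀ ε : ℝ, 0 < ε → ε ≤ ε₀ →
      (∀ a b, a ≠ b → ε ≤ chord θ a b) → ‖Φ θ‖ ≤ C * ε ^ (-p))
    (hsub : ∀ θ : Fin N → ℝ, (∀ i, |θ i| ≤ Real.pi) → ∀ ε : ℝ, 0 < ε → ε ≤ ε₀ →
      (∀ a b, a ≠ b → ε ≤ chord θ a b) → ∀ a b, a ≠ b → chord θ a b ^ 2 ≤ 2 * ε ^ 2 →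
      (∀ k, k ≠ a → k ≠ b → √ε ≤ chord θ a k ∧ √ε ≤ chord θ b k) →
      ‖Φ θ - Φ (θ ∘ Equiv.swap a b)‖ ≤ C * ε ^ (1 / 2 - p)) :
    ∫ θ, J θ ∂boxMeasure N = 0 := by
  have hΦc : ContinuousOn Φ (regAngles N) := fun θ hθ => by
    obtain ⟨D, hD, -⟩ := hΦ θ hθ
    exact hD.continuousAt.continuousWithinAt
  have hne : ∀ {j}, j ∈ Finset.univ.erase i → i ≠ j := fun hj => (Finset.ne_of_mem_erase hj).symm
  -- This is the partial derivative of `Φ` in the direction `i`, recovered from the identity for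
  -- `J`. In this form its continuity away from the walls is clear.
  set Φ' : (Fin N → ℝ) → ℂ := fun θ =>
    -Complex.I * (J θ - ∑ j ∈ Finset.univ.erase i, O j θ) with hΦ'
  have hΦ'c : ContinuousOn Φ' (regAngles N) :=
    continuousOn_const.mul (hJc.sub (continuousOn_finsetSum _ fun j hj => hOc j (hne hj)))
  -- the integral against the cutoff function
  have hcut : ∀ ε : ℝ, 0 < ε → ∫ θ, (cutoff ε θ : ℂ) * J θ ∂boxMeasure N
      = -Complex.I * ∑ j ∈ Finset.univ.erase i,
        ∫ θ, (cutoffDeriv ε i j θ : ℂ) * Φ θ ∂boxMeasure N := fun ε hε => by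
    have hcutc : ∀ {Ψ : (Fin N → ℝ) → ℂ}, ContinuousOn Ψ (regAngles N) →
        Continuous fun θ => (cutoff ε θ : ℂ) * Ψ θ := fun hΨ =>
      continuous_mul_of_wallSum hε (continuous_cutoff ε)
        (fun θ h => cutoff_of_le_wallSum h.le) hΨ
    have hTc : ∀ j, Continuous fun θ => (cutoffDeriv ε i j θ : ℂ) * Φ θ := fun j =>
      continuous_mul_of_wallSum hε (continuous_cutoffDeriv ε i j)
        (fun θ h => cutoffDeriv_of_lt_wallSum h) hΦc
    have hOint : ∀ j ∈ Finset.univ.erase i,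
        ∫ θ, (cutoff ε θ : ℂ) * O j θ ∂boxMeasure N = 0 := fun j hj => by
      have h1 := integral_comp_perm (hcutc (hOc j (hne hj))) (Equiv.swap i j)
      have h2 : ∀ θ : Fin N → ℝ, (cutoff ε (θ ∘ Equiv.swap i j) : ℂ) * O j (θ ∘ Equiv.swap i j)
          = -((cutoff ε θ : ℂ) * O j θ) := fun θ => by
        rw [cutoff_comp]
        by_cases hθ : θ ∈ regAngles N
        · rw [hO j (hne hj) θ hθ, mul_neg]
        · rw [cutoff_of_le_wallSum (wallSum_gt_one hε hθ).self_of_nhds.le]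
          simp
      simp only [h2, integral_neg] at h1
      exact self_eq_neg.1 h1.symm
    have hdiv : ∫ θ, ((cutoff ε θ : ℂ) * Φ' θ
        + ∑ j ∈ Finset.univ.erase i, (cutoffDeriv ε i j θ : ℂ) * Φ θ) ∂boxMeasure N = 0 := by
      refine integral_partial_eq_zero i (Ψ := fun θ => (cutoff ε θ : ℂ) * Φ θ) (fun θ => ?_)
        ((hcutc hΦ'c).add (continuous_finsetSum _ fun j _ => hTc j)) fun θ m => ?_
      · by_cases hθ : θ ∈ regAngles N
        · obtain ⟨D, hD, hDJ⟩ := hΦ θ hθ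
          obtain ⟨D₁, hD₁, hD₁i⟩ := hasFDerivAt_cutoff ε i θ
          have h1 : HasFDerivAt (fun θ => (cutoff ε θ : ℂ)) (Complex.ofRealCLM.comp D₁) θ :=
            Complex.ofRealCLM.hasFDerivAt.comp θ hD₁
          refine ⟨_, h1.mul hD, ?_⟩
          have h2 : D (Pi.single i 1) = Φ' θ := by
            rw [hΦ']
            simp only [hDJ, add_sub_cancel_right]
            rw [← mul_assoc, neg_mul, Complex.I_mul_I, neg_neg, one_mul]
          simp only [_root_.add_apply, _root_.smul_apply, ContinuousLinearMap.comp_apply, h2, hD₁i,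
            smul_eq_mul, Complex.ofRealCLM_apply]
          rw [← Finset.sum_mul]
          push_cast
          ring
        · have hev := wallSum_gt_one hε hθ
          refine ⟨0, (hasFDerivAt_const (0 : ℂ) θ).congr_of_eventuallyEq ?_, ?_⟩
          · filter_upwards [hev] with θ' h'
            rw [cutoff_of_le_wallSum h'.le, Complex.ofReal_zero, zero_mul]
          · have h1 := hev.self_of_nhds
            simp [cutoff_of_le_wallSum h1.le, cutoffDeriv_of_lt_wallSum h1]
      · simp only [hper, cutoff, wallSum_add_two_pi]
    rw [integral_add (integrable_of_continuous (hcutc hΦ'c))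
      (integrable_finsetSum _ fun j _ => integrable_of_continuous (hTc j)),
      integral_finsetSum _ fun j _ => integrable_of_continuous (hTc j)] at hdiv
    have e : ∀ θ, (cutoff ε θ : ℂ) * J θ = Complex.I * ((cutoff ε θ : ℂ) * Φ' θ)
        + ∑ j ∈ Finset.univ.erase i, (cutoff ε θ : ℂ) * O j θ := fun θ => by
      rw [← Finset.mul_sum, hΦ']
      linear_combination ((cutoff ε θ : ℂ) * (J θ - ∑ j ∈ Finset.univ.erase i, O j θ))
        * Complex.I_mul_I
    simp only [e]
    rw [integral_add ((integrable_of_continuous (hcutc hΦ'c)).const_mul _)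
      (integrable_finsetSum _ fun j hj => integrable_of_continuous (hcutc (hOc j (hne hj)))),
      integral_finsetSum _ fun j hj => integrable_of_continuous (hcutc (hOc j (hne hj))),
      Finset.sum_eq_zero hOint, integral_const_mul, add_zero]
    linear_combination Complex.I * hdiv
  -- the limit
  have hlim : Tendsto (fun ε : ℝ => ∫ θ, (cutoff ε θ : ℂ) * J θ ∂boxMeasure N) (𝓝[>] 0)
      (𝓝 (∫ θ, J θ ∂boxMeasure N)) := by
    refine tendsto_integral_filter_of_dominated_convergence (fun θ => ‖J θ‖)
      (Eventually.of_forall fun ε => ?_) (Eventually.of_forall fun ε =>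
        Eventually.of_forall fun θ => ?_) hJ.norm ?_
    · exact (Complex.continuous_ofReal.comp (continuous_cutoff ε)).aestronglyMeasurable.mul
        hJ.aestronglyMeasurable
    · rw [norm_mul, Complex.norm_real, Real.norm_eq_abs, abs_of_nonneg (cutoff_nonneg ε θ)]
      exact mul_le_of_le_one_left (norm_nonneg _) (cutoff_le_one ε θ)
    · filter_upwards [ae_mem_regAngles] with θ hθ
      have := (Complex.continuous_ofReal.tendsto 1).comp (tendsto_cutoff hθ)
      simpa using this.mul_const (J θ)
  have hzero : Tendsto (fun ε : ℝ => ∫ θ, (cutoff ε θ : ℂ) * J θ ∂boxMeasure N) (𝓝[>] 0)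
      (𝓝 0) := by
    have h1 : ∀ j ∈ Finset.univ.erase i, Tendsto (fun ε : ℝ =>
        ∫ θ, (cutoffDeriv ε i j θ : ℂ) * Φ θ ∂boxMeasure N) (𝓝[>] 0) (𝓝 0) := fun j hj => by
      obtain ⟨A, hA⟩ := exists_norm_integral_cutoffDeriv_le (hne hj) hΦc hC hbd
        fun θ hθ ε hε hε₀ hch hcl hfar => hsub θ hθ ε hε hε₀ hch i j (hne hj) hcl hfar
      have h2 : Tendsto (fun ε : ℝ => A * ε ^ (1 / 2 - p)) (𝓝[>] 0) (𝓝 0) := by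
        have h3 : ContinuousAt (fun ε : ℝ => A * ε ^ (1 / 2 - p)) 0 :=
          continuousAt_const.mul (Real.continuousAt_rpow_const _ _ (Or.inr (by linarith)))
        have h4 := h3.tendsto.mono_left (nhdsWithin_le_nhds (s := Ioi 0))
        rwa [Real.zero_rpow (by linarith), mul_zero] at h4
      refine squeeze_zero_norm' ?_ h2
      filter_upwards [self_mem_nhdsWithin, nhdsWithin_le_nhds (Iic_mem_nhds hε₀)] with ε h5 h6
      exact hA ε h5 h6
    have h2 := (tendsto_finsetSum _ h1).const_mul (-Complex.I)
    rw [Finset.sum_const_zero, mul_zero] at h2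
    refine h2.congr' ?_
    filter_upwards [self_mem_nhdsWithin] with ε hε
    exact (hcut ε hε).symm
  exact tendsto_nhds_unique hlim hzero

end torus

end

end TorusDunkl

namespace TorusDunkl

noncomputable section

open scoped Matrix.Norms.L2Operator
open Set Filter Topology

variable {N n : ℕ}

/-! ### Functions of class `C¹` on the torus -/

section regular

variable {F : (Fin N → ℝ) → Fin n → ℂ}

lemma norm_le_of_abs_le {θ : Fin N → ℝ} {r : ℝ} (hr : 0 ≤ r) (h : ∀ i, |θ i| ≤ r) :
    θ ∈ Metric.closedBall (0 : Fin N → ℝ) r := by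
  rw [mem_closedBall_zero_iff, pi_norm_le_iff_of_nonneg hr]
  exact h

lemma exists_norm_le_of_continuous {E : Type*} [NormedAddCommGroup E] {h : (Fin N → ℝ) → E}
    (hc : Continuous h) (r : ℝ) :
    ∃ B : ℝ, 0 ≤ B ∧ ∀ θ ∈ Metric.closedBall (0 : Fin N → ℝ) r, ‖h θ‖ ≤ B := by
  obtain ⟨B, hB⟩ := (isCompact_closedBall (0 : Fin N → ℝ) r).exists_bound_of_continuousOn
    hc.continuousOn
  exact ⟨max B 0, le_max_right _ _, fun θ hθ => (hB θ hθ).trans (le_max_left _ _)⟩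

/-- Mean value theorem. By periodicity `θ a` may first be moved to within `π` of `θ b`, where the
difference of angles is at most `π` times the chord. -/
lemma exists_norm_sub_comp_swap_le (hF : ContDiff ℝ 1 F)
    (hper : ∀ (θ : Fin N → ℝ) (m : Fin N → ℤ), F (fun i => θ i + m i * (2 * Real.pi)) = F θ) :
    ∃ C : ℝ, 0 ≤ C ∧ ∀ θ : Fin N → ℝ, (∀ i, |θ i| ≤ Real.pi) → ∀ a b : Fin N,
      ‖F θ - F (θ ∘ Equiv.swap a b)‖ ≤ C * chord θ a b := by
  have hpi := Real.pi_pos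
  obtain ⟨B, hB0, hB⟩ := exists_norm_le_of_continuous (hF.continuous_fderiv one_ne_zero)
    (3 * Real.pi)
  refine ⟨B * Real.pi, by positivity, fun θ hθ a b => ?_⟩
  have ha := abs_le.1 (hθ a)
  have hb := abs_le.1 (hθ b)
  obtain ⟨m₀, hm0, hm1⟩ : ∃ m₀ : ℤ, |(m₀ : ℝ)| ≤ 1 ∧
      |θ a + m₀ * (2 * Real.pi) - θ b| ≤ Real.pi ∧ (a = b → m₀ = 0) := by
    rcases le_or_gt (θ a - θ b) Real.pi with h1 | h1
    · rcases le_or_gt (-Real.pi) (θ a - θ b) with h2 | h2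
      · refine ⟨0, by simp, ?_, fun _ => rfl⟩
        rw [abs_le]
        constructor <;> push_cast <;> linarith
      · refine ⟨1, by simp, ?_, fun e => ?_⟩
        · rw [abs_le]
          constructor <;> push_cast <;> linarith
        · rw [e, sub_self] at h2
          linarith
    · refine ⟨-1, by simp, ?_, fun e => ?_⟩
      · rw [abs_le]
        constructor <;> push_cast <;> linarith
      · rw [e, sub_self] at h1
        linarith
  set m : Fin N → ℤ := Pi.single a m₀ with hm
  set θ' : Fin N → ℝ := fun i => θ i + m i * (2 * Real.pi) with hθ'
  have hmle : ∀ i, |(m i : ℝ)| ≤ 1 := fun i => by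
    by_cases hi : i = a
    · subst hi
      simpa [hm] using hm0
    · simp [hm, hi]
  have hbd : ∀ i, |θ' i| ≤ 3 * Real.pi := fun i => by
    have h1 : |(m i : ℝ) * (2 * Real.pi)| ≤ 2 * Real.pi := by
      rw [abs_mul, abs_of_pos Real.two_pi_pos]
      nlinarith [hmle i]
    exact (abs_add_le _ _).trans (by linarith [hθ i])
  have hdist : |θ' a - θ' b| ≤ Real.pi * chord θ a b := by
    have h1 : |θ' a - θ' b| ≤ Real.pi := by
      by_cases hab : a = b
      · rw [hab, sub_self, abs_zero]
        exact hpi.le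
      · simpa [hθ', hm, Pi.single_eq_of_ne (Ne.symm hab)] using hm1.1
    have h2 := Real.mul_abs_le_abs_sin (x := (θ' a - θ' b) / 2) (by
      rw [abs_div, abs_two]
      linarith)
    rw [← chord_add_two_pi θ m, chord]
    rw [abs_div, abs_two, div_mul_eq_mul_div, div_le_iff₀ hpi] at h2
    linarith
  have hsub : ‖θ' ∘ Equiv.swap a b - θ'‖ ≤ |θ' a - θ' b| := by
    rw [pi_norm_le_iff_of_nonneg (abs_nonneg _)]
    intro k
    by_cases hka : k = a
    · subst hka
      simp [abs_sub_comm]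
    by_cases hkb : k = b
    · subst hkb
      simp
    · simp [Equiv.swap_apply_of_ne_of_ne hka hkb]
  have h1 : F θ = F θ' := (hper θ m).symm
  have h2 : F (θ ∘ Equiv.swap a b) = F (θ' ∘ Equiv.swap a b) :=
    (hper (θ ∘ Equiv.swap a b) (m ∘ Equiv.swap a b)).symm
  have h3 := (convex_closedBall (0 : Fin N → ℝ) (3 * Real.pi)).norm_image_sub_le_of_norm_fderiv_le
    (𝕜 := ℝ) (f := F) (C := B) (fun x _ => hF.differentiable one_ne_zero x) hB
    (norm_le_of_abs_le (by positivity) hbd)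
    (norm_le_of_abs_le (by positivity) fun i => hbd (Equiv.swap a b i))
  rw [h1, h2, norm_sub_rev, mul_assoc]
  exact h3.trans (mul_le_mul_of_nonneg_left (hsub.trans hdist) hB0)

variable (τ : Equiv.Perm (Fin N) →* Matrix.orthogonalGroup (Fin n) ℝ) (κ : ℝ) (i : Fin N)

lemma continuousOn_angleDunkl (hF : ContDiff ℝ 1 F) :
    ContinuousOn (angleDunkl τ κ i F) (regAngles N) := by
  unfold angleDunkl
  have h0 : ContinuousOn (fun θ => (-Complex.I) • fderiv ℝ F θ (Pi.single i 1)) (regAngles N) :=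
    (((hF.continuous_fderiv one_ne_zero).clm_apply continuous_const).const_smul
      (-Complex.I)).continuousOn
  have h1 : ContinuousOn (fun θ => ∑ j ∈ Finset.univ.erase i, dunklCoeff θ i j •
      (rep τ (Equiv.swap i j) *ᵥ (F θ - F (θ ∘ Equiv.swap i j)))) (regAngles N) := by
    refine continuousOn_finsetSum _ fun j hj => ?_
    exact (continuousOn_dunklCoeff (Finset.ne_of_mem_erase hj).symm).smul
      (Continuous.continuousOn (continuous_const.matrix_mulVec (hF.continuous.sub
        (hF.continuous.comp (continuous_pi fun k => continuous_apply _)))))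
  exact h0.add (h1.const_smul (κ : ℂ))

/-- The pole of `x_i / (x_i - x_j)` is of the order of the inverse chord, and the difference of a
`C¹` function and its reflection is of the order of the chord. -/
lemma exists_norm_angleDunkl_le (hF : ContDiff ℝ 1 F)
    (hper : ∀ (θ : Fin N → ℝ) (m : Fin N → ℤ), F (fun i => θ i + m i * (2 * Real.pi)) = F θ) :
    ∃ B : ℝ, 0 ≤ B ∧ ∀ θ : Fin N → ℝ, (∀ i, |θ i| ≤ Real.pi) → θ ∈ regAngles N →
      ‖angleDunkl τ κ i F θ‖ ≤ B := by
  obtain ⟨B₀, hB₀, h₀⟩ := exists_norm_le_of_continuous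
    (((hF.continuous_fderiv one_ne_zero).clm_apply
      (continuous_const (y := (Pi.single i 1 : Fin N → ℝ)))).const_smul (-Complex.I)) Real.pi
  obtain ⟨C, hC, hsub⟩ := exists_norm_sub_comp_swap_le hF hper
  set R : Fin N → ℝ := fun j => ‖LinearMap.toContinuousLinearMap
    (Matrix.mulVecLin (rep τ (Equiv.swap i j)))‖ with hR
  refine ⟨B₀ + ‖(κ : ℂ)‖ * ∑ j ∈ Finset.univ.erase i, R j * C, by positivity, fun θ hθ hreg => ?_⟩
  rw [angleDunkl]
  refine (norm_add_le _ _).trans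
    (add_le_add (h₀ θ (norm_le_of_abs_le Real.pi_pos.le hθ)) ?_)
  rw [norm_smul]
  refine mul_le_mul_of_nonneg_left ((norm_sum_le _ _).trans (Finset.sum_le_sum fun j hj => ?_))
    (norm_nonneg _)
  have hch := hreg i j (Finset.ne_of_mem_erase hj).symm
  have h1 : ‖rep τ (Equiv.swap i j) *ᵥ (F θ - F (θ ∘ Equiv.swap i j))‖
      ≤ R j * (C * chord θ i j) :=
    ((LinearMap.toContinuousLinearMap (Matrix.mulVecLin (rep τ (Equiv.swap i j)))).le_opNorm
      _).trans (mul_le_mul_of_nonneg_left (hsub θ hθ i j) (norm_nonneg _))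
  rw [norm_smul, norm_dunklCoeff]
  calc _ ≤ (2 * chord θ i j)⁻¹ * (R j * (C * chord θ i j)) :=
        mul_le_mul_of_nonneg_left h1 (by positivity)
    _ = R j * C / 2 := by field_simp
    _ ≤ R j * C := half_le_self (by positivity)

end regular

/-! ### Integrability and the vanishing of the integral -/

section final

open MeasureTheory

variable {hN : 3 ≤ N} {τ : Equiv.Perm (Fin N) →* Matrix.orthogonalGroup (Fin n) ℝ} {κ : ℝ}
  {L : (Fin N → ℂ) → Matrix (Fin n) (Fin n) ℂ} {H : Matrix (Fin n) (Fin n) ℂ}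

/-- The second bound uses `N² - N ≤ N² - N + 2`, the first uses `2N ≤ N² - N + 2`, which is
`(N-1)(N-2) ≥ 0`. -/
lemma bounds_of_abs_lt (hN : 3 ≤ N) (hκ : |κ| < (2 * ((N : ℝ) ^ 2 - N + 2))⁻¹) :
    4 * (N * |κ|) ≤ 1 ∧ growthExp N κ < 1 / 2 := by
  have hN' : (3 : ℝ) ≤ N := by exact_mod_cast hN
  have hpos : 0 < 2 * ((N : ℝ) ^ 2 - N + 2) := by nlinarith
  have h1 : |κ| * (2 * ((N : ℝ) ^ 2 - N + 2)) < 1 := by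
    have := mul_lt_mul_of_pos_right hκ hpos
    rwa [inv_mul_cancel₀ hpos.ne'] at this
  rw [growthExp]
  constructor <;> nlinarith [abs_nonneg κ, mul_nonneg (abs_nonneg κ)
    (show (0 : ℝ) ≤ ((N : ℝ) - 1) * (N - 2) by nlinarith)]

lemma continuousOn_formMat (hn : 2 ≤ n) (hτ : (complexRep τ).IsIrreducible)
    (hL : IsFundamentalMatrix hN τ κ L) (hυ : Commute (upsilon τ) H) :
    ContinuousOn (fun θ => formMat L H (expPoint θ)) (regAngles N) := fun θ hθ => by
  obtain ⟨D, hD, -⟩ := hasFDerivAt_formMat hn hτ hL hυ (expPoint_injective_of_chord hθ)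
  exact hD.continuousAt.continuousWithinAt

/-- The form grows at most like the power `-growthExp N κ` of the smallest chord, and this exponent
is less than `1/2`, the order allowed by `integrable_of_norm_le`. -/
lemma integrable_sesq_formMat (hn : 2 ≤ n) (hτ : (complexRep τ).IsIrreducible)
    (hL : IsFundamentalMatrix hN τ κ L) (hυ : Commute (upsilon τ) H) (hp : growthExp N κ < 1 / 2)
    {u v : (Fin N → ℝ) → Fin n → ℂ} (hu : ContinuousOn u (regAngles N))
    (hv : ContinuousOn v (regAngles N)) {B B' : ℝ} (hB0 : 0 ≤ B)
    (hB : ∀ θ : Fin N → ℝ, (∀ i, |θ i| ≤ Real.pi) → θ ∈ regAngles N → ‖u θ‖ ≤ B)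
    (hB' : ∀ θ : Fin N → ℝ, (∀ i, |θ i| ≤ Real.pi) → θ ∈ regAngles N → ‖v θ‖ ≤ B') :
    Integrable (fun θ => sesq (u θ) (formMat L H (expPoint θ)) (v θ)) (boxMeasure N) := by
  obtain ⟨C, hC, hK⟩ := exists_norm_formMat_le hn hτ hL hυ
  obtain ⟨Cs, hCs, hs⟩ := exists_norm_sesq_le (n := n)
  refine integrable_of_norm_le (C := Cs * B * C * B') (aestronglyMeasurable_of_continuousOn
    (continuousOn_sesq hu (continuousOn_formMat hn hτ hL hυ) hv)) fun θ hθ ε hε hε1 hch => ?_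
  have hreg : θ ∈ regAngles N := fun a b hab => hε.trans_le (hch a b hab)
  have h1 : ε ^ (-growthExp N κ) ≤ ε ^ (-(1 / 2) : ℝ) :=
    Real.rpow_le_rpow_of_exponent_ge hε hε1 (by linarith)
  have h2 := hK θ hθ ε hε hch
  have h3 := hB θ hθ hreg
  have h4 := hB' θ hθ hreg
  calc _ ≤ Cs * ‖u θ‖ * ‖formMat L H (expPoint θ)‖ * ‖v θ‖ := hs _ _ _
    _ ≤ Cs * B * (C * ε ^ (-(1 / 2) : ℝ)) * B' := by
      gcongr
      exact h2.trans (mul_le_mul_of_nonneg_left h1 hC)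
    _ = _ := by ring

/-- All hypotheses of `integral_eq_zero_of_odd_add_partial` are supplied here for `Φ = F^* K G`: the
growth bound comes from `exists_norm_formMat_le`, the near symmetry at the walls from
`exists_norm_formMat_sub_le` together with the Lipschitz bounds for `F` and `G`. -/
theorem integral_sesq_angleDunkl_sub_eq_zero (hn : 2 ≤ n) (hτ : (complexRep τ).IsIrreducible)
    (hκ : 4 * (N * |κ|) ≤ 1) (hp : growthExp N κ < 1 / 2)
    (hL : IsFundamentalMatrix hN τ κ L) (hυ : Commute (upsilon τ) H)
    {D : Set ((Fin (N - 2) → ℂ) × ℂ)} {α₀ : (Fin (N - 2) → ℂ) × ℂ → Matrix (Fin n) (Fin n) ℂ}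
    (hα₀ : IsLeadingCoeff hN τ κ D α₀)
    (hσ : Commute (((seriesSol hN τ κ α₀ (basePoint N))ᴴ)⁻¹ * H *
        (seriesSol hN τ κ α₀ (basePoint N))⁻¹) (sigma hN τ))
    {F G : (Fin N → ℝ) → Fin n → ℂ} (hF : ContDiff ℝ 1 F) (hG : ContDiff ℝ 1 G)
    (hFper : ∀ (θ : Fin N → ℝ) (m : Fin N → ℤ), F (fun i => θ i + m i * (2 * Real.pi)) = F θ)
    (hGper : ∀ (θ : Fin N → ℝ) (m : Fin N → ℤ), G (fun i => θ i + m i * (2 * Real.pi)) = G θ)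
    (i : Fin N) :
    Integrable (fun θ => sesq (angleDunkl τ κ i F θ) (formMat L H (expPoint θ)) (G θ))
      (boxMeasure N) ∧
    Integrable (fun θ => sesq (F θ) (formMat L H (expPoint θ)) (angleDunkl τ κ i G θ))
      (boxMeasure N) ∧
    ∫ θ, (sesq (angleDunkl τ κ i F θ) (formMat L H (expPoint θ)) (G θ)
        - sesq (F θ) (formMat L H (expPoint θ)) (angleDunkl τ κ i G θ)) ∂boxMeasure N = 0 := by
  obtain ⟨BF, hBF0, hBF'⟩ := exists_norm_le_of_continuous hF.continuous Real.pi
  obtain ⟨BG, hBG0, hBG'⟩ := exists_norm_le_of_continuous hG.continuous Real.pi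
  have hBF : ∀ θ : Fin N → ℝ, (∀ i, |θ i| ≤ Real.pi) → ‖F θ‖ ≤ BF := fun θ hθ =>
    hBF' θ (norm_le_of_abs_le Real.pi_pos.le hθ)
  have hBG : ∀ θ : Fin N → ℝ, (∀ i, |θ i| ≤ Real.pi) → ‖G θ‖ ≤ BG := fun θ hθ =>
    hBG' θ (norm_le_of_abs_le Real.pi_pos.le hθ)
  obtain ⟨DF, hDF0, hDF⟩ := exists_norm_angleDunkl_le τ κ i hF hFper
  obtain ⟨DG, hDG0, hDG⟩ := exists_norm_angleDunkl_le τ κ i hG hGper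
  obtain ⟨SF, hSF0, hSF⟩ := exists_norm_sub_comp_swap_le hF hFper
  obtain ⟨SG, hSG0, hSG⟩ := exists_norm_sub_comp_swap_le hG hGper
  obtain ⟨C, hC, hK⟩ := exists_norm_formMat_le hn hτ hL hυ
  obtain ⟨Cd, ε₀, hCd, hε₀, hKsub⟩ :=
    exists_norm_formMat_sub_le hκ (by linarith) hα₀ hn hτ hL hυ hσ
  obtain ⟨Cs, hCs, hs⟩ := exists_norm_sesq_le (n := n)
  have hKc := continuousOn_formMat hn hτ hL hυ
  have hI1 := integrable_sesq_formMat hn hτ hL hυ hp (continuousOn_angleDunkl τ κ i hF)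
    hG.continuous.continuousOn hDF0 hDF fun θ hθ _ => hBG θ hθ
  have hI2 := integrable_sesq_formMat hn hτ hL hυ hp hF.continuous.continuousOn
    (continuousOn_angleDunkl τ κ i hG) hBF0 (fun θ hθ _ => hBF θ hθ) hDG
  refine ⟨hI1, hI2, ?_⟩
  have hKswap : ∀ θ ∈ regAngles N, ∀ a b, formMat L H (expPoint (θ ∘ Equiv.swap a b))
      = rep τ (Equiv.swap a b) * formMat L H (expPoint θ) * rep τ (Equiv.swap a b) :=
    fun θ hθ a b => by
      rw [expPoint_comp, formMat_comp hn hτ hL hυ (expPoint_injective_of_chord hθ),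
        Equiv.swap_inv]
  have hcomp : ∀ a b : Fin N, Continuous fun θ : Fin N → ℝ => θ ∘ Equiv.swap a b := fun a b =>
    continuous_pi fun k => continuous_apply _
  set p := growthExp N κ with hpd
  set A := Cs * BF * Cd * BG + Cs * (SF * 2) * C * BG + Cs * BF * C * (SG * 2) with hA
  have hA0 : 0 ≤ A := by positivity
  refine integral_eq_zero_of_odd_add_partial i
    (Φ := fun θ => sesq (F θ) (formMat L H (expPoint θ)) (G θ))
    (O := oddTerm τ κ (fun θ => formMat L H (expPoint θ)) F G i)
    (C := max (Cs * BF * C * BG) A) (ε₀ := min ε₀ 1) (p := p) ?_ (hI1.sub hI2) ?_ ?_ ?_ ?_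
    (le_max_of_le_right hA0) (lt_min hε₀ one_pos) hp ?_ ?_
  · exact fun θ hθ => sesq_angleDunkl_sub hθ i (hF.differentiable one_ne_zero θ)
      (hG.differentiable one_ne_zero θ)
      (hasFDerivAt_formMat hn hτ hL hυ (expPoint_injective_of_chord hθ))
  · exact (continuousOn_sesq (continuousOn_angleDunkl τ κ i hF) hKc hG.continuous.continuousOn).sub
      (continuousOn_sesq hF.continuous.continuousOn hKc (continuousOn_angleDunkl τ κ i hG))
  · intro j hij
    have hcoeff := continuousOn_dunklCoeff hij
    unfold oddTerm
    exact continuousOn_const.mul ((hcoeff.mul (continuousOn_sesq hF.continuous.continuousOn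
      (hKc.mul continuousOn_const) (hG.continuous.comp (hcomp i j)).continuousOn)).sub
      (hcoeff.star.mul (continuousOn_sesq (hF.continuous.comp (hcomp i j)).continuousOn
      (continuousOn_const.mul hKc) hG.continuous.continuousOn)))
  · exact fun j hij θ hθ => oddTerm_comp_swap hij hθ (hKswap θ hθ i j)
  · intro θ m
    simp only [hFper, hGper, expPoint_add_two_pi]
  · intro θ hθ ε hε _ hch
    have h2 := hK θ hθ ε hε hch
    have h3 := hBF θ hθ
    have h4 := hBG θ hθ
    calc _ ≤ Cs * ‖F θ‖ * ‖formMat L H (expPoint θ)‖ * ‖G θ‖ := hs _ _ _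
      _ ≤ Cs * BF * (C * ε ^ (-p)) * BG := by gcongr
      _ = Cs * BF * C * BG * ε ^ (-p) := by ring
      _ ≤ _ := mul_le_mul_of_nonneg_right (le_max_left _ _) (by positivity)
  · intro θ hθ ε hε hεle hch a b hab hcl hfar
    have hε1 : ε ≤ 1 := hεle.trans (min_le_right _ _)
    have hreg : θ ∈ regAngles N := fun a b hab => hε.trans_le (hch a b hab)
    have hchord : chord θ a b ≤ 2 * ε := by
      have := chord_nonneg θ a b
      nlinarith
    have hθs : ∀ k, |(θ ∘ Equiv.swap a b) k| ≤ Real.pi := fun k => hθ _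
    have h1 := hKsub θ hθ ε hε (hεle.trans (min_le_left _ _)) hch a b hab hcl hfar
    have h2 : ‖rep τ (Equiv.swap a b) * formMat L H (expPoint θ) * rep τ (Equiv.swap a b)‖
        ≤ C * ε ^ (-p) :=
      ((norm_mul_rep_le τ _ _).trans (norm_rep_mul_le τ _ _)).trans (hK θ hθ ε hε hch)
    have h3 : ‖F θ - F (θ ∘ Equiv.swap a b)‖ ≤ SF * (2 * ε) :=
      (hSF θ hθ a b).trans (mul_le_mul_of_nonneg_left hchord hSF0)
    have h4 : ‖G θ - G (θ ∘ Equiv.swap a b)‖ ≤ SG * (2 * ε) :=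
      (hSG θ hθ a b).trans (mul_le_mul_of_nonneg_left hchord hSG0)
    -- The reflection changes `F` and `G` by `O(ε)`, which against the growth of `K` is even smaller
    -- than the required order.
    have h5 : ε * ε ^ (-p) ≤ ε ^ (1 / 2 - p) := by
      have e : ε * ε ^ (-p) = ε ^ (1 - p) := by
        rw [sub_eq_add_neg, Real.rpow_add hε, Real.rpow_one]
      rw [e]
      exact Real.rpow_le_rpow_of_exponent_ge hε hε1 (by linarith)
    set K := formMat L H (expPoint θ) with hKd
    set K₁ := rep τ (Equiv.swap a b) * K * rep τ (Equiv.swap a b) with hK₁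
    have hFb := hBF θ hθ
    have hGb := hBG θ hθ
    have hFs := hBF _ hθs
    simp only [hKswap θ hreg a b, ← hKd, ← hK₁]
    -- Telescoping: the form, the left argument and the right argument are replaced by their
    -- reflections one at a time.
    have hdec : sesq (F θ) K (G θ)
          - sesq (F (θ ∘ Equiv.swap a b)) K₁ (G (θ ∘ Equiv.swap a b))
        = sesq (F θ) (K - K₁) (G θ) + sesq (F θ - F (θ ∘ Equiv.swap a b)) K₁ (G θ)
          + sesq (F (θ ∘ Equiv.swap a b)) K₁ (G θ - G (θ ∘ Equiv.swap a b)) := by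
      rw [sesq_sub_mid, sesq_sub_left, sesq_sub_right]
      ring
    have t1 : ‖sesq (F θ) (K - K₁) (G θ)‖ ≤ Cs * BF * (Cd * ε ^ (1 / 2 - p)) * BG :=
      (hs _ _ _).trans (by gcongr)
    have t2 : ‖sesq (F θ - F (θ ∘ Equiv.swap a b)) K₁ (G θ)‖
        ≤ Cs * (SF * (2 * ε)) * (C * ε ^ (-p)) * BG := (hs _ _ _).trans (by gcongr)
    have t3 : ‖sesq (F (θ ∘ Equiv.swap a b)) K₁ (G θ - G (θ ∘ Equiv.swap a b))‖
        ≤ Cs * BF * (C * ε ^ (-p)) * (SG * (2 * ε)) := (hs _ _ _).trans (by gcongr)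
    rw [hdec]
    calc _ ≤ Cs * BF * (Cd * ε ^ (1 / 2 - p)) * BG
          + Cs * (SF * (2 * ε)) * (C * ε ^ (-p)) * BG
          + Cs * BF * (C * ε ^ (-p)) * (SG * (2 * ε)) :=
        (norm_add_le _ _).trans (add_le_add ((norm_add_le _ _).trans (add_le_add t1 t2)) t3)
      _ = Cs * BF * Cd * BG * ε ^ (1 / 2 - p)
          + (Cs * (SF * 2) * C * BG + Cs * BF * C * (SG * 2)) * (ε * ε ^ (-p)) := by ring
      _ ≤ Cs * BF * Cd * BG * ε ^ (1 / 2 - p)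
          + (Cs * (SF * 2) * C * BG + Cs * BF * C * (SG * 2)) * ε ^ (1 / 2 - p) := by gcongr
      _ = A * ε ^ (1 / 2 - p) := by
        rw [hA]
        ring
      _ ≤ _ := mul_le_mul_of_nonneg_right (le_max_right _ _) (by positivity)

end final

end

end TorusDunkl

theorem theorem7p1 {N n : ℕ} (hN : 3 ≤ N) (hn : 2 ≤ n)
    (τ : Equiv.Perm (Fin N) →* Matrix.orthogonalGroup (Fin n) ℝ)
    (hτ : (TorusDunkl.complexRep τ).IsIrreducible)
    (κ : ℝ) (hκ : |κ| < (2 * ((N : ℝ) ^ 2 - N + 2))⁻¹)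
    (L : (Fin N → ℂ) → Matrix (Fin n) (Fin n) ℂ)
    (hL : TorusDunkl.IsFundamentalMatrix hN τ κ L)
    (D : Set ((Fin (N - 2) → ℂ) × ℂ))
    (α₀ : (Fin (N - 2) → ℂ) × ℂ → Matrix (Fin n) (Fin n) ℂ)
    (hα₀ : TorusDunkl.IsLeadingCoeff hN τ κ D α₀)
    (H : Matrix (Fin n) (Fin n) ℂ) (hH : H.IsHermitian)
    (hυ : Commute (TorusDunkl.upsilon τ) H)
    (hσ : Commute
      (((TorusDunkl.seriesSol hN τ κ α₀ (TorusDunkl.basePoint N))ᴴ)⁻¹ * H *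
        (TorusDunkl.seriesSol hN τ κ α₀ (TorusDunkl.basePoint N))⁻¹)
      (TorusDunkl.sigma hN τ))
    (f g : (Fin N → Circle) → (Fin n → ℂ)) (hf : TorusDunkl.IsC1 f) (hg : TorusDunkl.IsC1 g)
    (i : Fin N) :
    MeasureTheory.Integrable
      (fun θ => TorusDunkl.formDensity L H (TorusDunkl.xDunkl τ κ i f) g
        (TorusDunkl.torusPoint θ)) (TorusDunkl.angleMeasure N) ∧
    MeasureTheory.Integrable
      (fun θ => TorusDunkl.formDensity L H f (TorusDunkl.xDunkl τ κ i g)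
        (TorusDunkl.torusPoint θ)) (TorusDunkl.angleMeasure N) ∧
    ∫ θ, (TorusDunkl.formDensity L H (TorusDunkl.xDunkl τ κ i f) g (TorusDunkl.torusPoint θ)
        - TorusDunkl.formDensity L H f (TorusDunkl.xDunkl τ κ i g) (TorusDunkl.torusPoint θ))
        ∂(TorusDunkl.angleMeasure N) = 0 := by
  obtain ⟨hκ1, hp⟩ := TorusDunkl.bounds_of_abs_lt hN hκ
  have hper : ∀ f : (Fin N → Circle) → (Fin n → ℂ), ∀ (θ : Fin N → ℝ) (m : Fin N → ℤ),
      f (TorusDunkl.torusPoint fun i => θ i + m i * (2 * Real.pi))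
        = f (TorusDunkl.torusPoint θ) := fun f θ m => by
    rw [TorusDunkl.torusPoint_add_two_pi]
  obtain ⟨h1, h2, h3⟩ := TorusDunkl.integral_sesq_angleDunkl_sub_eq_zero hn hτ hκ1 hp hL hυ hα₀ hσ
    (F := fun θ => f (TorusDunkl.torusPoint θ)) (G := fun θ => g (TorusDunkl.torusPoint θ))
    hf hg (hper f) (hper g) i
  simp only [TorusDunkl.formDensity_torusPoint, TorusDunkl.xDunkl_torusPoint τ κ i hf,
    TorusDunkl.xDunkl_torusPoint τ κ i hg]
  refine ⟨h1.smul_measure ENNReal.ofReal_ne_top, h2.smul_measure ENNReal.ofReal_ne_top, ?_⟩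
  have e : TorusDunkl.angleMeasure N
      = ENNReal.ofReal (((2 * Real.pi) ^ N)⁻¹) • TorusDunkl.boxMeasure N := rfl
  rw [e, MeasureTheory.integral_smul_measure, h3, smul_zero]
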